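/- For $k\ge 0$ let $D_k=-\partial_x^2+k^2$ and $H_k=D_k+1+V$ on $\mathbb R$, where $V(x)=-\tfrac32\cosh(x/2)^{-2}$. The operator $-D_kH_k$ on $L^2(\mathbb R)$ with domain $\{u\in L^2(\mathbb R): D_kH_ku\in L^2(\mathbb R)\}=H^4(\mathbb R)$ generates a strongly continuous semigroup $e^{-tD_kH_k}$, and for $t>0$ this semigroup has an integral kernel $K(x,y,k,t)$ that is continuous in $(x,y)\in\mathbb R^2$, $$(e^{-tD_kH_k}f)(x)=\int_{\mathbb R}K(x,y,k,t)f(y)\,dy\qquad (f\in L^2(\mathbb R),\ \text{a.e. } x).$$ This kernel is twice continuously differentiable in $y$; put $S:=(\partial_y^2-k^2)K$. The following estimates hold. (a) For every $k_0>0$ there exist $C,c>0$ such that for all $k>k_0$, $t>1$ and $x,y\in\mathbb R$ $$|K(x,y,k,t)|,\ |S(x,y,k,t)|\le C e^{-\frac12k^4t}e^{-c|x-y|}.$$ (b) There exists $C>0$ such that for all $k\ge0$, $0<t<1$ and $x,y\in\mathbb R$ $$|K(x,y,k,t)|\le C e^{-\frac12k^4t}\,t^{-1/4}e^{-t^{-1/4}|x-y|},\qquad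 |S(x,y,k,t)|\le C e^{-\frac12k^4t}\,t^{-3/4}e^{-t^{-1/4}|x-y|}.$$ -/

import Mathlib

open MeasureTheory Filter Topology
open scoped ContDiff

noncomputable section

namespace CahnHilliard

/-- The complex Hilbert space `L²(ℝ)`. -/
abbrev L2 : Type := Lp ℂ 2 (volume : Measure ℝ)

/-- The potential `V(x) = -(3/2) cosh(x/2)⁻²`. -/
def V (x : ℝ) : ℝ := -(3 / 2) * (Real.cosh (x / 2) ^ 2)⁻¹

/-- The differential expression `D_k = -∂² + k²`. -/
def D (k : ℝ) (φ : ℝ → ℂ) : ℝ → ℂ :=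
  fun x => -iteratedDeriv 2 φ x + (k : ℂ) ^ 2 * φ x

/-- The differential expression `H_k = D_k + 1 + V`. -/
def H (k : ℝ) (φ : ℝ → ℂ) : ℝ → ℂ :=
  fun x => D k φ x + φ x + (V x : ℂ) * φ x

/-- `IsNegDH k u w`: the function `u ∈ L²(ℝ)` lies in the domain of the operator `-D_k H_k` and
`w = -D_k H_k u`, with `D_k H_k u` taken in the sense of distributions: it is tested against
`φ ∈ C_c^∞(ℝ)` through the formal transpose `H_k D_k` of `D_k H_k`. This is the realization of
`-D_k H_k` in `L²(ℝ)` with its maximal domain `{u ∈ L² | D_k H_k u ∈ L²}`, which is the Sobolev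
space `H⁴(ℝ)` since `D_k H_k` is elliptic of order four with leading coefficient one and smooth
coefficients all of whose derivatives are bounded. -/
def IsNegDH (k : ℝ) (u w : L2) : Prop :=
  ∀ φ : ℝ → ℂ, ContDiff ℝ ∞ φ → HasCompactSupport φ →
    ∫ x, u x * H k (D k φ) x = -∫ x, w x * φ x

/-- `T` (restricted to times `t ≥ 0`) is a strongly continuous semigroup of bounded operators on
`L²(ℝ)`, and its infinitesimal generator is precisely the operator with graph `G`. -/
structure IsC0SemigroupWithGenerator (T : ℝ → L2 →L[ℂ] L2) (G : L2 → L2 → Prop) : Prop where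
  map_zero : T 0 = ContinuousLinearMap.id ℂ L2
  map_add : ∀ s t : ℝ, 0 ≤ s → 0 ≤ t → T (s + t) = (T s).comp (T t)
  tendsto_zero : ∀ u : L2, Tendsto (fun t : ℝ => T t u) (𝓝[>] 0) (𝓝 u)
  generator : ∀ u w : L2,
    Tendsto (fun t : ℝ => ((t : ℂ)⁻¹) • (T t u - u)) (𝓝[>] 0) (𝓝 w) ↔ G u w

/-- `K` (a function of `x`, `y`, `t`) is the integral kernel of the semigroup `e^{-t D_k H_k}`,
`t > 0`. Among the functions that agree almost everywhere the kernel is, as usual, the one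
continuous in `(x, y)`; hence its values for `t > 0` are uniquely determined. -/
def IsSemigroupKernel (k : ℝ) (K : ℝ → ℝ → ℝ → ℂ) : Prop :=
  ∃ T : ℝ → L2 →L[ℂ] L2, IsC0SemigroupWithGenerator T (IsNegDH k) ∧
    ∀ t : ℝ, 0 < t →
      Continuous (fun p : ℝ × ℝ => K p.1 p.2 t) ∧
      ∀ f : L2, ∀ᵐ x : ℝ, Integrable (fun y => K x y t * f y) ∧
        T t f x = ∫ y, K x y t * f y

/-- The kernel `S(x,y,k,t) = (∂_y² - k²) K(x,y,k,t)`. -/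
def S (K : ℝ → ℝ → ℝ → ℝ → ℂ) (x y k t : ℝ) : ℂ :=
  iteratedDeriv 2 (fun y' => K x y' k t) y - (k : ℂ) ^ 2 * K x y k t

end CahnHilliard

end

noncomputable section

namespace CahnHilliard

/-! Write D for `D k`. Then D H = D(D+1) + D V is a constant-coefficient operator plus a
perturbation of order two. Put Duhamel's formula around the free kernel K₀ and integrate D by parts
off V K₀ onto the second variable of K. Since -D_z K = S, this gives K = K₀ + ∫∫ S(x,z,t-s) V(z)
K₀(z-y,s) dz ds. Applying ∂_y² - k² yields S = S₀ + ∫∫ S V S₀, a Volterra equation in S alone. Hence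
`kerS` is constructed first, as the fixed point of a contraction in a weighted sup norm, and `kerK`
is then an explicit expression in it.

The weight comes from the free kernels. Their Fourier integrals are moved to a line of height about
t^{-1/4} + 1 (`norm_osc_le`), which gives the off-diagonal decay, the powers of t and a factor
exp((const - 3k⁴/4)t) whose constant does not depend on k. Convolution in space and time preserves
such bounds, up to a larger constant that turns the Volterra map into a contraction
(`norm_stConv_S₀_le`). Lowering 3/4 to 1/2 absorbs the constant when t < 1 (`short_time_bounds`) and
when k is large (`large_k_bounds`).

That `kerK` is the right kernel takes three steps. The semigroup law follows from uniqueness for the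
Volterra equation (`integral_kerK_mul_kerS`). The generator lies in -D H by a short-time expansion
tested against C_c^∞ (`norm_rowK_sub_le`). The two operators agree because l - generator is onto for
large l (`exists_resolvent`) while l + D H is injective on the maximal domain
(`eq_zero_of_isNegDH`). A semigroup is determined by its generator, and a continuous kernel by its
operator, so every admissible K equals `kerK` for t > 0.

For large t and bounded k the growth constant must be beaten by spectral information. With τ =
tanh(x/2) one has -∂² + 1 + V = (-∂ + τ)(∂ + τ) ≥ 0, hence H ≥ k². The operator D H is not symmetric
in L² but it is for the form ⟨D⁻¹u, u⟩ = ‖(∂+k)⁻¹u‖², in which -D H contracts at rate k⁴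
(`norm_opL_semigroup_le`). One unit of time smooths this weak norm back into L²
(`norm_semigroup_decay`). Pointwise exponential localization then comes from conjugation by exp(cx)
with small c: over a fixed long time step the conjugated operator norm changes by O(c) only
(`norm_op_wker_le`), and the step is iterated on the columns of `kerK` and `kerS`
(`bounded_k_bound`). -/

/-! ### Contour shifts and oscillatory integrals with the free symbol. -/

/-- Moving the line of integration of an entire function. -/
theorem integral_add_mul_I_eq {f : ℂ → ℂ} (hf : Differentiable ℂ f) (η : ℝ) {B : ℝ → ℝ}
    (hB : ∀ x y : ℝ, |y| ≤ |η| → ‖f (x + y * Complex.I)‖ ≤ B x) (hBi : Integrable B)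
    (hB0 : Tendsto B (cocompact ℝ) (𝓝 0)) :
    ∫ x : ℝ, f (x + η * Complex.I) = ∫ x : ℝ, f x := by
  have hint : ∀ y : ℝ, |y| ≤ |η| → Integrable (fun x : ℝ => f (x + y * Complex.I)) := by
    intro y hy
    refine hBi.mono' ?_ (Eventually.of_forall fun x => hB x y hy)
    exact (hf.continuous.comp (by fun_prop)).aestronglyMeasurable
  have h1 : Tendsto (fun R : ℝ => ∫ x in (-R)..R, f (x + η * Complex.I)) atTop
      (𝓝 (∫ x : ℝ, f (x + η * Complex.I))) :=
    intervalIntegral_tendsto_integral (hint η le_rfl) tendsto_neg_atTop_atBot tendsto_id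
  have h2 : Tendsto (fun R : ℝ => ∫ x in (-R)..R, f x) atTop (𝓝 (∫ x : ℝ, f x)) := by
    have := hint 0 (by simp)
    simp only [Complex.ofReal_zero, zero_mul, add_zero] at this
    exact intervalIntegral_tendsto_integral this tendsto_neg_atTop_atBot tendsto_id
  have hside : ∀ s : ℝ → ℝ, Tendsto s atTop (cocompact ℝ) →
      Tendsto (fun R : ℝ => ∫ y in (0 : ℝ)..η, f (s R + y * Complex.I)) atTop (𝓝 0) := by
    intro s hs
    rw [tendsto_zero_iff_norm_tendsto_zero]
    have : Tendsto (fun R : ℝ => B (s R) * |η - 0|) atTop (𝓝 0) := by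
      simpa using (hB0.comp hs).mul_const |η - 0|
    refine squeeze_zero (fun _ => norm_nonneg _) (fun R => ?_) this
    refine intervalIntegral.norm_integral_le_of_norm_le_const fun y hy => hB _ _ ?_
    rcases le_total 0 η with h | h
    · rw [Set.uIoc_of_le h] at hy
      rw [abs_of_pos hy.1, abs_of_nonneg h]; exact hy.2
    · rw [Set.uIoc_of_ge h] at hy
      rw [abs_of_nonpos hy.2, abs_of_nonpos h]; linarith [hy.1]
  have h3 := hside (fun R => R) (by
    rw [cocompact_eq_atBot_atTop]; exact tendsto_id.mono_right le_sup_right)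
  have h4 := hside (fun R => -R) (by
    rw [cocompact_eq_atBot_atTop]; exact tendsto_neg_atTop_atBot.mono_right le_sup_left)
  have hrect : ∀ R : ℝ, (∫ x in (-R)..R, f (x + η * Complex.I)) = (∫ x in (-R)..R, f x)
      + Complex.I * (∫ y in (0 : ℝ)..η, f ((R : ℝ) + y * Complex.I))
      - Complex.I * (∫ y in (0 : ℝ)..η, f (((-R : ℝ) : ℂ) + y * Complex.I)) := by
    intro R
    have := Complex.integral_boundary_rect_eq_zero_of_differentiableOn f (((-R : ℝ) : ℂ))
      ((R : ℂ) + η * Complex.I) hf.differentiableOn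
    simp at this ⊢
    linear_combination -this
  have h5 := (h2.add (h3.const_mul Complex.I)).sub (h4.const_mul Complex.I)
  simp only [mul_zero, add_zero, sub_zero] at h5
  refine tendsto_nhds_unique h1 (h5.congr fun R => ?_)
  rw [hrect R]

/-- The symbol `ζ² + k²` of `D_k`. -/
def dsym (k : ℝ) (ζ : ℂ) : ℂ := ζ ^ 2 + (k : ℂ) ^ 2

/-- The symbol of `D_k (D_k + 1)`. -/
def psym (k : ℝ) (ζ : ℂ) : ℂ := dsym k ζ ^ 2 + dsym k ζ

theorem psym_re (k x y : ℝ) : (psym k (x + y * Complex.I)).re =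
    (x ^ 2 - y ^ 2 + k ^ 2) ^ 2 - (2 * x * y) ^ 2 + (x ^ 2 - y ^ 2 + k ^ 2) := by
  simp [psym, dsym, pow_two]
  ring

/-- On the line Im ζ = y the quartic x⁴ and k⁴ dominate all mixed terms, at a price of order y⁴ +
y². The remaining t x⁴/2 is weakened to √t x² - 1/2 by completing a square, so that Gaussian
integrals suffice from here on. -/
theorem norm_exp_psym_le (k x y : ℝ) {t : ℝ} (ht : 0 < t) :
    ‖Complex.exp (-t * psym k (x + y * Complex.I))‖ ≤
      Real.exp (1 / 2 + t * (25 * y ^ 4 + y ^ 2) - 7 / 8 * k ^ 4 * t) *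
        Real.exp (-√t * x ^ 2) := by
  rw [Complex.norm_exp, ← Real.exp_add, Real.exp_le_exp]
  have h1 : (-(t : ℂ) * psym k (x + y * Complex.I)).re = -t * (psym k (x + y * Complex.I)).re := by
    rw [← Complex.ofReal_neg, Complex.re_ofReal_mul]
  rw [h1, psym_re]
  -- The term -6x²y² is absorbed by x⁴/2 + 18y⁴ and -2k²y² by k⁴/8 + 8y⁴. With the y⁴ already
  -- present the debt is 18 + 8 - 1 = 25.
  have h2 : x ^ 4 / 2 + 7 / 8 * k ^ 4 - 25 * y ^ 4 - y ^ 2 ≤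
      (x ^ 2 - y ^ 2 + k ^ 2) ^ 2 - (2 * x * y) ^ 2 + (x ^ 2 - y ^ 2 + k ^ 2) := by
    nlinarith [sq_nonneg (x ^ 2 - 6 * y ^ 2), sq_nonneg (k ^ 2 - 8 * y ^ 2), sq_nonneg (x * k),
      sq_nonneg x, sq_nonneg k, sq_nonneg (y ^ 2)]
  have h3 := mul_le_mul_of_nonneg_left h2 ht.le
  have h4 : √t ^ 2 = t := Real.sq_sqrt ht.le
  have h5 : (√t * x ^ 2) ^ 2 = t * x ^ 4 := by rw [mul_pow, h4]; ring
  nlinarith [sq_nonneg (√t * x ^ 2 - 1)]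

/-- Amplitudes of exponential type. -/
structure IsAmp (a : ℂ → ℂ) : Prop where
  diff : Differentiable ℂ a
  bound : ∃ A : ℝ, 0 ≤ A ∧ ∀ ζ, ‖a ζ‖ ≤ A * Real.exp ‖ζ‖

theorem IsAmp.one : IsAmp fun _ => 1 :=
  ⟨by fun_prop, 1, zero_le_one, fun ζ => by simp⟩

theorem IsAmp.const_mul {a : ℂ → ℂ} (ha : IsAmp a) (c : ℂ) : IsAmp fun ζ => c * a ζ := by
  obtain ⟨A, hA, h⟩ := ha.bound
  refine ⟨ha.diff.const_mul c, ‖c‖ * A, by positivity, fun ζ => ?_⟩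
  rw [norm_mul, mul_assoc]
  exact mul_le_mul_of_nonneg_left (h ζ) (norm_nonneg _)

theorem IsAmp.add {a b : ℂ → ℂ} (ha : IsAmp a) (hb : IsAmp b) : IsAmp fun ζ => a ζ + b ζ := by
  obtain ⟨A, hA, h⟩ := ha.bound
  obtain ⟨A', hA', h'⟩ := hb.bound
  refine ⟨ha.diff.add hb.diff, A + A', by positivity, fun ζ => ?_⟩
  rw [add_mul]
  exact (norm_add_le _ _).trans (add_le_add (h ζ) (h' ζ))

theorem IsAmp.id : IsAmp fun ζ => ζ :=
  ⟨differentiable_id, 1, zero_le_one, fun ζ => by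
    linarith [Real.add_one_le_exp ‖ζ‖]⟩

theorem IsAmp.sq : IsAmp fun ζ => ζ ^ 2 :=
  ⟨by fun_prop, 2, zero_le_two, fun ζ => by
    rw [norm_pow]
    nlinarith [Real.quadratic_le_exp_of_nonneg (norm_nonneg ζ), norm_nonneg ζ]⟩

theorem IsAmp.dsym (k : ℝ) : IsAmp (dsym k) := by
  have := IsAmp.sq.add (IsAmp.one.const_mul ((k : ℂ) ^ 2))
  simpa [CahnHilliard.dsym] using! this

theorem differentiable_psym (k : ℝ) : Differentiable ℂ (psym k) := by
  unfold psym dsym; fun_prop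

theorem tendsto_exp_neg_mul_sq_cocompact {b : ℝ} (hb : 0 < b) :
    Tendsto (fun x : ℝ => Real.exp (-b * x ^ 2)) (cocompact ℝ) (𝓝 0) := by
  have := tendsto_rpow_abs_mul_exp_neg_mul_sq_cocompact hb 0
  simpa using this

/-- An amplitude of exponential type costs half of the Gaussian. -/
theorem exp_abs_mul_le {b : ℝ} (hb : 0 < b) (x : ℝ) :
    Real.exp |x| * Real.exp (-b * x ^ 2) ≤ Real.exp (1 / (2 * b)) * Real.exp (-(b / 2) * x ^ 2) := by
  rw [← Real.exp_add, ← Real.exp_add, Real.exp_le_exp]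
  have : 0 ≤ (b * |x| - 1) ^ 2 / (2 * b) := by positivity
  have h2 : (b * |x| - 1) ^ 2 / (2 * b) = b / 2 * x ^ 2 - |x| + 1 / (2 * b) := by
    have : |x| ^ 2 = x ^ 2 := sq_abs x
    field_simp
    linear_combination b ^ 2 * this
  nlinarith

/-- The oscillatory integral with amplitude `a`, i.e. the kernel of `a(-i∂) e^{-t D_k(D_k+1)}`. -/
def osc (a : ℂ → ℂ) (k z t : ℝ) : ℂ :=
  (2 * Real.pi : ℂ)⁻¹ * ∫ ξ : ℝ, a ξ * Complex.exp (-t * psym k ξ) * Complex.exp (Complex.I * ξ * z)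

/-- A majorant uniform over the whole strip |Im ζ| ≤ |η|. It justifies the contour shift, and with η
= 0 it provides the dominating functions for continuity and differentiation. -/
theorem norm_osc_integrand_le {a : ℂ → ℂ} {A : ℝ} (hA : 0 ≤ A)
    (ha : ∀ ζ, ‖a ζ‖ ≤ A * Real.exp ‖ζ‖) (k z : ℝ) {t : ℝ} (ht : 0 < t) (x y η : ℝ)
    (hy : |y| ≤ |η|) :
    ‖a (x + y * Complex.I) * Complex.exp (-t * psym k (x + y * Complex.I)) *
      Complex.exp (Complex.I * (x + y * Complex.I) * z)‖ ≤
      A * Real.exp (|η| + (1 / 2 + t * (25 * η ^ 4 + η ^ 2)) + |η| * |z| + 1 / (2 * √t)) *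
        Real.exp (-(√t / 2) * x ^ 2) := by
  rw [norm_mul, norm_mul]
  have h1 : ‖a (x + y * Complex.I)‖ ≤ A * Real.exp (|x| + |η|) := by
    refine (ha _).trans (mul_le_mul_of_nonneg_left (Real.exp_le_exp.2 ?_) hA)
    refine (norm_add_le _ _).trans ?_
    simp only [Complex.norm_real, norm_mul, Complex.norm_I, mul_one, Real.norm_eq_abs]
    linarith
  have h2 : ‖Complex.exp (-t * psym k (x + y * Complex.I))‖ ≤
      Real.exp (1 / 2 + t * (25 * η ^ 4 + η ^ 2)) * Real.exp (-√t * x ^ 2) := by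
    refine (norm_exp_psym_le k x y ht).trans (mul_le_mul_of_nonneg_right
      (Real.exp_le_exp.2 ?_) (Real.exp_pos _).le)
    have e1 : y ^ 2 ≤ η ^ 2 := sq_le_sq.2 hy
    have e2 : y ^ 4 ≤ η ^ 4 := by nlinarith [sq_nonneg y]
    have e3 : t * (25 * y ^ 4 + y ^ 2) ≤ t * (25 * η ^ 4 + η ^ 2) := by gcongr
    have : 0 ≤ 7 / 8 * k ^ 4 * t := by positivity
    linarith
  have h3 : ‖Complex.exp (Complex.I * (x + y * Complex.I) * z)‖ ≤ Real.exp (|η| * |z|) := by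
    rw [Complex.norm_exp, Real.exp_le_exp]
    have : (Complex.I * (x + y * Complex.I) * z).re = -(y * z) := by simp
    rw [this]
    calc -(y * z) ≤ |y * z| := neg_le_abs _
      _ = |y| * |z| := abs_mul _ _
      _ ≤ _ := by gcongr
  have hs : 0 < √t := Real.sqrt_pos.2 ht
  calc _ ≤ (A * Real.exp (|x| + |η|)) *
      (Real.exp (1 / 2 + t * (25 * η ^ 4 + η ^ 2)) * Real.exp (-√t * x ^ 2)) *
        Real.exp (|η| * |z|) := by gcongr
    _ = (A * Real.exp (|η| + (1 / 2 + t * (25 * η ^ 4 + η ^ 2)) + |η| * |z|)) *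
        (Real.exp |x| * Real.exp (-√t * x ^ 2)) := by
      simp only [Real.exp_add]; ring
    _ ≤ (A * Real.exp (|η| + (1 / 2 + t * (25 * η ^ 4 + η ^ 2)) + |η| * |z|)) *
        (Real.exp (1 / (2 * √t)) * Real.exp (-(√t / 2) * x ^ 2)) :=
      mul_le_mul_of_nonneg_left (exp_abs_mul_le hs x) (by positivity)
    _ = _ := by simp only [Real.exp_add]; ring

theorem osc_shift {a : ℂ → ℂ} (ha : IsAmp a) (k z : ℝ) {t : ℝ} (ht : 0 < t) (η : ℝ) :
    osc a k z t = (2 * Real.pi : ℂ)⁻¹ * ∫ ξ : ℝ, a (ξ + η * Complex.I) *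
      Complex.exp (-t * psym k (ξ + η * Complex.I)) *
        Complex.exp (Complex.I * (ξ + η * Complex.I) * z) := by
  obtain ⟨A, hA, hb⟩ := ha.bound
  have hs : 0 < √t / 2 := by have := Real.sqrt_pos.2 ht; positivity
  have hf : Differentiable ℂ fun ζ : ℂ => a ζ * Complex.exp (-t * psym k ζ) *
      Complex.exp (Complex.I * ζ * z) := by
    have h1 := ha.diff
    have h2 := differentiable_psym k
    fun_prop
  rw [osc, ← integral_add_mul_I_eq hf η
    (fun x y hy => norm_osc_integrand_le hA hb k z ht x y η hy)]
  · exact (integrable_exp_neg_mul_sq hs).const_mul _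
  · simpa using (tendsto_exp_neg_mul_sq_cocompact hs).const_mul _

theorem osc_integrand_integrable {a : ℂ → ℂ} (ha : IsAmp a) (k z : ℝ) {t : ℝ} (ht : 0 < t) :
    Integrable fun ξ : ℝ => a ξ * Complex.exp (-t * psym k ξ) *
      Complex.exp (Complex.I * ξ * z) := by
  obtain ⟨A, hA, hb⟩ := ha.bound
  have hs : 0 < √t / 2 := by have := Real.sqrt_pos.2 ht; positivity
  refine ((integrable_exp_neg_mul_sq hs).const_mul _).mono' ?_
    (Eventually.of_forall fun x => by
      have := norm_osc_integrand_le hA hb k z ht x 0 0 le_rfl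
      simpa only [Complex.ofReal_zero, zero_mul, add_zero] using this)
  have h1 := ha.diff.continuous
  have h2 := (differentiable_psym k).continuous
  exact Continuous.aestronglyMeasurable (by fun_prop)

theorem osc_add {a b : ℂ → ℂ} (ha : IsAmp a) (hb : IsAmp b) (k z : ℝ) {t : ℝ} (ht : 0 < t) :
    osc (fun ζ => a ζ + b ζ) k z t = osc a k z t + osc b k z t := by
  simp only [osc, ← mul_add]
  rw [← integral_add (osc_integrand_integrable ha k z ht) (osc_integrand_integrable hb k z ht)]
  simp only [add_mul]

theorem osc_const_mul (a : ℂ → ℂ) (c : ℂ) (k z t : ℝ) :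
    osc (fun ζ => c * a ζ) k z t = c * osc a k z t := by
  simp only [osc, mul_assoc, integral_const_mul]
  ring

theorem osc_neg_arg {a : ℂ → ℂ} (ha : ∀ ζ, a (-ζ) = a ζ) (k z t : ℝ) :
    osc a k (-z) t = osc a k z t := by
  have hp : ∀ ζ, psym k (-ζ) = psym k ζ := fun ζ => by simp [psym, dsym]
  simp only [osc]
  congr 1
  rw [← integral_neg_eq_self]
  congr 1; ext ξ
  push_cast
  rw [ha, hp]
  congr 2; ring

theorem continuousOn_osc {a : ℂ → ℂ} (ha : IsAmp a) (k : ℝ) :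
    ContinuousOn (fun p : ℝ × ℝ => osc a k p.1 p.2) {p | 0 < p.2} := by
  obtain ⟨A, hA, hb⟩ := ha.bound
  intro p hp
  refine ContinuousAt.continuousWithinAt ?_
  refine ContinuousAt.mul continuousAt_const ?_
  have hp2 : 0 < p.2 / 2 := half_pos hp
  have hs : 0 < √(p.2 / 2) / 2 := by have := Real.sqrt_pos.2 hp2; positivity
  have hev : ∀ᶠ q : ℝ × ℝ in 𝓝 p, p.2 / 2 < q.2 :=
    continuousAt_snd.eventually_const_lt (half_lt_self hp)
  have h1 := ha.diff.continuous
  have h2 := (differentiable_psym k).continuous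
  refine continuousAt_of_dominated (bound := fun ξ => A * Real.exp (1 / 2 + 1 / (2 * √(p.2 / 2))) *
        Real.exp (-(√(p.2 / 2) / 2) * ξ ^ 2)) ?_ ?_ ?_ ?_
  · exact Eventually.of_forall fun q => Continuous.aestronglyMeasurable (by fun_prop)
  · filter_upwards [hev] with q hq
    refine Eventually.of_forall fun x => ?_
    have := norm_osc_integrand_le hA hb k q.1 (hp2.trans hq) x 0 0 le_rfl
    simp only [Complex.ofReal_zero, zero_mul, add_zero] at this
    refine this.trans ?_
    have hq0 := Real.sqrt_pos.2 hp2
    have hq' := Real.sqrt_le_sqrt hq.le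
    have : 0 < √q.2 := hq0.trans_le hq'
    simp only [abs_zero, zero_mul, ne_eq, OfNat.ofNat_ne_zero, not_false_eq_true, zero_pow,
      mul_zero, add_zero, zero_add]
    gcongr
  · exact (integrable_exp_neg_mul_sq hs).const_mul _
  · exact Eventually.of_forall fun ξ => by fun_prop

theorem hasDerivAt_osc {a : ℂ → ℂ} (ha : IsAmp a) (ha' : IsAmp fun ζ => ζ * a ζ) (k z : ℝ)
    {t : ℝ} (ht : 0 < t) :
    HasDerivAt (fun z => osc a k z t) (osc (fun ζ => Complex.I * (ζ * a ζ)) k z t) z := by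
  obtain ⟨A, hA, hb⟩ := (ha'.const_mul Complex.I).bound
  have hs : 0 < √t / 2 := by have := Real.sqrt_pos.2 ht; positivity
  have h1 := ha.diff.continuous
  have h2 := (differentiable_psym k).continuous
  refine HasDerivAt.const_mul _ ?_
  refine (hasDerivAt_integral_of_dominated_loc_of_deriv_le (F' := fun (z : ℝ) (ξ : ℝ) =>
    Complex.I * (ξ * a ξ) * Complex.exp (-t * psym k ξ) * Complex.exp (Complex.I * ξ * z))
    (bound := fun ξ => A * Real.exp (1 / 2 + 1 / (2 * √t)) *
        Real.exp (-(√t / 2) * ξ ^ 2)) (s := Set.univ) univ_mem ?_ ?_ ?_ ?_ ?_ ?_).2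
  · exact Eventually.of_forall fun q => Continuous.aestronglyMeasurable (by fun_prop)
  · exact osc_integrand_integrable ha k z ht
  · exact Continuous.aestronglyMeasurable (by fun_prop)
  · refine Eventually.of_forall fun x w _ => ?_
    have := norm_osc_integrand_le hA hb k w ht x 0 0 le_rfl
    simp only [Complex.ofReal_zero, zero_mul, add_zero] at this
    refine this.trans (le_of_eq ?_)
    simp
  · exact (integrable_exp_neg_mul_sq hs).const_mul _
  · refine Eventually.of_forall fun ξ w _ => ?_
    have h3 : HasDerivAt (fun w : ℝ => Complex.I * ξ * (w : ℂ)) (Complex.I * ξ * 1) w :=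
      (Complex.ofRealCLM.hasDerivAt (x := w)).const_mul _
    exact ((h3.cexp).const_mul (a ξ * Complex.exp (-t * psym k ξ))).congr_deriv (by ring)


/-! ### Pointwise bounds for the free kernels. -/

/-- The spatial decay rate at time `t`. -/
def rate (t : ℝ) : ℝ := t ^ (-(1 / 4) : ℝ) + 1

theorem rpow_neg_quarter_sq {t : ℝ} (ht : 0 < t) : (t ^ (-(1 / 4) : ℝ)) ^ 2 * √t = 1 := by
  rw [Real.sqrt_eq_rpow, ← Real.rpow_natCast, ← Real.rpow_mul ht.le, ← Real.rpow_add ht]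
  norm_num

theorem rpow_neg_quarter_four {t : ℝ} (ht : 0 < t) : (t ^ (-(1 / 4) : ℝ)) ^ 4 * t = 1 := by
  rw [← Real.rpow_natCast, ← Real.rpow_mul ht.le]
  nth_rewrite 2 [← Real.rpow_one t]
  rw [← Real.rpow_add ht]
  norm_num

theorem rpow_neg_quarter_le_rate (t : ℝ) : t ^ (-(1 / 4) : ℝ) ≤ rate t := by
  unfold rate; linarith

/-- This is the purpose of the summand 1: every weight exp(-rate t |x-y|) is dominated by
exp(-|x-y|), however large t is. -/
theorem one_le_rate {t : ℝ} (ht : 0 < t) : 1 ≤ rate t := by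
  have := Real.rpow_pos_of_pos ht (-(1 / 4))
  unfold rate; linarith

theorem rate_pos {t : ℝ} (ht : 0 < t) : 0 < rate t := zero_lt_one.trans_le (one_le_rate ht)

theorem rate_anti {s t : ℝ} (hs : 0 < s) (hst : s ≤ t) : rate t ≤ rate s := by
  unfold rate
  have := Real.rpow_le_rpow_of_nonpos hs hst (by norm_num : (-(1 / 4) : ℝ) ≤ 0)
  linarith

theorem continuousOn_rate : ContinuousOn rate (Set.Ioi 0) := by
  unfold rate
  exact (ContinuousOn.rpow_const continuousOn_id fun x hx => Or.inl (ne_of_gt hx)).add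
    continuousOn_const

theorem sqrt_mul_rate_sq_le {t : ℝ} (ht : 0 < t) : √t * rate t ^ 2 ≤ 2 * (1 + √t) := by
  have h := rpow_neg_quarter_sq ht
  have hs := Real.sqrt_nonneg t
  unfold rate
  nlinarith [mul_nonneg hs (sq_nonneg (t ^ (-(1 / 4) : ℝ) - 1))]

theorem mul_rate_four_le {t : ℝ} (ht : 0 < t) : t * rate t ^ 4 ≤ 8 * (1 + t) := by
  have h := rpow_neg_quarter_four ht
  unfold rate
  set q := t ^ (-(1 / 4) : ℝ)
  have h1 : (q + 1) ^ 4 ≤ 8 * (q ^ 4 + 1) := by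
    have : (q + 1) ^ 2 ≤ 2 * (q ^ 2 + 1) := by nlinarith [sq_nonneg (q - 1)]
    nlinarith [sq_nonneg (q ^ 2 - 1), sq_nonneg (q + 1)]
  nlinarith [mul_le_mul_of_nonneg_left h1 ht.le]

theorem sqrt_le_one_add {t : ℝ} (ht : 0 < t) : √t ≤ 1 + t := by
  nlinarith [Real.sq_sqrt ht.le, sq_nonneg (√t - 1)]

theorem mul_rate_sq_le {t : ℝ} (ht : 0 < t) : t * rate t ^ 2 ≤ 4 * (1 + t) := by
  have h := sqrt_mul_rate_sq_le ht
  have hs := Real.sqrt_nonneg t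
  have h1 : √t ^ 2 = t := Real.sq_sqrt ht.le
  have h2 := sqrt_le_one_add ht
  nlinarith [mul_le_mul_of_nonneg_left h hs]

theorem integral_gaussian_quarter {t : ℝ} (ht : 0 < t) :
    (2 * Real.pi)⁻¹ * ∫ x : ℝ, Real.exp (-(√t / 2) * x ^ 2) ≤ t ^ (-(1 / 4) : ℝ) := by
  rw [integral_gaussian]
  have hq : 0 < t ^ (-(1 / 4) : ℝ) := Real.rpow_pos_of_pos ht _
  have hs : 0 < √t := Real.sqrt_pos.2 ht
  have h1 : Real.pi / (√t / 2) = (2 * Real.pi) * (t ^ (-(1 / 4) : ℝ)) ^ 2 := by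
    have h := rpow_neg_quarter_sq ht
    field_simp
    linear_combination -h
  rw [h1, Real.sqrt_mul (by positivity), Real.sqrt_sq hq.le, ← mul_assoc]
  refine mul_le_of_le_one_left hq.le ?_
  have hpi : 1 ≤ 2 * Real.pi := by linarith [Real.pi_gt_three]
  rw [inv_mul_le_iff₀ (by positivity), mul_one]
  rw [Real.sqrt_le_left (by positivity)]
  nlinarith

/-- The contour is moved to height 2 rate t, with the sign that makes exp(iζz) decay. As t rate(t)⁴
= O(1+t), the shift costs only exp(O(1+t)), and the Gaussian integral in x gives t^{-1/4}. The
factor 2 is a reserve: half of the decay is later spent on integrations over intermediate points. -/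
theorem norm_osc_le {a : ℂ → ℂ} (ha : IsAmp a) (k z : ℝ) {t : ℝ} (ht : 0 < t) {M : ℝ} (hM : 0 ≤ M)
    (h : ∀ x y : ℝ, |y| = 2 * rate t →
      ‖a (x + y * Complex.I)‖ * Real.exp (-√t * x ^ 2) ≤ M * Real.exp (-(√t / 2) * x ^ 2)) :
    ‖osc a k z t‖ ≤ M * t ^ (-(1 / 4) : ℝ) * Real.exp (3300 * (1 + t) - 7 / 8 * k ^ 4 * t) *
      Real.exp (-(2 * rate t * |z|)) := by
  have hrate := rate_pos ht
  obtain ⟨η, hη, hηz⟩ : ∃ η : ℝ, |η| = 2 * rate t ∧ η * z = 2 * rate t * |z| := by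
    rcases le_total 0 z with hz | hz
    · exact ⟨2 * rate t, abs_of_pos (by positivity), by rw [abs_of_nonneg hz]⟩
    · exact ⟨-(2 * rate t), by rw [abs_neg]; exact abs_of_pos (by positivity), by
        rw [abs_of_nonpos hz]; ring⟩
  have hη2 : η ^ 2 = 4 * rate t ^ 2 := by rw [← sq_abs, hη]; ring
  have hη4 : η ^ 4 = 16 * rate t ^ 4 := by
    calc η ^ 4 = (η ^ 2) ^ 2 := by ring
      _ = _ := by rw [hη2]; ring
  -- 25·16·8 = 3200 from the quartic term, 4·4 = 16 from the quadratic one, and 1/2.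
  have hexp : 1 / 2 + t * (25 * η ^ 4 + η ^ 2) ≤ 3300 * (1 + t) := by
    have h1 := mul_rate_four_le ht
    have h2 := mul_rate_sq_le ht
    rw [hη2, hη4]
    nlinarith
  rw [osc_shift ha k z ht η, norm_mul]
  have hn : ‖(2 * Real.pi : ℂ)⁻¹‖ = (2 * Real.pi)⁻¹ := by
    rw [norm_inv]; simp [abs_of_pos Real.pi_pos]
  have hs : 0 < √t / 2 := by have := Real.sqrt_pos.2 ht; positivity
  set E := M * Real.exp (3300 * (1 + t) - 7 / 8 * k ^ 4 * t) * Real.exp (-(2 * rate t * |z|))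
  have hpt : ∀ x : ℝ, ‖a (x + η * Complex.I) * Complex.exp (-t * psym k (x + η * Complex.I)) *
      Complex.exp (Complex.I * (x + η * Complex.I) * z)‖ ≤ E * Real.exp (-(√t / 2) * x ^ 2) := by
    intro x
    rw [norm_mul, norm_mul]
    have e1 : ‖Complex.exp (Complex.I * (x + η * Complex.I) * z)‖ =
        Real.exp (-(2 * rate t * |z|)) := by
      rw [Complex.norm_exp]
      have : (Complex.I * (x + η * Complex.I) * z).re = -(η * z) := by simp
      rw [this, hηz]
    have e2 := norm_exp_psym_le k x η ht
    have e3 : Real.exp (1 / 2 + t * (25 * η ^ 4 + η ^ 2) - 7 / 8 * k ^ 4 * t) ≤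
        Real.exp (3300 * (1 + t) - 7 / 8 * k ^ 4 * t) := Real.exp_le_exp.2 (by linarith)
    rw [e1]
    calc _ ≤ ‖a (x + η * Complex.I)‖ * (Real.exp (3300 * (1 + t) - 7 / 8 * k ^ 4 * t) *
          Real.exp (-√t * x ^ 2)) * Real.exp (-(2 * rate t * |z|)) := by
          gcongr
          exact e2.trans (mul_le_mul_of_nonneg_right e3 (Real.exp_pos _).le)
      _ = (‖a (x + η * Complex.I)‖ * Real.exp (-√t * x ^ 2)) *
          (Real.exp (3300 * (1 + t) - 7 / 8 * k ^ 4 * t) * Real.exp (-(2 * rate t * |z|))) := by ring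
      _ ≤ (M * Real.exp (-(√t / 2) * x ^ 2)) *
          (Real.exp (3300 * (1 + t) - 7 / 8 * k ^ 4 * t) * Real.exp (-(2 * rate t * |z|))) :=
          mul_le_mul_of_nonneg_right (h x η hη) (by positivity)
      _ = _ := by simp only [E]; ring
  have hI := norm_integral_le_of_norm_le ((integrable_exp_neg_mul_sq hs).const_mul E)
    (Eventually.of_forall hpt)
  rw [integral_const_mul] at hI
  rw [hn]
  calc _ ≤ (2 * Real.pi)⁻¹ * (E * ∫ x : ℝ, Real.exp (-(√t / 2) * x ^ 2)) := by gcongr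
    _ = E * ((2 * Real.pi)⁻¹ * ∫ x : ℝ, Real.exp (-(√t / 2) * x ^ 2)) := by ring
    _ ≤ E * t ^ (-(1 / 4) : ℝ) := by
      refine mul_le_mul_of_nonneg_left (integral_gaussian_quarter ht) ?_
      positivity
    _ = _ := by simp only [E]; ring

/-- The free kernel `e^{-t D_k(D_k+1)}(z)`. -/
def K₀ (k z t : ℝ) : ℂ := osc (fun _ => 1) k z t

/-- The first spatial derivative of the free kernel. -/
def K₀' (k z t : ℝ) : ℂ := osc (fun ζ => Complex.I * ζ) k z t

/-- `(∂² - k²)` applied to the free kernel. -/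
def S₀ (k z t : ℝ) : ℂ := osc (fun ζ => -1 * dsym k ζ) k z t

theorem isAmp_S₀ (k : ℝ) : IsAmp fun ζ => -1 * dsym k ζ := (IsAmp.dsym k).const_mul _

theorem isAmp_K₀' : IsAmp fun ζ => Complex.I * ζ := IsAmp.id.const_mul _

/-- A constant for the free kernel bounds. -/
def C₀ : ℝ := 26 * Real.exp 3300

/-- An exponential growth rate for the free kernel bounds. -/
def Λ₀ : ℝ := 3301

theorem C₀_pos : 0 < C₀ := by unfold C₀; positivity

/-- Polynomial factors in t and in √t k² produced by amplitudes are absorbed by exp(t + k⁴t/8). This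
lowers 7/8 to 3/4 and raises the growth rate from 3300 to 3301. -/
theorem exp_mul_add_le_of_rate (k : ℝ) {t : ℝ} {M M' : ℝ}
    (h : M ≤ 26 * M' * Real.exp (t + 1 / 8 * k ^ 4 * t)) :
    M * Real.exp (3300 * (1 + t) - 7 / 8 * k ^ 4 * t) ≤
      C₀ * M' * Real.exp ((Λ₀ - 3 / 4 * k ^ 4) * t) := by
  calc _ ≤ 26 * M' * Real.exp (t + 1 / 8 * k ^ 4 * t) *
        Real.exp (3300 * (1 + t) - 7 / 8 * k ^ 4 * t) := by gcongr
    _ = 26 * M' * (Real.exp (t + 1 / 8 * k ^ 4 * t) *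
        Real.exp (3300 * (1 + t) - 7 / 8 * k ^ 4 * t)) := by ring
    _ = 26 * M' * (Real.exp 3300 * Real.exp ((Λ₀ - 3 / 4 * k ^ 4) * t)) := by
      rw [← Real.exp_add, ← Real.exp_add]; congr 2; unfold Λ₀; ring
    _ = _ := by unfold C₀; ring

theorem norm_K₀_le (k z : ℝ) {t : ℝ} (ht : 0 < t) :
    ‖K₀ k z t‖ ≤ C₀ * Real.exp ((Λ₀ - 3 / 4 * k ^ 4) * t) * t ^ (-(1 / 4) : ℝ) *
      Real.exp (-(2 * rate t * |z|)) := by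
  have h1 := norm_osc_le IsAmp.one k z ht zero_le_one fun x y _ => by
    rw [norm_one, one_mul, one_mul, Real.exp_le_exp]
    nlinarith [Real.sqrt_nonneg t, mul_nonneg (Real.sqrt_nonneg t) (sq_nonneg x)]
  refine h1.trans (mul_le_mul_of_nonneg_right ?_ (Real.exp_pos _).le)
  have h2 := exp_mul_add_le_of_rate k (t := t) (M := 1) (M' := 1) (by
    have : 0 ≤ t + 1 / 8 * k ^ 4 * t := by positivity
    linarith [Real.one_le_exp this])
  have hq : 0 < t ^ (-(1 / 4) : ℝ) := Real.rpow_pos_of_pos ht _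
  nlinarith [mul_le_mul_of_nonneg_right h2 hq.le]

theorem rpow_neg_three_quarter {t : ℝ} (ht : 0 < t) :
    t ^ (-(3 / 4) : ℝ) * √t = t ^ (-(1 / 4) : ℝ) := by
  rw [Real.sqrt_eq_rpow, ← Real.rpow_add ht]; norm_num

theorem rpow_neg_half_mul {t : ℝ} (ht : 0 < t) :
    t ^ (-(1 / 4) : ℝ) * t ^ (-(1 / 4) : ℝ) = t ^ (-(1 / 2) : ℝ) := by
  rw [← Real.rpow_add ht]; norm_num

theorem norm_S₀_le (k z : ℝ) {t : ℝ} (ht : 0 < t) :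
    ‖S₀ k z t‖ ≤ C₀ * Real.exp ((Λ₀ - 3 / 4 * k ^ 4) * t) * t ^ (-(3 / 4) : ℝ) *
      Real.exp (-(2 * rate t * |z|)) := by
  have hs : 0 < √t := Real.sqrt_pos.2 ht
  set M := 26 * Real.exp (t + 1 / 8 * k ^ 4 * t) with hM
  have h1 := norm_osc_le (isAmp_S₀ k) k z ht (M := M * (√t)⁻¹) (by positivity) fun x y hy => by
    have e1 : ‖-1 * dsym k (x + y * Complex.I)‖ ≤ x ^ 2 + (2 * rate t) ^ 2 + k ^ 2 := by
      rw [neg_one_mul, norm_neg, dsym]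
      refine (norm_add_le _ _).trans ?_
      rw [norm_pow, norm_pow, Complex.norm_real, Real.norm_eq_abs, sq_abs, Complex.sq_norm,
        Complex.normSq_add_mul_I, ← hy, sq_abs]
    have e2 : Real.exp (-√t * x ^ 2) = Real.exp (-(√t / 2) * x ^ 2) *
        Real.exp (-(√t / 2 * x ^ 2)) := by rw [← Real.exp_add]; congr 1; ring
    rw [e2]
    -- With E = exp(t + k⁴t/8): the x² part is at most 2, the contour height gives at most 8(2+t) =
    -- 8 + 8(1+t), and √t k² gives at most 8E. Together these are at most (2 + 8 + 8 + 8)E = 26E.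
    have e3 : √t * (x ^ 2 + (2 * rate t) ^ 2 + k ^ 2) * Real.exp (-(√t / 2 * x ^ 2)) ≤ M := by
      have hy0 : 0 ≤ √t / 2 * x ^ 2 := by positivity
      have f1 : √t * x ^ 2 * Real.exp (-(√t / 2 * x ^ 2)) ≤ 2 := by
        rw [Real.exp_neg, ← div_eq_mul_inv, div_le_iff₀ (Real.exp_pos _)]
        linarith [Real.add_one_le_exp (√t / 2 * x ^ 2)]
      have f2 : Real.exp (-(√t / 2 * x ^ 2)) ≤ 1 := Real.exp_le_one_iff.2 (by linarith)
      have f3 := sqrt_mul_rate_sq_le ht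
      have f4 := sqrt_le_one_add ht
      have f5 : √t * k ^ 2 ≤ 8 * Real.exp (1 / 8 * k ^ 4 * t) := by
        have g1 : 1 / 8 * k ^ 4 * t = (√t * k ^ 2) ^ 2 / 8 := by
          rw [mul_pow, Real.sq_sqrt ht.le]; ring
        rw [g1]
        nlinarith [Real.add_one_le_exp ((√t * k ^ 2) ^ 2 / 8), sq_nonneg (√t * k ^ 2 - 1)]
      have f6 : √t * (2 * rate t) ^ 2 ≤ 8 * (2 + t) := by nlinarith
      have f7 : 0 ≤ √t * (2 * rate t) ^ 2 + √t * k ^ 2 := by positivity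
      have f8 := mul_le_mul_of_nonneg_left f2 f7
      have f9 : Real.exp (1 / 8 * k ^ 4 * t) ≤ Real.exp (t + 1 / 8 * k ^ 4 * t) :=
        Real.exp_le_exp.2 (by linarith)
      have f10 : t + 1 ≤ Real.exp (t + 1 / 8 * k ^ 4 * t) := by
        refine (Real.add_one_le_exp t).trans (Real.exp_le_exp.2 ?_)
        have : 0 ≤ k ^ 4 * t := by positivity
        linarith
      nlinarith
    calc _ ≤ (x ^ 2 + (2 * rate t) ^ 2 + k ^ 2) * (Real.exp (-(√t / 2) * x ^ 2) *
        Real.exp (-(√t / 2 * x ^ 2))) := by gcongr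
      _ = (√t * (x ^ 2 + (2 * rate t) ^ 2 + k ^ 2) * Real.exp (-(√t / 2 * x ^ 2))) * (√t)⁻¹ *
          Real.exp (-(√t / 2) * x ^ 2) := by field_simp
      _ ≤ _ := by gcongr
  refine h1.trans (mul_le_mul_of_nonneg_right ?_ (Real.exp_pos _).le)
  have hq : 0 < t ^ (-(3 / 4) : ℝ) := Real.rpow_pos_of_pos ht _
  have h2 := exp_mul_add_le_of_rate k (t := t) (M := M) (M' := 1) (by rw [hM, mul_one])
  rw [← rpow_neg_three_quarter ht]
  calc _ = M * Real.exp (3300 * (1 + t) - 7 / 8 * k ^ 4 * t) * t ^ (-(3 / 4) : ℝ) := by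
        field_simp
    _ ≤ _ := by
      rw [mul_one] at h2
      gcongr

theorem norm_K₀'_le (k z : ℝ) {t : ℝ} (ht : 0 < t) :
    ‖K₀' k z t‖ ≤ C₀ * Real.exp ((Λ₀ - 3 / 4 * k ^ 4) * t) * t ^ (-(1 / 2) : ℝ) *
      Real.exp (-(2 * rate t * |z|)) := by
  have hq : 0 < t ^ (-(1 / 4) : ℝ) := Real.rpow_pos_of_pos ht _
  have hq2 := rpow_neg_quarter_sq ht
  set q := t ^ (-(1 / 4) : ℝ) with hqd
  set M := 26 * Real.exp (t + 1 / 8 * k ^ 4 * t) with hM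
  have h1 := norm_osc_le isAmp_K₀' k z ht (M := M * q) (by positivity) fun x y hy => by
    have e1 : ‖Complex.I * (x + y * Complex.I)‖ ≤ |x| + 2 * rate t := by
      rw [norm_mul, Complex.norm_I, one_mul]
      refine (norm_add_le _ _).trans ?_
      simp [hy]
    have e2 : Real.exp (-√t * x ^ 2) = Real.exp (-(√t / 2) * x ^ 2) *
        Real.exp (-(√t / 2 * x ^ 2)) := by rw [← Real.exp_add]; congr 1; ring
    rw [e2]
    have f10 : t + 1 ≤ Real.exp (t + 1 / 8 * k ^ 4 * t) := by
      refine (Real.add_one_le_exp t).trans (Real.exp_le_exp.2 ?_)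
      have : 0 ≤ k ^ 4 * t := by positivity
      linarith
    have e3 : (|x| + 2 * rate t) * Real.exp (-(√t / 2 * x ^ 2)) ≤ M * q := by
      have hx : |x| ^ 2 = x ^ 2 := sq_abs x
      have f1 : |x| * Real.exp (-(√t / 2 * x ^ 2)) ≤ q := by
        rw [Real.exp_neg, ← div_eq_mul_inv, div_le_iff₀ (Real.exp_pos _)]
        have g := Real.add_one_le_exp (√t / 2 * x ^ 2)
        have g2 : |x| ≤ q * (√t / 2 * x ^ 2 + 1) := by
          have : 0 ≤ q * (√t * (|x| - q) ^ 2) := by positivity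
          have h3 : q * (√t * (|x| - q) ^ 2) = q * √t * x ^ 2 - 2 * |x| + q := by
            linear_combination (q * √t) * hx + (q - 2 * |x|) * hq2
          linarith
        exact g2.trans (by gcongr)
      have f2 : Real.exp (-(√t / 2 * x ^ 2)) ≤ 1 := Real.exp_le_one_iff.2 (by
        have : 0 ≤ √t / 2 * x ^ 2 := by positivity
        linarith)
      have hrate := rate_pos ht
      have f3 : rate t ≤ q * (2 + t) := by
        have : rate t = q + 1 := rfl
        have h4 := rpow_neg_quarter_four ht
        have : 1 ≤ q * (1 + t) := by
          by_contra hc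
          push Not at hc
          have hq1 : q < 1 := by nlinarith
          have : q ^ 4 * t ≤ q * t := by
            have : q ^ 4 ≤ q := pow_le_of_le_one hq.le hq1.le (by norm_num)
            gcongr
          nlinarith
        nlinarith
      have f4 : 2 * rate t * Real.exp (-(√t / 2 * x ^ 2)) ≤ 2 * rate t :=
        mul_le_of_le_one_right (by positivity) f2
      have f5 : q * (t + 1) ≤ q * Real.exp (t + 1 / 8 * k ^ 4 * t) := by gcongr
      nlinarith [mul_pos hq ht]
    calc _ ≤ (|x| + 2 * rate t) * (Real.exp (-(√t / 2) * x ^ 2) *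
        Real.exp (-(√t / 2 * x ^ 2))) := by gcongr
      _ = ((|x| + 2 * rate t) * Real.exp (-(√t / 2 * x ^ 2))) *
          Real.exp (-(√t / 2) * x ^ 2) := by ring
      _ ≤ _ := by gcongr
  refine h1.trans (mul_le_mul_of_nonneg_right ?_ (Real.exp_pos _).le)
  have h2 := exp_mul_add_le_of_rate k (t := t) (M := M) (M' := 1) (by rw [hM, mul_one])
  rw [← rpow_neg_half_mul ht]
  rw [mul_one] at h2
  calc _ = M * Real.exp (3300 * (1 + t) - 7 / 8 * k ^ 4 * t) * (q * q) := by ring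
    _ ≤ _ := by gcongr

theorem continuousOn_K₀ (k : ℝ) :
    ContinuousOn (fun p : ℝ × ℝ => K₀ k p.1 p.2) {p | 0 < p.2} := continuousOn_osc IsAmp.one k

theorem continuousOn_K₀' (k : ℝ) :
    ContinuousOn (fun p : ℝ × ℝ => K₀' k p.1 p.2) {p | 0 < p.2} := continuousOn_osc isAmp_K₀' k

theorem continuousOn_S₀ (k : ℝ) :
    ContinuousOn (fun p : ℝ × ℝ => S₀ k p.1 p.2) {p | 0 < p.2} := continuousOn_osc (isAmp_S₀ k) k

theorem K₀_neg (k z t : ℝ) : K₀ k (-z) t = K₀ k z t := osc_neg_arg (fun _ => rfl) k z t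

theorem S₀_neg (k z t : ℝ) : S₀ k (-z) t = S₀ k z t :=
  osc_neg_arg (fun ζ => by simp [dsym]) k z t

theorem hasDerivAt_K₀ (k z : ℝ) {t : ℝ} (ht : 0 < t) :
    HasDerivAt (fun z => K₀ k z t) (K₀' k z t) z := by
  have := hasDerivAt_osc IsAmp.one (by simpa using IsAmp.id) k z ht
  simp only [mul_one] at this
  exact this

theorem hasDerivAt_K₀' (k z : ℝ) {t : ℝ} (ht : 0 < t) :
    HasDerivAt (fun z => K₀' k z t) (S₀ k z t + (k : ℂ) ^ 2 * K₀ k z t) z := by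
  have h1 : IsAmp fun ζ : ℂ => ζ * (Complex.I * ζ) := by
    convert IsAmp.sq.const_mul Complex.I using 2
    ring
  have := hasDerivAt_osc isAmp_K₀' h1 k z ht
  refine this.congr_deriv ?_
  unfold S₀ K₀
  rw [← osc_const_mul, ← osc_add (isAmp_S₀ k) (IsAmp.one.const_mul _) k z ht]
  congr 1
  ext ζ
  simp only [dsym]
  linear_combination ζ ^ 2 * Complex.I_sq


/-! ### Fourier multipliers and composition of free kernels. -/

open scoped FourierTransform

/-- The Fourier multiplier belonging to `osc a k · t`. -/
def mult (a : ℂ → ℂ) (k t ξ : ℝ) : ℂ :=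
  a ((2 * Real.pi * ξ : ℝ)) * Complex.exp (-t * psym k ((2 * Real.pi * ξ : ℝ)))

theorem fourierInv_real (m : ℝ → ℂ) (x : ℝ) :
    𝓕⁻ m x = ∫ ξ : ℝ, m ξ * Complex.exp (Complex.I * (2 * Real.pi * ξ : ℝ) * x) := by
  rw [Real.fourierInv_eq']
  congr 1; ext ξ
  rw [smul_eq_mul, mul_comm]
  congr 2
  simp
  ring

theorem osc_eq_fourierInv (a : ℂ → ℂ) (k z t : ℝ) : osc a k z t = 𝓕⁻ (mult a k t) z := by
  rw [fourierInv_real, osc]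
  have := Measure.integral_comp_mul_left (fun ξ : ℝ => a ξ * Complex.exp (-t * psym k ξ) *
    Complex.exp (Complex.I * ξ * z)) (2 * Real.pi)
  unfold mult
  rw [this, abs_of_pos (by positivity), Complex.real_smul]
  push_cast
  rfl

theorem integrable_mult {a : ℂ → ℂ} (ha : IsAmp a) (k : ℝ) {t : ℝ} (ht : 0 < t) :
    Integrable (mult a k t) := by
  have := (osc_integrand_integrable ha k 0 ht).comp_mul_left' (g := fun ξ : ℝ =>
    a ξ * Complex.exp (-t * psym k ξ) * Complex.exp (Complex.I * ξ * (0 : ℝ)))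
    (R := 2 * Real.pi) (by positivity)
  refine this.congr (Eventually.of_forall fun ξ => ?_)
  simp [mult]

theorem continuous_mult {a : ℂ → ℂ} (ha : IsAmp a) (k t : ℝ) : Continuous (mult a k t) := by
  have h1 := ha.diff.continuous
  have h2 := (differentiable_psym k).continuous
  unfold mult
  fun_prop

/-- Convolution with an inverse Fourier transform is a Fourier multiplier. -/
theorem integral_fourierInv_sub_mul {m g : ℝ → ℂ} (hm : Integrable m) (hg : Integrable g) (x : ℝ) :
    ∫ y, 𝓕⁻ m (x - y) * g y = 𝓕⁻ (fun ξ => m ξ * 𝓕 g ξ) x := by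
  have h1 : Integrable (fun p : ℝ × ℝ => (m p.2 *
      Complex.exp (Complex.I * (2 * Real.pi * p.2 : ℝ) * (x - p.1 : ℝ))) * g p.1) := by
    have h2 := (hg.mul_prod hm)
    have h3 : Integrable (fun p : ℝ × ℝ => Complex.exp (Complex.I * (2 * Real.pi * p.2 : ℝ) *
        (x - p.1 : ℝ)) * (g p.1 * m p.2)) (volume.prod volume) := by
      refine h2.bdd_mul (c := 1) ?_ ?_
      · exact Continuous.aestronglyMeasurable (by fun_prop)
      · refine Eventually.of_forall fun p => ?_
        rw [mul_assoc, ← Complex.ofReal_mul, Complex.norm_exp_I_mul_ofReal]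
    exact h3.congr (Eventually.of_forall fun p => by ring)
  simp_rw [fourierInv_real, ← integral_mul_const]
  rw [integral_integral_swap (f := fun y ξ => (m ξ *
      Complex.exp (Complex.I * (2 * Real.pi * ξ : ℝ) * (x - y : ℝ))) * g y) h1]
  congr 1; ext ξ
  rw [Real.fourier_real_eq_integral_exp_smul, mul_right_comm (m ξ), ← integral_const_mul]
  congr 1; ext y
  have e1 : Complex.exp (Complex.I * (2 * Real.pi * ξ : ℝ) * (x - y : ℝ)) =
      Complex.exp (Complex.I * (2 * Real.pi * ξ : ℝ) * x) *
        Complex.exp ((-2 * Real.pi * y * ξ : ℝ) * Complex.I) := by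
    rw [← Complex.exp_add]
    congr 1
    push_cast
    ring
  rw [smul_eq_mul, e1]
  ring

theorem integral_exp_neg_mul_abs {c : ℝ} (hc : 0 < c) :
    ∫ x : ℝ, Real.exp (-(c * |x|)) = 2 / c := by
  rw [integral_comp_abs (f := fun x => Real.exp (-(c * x)))]
  have := integral_exp_mul_Ioi (a := -c) (by linarith) 0
  simp only [neg_mul, mul_zero, Real.exp_zero] at this
  rw [this]
  field_simp

theorem integrable_exp_neg_mul_abs {c : ℝ} (hc : 0 < c) :
    Integrable fun x : ℝ => Real.exp (-(c * |x|)) := by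
  by_contra h
  have := integral_undef h
  rw [integral_exp_neg_mul_abs hc] at this
  exact (ne_of_gt (by positivity)) this

theorem integrable_exp_neg_mul_abs_sub {c : ℝ} (hc : 0 < c) (x : ℝ) :
    Integrable fun y : ℝ => Real.exp (-(c * |x - y|)) :=
  (integrable_exp_neg_mul_abs hc).comp_sub_left x

theorem integral_exp_neg_mul_abs_sub {c : ℝ} (hc : 0 < c) (x : ℝ) :
    ∫ y : ℝ, Real.exp (-(c * |x - y|)) = 2 / c := by
  rw [integral_sub_left_eq_self (fun y => Real.exp (-(c * |y|))) volume x]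
  exact integral_exp_neg_mul_abs hc

theorem integrable_osc {a : ℂ → ℂ} (ha : IsAmp a) (k : ℝ) {t B : ℝ} (ht : 0 < t)
    (hB : ∀ z, ‖osc a k z t‖ ≤ B * Real.exp (-(2 * rate t * |z|))) :
    Integrable fun z => osc a k z t := by
  refine ((integrable_exp_neg_mul_abs
    (mul_pos two_pos (rate_pos ht))).const_mul B).mono' ?_ (Eventually.of_forall hB)
  have : Continuous fun z => osc a k z t := by
    rw [← continuousOn_univ]
    exact (continuousOn_osc ha k).comp (f := fun z : ℝ => (z, t)) (by fun_prop) fun z _ => ht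
  exact this.aestronglyMeasurable

theorem integrable_K₀ (k : ℝ) {t : ℝ} (ht : 0 < t) : Integrable fun z => K₀ k z t :=
  integrable_osc IsAmp.one k ht fun z => norm_K₀_le k z ht

theorem integrable_S₀ (k : ℝ) {t : ℝ} (ht : 0 < t) : Integrable fun z => S₀ k z t :=
  integrable_osc (isAmp_S₀ k) k ht fun z => norm_S₀_le k z ht

/-- Convolution multiplies the Fourier multipliers, and the times add up in the exponent. -/
theorem osc_comp_osc {b : ℂ → ℂ} (hb : IsAmp b) (k x y : ℝ) {t r : ℝ} (ht : 0 < t)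
    (hr : 0 < r) (hbi : Integrable fun z => osc b k z r) :
    ∫ z, K₀ k (x - z) t * osc b k (z - y) r = osc b k (x - y) (t + r) := by
  have h1 : ∫ z, K₀ k (x - z) t * osc b k (z - y) r =
      ∫ z, 𝓕⁻ (mult (fun _ => 1) k t) (x - y - z) * osc b k z r := by
    rw [← integral_add_right_eq_self _ y]
    congr 1; ext z
    rw [K₀, osc_eq_fourierInv, add_sub_cancel_right, show x - (z + y) = x - y - z by ring]
  have h2 : 𝓕 (fun z => osc b k z r) = mult b k r := by
    have h3 : (fun z => osc b k z r) = 𝓕⁻ (mult b k r) := by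
      ext z; rw [osc_eq_fourierInv]
    rw [h3]
    refine (continuous_mult hb k r).fourier_fourierInv_eq (integrable_mult hb k hr) ?_
    -- The Fourier transform of the multiplier is the reflected kernel, so the hypothesis `hbi`
    -- supplies the integrability needed for Fourier inversion.
    have h4 : 𝓕 (mult b k r) = fun z => osc b k (-z) r := by
      ext z
      rw [osc_eq_fourierInv, Real.fourierInv_eq_fourier_neg, neg_neg]
    rw [h4]
    exact hbi.comp_neg
  rw [h1, integral_fourierInv_sub_mul (integrable_mult IsAmp.one k ht) hbi, h2, osc_eq_fourierInv]
  refine congrArg (fun m : ℝ → ℂ => 𝓕⁻ m (x - y)) (funext fun ξ => ?_)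
  simp only [mult, one_mul]
  rw [mul_left_comm, ← Complex.exp_add]
  congr 2
  push_cast
  ring

theorem K₀_comp_K₀ (k x y : ℝ) {t r : ℝ} (ht : 0 < t) (hr : 0 < r) :
    ∫ z, K₀ k (x - z) t * K₀ k (z - y) r = K₀ k (x - y) (t + r) :=
  osc_comp_osc IsAmp.one k x y ht hr (integrable_K₀ k hr)

theorem K₀_comp_S₀ (k x y : ℝ) {t r : ℝ} (ht : 0 < t) (hr : 0 < r) :
    ∫ z, K₀ k (x - z) t * S₀ k (z - y) r = S₀ k (x - y) (t + r) :=
  osc_comp_osc (isAmp_S₀ k) k x y ht hr (integrable_S₀ k hr)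

/-! ### Test functions and their free evolution. -/

/-- Test functions. -/
structure IsTest (φ : ℝ → ℂ) : Prop where
  smooth : ContDiff ℝ ∞ φ
  supp : HasCompactSupport φ

namespace IsTest

variable {φ ψ : ℝ → ℂ}

theorem add (h : IsTest φ) (h' : IsTest ψ) : IsTest fun x => φ x + ψ x :=
  ⟨h.smooth.add h'.smooth, h.supp.add h'.supp⟩

theorem smooth_mul (h : IsTest φ) {g : ℝ → ℂ} (hg : ContDiff ℝ ∞ g) : IsTest fun x => g x * φ x :=
  ⟨hg.mul h.smooth, h.supp.mul_left⟩

theorem const_mul (h : IsTest φ) (c : ℂ) : IsTest fun x => c * φ x :=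
  h.smooth_mul contDiff_const

theorem neg (h : IsTest φ) : IsTest fun x => -φ x := by
  simpa using h.const_mul (-1)

theorem deriv (h : IsTest φ) : IsTest (deriv φ) :=
  ⟨(contDiff_infty_iff_deriv.1 h.smooth).2, h.supp.deriv⟩

theorem iteratedDeriv (h : IsTest φ) (n : ℕ) : IsTest (iteratedDeriv n φ) := by
  induction n with
  | zero => simpa using h
  | succ n ih => rw [iteratedDeriv_succ]; exact ih.deriv

theorem D (h : IsTest φ) (k : ℝ) : IsTest (D k φ) :=
  (h.iteratedDeriv 2).neg.add (h.const_mul _)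

theorem integrable (h : IsTest φ) : Integrable φ :=
  h.smooth.continuous.integrable_of_hasCompactSupport h.supp

/-- Compact support is traded for exponential decay, a property that the free evolution preserves.
-/
theorem exists_bound (h : IsTest φ) : ∃ C : ℝ, 0 ≤ C ∧ ∀ x, ‖φ x‖ ≤ C * Real.exp (-|x|) := by
  have hc : Continuous fun x => (Real.exp |x| : ℂ) * φ x := by
    have := h.smooth.continuous
    fun_prop
  have hs : HasCompactSupport fun x => (Real.exp |x| : ℂ) * φ x := h.supp.mul_left
  obtain ⟨C, hC⟩ := hc.bounded_above_of_compact_support hs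
  refine ⟨C, (norm_nonneg _).trans (hC 0), fun x => ?_⟩
  have := hC x
  rw [norm_mul, Complex.norm_real, Real.norm_of_nonneg (Real.exp_pos _).le] at this
  rw [Real.exp_neg, ← div_eq_mul_inv, le_div_iff₀ (Real.exp_pos _)]
  linarith

theorem fourierInv_fourier (h : IsTest φ) : 𝓕⁻ (𝓕 φ) = φ := by
  have := h.smooth.continuous
  refine this.fourierInv_fourier_eq h.integrable ?_
  exact (𝓕 (h.supp.toSchwartzMap h.smooth)).integrable

theorem integrable_fourier (h : IsTest φ) : Integrable (𝓕 φ) :=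
  (𝓕 (h.supp.toSchwartzMap h.smooth)).integrable

theorem fourier_iteratedDeriv_two (h : IsTest φ) (ξ : ℝ) :
    𝓕 (_root_.iteratedDeriv 2 φ) ξ = -((2 * Real.pi * ξ : ℝ) : ℂ) ^ 2 * 𝓕 φ ξ := by
  rw [Real.fourier_iteratedDeriv (N := ⊤) (n := 2) h.smooth
    (fun n _ => (h.iteratedDeriv n).integrable) (by simp)]
  simp only [smul_eq_mul]
  push_cast
  linear_combination (2 * Real.pi * ξ : ℂ) ^ 2 * 𝓕 φ ξ * Complex.I_sq

theorem fourier_D (h : IsTest φ) (k ξ : ℝ) :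
    𝓕 (CahnHilliard.D k φ) ξ = dsym k (2 * Real.pi * ξ : ℝ) * 𝓕 φ ξ := by
  have e : ∀ f : ℝ → ℂ, 𝓕 f ξ = ∫ v, Complex.exp ((-2 * Real.pi * v * ξ : ℝ) * Complex.I) • f v :=
    fun f => Real.fourier_real_eq_integral_exp_smul f ξ
  have hi : ∀ f : ℝ → ℂ, IsTest f → Integrable fun v : ℝ =>
      Complex.exp ((-2 * Real.pi * v * ξ : ℝ) * Complex.I) • f v := by
    intro f hf
    refine hf.integrable.bdd_mul (c := 1) (Continuous.aestronglyMeasurable (by fun_prop)) ?_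
    exact Eventually.of_forall fun v => by rw [Complex.norm_exp_ofReal_mul_I]
  have h1 := h.fourier_iteratedDeriv_two ξ
  rw [e] at h1
  have h2 : 𝓕 (CahnHilliard.D k φ) ξ =
      -𝓕 (_root_.iteratedDeriv 2 φ) ξ + (k : ℂ) ^ 2 * 𝓕 φ ξ := by
    have hi2 := (hi _ (h.iteratedDeriv 2)).fun_neg
    rw [e, e (_root_.iteratedDeriv 2 φ), e φ, ← integral_neg, ← integral_const_mul,
      ← integral_add hi2 ((hi _ h).const_mul _)]
    congr 1; ext v
    simp only [CahnHilliard.D, smul_eq_mul]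
    ring
  rw [h2, h.fourier_iteratedDeriv_two, dsym]
  ring

end IsTest

/-- The free evolution of `φ`. -/
def freeEvol (k : ℝ) (φ : ℝ → ℂ) (t x : ℝ) : ℂ := ∫ y, K₀ k (x - y) t * φ y

theorem freeEvol_eq (k : ℝ) {φ : ℝ → ℂ} (h : Integrable φ) {t : ℝ} (ht : 0 < t) (x : ℝ) :
    freeEvol k φ t x = 𝓕⁻ (fun ξ => mult (fun _ => 1) k t ξ * 𝓕 φ ξ) x := by
  rw [freeEvol, ← integral_fourierInv_sub_mul (integrable_mult IsAmp.one k ht) h]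
  simp only [K₀, osc_eq_fourierInv]

theorem integral_S₀_mul (k : ℝ) {φ : ℝ → ℂ} (h : IsTest φ) {t : ℝ} (ht : 0 < t) (x : ℝ) :
    ∫ y, S₀ k (x - y) t * φ y = -freeEvol k (D k φ) t x := by
  have h1 := integral_fourierInv_sub_mul (integrable_mult (isAmp_S₀ k) k ht) h.integrable x
  rw [freeEvol_eq k (h.D k).integrable ht]
  simp only [S₀, osc_eq_fourierInv, h1]
  rw [fourierInv_real, fourierInv_real, ← integral_neg]
  congr 1; ext ξ
  rw [h.fourier_D, mult, mult]
  ring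

/-- `-D_k (D_k + 1) φ`. -/
def freeGen (k : ℝ) (φ : ℝ → ℂ) : ℝ → ℂ := fun x => -(D k (D k φ) x + D k φ x)

theorem IsTest.freeGen {φ : ℝ → ℂ} (h : IsTest φ) (k : ℝ) : IsTest (freeGen k φ) :=
  (((h.D k).D k).add (h.D k)).neg

theorem IsTest.fourier_freeGen {φ : ℝ → ℂ} (h : IsTest φ) (k ξ : ℝ) :
    𝓕 (CahnHilliard.freeGen k φ) ξ = -psym k (2 * Real.pi * ξ : ℝ) * 𝓕 φ ξ := by
  have e : ∀ f : ℝ → ℂ, 𝓕 f ξ = ∫ v, Complex.exp ((-2 * Real.pi * v * ξ : ℝ) * Complex.I) • f v :=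
    fun f => Real.fourier_real_eq_integral_exp_smul f ξ
  have hi : ∀ f : ℝ → ℂ, IsTest f → Integrable fun v : ℝ =>
      Complex.exp ((-2 * Real.pi * v * ξ : ℝ) * Complex.I) • f v := by
    intro f hf
    refine hf.integrable.bdd_mul (c := 1) (Continuous.aestronglyMeasurable (by fun_prop)) ?_
    exact Eventually.of_forall fun v => by rw [Complex.norm_exp_ofReal_mul_I]
  have h2 := (h.D k).fourier_D k ξ
  have h1 := h.fourier_D k ξ
  have h3 : 𝓕 (CahnHilliard.freeGen k φ) ξ =
      -(𝓕 (CahnHilliard.D k (CahnHilliard.D k φ)) ξ + 𝓕 (CahnHilliard.D k φ) ξ) := by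
    rw [e, e, e, ← integral_add (hi _ ((h.D k).D k)) (hi _ (h.D k)), ← integral_neg]
    congr 1; ext v
    simp only [CahnHilliard.freeGen, smul_eq_mul]
    ring
  rw [h3, h2, h1, psym]
  ring

theorem psym_ofReal (k ξ : ℝ) :
    psym k (ξ : ℂ) = (((ξ ^ 2 + k ^ 2) ^ 2 + (ξ ^ 2 + k ^ 2) : ℝ) : ℂ) := by
  simp [psym, dsym]

theorem norm_exp_neg_psym_le_one (k ξ : ℝ) {t : ℝ} (ht : 0 ≤ t) :
    ‖Complex.exp (-t * psym k (ξ : ℂ))‖ ≤ 1 := by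
  rw [psym_ofReal, ← Complex.ofReal_neg, ← Complex.ofReal_mul, Complex.norm_exp_ofReal,
    Real.exp_le_one_iff]
  have : 0 ≤ t * ((ξ ^ 2 + k ^ 2) ^ 2 + (ξ ^ 2 + k ^ 2)) := by positivity
  linarith

/-- Duhamel's formula for the free evolution of a test function. -/
theorem freeEvol_sub_eq (k : ℝ) {φ : ℝ → ℂ} (h : IsTest φ) {t : ℝ} (ht : 0 < t) (x : ℝ) :
    freeEvol k φ t x - φ x = ∫ s in (0 : ℝ)..t, freeEvol k (freeGen k φ) s x := by
  set p : ℝ → ℂ := fun ξ => psym k (2 * Real.pi * ξ : ℝ) with hp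
  set e : ℝ → ℂ := fun ξ => Complex.exp (Complex.I * (2 * Real.pi * ξ : ℝ) * x) with he
  have hpc : Continuous p := by
    have h2 := (differentiable_psym k).continuous
    fun_prop
  have hF : Integrable (𝓕 (freeGen k φ)) := (h.freeGen k).integrable_fourier
  have hnorm : ∀ ξ, ‖e ξ‖ ≤ 1 := fun ξ => by
    rw [he]; dsimp only
    rw [mul_assoc, ← Complex.ofReal_mul, Complex.norm_exp_I_mul_ofReal]
  have hec : Continuous e := by fun_prop
  have hdx : ∀ s : ℝ, 0 ≤ s → Integrable (fun ξ => Complex.exp (-s * p ξ) * 𝓕 φ ξ * e ξ) := by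
    intro s hs
    have h1 := h.integrable_fourier.bdd_mul (c := 1)
      (f := fun ξ => Complex.exp (-s * p ξ) * e ξ) (Continuous.aestronglyMeasurable (by fun_prop))
      (Eventually.of_forall fun ξ => by
        rw [norm_mul]
        exact mul_le_one₀ (norm_exp_neg_psym_le_one k _ hs) (norm_nonneg _) (hnorm ξ))
    exact h1.congr (Eventually.of_forall fun ξ => by ring)
  have h0 : φ x = ∫ ξ, Complex.exp (-(0 : ℝ) * p ξ) * 𝓕 φ ξ * e ξ := by
    conv_lhs => rw [← h.fourierInv_fourier]
    rw [fourierInv_real]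
    simp [he]
  have h1 : freeEvol k φ t x = ∫ ξ, Complex.exp (-t * p ξ) * 𝓕 φ ξ * e ξ := by
    rw [freeEvol_eq k h.integrable ht, fourierInv_real]
    simp [mult, he, hp]
  have h2 : ∀ s ∈ Set.Ioc (0 : ℝ) t, freeEvol k (freeGen k φ) s x =
      ∫ ξ, Complex.exp (-s * p ξ) * 𝓕 (freeGen k φ) ξ * e ξ := by
    intro s hs
    rw [freeEvol_eq k (h.freeGen k).integrable hs.1, fourierInv_real]
    simp [mult, he, hp]
  rw [h1, h0, ← integral_sub (hdx t ht.le) (hdx 0 le_rfl), intervalIntegral.integral_of_le ht.le,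
    setIntegral_congr_fun measurableSet_Ioc h2, integral_integral_swap]
  -- After the exchange of integrals the identity holds at each frequency: it is the fundamental
  -- theorem of calculus for s ↦ exp(-s p(ξ)), whose derivative brings down the multiplier of
  -- `freeGen`.
  · congr 1; ext ξ
    rw [← intervalIntegral.integral_of_le ht.le]
    have hd : ∀ s : ℝ, HasDerivAt (fun s : ℝ => Complex.exp (-s * p ξ) * 𝓕 φ ξ * e ξ)
        (Complex.exp (-s * p ξ) * 𝓕 (freeGen k φ) ξ * e ξ) s := by
      intro s
      have h3 : HasDerivAt (fun s : ℝ => -(s : ℂ) * p ξ) (-1 * p ξ) s :=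
        ((Complex.ofRealCLM.hasDerivAt (x := s)).neg).mul_const _
      refine (((h3.cexp).mul_const (𝓕 φ ξ)).mul_const (e ξ)).congr_deriv ?_
      rw [h.fourier_freeGen]
      ring
    rw [intervalIntegral.integral_eq_sub_of_hasDerivAt (fun s _ => hd s)]
    exact Continuous.intervalIntegrable (by fun_prop) _ _
  · have h3 : Integrable (fun q : ℝ × ℝ => (1 : ℂ) * 𝓕 (freeGen k φ) q.2)
        ((volume.restrict (Set.Ioc 0 t)).prod volume) := (integrable_const _).mul_prod hF
    -- The multiplier is bounded by one only for s ≥ 0. Cutting off negative times makes the bound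
    -- hold everywhere and changes nothing on (0, t].
    have h4 := h3.bdd_mul (c := 1) (f := fun q : ℝ × ℝ => Set.indicator {q : ℝ × ℝ | 0 ≤ q.1}
      (fun q => Complex.exp (-q.1 * p q.2) * e q.2) q)
      ((Continuous.aestronglyMeasurable (by fun_prop)).indicator
        (measurableSet_le measurable_const measurable_fst))
      (Eventually.of_forall fun q => by
        by_cases hq : 0 ≤ q.1
        · rw [Set.indicator_of_mem (by exact hq), norm_mul]
          exact mul_le_one₀ (norm_exp_neg_psym_le_one k _ hq) (norm_nonneg _) (hnorm _)
        · rw [Set.indicator_of_notMem (by exact hq)]; simp)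
    refine h4.congr ?_
    have h5 : ∀ᵐ q : ℝ × ℝ ∂((volume.restrict (Set.Ioc 0 t)).prod volume), 0 ≤ q.1 := by
      have : ∀ᵐ s ∂(volume.restrict (Set.Ioc 0 t)), 0 ≤ s := by
        filter_upwards [ae_restrict_mem measurableSet_Ioc] with s hs using hs.1.le
      exact Measure.quasiMeasurePreserving_fst.ae this
    filter_upwards [h5] with q hq
    rw [Set.indicator_of_mem (by exact hq)]
    simp only [Function.uncurry]
    ring

/-- Of the rate 2 rate t, one half carries the decay from y to x. The other half is integrated and
yields 2 / rate t, which cancels t^{-1/4}. -/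
theorem norm_freeEvol_le (k : ℝ) {φ : ℝ → ℂ} {C : ℝ} (hC : 0 ≤ C)
    (hφ : ∀ x, ‖φ x‖ ≤ C * Real.exp (-|x|)) {t : ℝ} (ht : 0 < t) (x : ℝ) :
    ‖freeEvol k φ t x‖ ≤ 2 * C₀ * C * Real.exp (Λ₀ * t) * Real.exp (-|x|) := by
  have hω := rate_pos ht
  have hq : 0 < t ^ (-(1 / 4) : ℝ) := Real.rpow_pos_of_pos ht _
  set B := C₀ * Real.exp (Λ₀ * t) * t ^ (-(1 / 4) : ℝ) * C * Real.exp (-|x|)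
  have hB : 0 ≤ B := by have := C₀_pos; positivity
  have h1 : ∀ y, ‖K₀ k (x - y) t * φ y‖ ≤ B * Real.exp (-(rate t * |x - y|)) := by
    intro y
    have e0 : Real.exp ((Λ₀ - 3 / 4 * k ^ 4) * t) ≤ Real.exp (Λ₀ * t) := by
      rw [Real.exp_le_exp]
      have : 0 ≤ 3 / 4 * k ^ 4 * t := by positivity
      linarith
    have e1 : Real.exp (-(2 * rate t * |x - y|)) * Real.exp (-|y|) ≤
        Real.exp (-|x|) * Real.exp (-(rate t * |x - y|)) := by
      rw [← Real.exp_add, ← Real.exp_add, Real.exp_le_exp]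
      have := abs_sub_abs_le_abs_sub x y
      nlinarith [one_le_rate ht, abs_nonneg (x - y)]
    have := C₀_pos
    rw [norm_mul]
    calc _ ≤ (C₀ * Real.exp (Λ₀ * t) * t ^ (-(1 / 4) : ℝ) * Real.exp (-(2 * rate t * |x - y|))) *
          (C * Real.exp (-|y|)) := by
          gcongr
          · exact (norm_K₀_le k _ ht).trans (by gcongr)
          · exact hφ y
      _ = (C₀ * Real.exp (Λ₀ * t) * t ^ (-(1 / 4) : ℝ) * C) * (Real.exp (-(2 * rate t * |x - y|)) *
          Real.exp (-|y|)) := by ring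
      _ ≤ (C₀ * Real.exp (Λ₀ * t) * t ^ (-(1 / 4) : ℝ) * C) *
          (Real.exp (-|x|) * Real.exp (-(rate t * |x - y|))) := by gcongr
      _ = _ := by simp only [B]; ring
  have h2 := norm_integral_le_of_norm_le
    ((integrable_exp_neg_mul_abs_sub hω x).const_mul B) (Eventually.of_forall h1)
  rw [integral_const_mul, integral_exp_neg_mul_abs_sub hω] at h2
  refine h2.trans ?_
  have h3 : t ^ (-(1 / 4) : ℝ) / rate t ≤ 1 := by
    rw [div_le_one hω]; exact rpow_neg_quarter_le_rate t
  calc B * (2 / rate t) = (2 * C₀ * C * Real.exp (Λ₀ * t) * Real.exp (-|x|)) *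
        (t ^ (-(1 / 4) : ℝ) / rate t) := by simp only [B]; ring
    _ ≤ _ := mul_le_of_le_one_right (by have := C₀_pos; positivity) h3

theorem norm_freeEvol_sub_le (k : ℝ) {φ : ℝ → ℂ} (h : IsTest φ) : ∃ C : ℝ, 0 ≤ C ∧
    ∀ t x : ℝ, 0 < t → t ≤ 1 → ‖freeEvol k φ t x - φ x‖ ≤ C * t * Real.exp (-|x|) := by
  obtain ⟨C, hC, hb⟩ := (h.freeGen k).exists_bound
  have := C₀_pos
  refine ⟨2 * C₀ * C * Real.exp Λ₀, by positivity, fun t x ht ht1 => ?_⟩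
  rw [freeEvol_sub_eq k h ht]
  have h1 := intervalIntegral.norm_integral_le_of_norm_le_const (a := 0) (b := t)
    (f := fun s => freeEvol k (freeGen k φ) s x)
    (C := 2 * C₀ * C * Real.exp Λ₀ * Real.exp (-|x|)) fun s hs => by
      rw [Set.uIoc_of_le ht.le] at hs
      refine (norm_freeEvol_le k hC hb hs.1 x).trans ?_
      have : Λ₀ * s ≤ Λ₀ := by
        have : 0 ≤ Λ₀ := by unfold Λ₀; norm_num
        exact mul_le_of_le_one_right this (hs.2.trans ht1)
      gcongr
  rw [sub_zero, abs_of_pos ht] at h1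
  exact h1.trans (le_of_eq (by ring))


/-! ### Singular time integrals. -/

/-- On each half of (0, t) one of the two singular factors is bounded by its value at t/2. -/
theorem rpow_mul_rpow_le {s t a b : ℝ} (ha : 0 ≤ a) (hb : 0 ≤ b) (hs : 0 < s) (hst : s < t) :
    (t - s) ^ (-a) * s ^ (-b) ≤ (t / 2) ^ (-a) * s ^ (-b) + (t / 2) ^ (-b) * (t - s) ^ (-a) := by
  have h1 : 0 < t - s := sub_pos.2 hst
  have ht : 0 < t / 2 := by linarith
  have p1 : 0 < s ^ (-b) := Real.rpow_pos_of_pos hs _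
  have p2 : 0 < (t - s) ^ (-a) := Real.rpow_pos_of_pos h1 _
  have p3 : 0 < (t / 2) ^ (-a) := Real.rpow_pos_of_pos ht _
  have p4 : 0 < (t / 2) ^ (-b) := Real.rpow_pos_of_pos ht _
  rcases le_total s (t / 2) with h | h
  · have : (t - s) ^ (-a) ≤ (t / 2) ^ (-a) :=
      Real.rpow_le_rpow_of_nonpos ht (by linarith) (by linarith)
    nlinarith [mul_le_mul_of_nonneg_right this p1.le, mul_pos p4 p2]
  · have : s ^ (-b) ≤ (t / 2) ^ (-b) := Real.rpow_le_rpow_of_nonpos ht h (by linarith)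
    nlinarith [mul_le_mul_of_nonneg_left this p2.le, mul_pos p3 p1]

theorem integrableOn_rpow_Ioo {b : ℝ} (hb : b < 1) (t : ℝ) :
    IntegrableOn (fun s : ℝ => s ^ (-b)) (Set.Ioo 0 t) := by
  rcases le_total 0 t with ht | ht
  · have h := intervalIntegral.intervalIntegrable_rpow' (a := 0) (b := t) (by linarith : -1 < -b)
    rw [intervalIntegrable_iff_integrableOn_Ioo_of_le ht] at h
    exact h
  · simp [Set.Ioo_eq_empty (not_lt.2 ht)]

theorem integrableOn_rpow_sub_Ioo {a : ℝ} (ha : a < 1) (t : ℝ) :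
    IntegrableOn (fun s : ℝ => (t - s) ^ (-a)) (Set.Ioo 0 t) := by
  rcases le_total 0 t with ht | ht
  · have h := (intervalIntegral.intervalIntegrable_rpow' (a := 0) (b := t)
      (by linarith : -1 < -a)).comp_sub_left t
    rw [sub_zero, sub_self] at h
    have h := h.symm
    rw [intervalIntegrable_iff_integrableOn_Ioo_of_le ht] at h
    exact h
  · simp [Set.Ioo_eq_empty (not_lt.2 ht)]

theorem integral_rpow_sub_Ioo {a : ℝ} (ha : a < 1) {t : ℝ} (ht : 0 < t) :
    ∫ s in Set.Ioo 0 t, (t - s) ^ (-a) = t ^ (1 - a) / (1 - a) := by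
  rw [← integral_Ioc_eq_integral_Ioo, ← intervalIntegral.integral_of_le ht.le,
    intervalIntegral.integral_comp_sub_left (fun s => s ^ (-a)) t, sub_self, sub_zero,
    integral_rpow (Or.inl (by linarith)), Real.zero_rpow (by linarith)]
  rw [show -a + 1 = 1 - a by ring, sub_zero]

theorem continuousOn_rpow_sub_mul_rpow (a b t : ℝ) :
    ContinuousOn (fun s : ℝ => (t - s) ^ (-a) * s ^ (-b)) (Set.Ioo 0 t) :=
  ((continuousOn_const.sub continuousOn_id).rpow_const
    fun _ hs => Or.inl (sub_pos.2 hs.2).ne').mul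
    (continuousOn_id.rpow_const fun _ hs => Or.inl hs.1.ne')

theorem integrableOn_rpow_mul_rpow {a b : ℝ} (ha : 0 ≤ a) (ha1 : a < 1) (hb : 0 ≤ b) (hb1 : b < 1)
    (t : ℝ) : IntegrableOn (fun s : ℝ => (t - s) ^ (-a) * s ^ (-b)) (Set.Ioo 0 t) := by
  refine (((integrableOn_rpow_Ioo hb1 t).const_mul ((t / 2) ^ (-a))).add
    ((integrableOn_rpow_sub_Ioo ha1 t).const_mul ((t / 2) ^ (-b)))).mono'
    ((continuousOn_rpow_sub_mul_rpow a b t).aestronglyMeasurable measurableSet_Ioo) ?_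
  filter_upwards [ae_restrict_mem measurableSet_Ioo] with s hs
  have h1 : 0 < (t - s) ^ (-a) := Real.rpow_pos_of_pos (sub_pos.2 hs.2) _
  have h2 : 0 < s ^ (-b) := Real.rpow_pos_of_pos hs.1 _
  rw [Real.norm_of_nonneg (by positivity)]
  exact rpow_mul_rpow_le ha hb hs.1 hs.2

theorem integral_rpow_neg_half_mul_exp {l : ℝ} (hl : 0 < l) :
    IntegrableOn (fun s : ℝ => s ^ (-(1 / 2) : ℝ) * Real.exp (-(l * s))) (Set.Ioi 0) ∧
    ∫ s in Set.Ioi (0 : ℝ), s ^ (-(1 / 2) : ℝ) * Real.exp (-(l * s)) ≤ 2 * l ^ (-(1 / 2) : ℝ) := by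
  have h := Real.integral_rpow_mul_exp_neg_mul_Ioi (a := 1 / 2) (by norm_num) hl
  rw [Real.Gamma_one_half_eq, show (1 / 2 - 1 : ℝ) = -(1 / 2) by norm_num, one_div l,
    Real.inv_rpow hl.le, ← Real.rpow_neg hl.le] at h
  have hp : 0 < l ^ (-(1 / 2) : ℝ) := Real.rpow_pos_of_pos hl _
  constructor
  · by_contra hc
    rw [integral_undef hc] at h
    have := Real.sqrt_pos.2 Real.pi_pos
    exact (by positivity : l ^ (-(1 / 2) : ℝ) * √Real.pi ≠ 0) h.symm
  · rw [h, mul_comm]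
    gcongr
    rw [Real.sqrt_le_left (by norm_num)]
    linarith [Real.pi_lt_four]

theorem exp_neg_le_rpow_neg_half {x : ℝ} (hx : 0 < x) : Real.exp (-x) ≤ x ^ (-(1 / 2) : ℝ) := by
  rw [Real.rpow_neg hx.le, Real.exp_neg, ← Real.sqrt_eq_rpow]
  gcongr
  rw [Real.sqrt_le_left (Real.exp_pos _).le]
  nlinarith [Real.add_one_le_exp x]

/-- The gain l^{-1/2} is what makes the Volterra map contract. For s ≤ t/2 the factor (t-s)^{-3/4}
is at most 2t^{-3/4} and a Gamma integral remains, contributing 4. For s ≥ t/2 the bound exp(-ls) ≤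
(ls)^{-1/2} leaves 1/s ≤ 2/t and the integral 4t^{1/4}, contributing 8. -/
theorem integral_rpow_exp_le {l t : ℝ} (hl : 0 < l) (ht : 0 < t) :
    ∫ s in Set.Ioo 0 t, (t - s) ^ (-(3 / 4) : ℝ) * s ^ (-(1 / 2) : ℝ) * Real.exp (-(l * s)) ≤
      12 * l ^ (-(1 / 2) : ℝ) * t ^ (-(3 / 4) : ℝ) := by
  obtain ⟨hi, hle⟩ := integral_rpow_neg_half_mul_exp hl
  have hp : 0 < l ^ (-(1 / 2) : ℝ) := Real.rpow_pos_of_pos hl _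
  have hpt : 0 < t ^ (-(3 / 4) : ℝ) := Real.rpow_pos_of_pos ht _
  have hi' := hi.mono_set (fun s (hs : s ∈ Set.Ioo 0 t) => hs.1)
  have hj := integrableOn_rpow_sub_Ioo (a := 3 / 4) (by norm_num) t
  have key : ∀ s ∈ Set.Ioo 0 t,
      (t - s) ^ (-(3 / 4) : ℝ) * s ^ (-(1 / 2) : ℝ) * Real.exp (-(l * s)) ≤
      2 * t ^ (-(3 / 4) : ℝ) * (s ^ (-(1 / 2) : ℝ) * Real.exp (-(l * s))) +
        2 * l ^ (-(1 / 2) : ℝ) * t⁻¹ * (t - s) ^ (-(3 / 4) : ℝ) := by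
    intro s hs
    have h1 : 0 < t - s := sub_pos.2 hs.2
    have p1 : 0 < s ^ (-(1 / 2) : ℝ) := Real.rpow_pos_of_pos hs.1 _
    have p2 : 0 < (t - s) ^ (-(3 / 4) : ℝ) := Real.rpow_pos_of_pos h1 _
    have p3 := Real.exp_pos (-(l * s))
    have pt : 0 < t⁻¹ := inv_pos.2 ht
    rcases le_total s (t / 2) with h | h
    · have e1 : (t - s) ^ (-(3 / 4) : ℝ) ≤ 2 * t ^ (-(3 / 4) : ℝ) := by
        calc (t - s) ^ (-(3 / 4) : ℝ) ≤ (t / 2) ^ (-(3 / 4) : ℝ) :=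
              Real.rpow_le_rpow_of_nonpos (by linarith) (by linarith) (by norm_num)
          _ = t ^ (-(3 / 4) : ℝ) * 2 ^ (3 / 4 : ℝ) := by
              rw [Real.div_rpow ht.le (by norm_num), Real.rpow_neg (by norm_num : (0 : ℝ) ≤ 2),
                div_inv_eq_mul]
          _ ≤ t ^ (-(3 / 4) : ℝ) * 2 := by
              gcongr
              calc (2 : ℝ) ^ (3 / 4 : ℝ) ≤ 2 ^ (1 : ℝ) :=
                    Real.rpow_le_rpow_of_exponent_le (by norm_num) (by norm_num)
                _ = 2 := Real.rpow_one 2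
          _ = _ := mul_comm _ _
      have : 0 ≤ 2 * l ^ (-(1 / 2) : ℝ) * t⁻¹ * (t - s) ^ (-(3 / 4) : ℝ) := by positivity
      have e2 := mul_le_mul_of_nonneg_right e1 (mul_pos p1 p3).le
      nlinarith
    · have e1 : s ^ (-(1 / 2) : ℝ) * Real.exp (-(l * s)) ≤ 2 * l ^ (-(1 / 2) : ℝ) * t⁻¹ := by
        calc s ^ (-(1 / 2) : ℝ) * Real.exp (-(l * s))
            ≤ s ^ (-(1 / 2) : ℝ) * (l * s) ^ (-(1 / 2) : ℝ) := by
              gcongr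
              exact exp_neg_le_rpow_neg_half (mul_pos hl hs.1)
          _ = l ^ (-(1 / 2) : ℝ) * s⁻¹ := by
              rw [Real.mul_rpow hl.le hs.1.le, mul_left_comm, ← Real.rpow_add hs.1]
              norm_num
              left
              exact Real.rpow_neg_one s
          _ ≤ l ^ (-(1 / 2) : ℝ) * (2 * t⁻¹) := by
              gcongr
              rw [← div_eq_mul_inv, ← inv_div]
              exact inv_anti₀ (by linarith) h
          _ = _ := by ring
      have : 0 ≤ 2 * t ^ (-(3 / 4) : ℝ) * (s ^ (-(1 / 2) : ℝ) * Real.exp (-(l * s))) := by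
        positivity
      have e2 := mul_le_mul_of_nonneg_left e1 p2.le
      nlinarith
  have hI : IntegrableOn (fun s : ℝ => (t - s) ^ (-(3 / 4) : ℝ) * s ^ (-(1 / 2) : ℝ) *
      Real.exp (-(l * s))) (Set.Ioo 0 t) :=
    (integrableOn_rpow_mul_rpow (by norm_num) (by norm_num) (by norm_num) (by norm_num) t).mul_bdd
      (c := 1) (Continuous.aestronglyMeasurable (by fun_prop)) (by
        filter_upwards [ae_restrict_mem measurableSet_Ioo] with s hs
        rw [Real.norm_of_nonneg (Real.exp_pos _).le, Real.exp_le_one_iff]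
        have := mul_pos hl hs.1
        linarith)
  have h1 := setIntegral_mono_on hI
    ((hi'.const_mul (2 * t ^ (-(3 / 4) : ℝ))).add (hj.const_mul (2 * l ^ (-(1 / 2) : ℝ) * t⁻¹)))
    measurableSet_Ioo key
  simp only [Pi.add_apply] at h1
  rw [integral_add (hi'.const_mul _) (hj.const_mul _), integral_const_mul, integral_const_mul,
    integral_rpow_sub_Ioo (by norm_num) ht] at h1
  have h2 : ∫ s in Set.Ioo 0 t, s ^ (-(1 / 2) : ℝ) * Real.exp (-(l * s)) ≤
      2 * l ^ (-(1 / 2) : ℝ) := by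
    refine (setIntegral_mono_set hi ?_ (LE.le.eventuallyLE
      fun s (hs : s ∈ Set.Ioo 0 t) => hs.1)).trans hle
    filter_upwards [ae_restrict_mem measurableSet_Ioi] with s hs
    have := Real.rpow_pos_of_pos (Set.mem_Ioi.1 hs) (-(1 / 2))
    exact (mul_pos this (Real.exp_pos _)).le
  have h3 : t⁻¹ * t ^ (1 - 3 / 4 : ℝ) = t ^ (-(3 / 4) : ℝ) := by
    rw [← Real.rpow_neg_one, ← Real.rpow_add ht]; norm_num
  have h4 := mul_le_mul_of_nonneg_left h2 (mul_pos two_pos hpt).le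
  refine h1.trans ?_
  have h5 : 2 * l ^ (-(1 / 2) : ℝ) * t⁻¹ * (t ^ (1 - 3 / 4 : ℝ) / (1 - 3 / 4)) =
      8 * l ^ (-(1 / 2) : ℝ) * t ^ (-(3 / 4) : ℝ) := by rw [← h3]; ring
  rw [h5]
  linarith

/-! ### Space-time convolutions and their bounds. -/

/-- The space-time slab `(0, t) × ℝ`. -/
def slab (t : ℝ) : Set (ℝ × ℝ) := Set.Ioo 0 t ×ˢ Set.univ

theorem measurableSet_slab (t : ℝ) : MeasurableSet (slab t) := measurableSet_Ioo.prod .univ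

theorem volume_restrict_slab (t : ℝ) : (volume : Measure (ℝ × ℝ)).restrict (slab t) =
    ((volume : Measure ℝ).restrict (Set.Ioo 0 t)).prod volume := by
  rw [slab, Measure.volume_eq_prod, ← Measure.prod_restrict, Measure.restrict_univ]

theorem slab_exp {c : ℝ → ℝ} {t : ℝ} (hc : ContinuousOn c (Set.Ioo 0 t))
    (hc0 : ∀ s ∈ Set.Ioo 0 t, 0 ≤ c s)
    (hi : IntegrableOn (fun s => c s * (2 / rate s)) (Set.Ioo 0 t)) (y : ℝ) :
    IntegrableOn (fun p : ℝ × ℝ => c p.1 * Real.exp (-(rate p.1 * |p.2 - y|))) (slab t) ∧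
    ∫ p in slab t, c p.1 * Real.exp (-(rate p.1 * |p.2 - y|)) =
      ∫ s in Set.Ioo 0 t, c s * (2 / rate s) := by
  have h1 : ∀ s ∈ Set.Ioo 0 t, ∫ z, c s * Real.exp (-(rate s * |z - y|)) = c s * (2 / rate s) := by
    intro s hs
    rw [integral_const_mul]
    congr 1
    rw [← integral_exp_neg_mul_abs_sub (rate_pos hs.1) y]
    simp only [abs_sub_comm]
  have hI : IntegrableOn (fun p : ℝ × ℝ => c p.1 * Real.exp (-(rate p.1 * |p.2 - y|))) (slab t) := by
    rw [IntegrableOn, volume_restrict_slab, integrable_prod_iff]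
    · constructor
      · filter_upwards [ae_restrict_mem measurableSet_Ioo] with s hs
        have := integrable_exp_neg_mul_abs_sub (rate_pos hs.1) y
        simp only [abs_sub_comm y] at this
        exact this.const_mul _
      · refine hi.congr_fun (fun s hs => ?_) measurableSet_Ioo
        dsimp only
        rw [← h1 s hs]
        congr 1; ext z
        exact (Real.norm_of_nonneg (mul_nonneg (hc0 s hs) (Real.exp_pos _).le)).symm
    · rw [← volume_restrict_slab]
      refine ContinuousOn.aestronglyMeasurable ?_ (measurableSet_slab t)
      have e1 : ContinuousOn (fun p : ℝ × ℝ => c p.1) (slab t) :=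
        hc.comp continuousOn_fst fun p hp => hp.1
      have e2 : ContinuousOn (fun p : ℝ × ℝ => rate p.1) (slab t) :=
        continuousOn_rate.comp continuousOn_fst fun p hp => hp.1.1
      exact e1.mul ((e2.mul (by fun_prop)).neg.rexp)
  refine ⟨hI, ?_⟩
  rw [volume_restrict_slab, integral_prod]
  · exact setIntegral_congr_fun measurableSet_Ioo h1
  · rw [← volume_restrict_slab]; exact hI

theorem contDiff_V : ContDiff ℝ ∞ fun x => (V x : ℂ) := by
  refine Complex.ofRealCLM.contDiff.comp (g := Complex.ofRealCLM) (f := V) ?_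
  unfold V
  refine contDiff_const.mul (ContDiff.inv ?_ fun x => ?_)
  · exact (Real.contDiff_cosh.comp (contDiff_id.div_const 2)).pow 2
  · exact pow_ne_zero _ (Real.cosh_pos _).ne'

theorem continuous_V : Continuous fun x => (V x : ℂ) := contDiff_V.continuous

theorem norm_V_le (x : ℝ) : ‖(V x : ℂ)‖ ≤ 3 / 2 := by
  have h : 1 ≤ Real.cosh (x / 2) ^ 2 := one_le_pow₀ (Real.one_le_cosh _)
  have h2 : (Real.cosh (x / 2) ^ 2)⁻¹ ≤ 1 := inv_le_one_of_one_le₀ h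
  have h3 : 0 ≤ (Real.cosh (x / 2) ^ 2)⁻¹ := by positivity
  rw [Complex.norm_real, V, norm_mul, Real.norm_of_nonneg h3, norm_neg]
  norm_num
  linarith

/-- Convolution kernels with the same kind of bound as the free kernels. -/
structure IsFreeKer (P : ℝ → ℝ → ℂ) (θ N b : ℝ) : Prop where
  cont : ContinuousOn (fun p : ℝ × ℝ => P p.1 p.2) {p | 0 < p.2}
  nonneg : 0 ≤ N
  bound : ∀ z s : ℝ, 0 < s →
    ‖P z s‖ ≤ N * Real.exp (θ * s) * s ^ (-b) * Real.exp (-(2 * rate s * |z|))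

theorem isFreeKer_K₀ (k : ℝ) : IsFreeKer (K₀ k) (Λ₀ - 3 / 4 * k ^ 4) C₀ (1 / 4) :=
  ⟨continuousOn_K₀ k, C₀_pos.le, fun z _ hs => norm_K₀_le k z hs⟩

theorem isFreeKer_K₀' (k : ℝ) : IsFreeKer (K₀' k) (Λ₀ - 3 / 4 * k ^ 4) C₀ (1 / 2) :=
  ⟨continuousOn_K₀' k, C₀_pos.le, fun z _ hs => norm_K₀'_le k z hs⟩

theorem isFreeKer_S₀ (k : ℝ) : IsFreeKer (S₀ k) (Λ₀ - 3 / 4 * k ^ 4) C₀ (3 / 4) :=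
  ⟨continuousOn_S₀ k, C₀_pos.le, fun z _ hs => norm_S₀_le k z hs⟩

/-- The integrand of the space-time convolution. -/
def stInt (F P : ℝ → ℝ → ℂ) (y t : ℝ) (p : ℝ × ℝ) : ℂ :=
  F p.2 (t - p.1) * V p.2 * P (p.2 - y) p.1

/-- The space-time convolution `∫₀ᵗ ∫ F(z, t - s) V(z) P(z - y, s) dz ds`. -/
def stConv (F P : ℝ → ℝ → ℂ) (y t : ℝ) : ℂ := ∫ p in slab t, stInt F P y t p

theorem continuousOn_stInt {F P : ℝ → ℝ → ℂ} (y t : ℝ)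
    (hF : ContinuousOn (fun p : ℝ × ℝ => F p.1 p.2) {p | 0 < p.2})
    (hP : ContinuousOn (fun p : ℝ × ℝ => P p.1 p.2) {p | 0 < p.2}) :
    ContinuousOn (stInt F P y t) (slab t) := by
  have h1 : ContinuousOn (fun p : ℝ × ℝ => F p.2 (t - p.1)) (slab t) :=
    hF.comp (f := fun p : ℝ × ℝ => (p.2, t - p.1)) (by fun_prop) fun p hp => sub_pos.2 hp.1.2
  have h2 : ContinuousOn (fun p : ℝ × ℝ => P (p.2 - y) p.1) (slab t) :=
    hP.comp (f := fun p : ℝ × ℝ => (p.2 - y, p.1)) (by fun_prop) fun p hp => hp.1.1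
  exact (h1.mul (continuous_V.comp continuous_snd).continuousOn).mul h2

/-- `rate` is decreasing, so rate (t-s) and rate s are both at least rate t, and the triangle
inequality through z reproduces the weight exp(-ε rate t |x-y|). This uses one of the two copies of
rate s in the free kernel; the other remains for the z-integration. The extra growth l of `F` turns
into the damping exp(-ls). The value ε = 1 serves the construction, ε = 0 the uniqueness argument.
-/
theorem norm_stInt_le {F P : ℝ → ℝ → ℂ} {θ N b l M ε x y t : ℝ} (hP : IsFreeKer P θ N b)
    (hM : 0 ≤ M) (hε : 0 ≤ ε) (hε1 : ε ≤ 1)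
    (hF : ∀ z s : ℝ, 0 < s → ‖F z s‖ ≤
      M * Real.exp ((θ + l) * s) * s ^ (-(3 / 4) : ℝ) * Real.exp (-(ε * (rate s * |x - z|))))
    {p : ℝ × ℝ} (hp : p ∈ slab t) :
    ‖stInt F P y t p‖ ≤ (3 / 2 * M * N * Real.exp ((θ + l) * t) *
      Real.exp (-(ε * (rate t * |x - y|)))) *
      (((t - p.1) ^ (-(3 / 4) : ℝ) * p.1 ^ (-b) * Real.exp (-(l * p.1))) *
        Real.exp (-(rate p.1 * |p.2 - y|))) := by
  obtain ⟨s, z⟩ := p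
  obtain ⟨hs, hst⟩ : 0 < s ∧ s < t := hp.1
  have h1 : 0 < t - s := sub_pos.2 hst
  dsimp only [stInt]
  have hN := hP.nonneg
  have p1 : 0 < s ^ (-b) := Real.rpow_pos_of_pos hs _
  have p2 : 0 < (t - s) ^ (-(3 / 4) : ℝ) := Real.rpow_pos_of_pos h1 _
  have e1 : Real.exp (-(ε * (rate (t - s) * |x - z|))) * Real.exp (-(2 * rate s * |z - y|)) ≤
      Real.exp (-(ε * (rate t * |x - y|))) * Real.exp (-(rate s * |z - y|)) := by
    rw [← Real.exp_add, ← Real.exp_add, Real.exp_le_exp]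
    have r1 := rate_anti h1 (by linarith : t - s ≤ t)
    have r2 := rate_anti hs hst.le
    have r0 := rate_pos (hs.trans hst)
    have a1 : |x - y| ≤ |x - z| + |z - y| := abs_sub_le x z y
    have a2 : rate t * |x - y| ≤ rate (t - s) * |x - z| + rate s * |z - y| := by
      nlinarith [mul_le_mul_of_nonneg_right r1 (abs_nonneg (x - z)),
        mul_le_mul_of_nonneg_right r2 (abs_nonneg (z - y))]
    have a3 := mul_le_mul_of_nonneg_left a2 hε
    have a4 : ε * (rate s * |z - y|) ≤ rate s * |z - y| :=
      mul_le_of_le_one_left (mul_nonneg (rate_pos hs).le (abs_nonneg _)) hε1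
    linarith
  have e2 : Real.exp ((θ + l) * (t - s)) * Real.exp (θ * s) =
      Real.exp ((θ + l) * t) * Real.exp (-(l * s)) := by
    rw [← Real.exp_add, ← Real.exp_add]; congr 1; ring
  rw [norm_mul, norm_mul]
  calc _ ≤ (M * Real.exp ((θ + l) * (t - s)) * (t - s) ^ (-(3 / 4) : ℝ) *
        Real.exp (-(ε * (rate (t - s) * |x - z|)))) * (3 / 2) *
        (N * Real.exp (θ * s) * s ^ (-b) * Real.exp (-(2 * rate s * |z - y|))) := by
        gcongr
        · exact hF z _ h1
        · exact norm_V_le z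
        · exact hP.bound _ _ hs
    _ = (3 / 2 * M * N * ((t - s) ^ (-(3 / 4) : ℝ) * s ^ (-b))) *
        (Real.exp ((θ + l) * (t - s)) * Real.exp (θ * s)) *
        (Real.exp (-(ε * (rate (t - s) * |x - z|))) * Real.exp (-(2 * rate s * |z - y|))) := by ring
    _ ≤ (3 / 2 * M * N * ((t - s) ^ (-(3 / 4) : ℝ) * s ^ (-b))) *
        (Real.exp ((θ + l) * t) * Real.exp (-(l * s))) *
        (Real.exp (-(ε * (rate t * |x - y|))) * Real.exp (-(rate s * |z - y|))) := by
        rw [e2]; gcongr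
    _ = _ := by ring

theorem two_div_rate_le {s : ℝ} (hs : 0 < s) : 2 / rate s ≤ 2 * s ^ (1 / 4 : ℝ) := by
  rw [div_le_iff₀ (rate_pos hs)]
  have h1 : s ^ (1 / 4 : ℝ) * s ^ (-(1 / 4) : ℝ) = 1 := by
    rw [← Real.rpow_add hs]; norm_num
  have h2 : 0 < s ^ (1 / 4 : ℝ) := Real.rpow_pos_of_pos hs _
  unfold rate
  nlinarith

theorem stInt_majorant {b l t : ℝ} (hb : 0 ≤ b) (hb1 : b < 1) (hl : 0 ≤ l) (y : ℝ) :
    IntegrableOn (fun p : ℝ × ℝ => ((t - p.1) ^ (-(3 / 4) : ℝ) * p.1 ^ (-b) *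
      Real.exp (-(l * p.1))) * Real.exp (-(rate p.1 * |p.2 - y|))) (slab t) ∧
    ∫ p in slab t, ((t - p.1) ^ (-(3 / 4) : ℝ) * p.1 ^ (-b) * Real.exp (-(l * p.1))) *
      Real.exp (-(rate p.1 * |p.2 - y|)) ≤
      2 * ∫ s in Set.Ioo 0 t, (t - s) ^ (-(3 / 4) : ℝ) * s ^ (-b) * Real.exp (-(l * s)) *
        s ^ (1 / 4 : ℝ) := by
  have hI : IntegrableOn (fun s : ℝ => (t - s) ^ (-(3 / 4) : ℝ) * s ^ (-b) *
      Real.exp (-(l * s))) (Set.Ioo 0 t) :=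
    (integrableOn_rpow_mul_rpow (by norm_num) (by norm_num) hb hb1 t).mul_bdd
      (c := 1) (Continuous.aestronglyMeasurable (by fun_prop)) (by
        filter_upwards [ae_restrict_mem measurableSet_Ioo] with s hs
        rw [Real.norm_of_nonneg (Real.exp_pos _).le, Real.exp_le_one_iff]
        have := mul_nonneg hl hs.1.le
        linarith)
  have hnn : ∀ s ∈ Set.Ioo 0 t,
      0 ≤ (t - s) ^ (-(3 / 4) : ℝ) * s ^ (-b) * Real.exp (-(l * s)) := by
    intro s hs
    have h1 := Real.rpow_pos_of_pos (sub_pos.2 hs.2) (-(3 / 4))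
    have h2 := Real.rpow_pos_of_pos hs.1 (-b)
    positivity
  have hI2 : IntegrableOn (fun s : ℝ => (t - s) ^ (-(3 / 4) : ℝ) * s ^ (-b) *
      Real.exp (-(l * s)) * (2 / rate s)) (Set.Ioo 0 t) := by
    refine hI.mul_bdd (c := 2) ?_ ?_
    · refine ContinuousOn.aestronglyMeasurable ?_ measurableSet_Ioo
      exact continuousOn_const.div (continuousOn_rate.mono fun s hs => hs.1)
        fun s hs => (rate_pos hs.1).ne'
    · filter_upwards [ae_restrict_mem measurableSet_Ioo] with s hs
      rw [Real.norm_of_nonneg (div_nonneg zero_le_two (rate_pos hs.1).le),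
        div_le_iff₀ (rate_pos hs.1)]
      linarith [one_le_rate hs.1]
  have hI3 : IntegrableOn (fun s : ℝ => (t - s) ^ (-(3 / 4) : ℝ) * s ^ (-b) *
      Real.exp (-(l * s)) * s ^ (1 / 4 : ℝ)) (Set.Ioo 0 t) := by
    refine hI.mul_bdd (c := t ^ (1 / 4 : ℝ)) ?_ ?_
    · exact ((Real.continuous_rpow_const (by norm_num)).aestronglyMeasurable)
    · filter_upwards [ae_restrict_mem measurableSet_Ioo] with s hs
      rw [Real.norm_of_nonneg (Real.rpow_nonneg hs.1.le _)]
      exact Real.rpow_le_rpow hs.1.le hs.2.le (by norm_num)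
  obtain ⟨h1, h2⟩ := slab_exp (c := fun s => (t - s) ^ (-(3 / 4) : ℝ) * s ^ (-b) *
    Real.exp (-(l * s))) ((continuousOn_rpow_sub_mul_rpow (3 / 4) b t).mul
      (Continuous.continuousOn (by fun_prop))) hnn hI2 y
  refine ⟨h1, ?_⟩
  rw [h2, ← integral_const_mul]
  refine setIntegral_mono_on hI2 (hI3.const_mul 2) measurableSet_Ioo fun s hs => ?_
  have := mul_le_mul_of_nonneg_left (two_div_rate_le hs.1) (hnn s hs)
  linarith

theorem integrableOn_stInt {F P : ℝ → ℝ → ℂ} {θ N b l M ε x y t : ℝ} (hP : IsFreeKer P θ N b)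
    (hb : 0 ≤ b) (hb1 : b < 1) (hl : 0 ≤ l) (hM : 0 ≤ M) (hε : 0 ≤ ε) (hε1 : ε ≤ 1)
    (hFc : ContinuousOn (fun p : ℝ × ℝ => F p.1 p.2) {p | 0 < p.2})
    (hF : ∀ z s : ℝ, 0 < s → ‖F z s‖ ≤
      M * Real.exp ((θ + l) * s) * s ^ (-(3 / 4) : ℝ) * Real.exp (-(ε * (rate s * |x - z|)))) :
    IntegrableOn (stInt F P y t) (slab t) := by
  refine ((stInt_majorant (t := t) hb hb1 hl y).1.const_mul (3 / 2 * M * N *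
    Real.exp ((θ + l) * t) * Real.exp (-(ε * (rate t * |x - y|))))).mono'
    ((continuousOn_stInt y t hFc hP.cont).aestronglyMeasurable (measurableSet_slab t)) ?_
  filter_upwards [ae_restrict_mem (measurableSet_slab t)] with p hp
  exact norm_stInt_le hP hM hε hε1 hF hp

theorem norm_stConv_le {F P : ℝ → ℝ → ℂ} {θ N b l M ε x y t : ℝ} (hP : IsFreeKer P θ N b)
    (hb : 0 ≤ b) (hb1 : b < 1) (hl : 0 ≤ l) (hM : 0 ≤ M) (hε : 0 ≤ ε) (hε1 : ε ≤ 1)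
    (hF : ∀ z s : ℝ, 0 < s → ‖F z s‖ ≤
      M * Real.exp ((θ + l) * s) * s ^ (-(3 / 4) : ℝ) * Real.exp (-(ε * (rate s * |x - z|)))) :
    ‖stConv F P y t‖ ≤ (3 * M * N * Real.exp ((θ + l) * t) *
      Real.exp (-(ε * (rate t * |x - y|)))) *
      ∫ s in Set.Ioo 0 t, (t - s) ^ (-(3 / 4) : ℝ) * s ^ (-b) * Real.exp (-(l * s)) *
        s ^ (1 / 4 : ℝ) := by
  obtain ⟨h1, h2⟩ := stInt_majorant (t := t) hb hb1 hl y
  have hN := hP.nonneg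
  refine (norm_integral_le_of_norm_le (h1.const_mul (3 / 2 * M * N *
    Real.exp ((θ + l) * t) * Real.exp (-(ε * (rate t * |x - y|))))) ?_).trans ?_
  · filter_upwards [ae_restrict_mem (measurableSet_slab t)] with p hp
    exact norm_stInt_le hP hM hε hε1 hF hp
  · rw [integral_const_mul]
    refine (mul_le_mul_of_nonneg_left h2 (by positivity)).trans (le_of_eq (by ring))

/-- The additional exponential growth needed to solve the perturbation equation. -/
def l₀ : ℝ := (72 * C₀) ^ 2

theorem l₀_pos : 0 < l₀ := by have := C₀_pos; unfold l₀; positivity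

theorem l₀_rpow : C₀ * l₀ ^ (-(1 / 2) : ℝ) = 1 / 72 := by
  have := C₀_pos
  rw [Real.rpow_neg l₀_pos.le, ← Real.sqrt_eq_rpow, l₀, Real.sqrt_sq (by positivity)]
  field_simp

/-- The exponential growth rate of the perturbed kernels. -/
def kap (k : ℝ) : ℝ := Λ₀ - 3 / 4 * k ^ 4 + l₀

/-- Integration in z contributes s^{1/4} and softens s^{-3/4} to s^{-1/2}. The constant is then
3·12·C₀·l₀^{-1/2}, which equals 1/2 because l₀ = (72 C₀)². -/
theorem norm_stConv_S₀_le {F : ℝ → ℝ → ℂ} {k M ε x y t : ℝ} (hM : 0 ≤ M) (hε : 0 ≤ ε)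
    (hε1 : ε ≤ 1) (hF : ∀ z s : ℝ, 0 < s → ‖F z s‖ ≤
      M * Real.exp (kap k * s) * s ^ (-(3 / 4) : ℝ) * Real.exp (-(ε * (rate s * |x - z|))))
    (ht : 0 < t) :
    ‖stConv F (S₀ k) y t‖ ≤ M / 2 * Real.exp (kap k * t) * t ^ (-(3 / 4) : ℝ) *
      Real.exp (-(ε * (rate t * |x - y|))) := by
  refine (norm_stConv_le (isFreeKer_S₀ k) (by norm_num) (by norm_num) l₀_pos.le hM hε hε1 hF).trans
    ?_
  have h1 : ∫ s in Set.Ioo 0 t, (t - s) ^ (-(3 / 4) : ℝ) * s ^ (-(3 / 4) : ℝ) *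
      Real.exp (-(l₀ * s)) * s ^ (1 / 4 : ℝ) =
      ∫ s in Set.Ioo 0 t, (t - s) ^ (-(3 / 4) : ℝ) * s ^ (-(1 / 2) : ℝ) *
        Real.exp (-(l₀ * s)) := by
    refine setIntegral_congr_fun measurableSet_Ioo fun s hs => ?_
    have : s ^ (-(1 / 2) : ℝ) = s ^ (-(3 / 4) : ℝ) * s ^ (1 / 4 : ℝ) := by
      rw [← Real.rpow_add hs.1]; norm_num
    rw [this]; ring
  have h2 := integral_rpow_exp_le l₀_pos ht
  rw [h1]
  have := C₀_pos
  refine (mul_le_mul_of_nonneg_left h2 (by positivity)).trans (le_of_eq ?_)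
  have := l₀_rpow
  unfold kap
  linear_combination (36 * M * Real.exp ((Λ₀ - 3 / 4 * k ^ 4 + l₀) * t) *
    Real.exp (-(ε * (rate t * |x - y|))) * t ^ (-(3 / 4) : ℝ)) * this

/-- The s^{1/4} from the z-integration cancels the singularity of the free kernel, and ∫(t-s)^{-3/4}
ds = 4t^{1/4} is left. The perturbation is thus smaller than the free kernel by √t as t tends to 0.
-/
theorem norm_stConv_K₀_le {F : ℝ → ℝ → ℂ} {k M ε x y t : ℝ} (hM : 0 ≤ M) (hε : 0 ≤ ε)
    (hε1 : ε ≤ 1) (hF : ∀ z s : ℝ, 0 < s → ‖F z s‖ ≤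
      M * Real.exp (kap k * s) * s ^ (-(3 / 4) : ℝ) * Real.exp (-(ε * (rate s * |x - z|))))
    (ht : 0 < t) :
    ‖stConv F (K₀ k) y t‖ ≤ 12 * C₀ * M * Real.exp (kap k * t) * t ^ (1 / 4 : ℝ) *
      Real.exp (-(ε * (rate t * |x - y|))) := by
  refine (norm_stConv_le (isFreeKer_K₀ k) (by norm_num) (by norm_num) l₀_pos.le hM hε hε1 hF).trans
    ?_
  have h1 : ∫ s in Set.Ioo 0 t, (t - s) ^ (-(3 / 4) : ℝ) * s ^ (-(1 / 4) : ℝ) *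
      Real.exp (-(l₀ * s)) * s ^ (1 / 4 : ℝ) ≤ ∫ s in Set.Ioo 0 t, (t - s) ^ (-(3 / 4) : ℝ) := by
    refine integral_mono_of_nonneg ?_ (integrableOn_rpow_sub_Ioo (by norm_num) t) ?_
    · filter_upwards [ae_restrict_mem measurableSet_Ioo] with s hs
      have h1 := Real.rpow_pos_of_pos (sub_pos.2 hs.2) (-(3 / 4))
      have h2 := Real.rpow_pos_of_pos hs.1 (-(1 / 4))
      have h3 := Real.rpow_pos_of_pos hs.1 (1 / 4)
      simp only [Pi.zero_apply]
      positivity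
    · filter_upwards [ae_restrict_mem measurableSet_Ioo] with s hs
      have h1 := Real.rpow_pos_of_pos (sub_pos.2 hs.2) (-(3 / 4))
      have h2 : s ^ (-(1 / 4) : ℝ) * s ^ (1 / 4 : ℝ) = 1 := by
        rw [← Real.rpow_add hs.1]; norm_num
      have h3 : Real.exp (-(l₀ * s)) ≤ 1 := by
        rw [Real.exp_le_one_iff]
        have := mul_pos l₀_pos hs.1
        linarith
      calc _ = (t - s) ^ (-(3 / 4) : ℝ) * (s ^ (-(1 / 4) : ℝ) * s ^ (1 / 4 : ℝ)) *
            Real.exp (-(l₀ * s)) := by ring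
        _ ≤ _ := by rw [h2, mul_one]; exact mul_le_of_le_one_right h1.le h3
  rw [integral_rpow_sub_Ioo (by norm_num) ht] at h1
  have := C₀_pos
  refine (mul_le_mul_of_nonneg_left h1 (by positivity)).trans (le_of_eq ?_)
  unfold kap
  rw [show (1 - 3 / 4 : ℝ) = 1 / 4 by norm_num]
  ring


/-! ### Joint continuity of space-time convolutions. -/

theorem integrable_slab_mul {c : ℝ → ℝ} {g : ℝ → ℝ} {t : ℝ} (hc : IntegrableOn c (Set.Ioo 0 t))
    (hg : Integrable g) : IntegrableOn (fun p : ℝ × ℝ => c p.1 * g p.2) (slab t) := by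
  rw [IntegrableOn, volume_restrict_slab]
  exact hc.mul_prod hg

/-- Rescaling of the time variable in an integral over a slab. -/
theorem integral_slab_eq {f : ℝ × ℝ → ℂ} {t : ℝ} (ht : 0 < t) (hf : IntegrableOn f (slab t))
    (hf' : IntegrableOn (fun p : ℝ × ℝ => f (t * p.1, p.2)) (slab 1)) :
    ∫ p in slab t, f p = t * ∫ p in slab 1, f (t * p.1, p.2) := by
  rw [volume_restrict_slab, volume_restrict_slab, integral_prod, integral_prod]
  · rw [← integral_Ioc_eq_integral_Ioo, ← integral_Ioc_eq_integral_Ioo,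
      ← intervalIntegral.integral_of_le ht.le, ← intervalIntegral.integral_of_le zero_le_one,
      intervalIntegral.integral_comp_mul_left (fun s => ∫ z, f (s, z)) ht.ne', mul_zero, mul_one,
      Complex.real_smul, ← mul_assoc, ← Complex.ofReal_mul, mul_inv_cancel₀ ht.ne',
      Complex.ofReal_one, one_mul]
  · rw [← volume_restrict_slab]; exact hf'
  · rw [← volume_restrict_slab]; exact hf

/-- After the substitution s = tσ the domain does not depend on t. The majorant is uniform for t in
[t₁, t₂] and for x within distance 1 of x₀, the latter at the price of the factor exp 1, so
dominated convergence applies. -/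
theorem norm_stInt_scaled_le {F P : ℝ → ℝ → ℂ} {θ N b κ M x x₀ y t t₁ t₂ : ℝ}
    (hP : IsFreeKer P θ N b) (hb : 0 ≤ b) (hM : 0 ≤ M)
    (hF : ∀ z s : ℝ, 0 < s → ‖F z s‖ ≤
      M * Real.exp (κ * s) * s ^ (-(3 / 4) : ℝ) * Real.exp (-(rate s * |x - z|)))
    (hx : |x - x₀| ≤ 1) (ht₁ : 0 < t₁) (h₁ : t₁ ≤ t) (h₂ : t ≤ t₂) {p : ℝ × ℝ} (hp : p ∈ slab 1) :
    ‖stInt F P y t (t * p.1, p.2)‖ ≤ (M * Real.exp (|κ| * t₂) * t₁ ^ (-(3 / 4) : ℝ) *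
      Real.exp 1 * (3 / 2) * (N * Real.exp (|θ| * t₂) * t₁ ^ (-b))) *
      (((1 - p.1) ^ (-(3 / 4) : ℝ) * p.1 ^ (-b)) * Real.exp (-(1 * |x₀ - p.2|))) := by
  obtain ⟨σ, z⟩ := p
  obtain ⟨hs, hs1⟩ : 0 < σ ∧ σ < 1 := hp.1
  have ht : 0 < t := ht₁.trans_le h₁
  have h1 : 0 < 1 - σ := sub_pos.2 hs1
  have hN := hP.nonneg
  dsimp only [stInt]
  have e0 : t - t * σ = t * (1 - σ) := by ring
  rw [e0, norm_mul, norm_mul]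
  have a1 : 0 < t * (1 - σ) := mul_pos ht h1
  have a2 : 0 < t * σ := mul_pos ht hs
  have hexp : ∀ c r : ℝ, 0 < r → r ≤ 1 → Real.exp (c * (t * r)) ≤ Real.exp (|c| * t₂) := by
    intro c r hr hr1
    rw [Real.exp_le_exp]
    calc c * (t * r) ≤ |c| * (t * r) := by gcongr; exact le_abs_self c
      _ ≤ |c| * (t * 1) := by gcongr
      _ ≤ _ := by rw [mul_one]; gcongr
  have hpow : ∀ c r : ℝ, 0 ≤ c → 0 < r → (t * r) ^ (-c) ≤ t₁ ^ (-c) * r ^ (-c) := by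
    intro c r hc hr
    rw [Real.mul_rpow ht.le hr.le]
    gcongr ?_ * _
    exact Real.rpow_le_rpow_of_nonpos ht₁ h₁ (by linarith)
  have q1 : 0 < t₁ ^ (-(3 / 4) : ℝ) := Real.rpow_pos_of_pos ht₁ _
  have q2 : 0 < t₁ ^ (-b) := Real.rpow_pos_of_pos ht₁ _
  have q3 : 0 < (1 - σ) ^ (-(3 / 4) : ℝ) := Real.rpow_pos_of_pos h1 _
  have q4 : 0 < σ ^ (-b) := Real.rpow_pos_of_pos hs _
  have b1 : ‖F z (t * (1 - σ))‖ ≤ M * Real.exp (|κ| * t₂) * (t₁ ^ (-(3 / 4) : ℝ) *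
      (1 - σ) ^ (-(3 / 4) : ℝ)) * (Real.exp 1 * Real.exp (-(1 * |x₀ - z|))) := by
    refine (hF z _ a1).trans ?_
    have e1 : Real.exp (-(rate (t * (1 - σ)) * |x - z|)) ≤
        Real.exp 1 * Real.exp (-(1 * |x₀ - z|)) := by
      rw [← Real.exp_add, Real.exp_le_exp]
      have := mul_le_mul_of_nonneg_right (one_le_rate a1) (abs_nonneg (x - z))
      have := abs_sub_le x₀ x z
      rw [abs_sub_comm x₀ x] at this
      linarith
    have e2 := hexp κ _ h1 (by linarith)
    have e3 := hpow (3 / 4) _ (by norm_num) h1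
    have e4 : 0 < (t * (1 - σ)) ^ (-(3 / 4) : ℝ) := Real.rpow_pos_of_pos a1 _
    exact mul_le_mul (mul_le_mul (mul_le_mul_of_nonneg_left e2 hM) e3 e4.le (by positivity)) e1
      (Real.exp_pos _).le (by positivity)
  have b2 : ‖P (z - y) (t * σ)‖ ≤ N * Real.exp (|θ| * t₂) * (t₁ ^ (-b) * σ ^ (-b)) := by
    refine (hP.bound _ _ a2).trans ?_
    have e1 : Real.exp (-(2 * rate (t * σ) * |z - y|)) ≤ 1 := by
      rw [Real.exp_le_one_iff]
      have := mul_nonneg (rate_pos a2).le (abs_nonneg (z - y))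
      linarith
    calc _ ≤ N * Real.exp (θ * (t * σ)) * (t * σ) ^ (-b) * 1 := by
          have := Real.rpow_pos_of_pos a2 (-b)
          gcongr
      _ ≤ _ := by
          rw [mul_one]
          exact mul_le_mul (mul_le_mul_of_nonneg_left (hexp θ _ hs hs1.le) hN) (hpow _ _ hb hs)
            (Real.rpow_nonneg a2.le _) (by positivity)
  calc _ ≤ (M * Real.exp (|κ| * t₂) * (t₁ ^ (-(3 / 4) : ℝ) *
      (1 - σ) ^ (-(3 / 4) : ℝ)) * (Real.exp 1 * Real.exp (-(1 * |x₀ - z|)))) * (3 / 2) *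
      (N * Real.exp (|θ| * t₂) * (t₁ ^ (-b) * σ ^ (-b))) := by
        gcongr
        exact norm_V_le z
    _ = _ := by ring

theorem integrableOn_scaled_majorant {b : ℝ} (hb : 0 ≤ b) (hb1 : b < 1) (x₀ : ℝ) :
    IntegrableOn (fun p : ℝ × ℝ => ((1 - p.1) ^ (-(3 / 4) : ℝ) * p.1 ^ (-b)) *
      Real.exp (-(1 * |x₀ - p.2|))) (slab 1) :=
  integrable_slab_mul (c := fun s => (1 - s) ^ (-(3 / 4) : ℝ) * s ^ (-b))
    (integrableOn_rpow_mul_rpow (by norm_num) (by norm_num) hb hb1 1)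
    (integrable_exp_neg_mul_abs_sub one_pos x₀)

theorem continuousOn_stInt_scaled {F P : ℝ → ℝ → ℂ} (y : ℝ) {t : ℝ} (ht : 0 < t)
    (hF : ContinuousOn (fun p : ℝ × ℝ => F p.1 p.2) {p | 0 < p.2})
    (hP : ContinuousOn (fun p : ℝ × ℝ => P p.1 p.2) {p | 0 < p.2}) :
    ContinuousOn (fun p : ℝ × ℝ => stInt F P y t (t * p.1, p.2)) (slab 1) := by
  refine (continuousOn_stInt y t hF hP).comp (by fun_prop) fun p hp => ⟨⟨?_, ?_⟩, trivial⟩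
  · exact mul_pos ht hp.1.1
  · exact mul_lt_of_lt_one_right ht hp.1.2

theorem continuousOn_slice {F : ℝ → ℝ → ℝ → ℂ}
    (hFc : ContinuousOn (fun p : ℝ × ℝ × ℝ => F p.1 p.2.1 p.2.2) {p | 0 < p.2.2}) (x : ℝ) :
    ContinuousOn (fun p : ℝ × ℝ => F x p.1 p.2) {p | 0 < p.2} :=
  hFc.comp (f := fun p : ℝ × ℝ => (x, p.1, p.2)) (by fun_prop) fun _ hp => hp

theorem stConv_eq_scaled {F P : ℝ → ℝ → ℂ} {θ N b l M x y t : ℝ} (hP : IsFreeKer P θ N b)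
    (hb : 0 ≤ b) (hb1 : b < 1) (hl : 0 ≤ l) (hM : 0 ≤ M)
    (hFc : ContinuousOn (fun p : ℝ × ℝ => F p.1 p.2) {p | 0 < p.2})
    (hF : ∀ z s : ℝ, 0 < s → ‖F z s‖ ≤
      M * Real.exp ((θ + l) * s) * s ^ (-(3 / 4) : ℝ) * Real.exp (-(rate s * |x - z|)))
    (ht : 0 < t) :
    stConv F P y t = t * ∫ p in slab 1, stInt F P y t (t * p.1, p.2) := by
  refine integral_slab_eq ht (integrableOn_stInt (ε := 1) hP hb hb1 hl hM zero_le_one le_rfl hFc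
    (by simpa only [one_mul] using hF)) ?_
  refine ((integrableOn_scaled_majorant hb hb1 x).const_mul
    (M * Real.exp (|θ + l| * t) * t ^ (-(3 / 4) : ℝ) *
      Real.exp 1 * (3 / 2) * (N * Real.exp (|θ| * t) * t ^ (-b)))).mono'
    ((continuousOn_stInt_scaled y ht hFc hP.cont).aestronglyMeasurable (measurableSet_slab 1)) ?_
  filter_upwards [ae_restrict_mem (measurableSet_slab 1)] with p hp
  exact norm_stInt_scaled_le (x₀ := x) (t₁ := t) (t₂ := t) hP hb hM hF (by simp) ht le_rfl le_rfl hp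

theorem continuousOn_stConv {F : ℝ → ℝ → ℝ → ℂ} {P : ℝ → ℝ → ℂ} {θ N b l M : ℝ}
    (hP : IsFreeKer P θ N b) (hb : 0 ≤ b) (hb1 : b < 1) (hl : 0 ≤ l) (hM : 0 ≤ M)
    (hFc : ContinuousOn (fun p : ℝ × ℝ × ℝ => F p.1 p.2.1 p.2.2) {p | 0 < p.2.2})
    (hF : ∀ x z s : ℝ, 0 < s → ‖F x z s‖ ≤
      M * Real.exp ((θ + l) * s) * s ^ (-(3 / 4) : ℝ) * Real.exp (-(rate s * |x - z|))) :
    ContinuousOn (fun p : ℝ × ℝ × ℝ => stConv (F p.1) P p.2.1 p.2.2) {p | 0 < p.2.2} := by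
  have h1 : ContinuousOn (fun p : ℝ × ℝ × ℝ => (p.2.2 : ℂ) *
      ∫ q in slab 1, stInt (F p.1) P p.2.1 p.2.2 (p.2.2 * q.1, q.2)) {p | 0 < p.2.2} := by
    refine ContinuousOn.mul (by fun_prop) ?_
    rintro ⟨x₀, y₀, t₀⟩ (ht₀ : 0 < t₀)
    have hev : ∀ᶠ p : ℝ × ℝ × ℝ in 𝓝 (x₀, y₀, t₀), |p.1 - x₀| ≤ 1 ∧ t₀ / 2 ≤ p.2.2 ∧
        p.2.2 ≤ 2 * t₀ := by
      have c1 : ContinuousAt (fun p : ℝ × ℝ × ℝ => |p.1 - x₀|) (x₀, y₀, t₀) := by fun_prop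
      have c2 : ContinuousAt (fun p : ℝ × ℝ × ℝ => p.2.2) (x₀, y₀, t₀) := by fun_prop
      filter_upwards [c1.eventually_lt_const (u := 1) (by simp),
        c2.eventually_const_lt (u := t₀ / 2) (half_lt_self ht₀),
        c2.eventually_lt_const (u := 2 * t₀) (by simpa using by linarith)] with p h1 h2 h3
      exact ⟨h1.le, h2.le, h3.le⟩
    refine ContinuousAt.continuousWithinAt (continuousAt_of_dominated (bound := fun q =>
      (M * Real.exp (|θ + l| * (2 * t₀)) * (t₀ / 2) ^ (-(3 / 4) : ℝ) *
      Real.exp 1 * (3 / 2) * (N * Real.exp (|θ| * (2 * t₀)) * (t₀ / 2) ^ (-b))) *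
      (((1 - q.1) ^ (-(3 / 4) : ℝ) * q.1 ^ (-b)) * Real.exp (-(1 * |x₀ - q.2|)))) ?_ ?_
      ((integrableOn_scaled_majorant hb hb1 x₀).const_mul _) ?_)
    · filter_upwards [hev] with p hp
      exact (continuousOn_stInt_scaled p.2.1 (by linarith) (continuousOn_slice hFc p.1)
        hP.cont).aestronglyMeasurable (measurableSet_slab 1)
    · filter_upwards [hev] with p hp
      filter_upwards [ae_restrict_mem (measurableSet_slab 1)] with q hq
      exact norm_stInt_scaled_le hP hb hM (hF p.1) hp.1 (half_pos ht₀) hp.2.1 hp.2.2 hq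
    · filter_upwards [ae_restrict_mem (measurableSet_slab 1)] with q hq
      obtain ⟨σ, z⟩ := q
      obtain ⟨hs, hs1⟩ : 0 < σ ∧ σ < 1 := hq.1
      have b1 : 0 < t₀ - t₀ * σ := by nlinarith
      have b2 : 0 < t₀ * σ := mul_pos ht₀ hs
      have o1 : IsOpen {p : ℝ × ℝ × ℝ | 0 < p.2.2} :=
        isOpen_lt continuous_const (by fun_prop)
      have o2 : IsOpen {p : ℝ × ℝ | 0 < p.2} := isOpen_lt continuous_const (by fun_prop)
      have m1 : (x₀, z, t₀ - t₀ * σ) ∈ {p : ℝ × ℝ × ℝ | 0 < p.2.2} := b1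
      have m2 : (z - y₀, t₀ * σ) ∈ {p : ℝ × ℝ | 0 < p.2} := b2
      have d1 := hFc.continuousAt (o1.mem_nhds m1)
      have d2 := hP.cont.continuousAt (o2.mem_nhds m2)
      have c1 : ContinuousAt (fun p : ℝ × ℝ × ℝ => F p.1 z (p.2.2 - p.2.2 * σ)) (x₀, y₀, t₀) :=
        ContinuousAt.comp_of_eq (f := fun p : ℝ × ℝ × ℝ => (p.1, z, p.2.2 - p.2.2 * σ))
          d1 (by fun_prop) rfl
      have c2 : ContinuousAt (fun p : ℝ × ℝ × ℝ => P (z - p.2.1) (p.2.2 * σ)) (x₀, y₀, t₀) :=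
        ContinuousAt.comp_of_eq (f := fun p : ℝ × ℝ × ℝ => (z - p.2.1, p.2.2 * σ))
          d2 (by fun_prop) rfl
      simp only [stInt]
      exact (c1.mul continuousAt_const).mul c2
  refine h1.congr fun p hp => ?_
  exact stConv_eq_scaled hP hb hb1 hl hM (continuousOn_slice hFc p.1) (hF p.1) hp

theorem stConv_sub {F G P : ℝ → ℝ → ℂ} {y t : ℝ} (hF : IntegrableOn (stInt F P y t) (slab t))
    (hG : IntegrableOn (stInt G P y t) (slab t)) :
    stConv (fun z s => F z s - G z s) P y t = stConv F P y t - stConv G P y t := by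
  rw [stConv, stConv, stConv, ← integral_sub hF hG]
  congr 1; ext p
  simp only [stInt]
  ring

/-! ### The Volterra equation for S, solved by contraction. -/

/-- The weight of the perturbed kernels. -/
def wt (k x y t : ℝ) : ℝ :=
  Real.exp (kap k * t) * t ^ (-(3 / 4) : ℝ) * Real.exp (-(rate t * |x - y|))

theorem wt_pos (k x y : ℝ) {t : ℝ} (ht : 0 < t) : 0 < wt k x y t := by
  have := Real.rpow_pos_of_pos ht (-(3 / 4))
  unfold wt; positivity

theorem continuousOn_wt (k : ℝ) :
    ContinuousOn (fun p : ℝ × ℝ × ℝ => wt k p.1 p.2.1 p.2.2) {p | 0 < p.2.2} := by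
  have h1 : ContinuousOn (fun p : ℝ × ℝ × ℝ => rate p.2.2) {p | 0 < p.2.2} :=
    continuousOn_rate.comp (f := fun p : ℝ × ℝ × ℝ => p.2.2) (by fun_prop) fun p hp => hp
  have h2 : ContinuousOn (fun p : ℝ × ℝ × ℝ => p.2.2 ^ (-(3 / 4) : ℝ)) {p | 0 < p.2.2} :=
    ContinuousOn.rpow_const (by fun_prop) fun p hp => Or.inl (ne_of_gt hp)
  unfold wt
  exact (ContinuousOn.mul (by fun_prop) h2).mul ((h1.mul (by fun_prop)).neg.rexp)

/-- The space of bounded continuous functions of `(x, y, t)`, `t > 0`. -/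
abbrev KerSpace : Type := BoundedContinuousFunction (ℝ × ℝ × Set.Ioi (0 : ℝ)) ℂ

/-- The kernel with quotient `g` by the weight. -/
def unw (k : ℝ) (g : KerSpace) (x y t : ℝ) : ℂ :=
  if h : 0 < t then (wt k x y t : ℂ) * g (x, y, ⟨t, h⟩) else 0

theorem norm_unw_le (k : ℝ) (g : KerSpace) (x y : ℝ) {t : ℝ} (ht : 0 < t) :
    ‖unw k g x y t‖ ≤ ‖g‖ * wt k x y t := by
  rw [unw, dif_pos ht, norm_mul, Complex.norm_real, Real.norm_of_nonneg (wt_pos k x y ht).le,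
    mul_comm]
  have := wt_pos k x y ht
  gcongr
  exact g.norm_coe_le_norm _

theorem norm_unw_le' (k : ℝ) (g : KerSpace) (x y t : ℝ) (ht : 0 < t) :
    ‖unw k g x y t‖ ≤ ‖g‖ * Real.exp ((Λ₀ - 3 / 4 * k ^ 4 + l₀) * t) * t ^ (-(3 / 4) : ℝ) *
      Real.exp (-(rate t * |x - y|)) :=
  (norm_unw_le k g x y ht).trans (le_of_eq (by unfold wt kap; ring))

theorem continuousOn_unw (k : ℝ) (g : KerSpace) :
    ContinuousOn (fun p : ℝ × ℝ × ℝ => unw k g p.1 p.2.1 p.2.2) {p | 0 < p.2.2} := by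
  rw [continuousOn_iff_continuous_domRestrict]
  have h1 : Continuous fun p : {p : ℝ × ℝ × ℝ | 0 < p.2.2} =>
      (wt k p.1.1 p.1.2.1 p.1.2.2 : ℂ) * g (p.1.1, p.1.2.1, ⟨p.1.2.2, p.2⟩) := by
    have := (continuousOn_iff_continuous_domRestrict.1 (continuousOn_wt k))
    refine (Complex.continuous_ofReal.comp this).mul (g.continuous.comp ?_)
    fun_prop
  refine h1.congr fun p => ?_
  have hp : 0 < p.1.2.2 := p.2
  simp only [Set.domRestrict_apply, unw, dif_pos hp]

theorem continuousOn_stConv_unw (k : ℝ) (g : KerSpace) :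
    ContinuousOn (fun p : ℝ × ℝ × ℝ => stConv (unw k g p.1) (S₀ k) p.2.1 p.2.2)
      {p | 0 < p.2.2} :=
  continuousOn_stConv (isFreeKer_S₀ k) (by norm_num) (by norm_num) l₀_pos.le (norm_nonneg g)
    (continuousOn_unw k g) (norm_unw_le' k g)

/-- The convolution is linear in its first kernel, so a contraction estimate for differences is the
factor 1/2 of `norm_stConv_S₀_le` applied to g - h. -/
theorem norm_stConv_unw_sub_le (k : ℝ) (g h : KerSpace) (x y : ℝ) {t : ℝ} (ht : 0 < t) :
    ‖stConv (unw k g x) (S₀ k) y t - stConv (unw k h x) (S₀ k) y t‖ ≤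
      ‖g - h‖ / 2 * wt k x y t := by
  have hi : ∀ g : KerSpace, IntegrableOn (stInt (unw k g x) (S₀ k) y t) (slab t) := fun g =>
    integrableOn_stInt (ε := 1) (x := x) (isFreeKer_S₀ k) (by norm_num) (by norm_num) l₀_pos.le
      (norm_nonneg g) zero_le_one le_rfl (continuousOn_slice (continuousOn_unw k g) x)
      (by simpa only [one_mul] using norm_unw_le' k g x)
  rw [← stConv_sub (hi g) (hi h)]
  have h1 := norm_stConv_S₀_le (F := fun z s => unw k g x z s - unw k h x z s) (k := k)
    (M := ‖g - h‖) (ε := 1) (x := x) (y := y) (norm_nonneg _) zero_le_one le_rfl (fun z s hs => by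
      have e : unw k g x z s - unw k h x z s = unw k (g - h) x z s := by
        simp only [unw, dif_pos hs, BoundedContinuousFunction.coe_sub, Pi.sub_apply]
        ring
      rw [e, one_mul]
      exact norm_unw_le' k (g - h) x z s hs) ht
  refine h1.trans (le_of_eq ?_)
  unfold wt
  rw [one_mul]
  ring

theorem norm_S₀_le_wt (k x y : ℝ) {t : ℝ} (ht : 0 < t) :
    ‖S₀ k (x - y) t‖ ≤ C₀ * wt k x y t := by
  refine (norm_S₀_le k (x - y) ht).trans ?_
  have h1 : Real.exp ((Λ₀ - 3 / 4 * k ^ 4) * t) ≤ Real.exp (kap k * t) := by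
    rw [Real.exp_le_exp]
    have := l₀_pos
    unfold kap
    gcongr
    linarith
  have h2 : Real.exp (-(2 * rate t * |x - y|)) ≤ Real.exp (-(rate t * |x - y|)) := by
    rw [Real.exp_le_exp]
    have := mul_nonneg (rate_pos ht).le (abs_nonneg (x - y))
    linarith
  have := C₀_pos
  have := Real.rpow_pos_of_pos ht (-(3 / 4))
  unfold wt
  calc _ ≤ C₀ * Real.exp (kap k * t) * t ^ (-(3 / 4) : ℝ) * Real.exp (-(rate t * |x - y|)) := by
        gcongr
    _ = _ := by ring

theorem stConv_zero_left (P : ℝ → ℝ → ℂ) (y t : ℝ) : stConv (fun _ _ => 0) P y t = 0 := by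
  simp [stConv, stInt]

theorem norm_stConv_unw_le (k : ℝ) (g : KerSpace) (x y : ℝ) {t : ℝ} (ht : 0 < t) :
    ‖stConv (unw k g x) (S₀ k) y t‖ ≤ ‖g‖ / 2 * wt k x y t := by
  have h := norm_stConv_unw_sub_le k g 0 x y ht
  have e : unw k 0 x = fun _ _ => 0 := by
    ext z s
    simp [unw]
  rw [e, stConv_zero_left, sub_zero, sub_zero] at h
  exact h

theorem norm_fixedPointMap_le (k : ℝ) (g : KerSpace) (x y : ℝ) {t : ℝ} (ht : 0 < t) :
    ‖(S₀ k (x - y) t + stConv (unw k g x) (S₀ k) y t) / (wt k x y t : ℂ)‖ ≤ C₀ + ‖g‖ / 2 := by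
  have hw := wt_pos k x y ht
  rw [norm_div, Complex.norm_real, Real.norm_of_nonneg hw.le, div_le_iff₀ hw]
  refine (norm_add_le _ _).trans ?_
  rw [add_mul]
  exact add_le_add (norm_S₀_le_wt k x y ht) (norm_stConv_unw_le k g x y ht)

/-- The map whose fixed point is the kernel `S`, divided by the weight. -/
def fixedPointMap (k : ℝ) (g : KerSpace) : KerSpace :=
  BoundedContinuousFunction.ofNormedAddCommGroup
    (fun p => (S₀ k (p.1 - p.2.1) p.2.2 + stConv (unw k g p.1) (S₀ k) p.2.1 p.2.2) /
      (wt k p.1 p.2.1 p.2.2 : ℂ))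
    (by
      have hm : Continuous fun p : ℝ × ℝ × Set.Ioi (0 : ℝ) => (p.1, p.2.1, (p.2.2 : ℝ)) := by
        fun_prop
      have c1 := (continuousOn_stConv_unw k g).comp_continuous hm fun p => p.2.2.2
      have c2 := (continuousOn_wt k).comp_continuous hm fun p => p.2.2.2
      have c3 := (continuousOn_S₀ k).comp_continuous
        (f := fun p : ℝ × ℝ × Set.Ioi (0 : ℝ) => (p.1 - p.2.1, (p.2.2 : ℝ))) (by fun_prop)
        fun p => p.2.2.2
      exact (c3.add c1).div (Complex.continuous_ofReal.comp c2) fun p =>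
        Complex.ofReal_ne_zero.2 (wt_pos k _ _ p.2.2.2).ne')
    (C₀ + ‖g‖ / 2) fun p => norm_fixedPointMap_le k g p.1 p.2.1 p.2.2.2

theorem contracting_fixedPointMap (k : ℝ) : ContractingWith (1 / 2) (fixedPointMap k) := by
  refine ⟨by rw [← NNReal.coe_lt_coe]; norm_num, LipschitzWith.of_dist_le_mul fun g h => ?_⟩
  rw [dist_eq_norm, dist_eq_norm]
  refine (BoundedContinuousFunction.norm_le (by positivity)).2 fun p => ?_
  have hw := wt_pos k p.1 p.2.1 p.2.2.2
  have h1 := norm_stConv_unw_sub_le k g h p.1 p.2.1 p.2.2.2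
  simp only [BoundedContinuousFunction.coe_sub, Pi.sub_apply, fixedPointMap,
    BoundedContinuousFunction.coe_ofNormedAddCommGroup]
  rw [← sub_div, add_sub_add_left_eq_sub, norm_div, Complex.norm_real, Real.norm_of_nonneg hw.le,
    div_le_iff₀ hw]
  refine h1.trans (le_of_eq ?_)
  push_cast
  ring

/-- The fixed point. -/
def fixPt (k : ℝ) : KerSpace := (contracting_fixedPointMap k).fixedPoint

theorem fixPt_eq (k : ℝ) : fixedPointMap k (fixPt k) = fixPt k :=
  (contracting_fixedPointMap k).fixedPoint_isFixedPt

theorem norm_fixPt_le (k : ℝ) : ‖fixPt k‖ ≤ 2 * C₀ := by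
  have h : ‖fixPt k‖ ≤ C₀ + ‖fixPt k‖ / 2 := by
    have := C₀_pos
    refine (BoundedContinuousFunction.norm_le (by positivity)).2 fun p => ?_
    conv_lhs => rw [← fixPt_eq k]
    exact norm_fixedPointMap_le k _ p.1 p.2.1 p.2.2.2
  linarith

/-- The kernel `(∂_y² - k²) K`. -/
def kerS (k x y t : ℝ) : ℂ := unw k (fixPt k) x y t

theorem continuousOn_kerS (k : ℝ) :
    ContinuousOn (fun p : ℝ × ℝ × ℝ => kerS k p.1 p.2.1 p.2.2) {p | 0 < p.2.2} :=
  continuousOn_unw k _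

theorem norm_kerS_le (k x y t : ℝ) (ht : 0 < t) :
    ‖kerS k x y t‖ ≤ 2 * C₀ * Real.exp (kap k * t) * t ^ (-(3 / 4) : ℝ) *
      Real.exp (-(rate t * |x - y|)) := by
  refine (norm_unw_le k _ x y ht).trans ?_
  refine (mul_le_mul_of_nonneg_right (norm_fixPt_le k) (wt_pos k x y ht).le).trans (le_of_eq ?_)
  unfold wt
  ring

/-- The fixed-point equation with the weight removed. It is Duhamel's formula after D_z has been
moved onto the first factor and ∂_y² - k² has been applied, so K itself no longer occurs. -/
theorem kerS_eq (k x y : ℝ) {t : ℝ} (ht : 0 < t) :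
    kerS k x y t = S₀ k (x - y) t + stConv (kerS k x) (S₀ k) y t := by
  have h := congrArg (fun g : KerSpace => g (x, y, ⟨t, ht⟩)) (fixPt_eq k)
  have hw : (wt k x y t : ℂ) ≠ 0 := Complex.ofReal_ne_zero.2 (wt_pos k x y ht).ne'
  have h2 : (S₀ k (x - y) t + stConv (unw k (fixPt k) x) (S₀ k) y t) / (wt k x y t : ℂ) =
    fixPt k (x, y, ⟨t, ht⟩) := h
  have h3 : kerS k x y t = (wt k x y t : ℂ) * fixPt k (x, y, ⟨t, ht⟩) := by
    rw [kerS, unw, dif_pos ht]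
  rw [h3, ← h2]
  field_simp
  rfl


/-! ### The kernel K and its derivatives in y. -/

theorem norm_kerS_le_one (k x y t : ℝ) (ht : 0 < t) :
    ‖kerS k x y t‖ ≤ 2 * C₀ * Real.exp ((Λ₀ - 3 / 4 * k ^ 4 + l₀) * t) * t ^ (-(3 / 4) : ℝ) *
      Real.exp (-(1 * (rate t * |x - y|))) := by
  rw [one_mul]; exact norm_kerS_le k x y t ht

theorem integrableOn_stInt_kerS {P : ℝ → ℝ → ℂ} {k N b : ℝ}
    (hP : IsFreeKer P (Λ₀ - 3 / 4 * k ^ 4) N b) (hb : 0 ≤ b) (hb1 : b < 1) (x y t : ℝ) :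
    IntegrableOn (stInt (kerS k x) P y t) (slab t) :=
  integrableOn_stInt (ε := 1) (x := x) hP hb hb1 l₀_pos.le (by have := C₀_pos; positivity)
    zero_le_one le_rfl (continuousOn_slice (continuousOn_kerS k) x)
    (norm_kerS_le_one k x)

/-- The kernel of the semigroup. -/
def kerK (k x y t : ℝ) : ℂ := K₀ k (x - y) t + stConv (kerS k x) (K₀ k) y t

theorem norm_stConv_kerS_K₀_le (k x y : ℝ) {t : ℝ} (ht : 0 < t) :
    ‖stConv (kerS k x) (K₀ k) y t‖ ≤ 24 * C₀ ^ 2 * Real.exp (kap k * t) * t ^ (1 / 4 : ℝ) *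
      Real.exp (-(rate t * |x - y|)) := by
  have h := norm_stConv_K₀_le (F := kerS k x) (k := k) (M := 2 * C₀) (ε := 1) (x := x) (y := y)
    (by have := C₀_pos; positivity) zero_le_one le_rfl (norm_kerS_le_one k x) ht
  rw [one_mul] at h
  exact h.trans (le_of_eq (by ring))

/-- A constant for the bounds of the perturbed kernels. -/
def C₁ : ℝ := 2 * C₀ + 24 * C₀ ^ 2

theorem C₁_pos : 0 < C₁ := by have := C₀_pos; unfold C₁; positivity

theorem norm_kerK_le (k x y : ℝ) {t : ℝ} (ht : 0 < t) :
    ‖kerK k x y t‖ ≤ C₁ * Real.exp ((kap k + 1) * t) * t ^ (-(1 / 4) : ℝ) *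
      Real.exp (-(rate t * |x - y|)) := by
  have hq : 0 < t ^ (-(1 / 4) : ℝ) := Real.rpow_pos_of_pos ht _
  have hC := C₀_pos
  have h1 : ‖K₀ k (x - y) t‖ ≤ 2 * C₀ * Real.exp ((kap k + 1) * t) * t ^ (-(1 / 4) : ℝ) *
      Real.exp (-(rate t * |x - y|)) := by
    refine (norm_K₀_le k (x - y) ht).trans ?_
    have e1 : Real.exp ((Λ₀ - 3 / 4 * k ^ 4) * t) ≤ Real.exp ((kap k + 1) * t) := by
      rw [Real.exp_le_exp]
      have := l₀_pos
      unfold kap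
      gcongr
      linarith
    have e2 : Real.exp (-(2 * rate t * |x - y|)) ≤ Real.exp (-(rate t * |x - y|)) := by
      rw [Real.exp_le_exp]
      have := mul_nonneg (rate_pos ht).le (abs_nonneg (x - y))
      linarith
    gcongr
    linarith
  have h2 : ‖stConv (kerS k x) (K₀ k) y t‖ ≤ 24 * C₀ ^ 2 * Real.exp ((kap k + 1) * t) *
      t ^ (-(1 / 4) : ℝ) * Real.exp (-(rate t * |x - y|)) := by
    refine (norm_stConv_kerS_K₀_le k x y ht).trans ?_
    -- The correction has the factor t^{1/4} = √t · t^{-1/4}; bounding √t by exp t explains the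
    -- growth rate `kap k + 1`.
    have e1 : Real.exp (kap k * t) * t ^ (1 / 4 : ℝ) ≤
        Real.exp ((kap k + 1) * t) * t ^ (-(1 / 4) : ℝ) := by
      have e2 : t ^ (1 / 4 : ℝ) = √t * t ^ (-(1 / 4) : ℝ) := by
        rw [Real.sqrt_eq_rpow, ← Real.rpow_add ht]; norm_num
      have e3 : √t ≤ Real.exp t := by
        linarith [sqrt_le_one_add ht, Real.add_one_le_exp t]
      rw [e2, add_mul, one_mul, Real.exp_add, ← mul_assoc]
      gcongr
    calc _ = 24 * C₀ ^ 2 * (Real.exp (kap k * t) * t ^ (1 / 4 : ℝ)) *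
          Real.exp (-(rate t * |x - y|)) := by ring
      _ ≤ 24 * C₀ ^ 2 * (Real.exp ((kap k + 1) * t) * t ^ (-(1 / 4) : ℝ)) *
          Real.exp (-(rate t * |x - y|)) := by gcongr
      _ = _ := by ring
  refine (norm_add_le _ _).trans ((add_le_add h1 h2).trans (le_of_eq ?_))
  unfold C₁
  ring

theorem continuousOn_kerK (k : ℝ) :
    ContinuousOn (fun p : ℝ × ℝ × ℝ => kerK k p.1 p.2.1 p.2.2) {p | 0 < p.2.2} := by
  have h1 := continuousOn_stConv (F := kerS k) (isFreeKer_K₀ k) (by norm_num) (by norm_num)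
    l₀_pos.le (M := 2 * C₀) (by have := C₀_pos; positivity) (continuousOn_kerS k) (norm_kerS_le k)
  have h2 : ContinuousOn (fun p : ℝ × ℝ × ℝ => K₀ k (p.1 - p.2.1) p.2.2) {p | 0 < p.2.2} :=
    (continuousOn_K₀ k).comp (f := fun p : ℝ × ℝ × ℝ => (p.1 - p.2.1, p.2.2)) (by fun_prop)
      fun p hp => hp
  exact h2.add h1

theorem continuous_kerK (k : ℝ) {t : ℝ} (ht : 0 < t) :
    Continuous fun p : ℝ × ℝ => kerK k p.1 p.2 t :=
  (continuousOn_kerK k).comp_continuous (f := fun p : ℝ × ℝ => (p.1, p.2, t)) (by fun_prop)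
    fun _ => ht

theorem continuous_kerS (k : ℝ) {t : ℝ} (ht : 0 < t) :
    Continuous fun p : ℝ × ℝ => kerS k p.1 p.2 t :=
  (continuousOn_kerS k).comp_continuous (f := fun p : ℝ × ℝ => (p.1, p.2, t)) (by fun_prop)
    fun _ => ht

theorem continuous_kerK_right (k x : ℝ) {t : ℝ} (ht : 0 < t) : Continuous fun y => kerK k x y t :=
  (continuous_kerK k ht).comp (f := fun y : ℝ => (x, y)) (by fun_prop)

theorem continuous_kerS_right (k x : ℝ) {t : ℝ} (ht : 0 < t) : Continuous fun y => kerS k x y t :=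
  (continuous_kerS k ht).comp (f := fun y : ℝ => (x, y)) (by fun_prop)

/-- The decay in z is taken from `F` alone, so the majorant does not involve y. This permits
differentiation in y under the integral. -/
theorem norm_stInt_le_of_bound {F P : ℝ → ℝ → ℂ} {N b κ M x y t : ℝ}
    (hM : 0 ≤ M) (hF : ∀ z s : ℝ, 0 < s → ‖F z s‖ ≤
      M * Real.exp (κ * s) * s ^ (-(3 / 4) : ℝ) * Real.exp (-(rate s * |x - z|)))
    (hP : ∀ z s : ℝ, 0 < s → s < t → ‖P z s‖ ≤ N * s ^ (-b)) {p : ℝ × ℝ} (hp : p ∈ slab t) :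
    ‖stInt F P y t p‖ ≤ (M * Real.exp (|κ| * t) * (3 / 2) * N) *
      (((t - p.1) ^ (-(3 / 4) : ℝ) * p.1 ^ (-b)) * Real.exp (-(1 * |x - p.2|))) := by
  obtain ⟨s, z⟩ := p
  obtain ⟨hs, hst⟩ : 0 < s ∧ s < t := hp.1
  have h1 : 0 < t - s := sub_pos.2 hst
  have q3 : 0 < (t - s) ^ (-(3 / 4) : ℝ) := Real.rpow_pos_of_pos h1 _
  have q4 : 0 < s ^ (-b) := Real.rpow_pos_of_pos hs _
  have b1 : ‖F z (t - s)‖ ≤ M * Real.exp (|κ| * t) * (t - s) ^ (-(3 / 4) : ℝ) *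
      Real.exp (-(1 * |x - z|)) := by
    refine (hF z _ h1).trans ?_
    have e1 : Real.exp (κ * (t - s)) ≤ Real.exp (|κ| * t) := by
      rw [Real.exp_le_exp]
      calc κ * (t - s) ≤ |κ| * (t - s) := by gcongr; exact le_abs_self κ
        _ ≤ _ := by gcongr; linarith
    have e2 : Real.exp (-(rate (t - s) * |x - z|)) ≤ Real.exp (-(1 * |x - z|)) := by
      rw [Real.exp_le_exp, neg_le_neg_iff]
      gcongr
      exact one_le_rate h1
    exact mul_le_mul (mul_le_mul_of_nonneg_right (mul_le_mul_of_nonneg_left e1 hM) q3.le) e2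
      (Real.exp_pos _).le (by positivity)
  dsimp only [stInt]
  rw [norm_mul, norm_mul]
  calc _ ≤ (M * Real.exp (|κ| * t) * (t - s) ^ (-(3 / 4) : ℝ) * Real.exp (-(1 * |x - z|))) *
        (3 / 2) * (N * s ^ (-b)) := by
        gcongr
        · exact norm_V_le z
        · exact hP _ _ hs hst
    _ = _ := by ring

theorem integrableOn_majorant {b t : ℝ} (hb : 0 ≤ b) (hb1 : b < 1) (x : ℝ) :
    IntegrableOn (fun p : ℝ × ℝ => ((t - p.1) ^ (-(3 / 4) : ℝ) * p.1 ^ (-b)) *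
      Real.exp (-(1 * |x - p.2|))) (slab t) :=
  integrable_slab_mul (c := fun s => (t - s) ^ (-(3 / 4) : ℝ) * s ^ (-b))
    (integrableOn_rpow_mul_rpow (by norm_num) (by norm_num) hb hb1 t)
    (integrable_exp_neg_mul_abs_sub one_pos x)

/-- All y-dependence sits in P(z-y, s), whence the minus sign. The singularity s^{-b} of P' with b <
1 is still integrable in time. -/
theorem hasDerivAt_stConv {F P P' : ℝ → ℝ → ℂ} {N b κ M x y t : ℝ} (hM : 0 ≤ M)
    (hb : 0 ≤ b) (hb1 : b < 1)
    (hFc : ContinuousOn (fun p : ℝ × ℝ => F p.1 p.2) {p | 0 < p.2})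
    (hPc : ContinuousOn (fun p : ℝ × ℝ => P p.1 p.2) {p | 0 < p.2})
    (hPc' : ContinuousOn (fun p : ℝ × ℝ => P' p.1 p.2) {p | 0 < p.2})
    (hF : ∀ z s : ℝ, 0 < s → ‖F z s‖ ≤
      M * Real.exp (κ * s) * s ^ (-(3 / 4) : ℝ) * Real.exp (-(rate s * |x - z|)))
    (hP' : ∀ z s : ℝ, 0 < s → s < t → ‖P' z s‖ ≤ N * s ^ (-b))
    (hI : IntegrableOn (stInt F P y t) (slab t))
    (hd : ∀ z s : ℝ, 0 < s → HasDerivAt (fun z => P z s) (P' z s) z) :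
    HasDerivAt (fun y => stConv F P y t) (-stConv F P' y t) y := by
  have h := hasDerivAt_integral_of_dominated_loc_of_deriv_le (μ := volume.restrict (slab t))
    (F := fun y p => stInt F P y t p) (F' := fun y p => -stInt F P' y t p) (x₀ := y)
    (s := Set.univ) (bound := fun p => (M * Real.exp (|κ| * t) * (3 / 2) * N) *
      (((t - p.1) ^ (-(3 / 4) : ℝ) * p.1 ^ (-b)) * Real.exp (-(1 * |x - p.2|)))) univ_mem
    (Eventually.of_forall fun w =>
      (continuousOn_stInt w t hFc hPc).aestronglyMeasurable (measurableSet_slab t)) hI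
    ((continuousOn_stInt y t hFc hPc').neg.aestronglyMeasurable (measurableSet_slab t))
    (by
      filter_upwards [ae_restrict_mem (measurableSet_slab t)] with p hp w _
      rw [norm_neg]
      exact norm_stInt_le_of_bound hM hF hP' hp)
    ((integrableOn_majorant hb hb1 x).const_mul _)
    (by
      filter_upwards [ae_restrict_mem (measurableSet_slab t)] with p hp w _
      have h1 : HasDerivAt (fun w => P (p.2 - w) p.1) (-P' (p.2 - w) p.1) w := by
        have := (hd (p.2 - w) p.1 hp.1.1).scomp w ((hasDerivAt_id w).const_sub p.2)
        simpa using! this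
      exact (h1.const_mul (F p.2 (t - p.1) * V p.2)).congr_deriv (by simp [stInt]))
  have h2 := h.2
  rw [integral_neg] at h2
  exact h2

theorem bound_of_isFreeKer {P : ℝ → ℝ → ℂ} {θ N b t : ℝ} (hP : IsFreeKer P θ N b) (z s : ℝ)
    (hs : 0 < s) (hst : s < t) : ‖P z s‖ ≤ N * Real.exp (|θ| * t) * s ^ (-b) := by
  have hN := hP.nonneg
  have q : 0 < s ^ (-b) := Real.rpow_pos_of_pos hs _
  refine (hP.bound z s hs).trans ?_
  have e1 : Real.exp (-(2 * rate s * |z|)) ≤ 1 := by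
    rw [Real.exp_le_one_iff]
    have := mul_nonneg (rate_pos hs).le (abs_nonneg z)
    linarith
  have e2 : Real.exp (θ * s) ≤ Real.exp (|θ| * t) := by
    rw [Real.exp_le_exp]
    calc θ * s ≤ |θ| * s := by gcongr; exact le_abs_self θ
      _ ≤ _ := by gcongr
  calc _ ≤ N * Real.exp (θ * s) * s ^ (-b) * 1 := by gcongr
    _ ≤ _ := by rw [mul_one]; gcongr

/-- The `y`-derivative of `kerK`. -/
def kerK' (k x y t : ℝ) : ℂ := -(K₀' k (x - y) t + stConv (kerS k x) (K₀' k) y t)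

theorem hasDerivAt_kerK (k x y : ℝ) {t : ℝ} (ht : 0 < t) :
    HasDerivAt (fun y => kerK k x y t) (kerK' k x y t) y := by
  have h1 : HasDerivAt (fun y => K₀ k (x - y) t) (-K₀' k (x - y) t) y := by
    have := (hasDerivAt_K₀ k (x - y) ht).scomp y ((hasDerivAt_id y).const_sub x)
    simpa using! this
  have hC := C₀_pos
  have h2 := hasDerivAt_stConv (x := x) (y := y) (t := t) (F := kerS k x)
    (N := C₀ * Real.exp (|Λ₀ - 3 / 4 * k ^ 4| * t)) (M := 2 * C₀) (b := 1 / 2) (by positivity)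
    (by norm_num) (by norm_num) (continuousOn_slice (continuousOn_kerS k) x)
    (continuousOn_K₀ k) (continuousOn_K₀' k) (norm_kerS_le k x)
    (bound_of_isFreeKer (isFreeKer_K₀' k))
    (integrableOn_stInt_kerS (isFreeKer_K₀ k) (by norm_num) (by norm_num) x y t)
    (fun z s hs => hasDerivAt_K₀ k z hs)
  exact (h1.add h2).congr_deriv (by unfold kerK'; ring)

/-- Two derivatives of the free kernel cost s^{-3/4}, which is integrable, so the second derivative
may be taken under the integral. Here `kerS`, built as an abstract fixed point, becomes ∂_y²K - k²K:
the convolution with S₀ that appears is the one in `kerS_eq`. -/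
theorem hasDerivAt_kerK' (k x y : ℝ) {t : ℝ} (ht : 0 < t) :
    HasDerivAt (fun y => kerK' k x y t) (kerS k x y t + (k : ℂ) ^ 2 * kerK k x y t) y := by
  have h1 : HasDerivAt (fun y => K₀' k (x - y) t)
      (-(S₀ k (x - y) t + (k : ℂ) ^ 2 * K₀ k (x - y) t)) y := by
    have := (hasDerivAt_K₀' k (x - y) ht).scomp y ((hasDerivAt_id y).const_sub x)
    rw [neg_one_smul] at this
    exact this
  have hC := C₀_pos
  set N := C₀ * Real.exp (|Λ₀ - 3 / 4 * k ^ 4| * t)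
  have h2 := hasDerivAt_stConv (x := x) (y := y) (t := t) (F := kerS k x) (P := K₀' k)
    (P' := fun z s => S₀ k z s + (k : ℂ) ^ 2 * K₀ k z s)
    (N := N + k ^ 2 * (N * √t)) (M := 2 * C₀) (b := 3 / 4) (by positivity)
    (by norm_num) (by norm_num) (continuousOn_slice (continuousOn_kerS k) x)
    (continuousOn_K₀' k) ((continuousOn_S₀ k).add (continuousOn_const.mul (continuousOn_K₀ k)))
    (norm_kerS_le k x)
    (fun z s hs hst => by
      have b1 := bound_of_isFreeKer (isFreeKer_S₀ k) z s hs hst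
      have b2 := bound_of_isFreeKer (isFreeKer_K₀ k) z s hs hst
      have q : 0 < s ^ (-(3 / 4) : ℝ) := Real.rpow_pos_of_pos hs _
      rw [← rpow_neg_three_quarter hs] at b2
      have b3 : ‖K₀ k z s‖ ≤ N * √t * s ^ (-(3 / 4) : ℝ) := by
        refine b2.trans ?_
        calc _ ≤ N * (s ^ (-(3 / 4) : ℝ) * √t) := by gcongr
          _ = _ := by ring
      refine (norm_add_le _ _).trans ?_
      rw [norm_mul, norm_pow, Complex.norm_real, Real.norm_eq_abs, sq_abs]
      have := mul_le_mul_of_nonneg_left b3 (sq_nonneg k)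
      linarith)
    (integrableOn_stInt_kerS (isFreeKer_K₀' k) (by norm_num) (by norm_num) x y t)
    (fun z s hs => hasDerivAt_K₀' k z hs)
  have h3 : stConv (kerS k x) (fun z s => S₀ k z s + (k : ℂ) ^ 2 * K₀ k z s) y t =
      stConv (kerS k x) (S₀ k) y t + (k : ℂ) ^ 2 * stConv (kerS k x) (K₀ k) y t := by
    have i1 := integrableOn_stInt_kerS (isFreeKer_S₀ k) (by norm_num) (by norm_num) x y t
    have i2 := integrableOn_stInt_kerS (isFreeKer_K₀ k) (by norm_num) (by norm_num) x y t
    rw [stConv, stConv, stConv, ← integral_const_mul, ← integral_add i1 (i2.const_mul _)]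
    congr 1; ext p
    simp only [stInt]
    ring
  refine ((h1.add h2).neg).congr_deriv ?_
  rw [h3, kerS_eq k x y ht, kerK]
  ring

theorem deriv_kerK (k x : ℝ) {t : ℝ} (ht : 0 < t) :
    deriv (fun y => kerK k x y t) = fun y => kerK' k x y t :=
  funext fun y => (hasDerivAt_kerK k x y ht).deriv

theorem deriv_kerK' (k x : ℝ) {t : ℝ} (ht : 0 < t) :
    deriv (fun y => kerK' k x y t) = fun y => kerS k x y t + (k : ℂ) ^ 2 * kerK k x y t :=
  funext fun y => (hasDerivAt_kerK' k x y ht).deriv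

theorem contDiff_kerK (k x : ℝ) {t : ℝ} (ht : 0 < t) : ContDiff ℝ 2 fun y => kerK k x y t := by
  rw [show (2 : WithTop ℕ∞) = 1 + 1 by norm_num, contDiff_succ_iff_deriv]
  refine ⟨fun y => (hasDerivAt_kerK k x y ht).differentiableAt, by simp, ?_⟩
  rw [deriv_kerK k x ht, contDiff_one_iff_deriv]
  refine ⟨fun y => (hasDerivAt_kerK' k x y ht).differentiableAt, ?_⟩
  rw [deriv_kerK' k x ht]
  have h1 : Continuous fun y => kerS k x y t := continuous_kerS_right k x ht
  have h2 : Continuous fun y => kerK k x y t := continuous_kerK_right k x ht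
  fun_prop

theorem S_kerK (k x y : ℝ) {t : ℝ} (ht : 0 < t) :
    S (fun x y k t => kerK k x y t) x y k t = kerS k x y t := by
  have h : iteratedDeriv 2 (fun y' => kerK k x y' t) y =
      kerS k x y t + (k : ℂ) ^ 2 * kerK k x y t := by
    rw [iteratedDeriv_succ, iteratedDeriv_one, deriv_kerK k x ht, deriv_kerK' k x ht]
  simp only [S, h, add_sub_cancel_right]


/-! ### The semigroup law for the kernels. -/

theorem integrable_prod_slab {f : ℝ → ℝ × ℝ → ℂ} {t : ℝ} {g : ℝ → ℝ} {m : ℝ × ℝ → ℝ}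
    (hc : ContinuousOn (Function.uncurry f) (Set.univ ×ˢ slab t)) (hg : Integrable g)
    (hm : IntegrableOn m (slab t)) (hb : ∀ z, ∀ p ∈ slab t, ‖f z p‖ ≤ g z * m p) :
    Integrable (Function.uncurry f) (volume.prod (volume.restrict (slab t))) := by
  have e : (volume : Measure ℝ).prod ((volume : Measure (ℝ × ℝ)).restrict (slab t)) =
      (volume.prod volume).restrict (Set.univ ×ˢ slab t) := by
    rw [← Measure.prod_restrict, Measure.restrict_univ]
  have hms : MeasurableSet ((Set.univ : Set ℝ) ×ˢ slab t) :=
    MeasurableSet.univ.prod (measurableSet_slab t)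
  refine (Integrable.mul_prod hg hm).mono' ?_ ?_
  · rw [e]; exact hc.aestronglyMeasurable hms
  · rw [e]
    filter_upwards [ae_restrict_mem hms] with q hq
    exact hb q.1 q.2 hq.2

/-- The row `∫ a(z) S(z, y, t) dz`. -/
def rowS (k : ℝ) (a : ℝ → ℂ) (y t : ℝ) : ℂ := ∫ z, a z * kerS k z y t

/-- The row `∫ a(z) K(z, y, t) dz`. -/
def rowK (k : ℝ) (a : ℝ → ℂ) (y t : ℝ) : ℂ := ∫ z, a z * kerK k z y t

/-- Half of the first decay is kept for integration; the other half and the second factor carry the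
decay from x to y. -/
theorem exp_mul_exp_le (x z y : ℝ) : Real.exp (-(1 * |x - z|)) * Real.exp (-(1 * |z - y|)) ≤
    Real.exp (-(1 / 2 * |x - z|)) * Real.exp (-(1 / 2 * |x - y|)) := by
  rw [← Real.exp_add, ← Real.exp_add, Real.exp_le_exp]
  have h1 := abs_sub_le x z y
  have h2 := abs_nonneg (z - y)
  linarith

theorem integrable_row {a : ℝ → ℂ} {A x₀ : ℝ} (hac : Continuous a)
    (hA : ∀ z, ‖a z‖ ≤ A * Real.exp (-(1 * |x₀ - z|))) : Integrable a :=
  ((integrable_exp_neg_mul_abs_sub one_pos x₀).const_mul A).mono' hac.aestronglyMeasurable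
    (Eventually.of_forall hA)

theorem const_nonneg_of_bound {a : ℝ → ℂ} {A x₀ : ℝ}
    (hA : ∀ z, ‖a z‖ ≤ A * Real.exp (-(1 * |x₀ - z|))) : 0 ≤ A := by
  have := (norm_nonneg _).trans (hA x₀)
  exact nonneg_of_mul_nonneg_left this (Real.exp_pos _)

theorem integrable_row_fubini {P : ℝ → ℝ → ℂ} {k N b : ℝ}
    (hP : IsFreeKer P (Λ₀ - 3 / 4 * k ^ 4) N b) (hb : 0 ≤ b) (hb1 : b < 1)
    {a : ℝ → ℂ} {A x₀ : ℝ} (hac : Continuous a)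
    (hA : ∀ z, ‖a z‖ ≤ A * Real.exp (-(1 * |x₀ - z|))) (y t : ℝ) :
    Integrable (Function.uncurry fun z p => a z * stInt (kerS k z) P y t p)
      (volume.prod (volume.restrict (slab t))) := by
  have hA0 := const_nonneg_of_bound hA
  have hC := C₀_pos
  set c := 2 * C₀ * Real.exp (|kap k| * t) * (3 / 2) *
    (N * Real.exp (|Λ₀ - 3 / 4 * k ^ 4| * t)) with hc
  have hi : IntegrableOn (fun p : ℝ × ℝ => ((t - p.1) ^ (-(3 / 4) : ℝ) * p.1 ^ (-b)) *
      Real.exp (-(1 / 2 * |x₀ - p.2|))) (slab t) :=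
    integrable_slab_mul (c := fun s => (t - s) ^ (-(3 / 4) : ℝ) * s ^ (-b))
      (integrableOn_rpow_mul_rpow (by norm_num) (by norm_num) hb hb1 t)
      (integrable_exp_neg_mul_abs_sub (by norm_num) x₀)
  refine integrable_prod_slab (g := fun z => A * Real.exp (-(1 / 2 * |x₀ - z|)))
    (m := fun p => c * (((t - p.1) ^ (-(3 / 4) : ℝ) * p.1 ^ (-b)) *
      Real.exp (-(1 / 2 * |x₀ - p.2|)))) ?_
    ((integrable_exp_neg_mul_abs_sub (by norm_num) x₀).const_mul _) (hi.const_mul _) ?_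
  · have h1 : ContinuousOn (fun q : ℝ × ℝ × ℝ => kerS k q.1 q.2.2 (t - q.2.1))
        (Set.univ ×ˢ slab t) :=
      (continuousOn_kerS k).comp (f := fun q : ℝ × ℝ × ℝ => (q.1, q.2.2, t - q.2.1))
        (by fun_prop) fun q hq => sub_pos.2 hq.2.1.2
    have h2 : ContinuousOn (fun q : ℝ × ℝ × ℝ => P (q.2.2 - y) q.2.1) (Set.univ ×ˢ slab t) :=
      hP.cont.comp (f := fun q : ℝ × ℝ × ℝ => (q.2.2 - y, q.2.1)) (by fun_prop)
        fun q hq => hq.2.1.1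
    have h3 : Continuous fun q : ℝ × ℝ × ℝ => (V q.2.2 : ℂ) := continuous_V.comp (by fun_prop)
    exact (hac.comp continuous_fst).continuousOn.mul ((h1.mul h3.continuousOn).mul h2)
  · intro z p hp
    have h1 := norm_stInt_le_of_bound (F := kerS k z) (P := P) (y := y) (M := 2 * C₀) (κ := kap k)
      (x := z) (by positivity) (norm_kerS_le k z) (bound_of_isFreeKer hP) hp
    have q1 : 0 ≤ (t - p.1) ^ (-(3 / 4) : ℝ) := Real.rpow_nonneg (sub_nonneg.2 hp.1.2.le) _
    have q2 : 0 ≤ p.1 ^ (-b) := Real.rpow_nonneg hp.1.1.le _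
    have hN := hP.nonneg
    rw [norm_mul]
    calc ‖a z‖ * ‖stInt (kerS k z) P y t p‖
        ≤ (A * Real.exp (-(1 * |x₀ - z|))) * (c * (((t - p.1) ^ (-(3 / 4) : ℝ) * p.1 ^ (-b)) *
          Real.exp (-(1 * |z - p.2|)))) :=
          mul_le_mul (hA z) h1 (norm_nonneg _) (by positivity)
      _ = A * c * ((t - p.1) ^ (-(3 / 4) : ℝ) * p.1 ^ (-b)) *
          (Real.exp (-(1 * |x₀ - z|)) * Real.exp (-(1 * |z - p.2|))) := by ring
      _ ≤ A * c * ((t - p.1) ^ (-(3 / 4) : ℝ) * p.1 ^ (-b)) *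
          (Real.exp (-(1 / 2 * |x₀ - z|)) * Real.exp (-(1 / 2 * |x₀ - p.2|))) :=
          mul_le_mul_of_nonneg_left (exp_mul_exp_le _ _ _) (by positivity)
      _ = _ := by ring

theorem integral_mul_stInt (k : ℝ) (P : ℝ → ℝ → ℂ) (a : ℝ → ℂ) (y t : ℝ) (p : ℝ × ℝ) :
    ∫ z, a z * stInt (kerS k z) P y t p = stInt (rowS k a) P y t p := by
  simp only [stInt, rowS]
  rw [← integral_mul_const, ← integral_mul_const]
  congr 1; ext z
  ring

theorem integrableOn_stInt_rowS {P : ℝ → ℝ → ℂ} {k N b : ℝ}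
    (hP : IsFreeKer P (Λ₀ - 3 / 4 * k ^ 4) N b) (hb : 0 ≤ b) (hb1 : b < 1)
    {a : ℝ → ℂ} {A x₀ : ℝ} (hac : Continuous a)
    (hA : ∀ z, ‖a z‖ ≤ A * Real.exp (-(1 * |x₀ - z|))) (y t : ℝ) :
    IntegrableOn (stInt (rowS k a) P y t) (slab t) := by
  have h := (integrable_row_fubini hP hb hb1 hac hA y t).integral_prod_right
  refine h.congr (Eventually.of_forall fun p => ?_)
  exact integral_mul_stInt k P a y t p

theorem integral_mul_stConv {P : ℝ → ℝ → ℂ} {k N b : ℝ}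
    (hP : IsFreeKer P (Λ₀ - 3 / 4 * k ^ 4) N b) (hb : 0 ≤ b) (hb1 : b < 1)
    {a : ℝ → ℂ} {A x₀ : ℝ} (hac : Continuous a)
    (hA : ∀ z, ‖a z‖ ≤ A * Real.exp (-(1 * |x₀ - z|))) (y t : ℝ) :
    Integrable (fun z => a z * stConv (kerS k z) P y t) ∧
    ∫ z, a z * stConv (kerS k z) P y t = stConv (rowS k a) P y t := by
  have hI := integrable_row_fubini hP hb hb1 hac hA y t
  have e : ∀ z, a z * stConv (kerS k z) P y t =
      ∫ p in slab t, a z * stInt (kerS k z) P y t p := fun z => by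
    rw [stConv, integral_const_mul]
  constructor
  · simp_rw [e]
    exact hI.integral_prod_left
  · simp_rw [e]
    rw [integral_integral_swap hI, stConv]
    congr 1; ext p
    exact integral_mul_stInt k P a y t p

theorem integrable_mul_freeKer {P : ℝ → ℝ → ℂ} {θ N b : ℝ} (hP : IsFreeKer P θ N b)
    {a : ℝ → ℂ} {A x₀ : ℝ} (hac : Continuous a)
    (hA : ∀ z, ‖a z‖ ≤ A * Real.exp (-(1 * |x₀ - z|))) (y : ℝ) {t : ℝ} (ht : 0 < t) :
    Integrable fun z => a z * P (z - y) t := by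
  refine (integrable_row hac hA).mul_bdd (c := N * Real.exp (|θ| * (t + 1)) * t ^ (-b)) ?_ ?_
  · exact (hP.cont.comp_continuous (f := fun z : ℝ => (z - y, t)) (by fun_prop)
      fun _ => ht).aestronglyMeasurable
  · exact Eventually.of_forall fun z => bound_of_isFreeKer hP _ _ ht (lt_add_one t)

/-- The Volterra equation acts on the second variable and on time only. It may therefore be
integrated against any decaying function of the first variable, and only the source term changes. -/
theorem rowS_eq (k : ℝ) {a : ℝ → ℂ} {A x₀ : ℝ} (hac : Continuous a)
    (hA : ∀ z, ‖a z‖ ≤ A * Real.exp (-(1 * |x₀ - z|))) (y : ℝ) {t : ℝ} (ht : 0 < t) :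
    rowS k a y t = (∫ z, a z * S₀ k (z - y) t) + stConv (rowS k a) (S₀ k) y t := by
  obtain ⟨h1, h2⟩ := integral_mul_stConv (isFreeKer_S₀ k) (by norm_num) (by norm_num) hac hA y t
  rw [← h2, ← integral_add (integrable_mul_freeKer (isFreeKer_S₀ k) hac hA y ht) h1, rowS]
  congr 1; ext z
  rw [kerS_eq k z y ht]
  ring

theorem rowK_eq (k : ℝ) {a : ℝ → ℂ} {A x₀ : ℝ} (hac : Continuous a)
    (hA : ∀ z, ‖a z‖ ≤ A * Real.exp (-(1 * |x₀ - z|))) (y : ℝ) {t : ℝ} (ht : 0 < t) :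
    rowK k a y t = (∫ z, a z * K₀ k (z - y) t) + stConv (rowS k a) (K₀ k) y t := by
  obtain ⟨h1, h2⟩ := integral_mul_stConv (isFreeKer_K₀ k) (by norm_num) (by norm_num) hac hA y t
  rw [← h2, ← integral_add (integrable_mul_freeKer (isFreeKer_K₀ k) hac hA y ht) h1, rowK]
  congr 1; ext z
  rw [kerK]
  ring

theorem norm_rowS_le (k : ℝ) {a : ℝ → ℂ} {A x₀ : ℝ}
    (hA : ∀ z, ‖a z‖ ≤ A * Real.exp (-(1 * |x₀ - z|))) (y : ℝ) {t : ℝ} (ht : 0 < t) :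
    ‖rowS k a y t‖ ≤ 8 * A * C₀ * Real.exp (kap k * t) * t ^ (-(3 / 4) : ℝ) *
      Real.exp (-(1 / 2 * |x₀ - y|)) := by
  have hA0 := const_nonneg_of_bound hA
  have hC := C₀_pos
  have q : 0 < t ^ (-(3 / 4) : ℝ) := Real.rpow_pos_of_pos ht _
  refine (norm_integral_le_of_norm_le (((integrable_exp_neg_mul_abs_sub (c := 1 / 2)
    (by norm_num) x₀)).const_mul (2 * A * C₀ * Real.exp (kap k * t) * t ^ (-(3 / 4) : ℝ) *
      Real.exp (-(1 / 2 * |x₀ - y|)))) (Eventually.of_forall fun z => ?_)).trans (le_of_eq ?_)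
  · have h1 : Real.exp (-(rate t * |z - y|)) ≤ Real.exp (-(1 * |z - y|)) := by
      rw [Real.exp_le_exp, neg_le_neg_iff]
      gcongr
      exact one_le_rate ht
    rw [norm_mul]
    calc _ ≤ (A * Real.exp (-(1 * |x₀ - z|))) * (2 * C₀ * Real.exp (kap k * t) *
          t ^ (-(3 / 4) : ℝ) * Real.exp (-(1 * |z - y|))) :=
          mul_le_mul (hA z) ((norm_kerS_le k z y t ht).trans
            (mul_le_mul_of_nonneg_left h1 (by positivity))) (norm_nonneg _) (by positivity)
      _ = 2 * A * C₀ * Real.exp (kap k * t) * t ^ (-(3 / 4) : ℝ) *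
          (Real.exp (-(1 * |x₀ - z|)) * Real.exp (-(1 * |z - y|))) := by ring
      _ ≤ 2 * A * C₀ * Real.exp (kap k * t) * t ^ (-(3 / 4) : ℝ) *
          (Real.exp (-(1 / 2 * |x₀ - z|)) * Real.exp (-(1 / 2 * |x₀ - y|))) :=
          mul_le_mul_of_nonneg_left (exp_mul_exp_le _ _ _) (by positivity)
      _ = _ := by ring
  · rw [integral_const_mul, integral_exp_neg_mul_abs_sub (by norm_num)]
    ring

/-- Splitting of the space-time convolution at an intermediate time. -/
theorem stConv_split {F P : ℝ → ℝ → ℂ} {y t r : ℝ} (ht : 0 < t) (hr : 0 < r)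
    (hI : IntegrableOn (stInt F P y (r + t)) (slab (r + t))) :
    stConv F P y (r + t) = stConv (fun z s => F z (r + s)) P y t +
      ∫ p in slab r, F p.2 (r - p.1) * V p.2 * P (p.2 - y) (p.1 + t) := by
  have hu : slab (r + t) = slab t ∪ (Set.Ico t (r + t) ×ˢ Set.univ) := by
    rw [slab, slab, ← Set.union_prod, Set.Ioo_union_Ico_eq_Ioo ht (by linarith)]
  have hd : Disjoint (slab t) (Set.Ico t (r + t) ×ˢ (Set.univ : Set ℝ)) := by
    rw [Set.disjoint_left]
    rintro p ⟨h1, -⟩ ⟨h2, -⟩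
    exact absurd h1.2 (not_lt.2 h2.1)
  have hms : MeasurableSet (Set.Ico t (r + t) ×ˢ (Set.univ : Set ℝ)) :=
    measurableSet_Ico.prod .univ
  rw [hu] at hI
  have h1 : stConv F P y (r + t) = (∫ p in slab t, stInt F P y (r + t) p) +
      ∫ p in Set.Ico t (r + t) ×ˢ (Set.univ : Set ℝ), stInt F P y (r + t) p := by
    rw [stConv, hu, setIntegral_union hd hms (hI.mono_set Set.subset_union_left)
      (hI.mono_set Set.subset_union_right)]
  rw [h1]
  congr 1
  · rw [stConv]
    congr 1; ext p
    simp only [stInt, add_sub_assoc]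
  · have hae : (Set.Ico t (r + t) ×ˢ (Set.univ : Set ℝ)) =ᵐ[volume]
        (Set.Ioo t (r + t) ×ˢ (Set.univ : Set ℝ)) :=
      Measure.set_prod_ae_eq Ioo_ae_eq_Ico.symm (ae_eq_refl _)
    rw [setIntegral_congr_set hae]
    have hpre : slab r = (fun p : ℝ × ℝ => p + (t, 0)) ⁻¹'
        (Set.Ioo t (r + t) ×ˢ (Set.univ : Set ℝ)) := by
      ext p
      simp [slab]
    rw [hpre, ← (measurePreserving_add_right (volume : Measure (ℝ × ℝ)) (t, 0)).setIntegral_preimage_emb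
      (MeasurableEquiv.addRight ((t, 0) : ℝ × ℝ)).measurableEmbedding]
    congr 1; ext p
    simp only [stInt, Prod.fst_add, Prod.snd_add, add_zero]
    rw [show r + t - (p.1 + t) = r - p.1 by ring]

theorem rowBound_kerK (k x : ℝ) {r : ℝ} (hr : 0 < r) (z : ℝ) :
    ‖kerK k x z r‖ ≤ (C₁ * Real.exp ((kap k + 1) * r) * r ^ (-(1 / 4) : ℝ)) *
      Real.exp (-(1 * |x - z|)) := by
  have q : 0 < r ^ (-(1 / 4) : ℝ) := Real.rpow_pos_of_pos hr _
  have hC := C₁_pos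
  refine (norm_kerK_le k x z hr).trans (mul_le_mul_of_nonneg_left ?_ (by positivity))
  rw [Real.exp_le_exp, neg_le_neg_iff]
  gcongr
  exact one_le_rate hr

/-- Composition of `kerK` with a free kernel. -/
theorem integral_kerK_mul_freeKer {P : ℝ → ℝ → ℂ} {k N b : ℝ}
    (hP : IsFreeKer P (Λ₀ - 3 / 4 * k ^ 4) N b)
    (hcomp : ∀ x y t r : ℝ, 0 < t → 0 < r →
      ∫ z, K₀ k (x - z) t * P (z - y) r = P (x - y) (t + r))
    (x y : ℝ) {t r : ℝ} (ht : 0 < t) (hr : 0 < r) (hPi : Integrable fun z => P z t) :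
    ∫ z, kerK k x z r * P (z - y) t = P (x - y) (r + t) +
      ∫ p in slab r, kerS k x p.2 (r - p.1) * V p.2 * P (p.2 - y) (p.1 + t) := by
  have hC := C₀_pos
  set N' := C₀ * Real.exp (|Λ₀ - 3 / 4 * k ^ 4| * r)
  have hPi' : Integrable fun z => P (z - y) t := hPi.comp_sub_right y
  have hPc : Continuous fun z => P (z - y) t :=
    hP.cont.comp_continuous (f := fun z : ℝ => (z - y, t)) (by fun_prop) fun _ => ht
  have hI : Integrable (Function.uncurry fun z p => stInt (kerS k x) (K₀ k) z r p * P (z - y) t)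
      (volume.prod (volume.restrict (slab r))) := by
    refine integrable_prod_slab (g := fun z => ‖P (z - y) t‖)
      (m := fun p => (2 * C₀ * Real.exp (|kap k| * r) * (3 / 2) * N') *
      (((r - p.1) ^ (-(3 / 4) : ℝ) * p.1 ^ (-(1 / 4) : ℝ)) * Real.exp (-(1 * |x - p.2|))))
      ?_ hPi'.norm ((integrableOn_majorant (by norm_num) (by norm_num) x).const_mul _) ?_
    · have h1 : ContinuousOn (fun q : ℝ × ℝ × ℝ => kerS k x q.2.2 (r - q.2.1))
          (Set.univ ×ˢ slab r) :=
        (continuousOn_kerS k).comp (f := fun q : ℝ × ℝ × ℝ => (x, q.2.2, r - q.2.1))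
          (by fun_prop) fun q hq => sub_pos.2 hq.2.1.2
      have h2 : ContinuousOn (fun q : ℝ × ℝ × ℝ => K₀ k (q.2.2 - q.1) q.2.1)
          (Set.univ ×ˢ slab r) :=
        (continuousOn_K₀ k).comp (f := fun q : ℝ × ℝ × ℝ => (q.2.2 - q.1, q.2.1)) (by fun_prop)
          fun q hq => hq.2.1.1
      have h3 : Continuous fun q : ℝ × ℝ × ℝ => (V q.2.2 : ℂ) := continuous_V.comp (by fun_prop)
      exact ((h1.mul h3.continuousOn).mul h2).mul (hPc.comp continuous_fst).continuousOn
    · intro z p hp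
      rw [norm_mul, mul_comm]
      refine mul_le_mul_of_nonneg_left ?_ (norm_nonneg _)
      exact norm_stInt_le_of_bound (F := kerS k x) (P := K₀ k) (κ := kap k) (by positivity)
        (norm_kerS_le k x) (bound_of_isFreeKer (isFreeKer_K₀ k)) hp
  have hi1 : Integrable fun z => K₀ k (x - z) r * P (z - y) t := by
    refine hPi'.bdd_mul (c := C₀ * Real.exp (|Λ₀ - 3 / 4 * k ^ 4| * (r + 1)) *
      r ^ (-(1 / 4) : ℝ)) ?_ (Eventually.of_forall fun z =>
        bound_of_isFreeKer (isFreeKer_K₀ k) _ _ hr (lt_add_one r))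
    exact ((continuousOn_K₀ k).comp_continuous (f := fun z : ℝ => (x - z, r)) (by fun_prop)
      fun _ => hr).aestronglyMeasurable
  have e : ∀ z, stConv (kerS k x) (K₀ k) z r * P (z - y) t =
      ∫ p in slab r, stInt (kerS k x) (K₀ k) z r p * P (z - y) t := fun z => by
    rw [stConv, integral_mul_const]
  have hi2 : Integrable fun z => stConv (kerS k x) (K₀ k) z r * P (z - y) t := by
    simp_rw [e]; exact hI.integral_prod_left
  have e2 : ∫ z, stConv (kerS k x) (K₀ k) z r * P (z - y) t =
      ∫ p in slab r, kerS k x p.2 (r - p.1) * V p.2 * P (p.2 - y) (p.1 + t) := by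
    simp_rw [e]
    rw [integral_integral_swap hI]
    refine setIntegral_congr_fun (measurableSet_slab r) fun p hp => ?_
    -- The z-integral joins the free kernel of time s to the one of time t.
    rw [← hcomp p.2 y p.1 t hp.1.1 ht, ← integral_const_mul]
    congr 1; ext z
    simp only [stInt]
    ring
  rw [← hcomp x y r t hr ht, ← e2, ← integral_add hi1 hi2]
  congr 1; ext z
  rw [kerK]
  ring

/-- Restarting at time r: in the equation at time r + t, the part of the time integral with s beyond
t is exactly the perturbation term of ∫ K(x,z,r) S₀(z-y,t) dz. What is left is a Volterra equation
on (0, t) with that integral as source. -/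
theorem kerS_add_eq (k x y : ℝ) {t r : ℝ} (ht : 0 < t) (hr : 0 < r) :
    kerS k x y (r + t) = (∫ z, kerK k x z r * S₀ k (z - y) t) +
      stConv (fun z s => kerS k x z (r + s)) (S₀ k) y t := by
  rw [kerS_eq k x y (add_pos hr ht), stConv_split ht hr
    (integrableOn_stInt_kerS (isFreeKer_S₀ k) (by norm_num) (by norm_num) x y _),
    integral_kerK_mul_freeKer (isFreeKer_S₀ k) (fun x y t r => K₀_comp_S₀ k x y) x y ht hr
      (integrable_S₀ k ht)]
  ring

theorem kerK_add_eq (k x y : ℝ) {t r : ℝ} (ht : 0 < t) (hr : 0 < r) :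
    kerK k x y (r + t) = (∫ z, kerK k x z r * K₀ k (z - y) t) +
      stConv (fun z s => kerS k x z (r + s)) (K₀ k) y t := by
  rw [kerK, stConv_split ht hr
    (integrableOn_stInt_kerS (isFreeKer_K₀ k) (by norm_num) (by norm_num) x y _),
    integral_kerK_mul_freeKer (isFreeKer_K₀ k) (fun x y t r => K₀_comp_K₀ k x y) x y ht hr
      (integrable_K₀ k ht)]
  ring

/-- Uniqueness for the homogeneous Volterra equation. -/
theorem eq_zero_of_eq_stConv {W : ℝ → ℝ → ℂ} {k M : ℝ} (hM : 0 ≤ M)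
    (hW : ∀ y t : ℝ, 0 < t → ‖W y t‖ ≤ M * Real.exp (kap k * t) * t ^ (-(3 / 4) : ℝ))
    (heq : ∀ y t : ℝ, 0 < t → W y t = stConv W (S₀ k) y t) (y : ℝ) {t : ℝ} (ht : 0 < t) :
    W y t = 0 := by
  have h : ∀ n : ℕ, ∀ y t : ℝ, 0 < t →
      ‖W y t‖ ≤ M / 2 ^ n * Real.exp (kap k * t) * t ^ (-(3 / 4) : ℝ) := by
    intro n
    induction n with
    | zero => simpa using hW
    | succ n ih =>
      intro y t ht
      rw [heq y t ht]
      -- With ε = 0 no spatial decay is required; each use of the equation halves the bound.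
      have := norm_stConv_S₀_le (F := W) (k := k) (M := M / 2 ^ n) (ε := 0) (x := 0) (y := y)
        (by positivity) le_rfl zero_le_one (by simpa using ih) ht
      refine this.trans (le_of_eq ?_)
      rw [zero_mul, neg_zero, Real.exp_zero, mul_one, pow_succ, div_div]
  have hl : Tendsto (fun n : ℕ => M / 2 ^ n * Real.exp (kap k * t) * t ^ (-(3 / 4) : ℝ)) atTop
      (𝓝 (0 * Real.exp (kap k * t) * t ^ (-(3 / 4) : ℝ))) :=
    ((tendsto_const_nhds.div_atTop (tendsto_pow_atTop_atTop_of_one_lt one_lt_two)).mul_const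
      _).mul_const _
  rw [zero_mul, zero_mul] at hl
  have := ge_of_tendsto hl (Eventually.of_forall fun n => h n y t ht)
  exact norm_le_zero_iff.1 this

/-- As functions of (y, t) both sides solve the Volterra equation with source ∫ K(x,z,r) S₀(z-y,t)
dz, by `rowS_eq` and `kerS_add_eq`. Their difference solves the homogeneous equation and vanishes.
-/
theorem integral_kerK_mul_kerS (k x y : ℝ) {t r : ℝ} (ht : 0 < t) (hr : 0 < r) :
    ∫ z, kerK k x z r * kerS k z y t = kerS k x y (r + t) := by
  have hac := continuous_kerK_right k x hr
  have hA := rowBound_kerK k x hr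
  set A := C₁ * Real.exp ((kap k + 1) * r) * r ^ (-(1 / 4) : ℝ)
  have hA0 := const_nonneg_of_bound hA
  have hC := C₀_pos
  have hS1 : ∀ z s : ℝ, 0 < s → ‖kerS k x z (r + s)‖ ≤
      2 * C₀ * Real.exp (kap k * r) * Real.exp (kap k * s) * s ^ (-(3 / 4) : ℝ) := by
    intro z s hs
    have hrs : 0 < r + s := add_pos hr hs
    have q : 0 < (r + s) ^ (-(3 / 4) : ℝ) := Real.rpow_pos_of_pos hrs _
    refine (norm_kerS_le k x z _ hrs).trans ?_
    have e1 : Real.exp (-(rate (r + s) * |x - z|)) ≤ 1 := by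
      rw [Real.exp_le_one_iff]
      have := mul_nonneg (rate_pos hrs).le (abs_nonneg (x - z))
      linarith
    have e2 : (r + s) ^ (-(3 / 4) : ℝ) ≤ s ^ (-(3 / 4) : ℝ) :=
      Real.rpow_le_rpow_of_nonpos hs (by linarith) (by norm_num)
    calc _ ≤ 2 * C₀ * Real.exp (kap k * (r + s)) * (r + s) ^ (-(3 / 4) : ℝ) * 1 := by gcongr
      _ ≤ 2 * C₀ * Real.exp (kap k * (r + s)) * s ^ (-(3 / 4) : ℝ) := by rw [mul_one]; gcongr
      _ = _ := by rw [mul_add, Real.exp_add]; ring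
  have hrow : ∀ z s : ℝ, 0 < s → ‖rowS k (fun z => kerK k x z r) z s‖ ≤
      8 * A * C₀ * Real.exp (kap k * s) * s ^ (-(3 / 4) : ℝ) := by
    intro z s hs
    have q : 0 < s ^ (-(3 / 4) : ℝ) := Real.rpow_pos_of_pos hs _
    refine (norm_rowS_le k hA z hs).trans (mul_le_of_le_one_right (by positivity) ?_)
    rw [Real.exp_le_one_iff]
    have := abs_nonneg (x - z)
    linarith
  have hSc : ContinuousOn (fun p : ℝ × ℝ => kerS k x p.1 (r + p.2)) {p | 0 < p.2} :=
    (continuousOn_kerS k).comp (f := fun p : ℝ × ℝ => (x, p.1, r + p.2)) (by fun_prop)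
      fun p hp => add_pos hr hp
  have h := eq_zero_of_eq_stConv (k := k)
    (W := fun y t => kerS k x y (r + t) - rowS k (fun z => kerK k x z r) y t)
    (M := 2 * C₀ * Real.exp (kap k * r) + 8 * A * C₀) (by positivity)
    (fun z s hs => (norm_sub_le _ _).trans ((add_le_add (hS1 z s hs) (hrow z s hs)).trans
      (le_of_eq (by ring))))
    (fun z s hs => by
      have i1 : IntegrableOn (stInt (fun z s => kerS k x z (r + s)) (S₀ k) z s) (slab s) :=
        integrableOn_stInt (ε := 0) (x := 0) (M := 2 * C₀ * Real.exp (kap k * r))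
          (isFreeKer_S₀ k) (by norm_num) (by norm_num)
          l₀_pos.le (by positivity) le_rfl zero_le_one hSc
          (fun z s hs => by simpa [kap] using hS1 z s hs)
      have i2 : IntegrableOn (stInt (rowS k fun z => kerK k x z r) (S₀ k) z s) (slab s) :=
        integrableOn_stInt_rowS (isFreeKer_S₀ k) (by norm_num) (by norm_num) hac hA z s
      rw [stConv_sub i1 i2, kerS_add_eq k x z hs hr, rowS_eq k hac hA z hs]
      ring) y ht
  exact (sub_eq_zero.1 h).symm

/-- No further uniqueness argument is needed: K is explicit in S, so the law for S carries over. -/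
theorem integral_kerK_mul_kerK (k x y : ℝ) {t r : ℝ} (ht : 0 < t) (hr : 0 < r) :
    ∫ z, kerK k x z r * kerK k z y t = kerK k x y (r + t) := by
  have h := rowK_eq k (continuous_kerK_right k x hr) (rowBound_kerK k x hr) y ht
  rw [rowK] at h
  rw [h, kerK_add_eq k x y ht hr]
  congr 1
  rw [stConv, stConv]
  refine setIntegral_congr_fun (measurableSet_slab t) fun p hp => ?_
  simp only [stInt, rowS]
  rw [integral_kerK_mul_kerS k x p.2 (sub_pos.2 hp.1.2) hr]


/-! ### Integral operators with exponentially decaying kernels on L². -/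

theorem norm_sq_L2 (f : L2) : ‖f‖ ^ 2 = ∫ x, ‖f x‖ ^ 2 := by
  rw [← inner_self_eq_norm_sq (𝕜 := ℂ) f, MeasureTheory.L2.inner_def]
  simp_rw [inner_self_eq_norm_sq_to_K]
  have h : ∫ x, ((‖f x‖ : ℂ)) ^ 2 = ((∫ x, ‖f x‖ ^ 2 : ℝ) : ℂ) := by
    rw [← integral_complex_ofReal]
    push_cast
    rfl
  simp only [Complex.coe_algebraMap, h, RCLike.re_to_complex, Complex.ofReal_re]

theorem integrable_norm_sq (f : L2) : Integrable fun x => ‖f x‖ ^ 2 :=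
  (memLp_two_iff_integrable_sq_norm (Lp.aestronglyMeasurable f)).1 (Lp.memLp f)

theorem integrable_mul_L2 {a : ℝ → ℂ} (ha : MemLp a 2) (f : L2) : Integrable fun x => a x * f x :=
  ha.integrable_mul (Lp.memLp f)

theorem memLp_two_of_bound {a : ℝ → ℂ} {A c x₀ : ℝ} (hc : 0 < c)
    (ham : AEStronglyMeasurable a volume)
    (hA : ∀ z, ‖a z‖ ≤ A * Real.exp (-(c * |x₀ - z|))) : MemLp a 2 := by
  rw [memLp_two_iff_integrable_sq_norm ham]
  refine ((integrable_exp_neg_mul_abs_sub (c := 2 * c) (by positivity) x₀).const_mul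
    (A ^ 2)).mono' (ham.norm.pow 2) (Eventually.of_forall fun z => ?_)
  rw [Real.norm_of_nonneg (by positivity)]
  calc ‖a z‖ ^ 2 ≤ (A * Real.exp (-(c * |x₀ - z|))) ^ 2 := by
        gcongr; exact hA z
    _ = _ := by rw [mul_pow, ← Real.exp_nat_mul]; push_cast; ring_nf

/-- Measurable kernels with exponential decay off the diagonal. -/
structure IsExpKer (P : ℝ → ℝ → ℂ) (C a : ℝ) : Prop where
  meas : Measurable (Function.uncurry P)
  pos : 0 < a
  bound : ∀ x y, ‖P x y‖ ≤ C * Real.exp (-(a * |x - y|))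

namespace IsExpKer

variable {P Q R : ℝ → ℝ → ℂ} {C a C' a' : ℝ}

theorem nonneg (h : IsExpKer P C a) : 0 ≤ C :=
  nonneg_of_mul_nonneg_left ((norm_nonneg _).trans (h.bound 0 0)) (Real.exp_pos _)

theorem memLp (h : IsExpKer P C a) (x : ℝ) : MemLp (P x) 2 :=
  memLp_two_of_bound h.pos (h.meas.of_uncurry_left).aestronglyMeasurable (h.bound x)

theorem integrable (h : IsExpKer P C a) (f : L2) (x : ℝ) : Integrable fun y => P x y * f y :=
  integrable_mul_L2 (h.memLp x) f

/-- Pointwise form of Schur's estimate. -/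
theorem norm_sq_le (h : IsExpKer P C a) (f : L2) (x : ℝ) :
    ‖∫ y, P x y * f y‖ ^ 2 ≤ 2 * C ^ 2 / a * ∫ y, ‖f y‖ ^ 2 * Real.exp (-(a * |x - y|)) := by
  have ha := h.pos
  set e : ℝ → ℝ := fun y => Real.exp (-(a * |x - y|)) with he
  have he1 : ∀ y, ‖e y‖ ≤ 1 := fun y => by
    rw [Real.norm_of_nonneg (Real.exp_pos _).le, Real.exp_le_one_iff]
    have := mul_nonneg ha.le (abs_nonneg (x - y)); linarith
  have hec : Continuous e := by fun_prop
  have hei : Integrable e := integrable_exp_neg_mul_abs_sub ha x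
  have i2 : Integrable fun y => ‖f y‖ ^ 2 * e y :=
    (integrable_norm_sq f).mul_bdd (c := 1) hec.aestronglyMeasurable (Eventually.of_forall he1)
  have i1 : Integrable fun y => ‖f y‖ * e y := by
    refine ((i2.add hei).mono' ((Lp.aestronglyMeasurable f).norm.mul hec.aestronglyMeasurable) ?_)
    refine Eventually.of_forall fun y => ?_
    have h0 : 0 ≤ e y := (Real.exp_pos _).le
    rw [Real.norm_of_nonneg (by positivity)]
    simp only [Pi.add_apply]
    nlinarith [sq_nonneg (‖f y‖ - 1), norm_nonneg (f y)]
  set m := ∫ y, ‖f y‖ * e y with hm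
  set q := ∫ y, ‖f y‖ ^ 2 * e y
  have hint : ∫ y, e y = 2 / a := integral_exp_neg_mul_abs_sub ha x
  -- Cauchy–Schwarz for the measure e(y) dy of total mass 2/a, obtained by expanding the weighted
  -- square of ‖f y‖ minus its mean (a/2)m.
  have key : m ^ 2 ≤ 2 / a * q := by
    have h0 : 0 ≤ ∫ y, e y * (‖f y‖ - a / 2 * m) ^ 2 :=
      integral_nonneg fun y => mul_nonneg (Real.exp_pos _).le (sq_nonneg _)
    have h1 : ∀ c : ℝ, ∫ y, e y * (‖f y‖ - c) ^ 2 = q - 2 * c * m + c ^ 2 * (2 / a) := by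
      intro c
      have e1 : ∀ y, e y * (‖f y‖ - c) ^ 2 =
          ‖f y‖ ^ 2 * e y - 2 * c * (‖f y‖ * e y) + c ^ 2 * e y := fun y => by ring
      simp_rw [e1]
      have i3 : Integrable fun y => ‖f y‖ ^ 2 * e y - 2 * c * (‖f y‖ * e y) :=
        i2.sub (i1.const_mul _)
      rw [integral_add i3 (hei.const_mul _),
        integral_sub i2 (i1.const_mul _), integral_const_mul, integral_const_mul, hint]
    rw [h1] at h0
    have h2 : (a / 2 * m) ^ 2 * (2 / a) = a / 2 * m ^ 2 := by field_simp
    rw [div_mul_eq_mul_div, le_div_iff₀ ha]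
    nlinarith
  have hle : ‖∫ y, P x y * f y‖ ≤ C * m := by
    rw [hm, ← integral_const_mul]
    refine norm_integral_le_of_norm_le (i1.const_mul C) (Eventually.of_forall fun y => ?_)
    rw [norm_mul]
    calc _ ≤ (C * e y) * ‖f y‖ := by gcongr; exact h.bound x y
      _ = _ := by ring
  calc _ ≤ (C * m) ^ 2 := by gcongr
    _ = C ^ 2 * m ^ 2 := by ring
    _ ≤ C ^ 2 * (2 / a * q) := by gcongr
    _ = _ := by ring

theorem aestronglyMeasurable (h : IsExpKer P C a) (f : L2) :
    AEStronglyMeasurable (fun x => ∫ y, P x y * f y) volume := by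
  have h1 : StronglyMeasurable (Function.uncurry fun x y => P x y * f y) :=
    h.meas.stronglyMeasurable.mul ((Lp.stronglyMeasurable f).comp_measurable measurable_snd)
  exact h1.integral_prod_right.aestronglyMeasurable

theorem integrable_majorant (ha : 0 < a) (f : L2) :
    Integrable (fun x => ∫ y, ‖f y‖ ^ 2 * Real.exp (-(a * |x - y|))) ∧
    ∫ x, ∫ y, ‖f y‖ ^ 2 * Real.exp (-(a * |x - y|)) = ‖f‖ ^ 2 * (2 / a) := by
  have hg := integrable_exp_neg_mul_abs_sub ha 0
  simp only [zero_sub, abs_neg] at hg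
  have h1 := (integrable_norm_sq f).convolution_integrand (ContinuousLinearMap.mul ℝ ℝ) hg
  have h2 := integral_convolution (ContinuousLinearMap.mul ℝ ℝ) (integrable_norm_sq f) hg
  have h3 := integral_exp_neg_mul_abs_sub ha 0
  simp only [zero_sub, abs_neg] at h3
  refine ⟨by simpa using h1.integral_prod_left, ?_⟩
  simpa [convolution_def, h3, norm_sq_L2 f] using h2

theorem memLp_apply (h : IsExpKer P C a) (f : L2) : MemLp (fun x => ∫ y, P x y * f y) 2 := by
  rw [memLp_two_iff_integrable_sq_norm (h.aestronglyMeasurable f)]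
  refine ((integrable_majorant h.pos f).1.const_mul (2 * C ^ 2 / a)).mono'
    ((h.aestronglyMeasurable f).norm.pow 2) (Eventually.of_forall fun x => ?_)
  rw [Real.norm_of_nonneg (by positivity)]
  exact h.norm_sq_le f x

theorem norm_toLp_le (h : IsExpKer P C a) (f : L2) :
    ‖(h.memLp_apply f).toLp‖ ≤ 2 * C / a * ‖f‖ := by
  have ha := h.pos
  have hC := h.nonneg
  refine le_of_sq_le_sq ?_ (by positivity)
  rw [norm_sq_L2]
  obtain ⟨h1, h2⟩ := integrable_majorant ha f
  calc ∫ x, ‖(h.memLp_apply f).toLp _ x‖ ^ 2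
      = ∫ x, ‖∫ y, P x y * f y‖ ^ 2 := by
        refine integral_congr_ae ?_
        filter_upwards [(h.memLp_apply f).coeFn_toLp] with x hx
        rw [hx]
    _ ≤ ∫ x, 2 * C ^ 2 / a * ∫ y, ‖f y‖ ^ 2 * Real.exp (-(a * |x - y|)) :=
        integral_mono_of_nonneg (Eventually.of_forall fun x => by positivity) (h1.const_mul _)
          (Eventually.of_forall fun x => h.norm_sq_le f x)
    _ = _ := by rw [integral_const_mul, h2]; field_simp

/-- The integral operator with kernel `P`. -/
def op (h : IsExpKer P C a) : L2 →L[ℂ] L2 :=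
  LinearMap.mkContinuous
    { toFun := fun f => (h.memLp_apply f).toLp
      map_add' := fun f g => by
        rw [← MemLp.toLp_add]
        refine (MemLp.toLp_eq_toLp_iff _ _).2 (Eventually.of_forall fun x => ?_)
        simp only [Pi.add_apply]
        rw [← integral_add (h.integrable f x) (h.integrable g x)]
        refine integral_congr_ae ?_
        filter_upwards [Lp.coeFn_add f g] with y hy
        rw [hy, Pi.add_apply]
        ring
      map_smul' := fun c f => by
        rw [RingHom.id_apply, ← MemLp.toLp_const_smul]
        refine (MemLp.toLp_eq_toLp_iff _ _).2 (Eventually.of_forall fun x => ?_)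
        simp only [Pi.smul_apply, smul_eq_mul]
        rw [← integral_const_mul]
        refine integral_congr_ae ?_
        filter_upwards [Lp.coeFn_smul c f] with y hy
        rw [hy, Pi.smul_apply, smul_eq_mul]
        ring }
    (2 * C / a) fun f => h.norm_toLp_le f

theorem op_ae (h : IsExpKer P C a) (f : L2) : h.op f =ᵐ[volume] fun x => ∫ y, P x y * f y :=
  (h.memLp_apply f).coeFn_toLp

theorem norm_op_le (h : IsExpKer P C a) : ‖h.op‖ ≤ 2 * C / a :=
  LinearMap.mkContinuous_norm_le _ (by have := h.pos; have := h.nonneg; positivity) _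

/-- Transposition of an integral operator. -/
theorem integrable_pairing (h : IsExpKer P C a) (f : L2) {g : ℝ → ℂ} {A c x₀ : ℝ} (hc : 0 < c)
    (hgm : Measurable g) (hg : ∀ x, ‖g x‖ ≤ A * Real.exp (-(c * |x₀ - x|))) :
    Integrable (Function.uncurry fun x y => g x * (P x y * f y)) := by
  have ha := h.pos
  have hC := h.nonneg
  have hA : 0 ≤ A := nonneg_of_mul_nonneg_left ((norm_nonneg _).trans (hg 0)) (Real.exp_pos _)
  -- With this rate the decay in x₀ - x and in x - y can be redistributed into equal decay in x and
  -- in y separately, giving a product majorant for Fubini.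
  set m := min a c / 2 with hm
  have hm0 : 0 < m := by have := lt_min ha hc; positivity
  have i1 : Integrable fun y => ‖f y‖ * Real.exp (-(m * |x₀ - y|)) := by
    have e1 : MemLp (fun y => (Real.exp (-(m * |x₀ - y|)) : ℂ)) 2 :=
      memLp_two_of_bound (A := 1) (x₀ := x₀) hm0
        (Continuous.aestronglyMeasurable (by fun_prop)) fun z => by
          rw [one_mul, Complex.norm_real, Real.norm_of_nonneg (Real.exp_pos _).le]
    refine (integrable_mul_L2 e1 f).norm.congr (Eventually.of_forall fun y => ?_)
    simp only [norm_mul]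
    rw [Complex.norm_real, Real.norm_of_nonneg (Real.exp_pos _).le, mul_comm]
  have i2 := (integrable_exp_neg_mul_abs_sub hm0 x₀).const_mul (A * C)
  refine (i2.mul_prod i1).mono' ?_ (Eventually.of_forall fun q => ?_)
  · exact ((hgm.comp measurable_fst).stronglyMeasurable.mul (h.meas.stronglyMeasurable.mul
      ((Lp.stronglyMeasurable f).comp_measurable measurable_snd))).aestronglyMeasurable
  · obtain ⟨x, y⟩ := q
    simp only [Function.uncurry_apply_pair, norm_mul]
    have e : Real.exp (-(c * |x₀ - x|)) * Real.exp (-(a * |x - y|)) ≤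
        Real.exp (-(m * |x₀ - x|)) * Real.exp (-(m * |x₀ - y|)) := by
      rw [← Real.exp_add, ← Real.exp_add, Real.exp_le_exp]
      have h1 := abs_sub_le x₀ x y
      have h2 := abs_nonneg (x - y)
      have h3 := abs_nonneg (x₀ - x)
      have h4 : 2 * m ≤ a := by have := min_le_left a c; linarith
      have h5 : 2 * m ≤ c := by have := min_le_right a c; linarith
      nlinarith
    calc _ ≤ (A * Real.exp (-(c * |x₀ - x|))) * ((C * Real.exp (-(a * |x - y|))) * ‖f y‖) := by
          gcongr
          · exact hg x
          · exact h.bound x y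
      _ = A * C * ‖f y‖ * (Real.exp (-(c * |x₀ - x|)) * Real.exp (-(a * |x - y|))) := by ring
      _ ≤ A * C * ‖f y‖ * (Real.exp (-(m * |x₀ - x|)) * Real.exp (-(m * |x₀ - y|))) := by gcongr
      _ = _ := by ring

theorem pairing (h : IsExpKer P C a) (f : L2) {g : ℝ → ℂ} {A c x₀ : ℝ} (hc : 0 < c)
    (hgm : Measurable g) (hg : ∀ x, ‖g x‖ ≤ A * Real.exp (-(c * |x₀ - x|))) :
    ∫ x, g x * ∫ y, P x y * f y = ∫ y, (∫ x, g x * P x y) * f y := by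
  have hI := h.integrable_pairing f hc hgm hg
  simp_rw [← integral_const_mul, ← integral_mul_const]
  rw [integral_integral_swap hI]
  congr 1; ext y
  congr 1; ext x
  ring

theorem op_op_ae (hP : IsExpKer P C a) (hQ : IsExpKer Q C' a') (f : L2) :
    hP.op (hQ.op f) =ᵐ[volume] fun x => ∫ y, (∫ z, P x z * Q z y) * f y := by
  filter_upwards [hP.op_ae (hQ.op f)] with x h1
  have e : ∫ y, P x y * hQ.op f y = ∫ y, P x y * ∫ z, Q y z * f z := by
    refine integral_congr_ae ?_
    filter_upwards [hQ.op_ae f] with y hy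
    rw [hy]
  rw [h1, e, hQ.pairing f hP.pos hP.meas.of_uncurry_left (hP.bound x)]

theorem op_comp_op (hP : IsExpKer P C a) (hQ : IsExpKer Q C' a') {C'' a'' : ℝ}
    (hR : IsExpKer R C'' a'') (h : ∀ x y, ∫ z, P x z * Q z y = R x y) :
    hP.op.comp hQ.op = hR.op := by
  ext1 f
  refine Lp.ext ?_
  filter_upwards [hP.op_op_ae hQ f, hR.op_ae f] with x h1 h2
  rw [ContinuousLinearMap.comp_apply, h1, h2]
  simp_rw [h]

theorem op_eq_op (hP : IsExpKer P C a) (hP' : IsExpKer P C' a') : hP.op = hP'.op := by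
  ext1 f
  exact Lp.ext ((hP.op_ae f).trans (hP'.op_ae f).symm)

end IsExpKer


/-! ### The semigroup and its strong continuity. -/

theorem isExpKer_kerK (k : ℝ) {t : ℝ} (ht : 0 < t) :
    IsExpKer (fun x y => kerK k x y t)
      (C₁ * Real.exp ((kap k + 1) * t) * t ^ (-(1 / 4) : ℝ)) (rate t) :=
  ⟨(continuous_kerK k ht).measurable, rate_pos ht, fun x y => norm_kerK_le k x y ht⟩

/-- The semigroup with kernel `kerK`. -/
def semigroup (k t : ℝ) : L2 →L[ℂ] L2 :=
  if ht : 0 < t then (isExpKer_kerK k ht).op else ContinuousLinearMap.id ℂ L2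

theorem semigroup_of_pos (k : ℝ) {t : ℝ} (ht : 0 < t) :
    semigroup k t = (isExpKer_kerK k ht).op := dif_pos ht

theorem semigroup_zero (k : ℝ) : semigroup k 0 = ContinuousLinearMap.id ℂ L2 :=
  dif_neg (lt_irrefl _)

theorem semigroup_ae (k : ℝ) {t : ℝ} (ht : 0 < t) (f : L2) :
    semigroup k t f =ᵐ[volume] fun x => ∫ y, kerK k x y t * f y := by
  rw [semigroup_of_pos k ht]; exact (isExpKer_kerK k ht).op_ae f

theorem semigroup_add (k : ℝ) {s t : ℝ} (hs : 0 ≤ s) (ht : 0 ≤ t) :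
    semigroup k (s + t) = (semigroup k s).comp (semigroup k t) := by
  rcases hs.eq_or_lt with rfl | hs
  · rw [zero_add, semigroup_zero, ContinuousLinearMap.id_comp]
  rcases ht.eq_or_lt with rfl | ht
  · rw [add_zero, semigroup_zero, ContinuousLinearMap.comp_id]
  rw [semigroup_of_pos k hs, semigroup_of_pos k ht, semigroup_of_pos k (add_pos hs ht)]
  exact ((isExpKer_kerK k hs).op_comp_op (isExpKer_kerK k ht) (isExpKer_kerK k (add_pos hs ht))
    fun x y => integral_kerK_mul_kerK k x y ht hs).symm

/-- Schur's bound divides by rate t, which cancels t^{-1/4}; the norms stay bounded as t tends to 0.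
-/
theorem norm_semigroup_le (k : ℝ) {t : ℝ} (ht : 0 < t) :
    ‖semigroup k t‖ ≤ 2 * C₁ * Real.exp ((kap k + 1) * t) := by
  rw [semigroup_of_pos k ht]
  refine (isExpKer_kerK k ht).norm_op_le.trans ?_
  rw [div_le_iff₀ (rate_pos ht)]
  have h1 := rpow_neg_quarter_le_rate t
  have hC := C₁_pos
  calc _ = 2 * C₁ * Real.exp ((kap k + 1) * t) * t ^ (-(1 / 4) : ℝ) := by ring
    _ ≤ _ := by gcongr

theorem norm_semigroup_le_of_le_one (k : ℝ) {t : ℝ} (ht : 0 < t) (ht1 : t ≤ 1) :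
    ‖semigroup k t‖ ≤ 2 * C₁ * Real.exp |kap k + 1| := by
  refine (norm_semigroup_le k ht).trans ?_
  have hC := C₁_pos
  gcongr
  calc (kap k + 1) * t ≤ |kap k + 1| * t := by gcongr; exact le_abs_self _
    _ ≤ _ := mul_le_of_le_one_right (abs_nonneg _) ht1

theorem norm_le_of_ae_bound_sub {f : L2} {A c : ℝ} (x₀ : ℝ) (hA : 0 ≤ A) (hc : 0 < c)
    (h : ∀ᵐ x, ‖f x‖ ≤ A * Real.exp (-(c * |x₀ - x|))) : ‖f‖ ≤ A / √c := by
  refine le_of_sq_le_sq ?_ (by positivity)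
  rw [norm_sq_L2, div_pow, Real.sq_sqrt hc.le]
  have h1 := integral_exp_neg_mul_abs_sub (c := 2 * c) (by positivity) x₀
  have h2 := integrable_exp_neg_mul_abs_sub (c := 2 * c) (by positivity) x₀
  calc _ ≤ ∫ x, A ^ 2 * Real.exp (-(2 * c * |x₀ - x|)) := by
        refine integral_mono_of_nonneg (Eventually.of_forall fun x => by positivity)
          (h2.const_mul _) ?_
        filter_upwards [h] with x hx
        calc ‖f x‖ ^ 2 ≤ (A * Real.exp (-(c * |x₀ - x|))) ^ 2 := by gcongr
          _ = _ := by rw [mul_pow, ← Real.exp_nat_mul]; push_cast; ring_nf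
    _ = _ := by rw [integral_const_mul, h1]; field_simp

theorem norm_le_of_ae_bound {f : L2} {A c : ℝ} (hA : 0 ≤ A) (hc : 0 < c)
    (h : ∀ᵐ x, ‖f x‖ ≤ A * Real.exp (-(c * |x|))) : ‖f‖ ≤ A / √c :=
  norm_le_of_ae_bound_sub 0 hA hc (by simpa using h)

theorem IsTest.bound' {φ : ℝ → ℂ} {C : ℝ} (h : ∀ x, ‖φ x‖ ≤ C * Real.exp (-|x|)) (x : ℝ) :
    ‖φ x‖ ≤ C * Real.exp (-(1 * |0 - x|)) := by
  simpa using h x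

theorem IsTest.memLp {φ : ℝ → ℂ} (h : IsTest φ) : MemLp φ 2 :=
  h.smooth.continuous.memLp_of_hasCompactSupport h.supp

theorem norm_stConv_kerS_K₀_le_of_le_one (k x y : ℝ) {t : ℝ} (ht : 0 < t) (ht1 : t ≤ 1) :
    ‖stConv (kerS k x) (K₀ k) y t‖ ≤ 24 * C₀ ^ 2 * Real.exp |kap k| * t ^ (1 / 4 : ℝ) *
      Real.exp (-(1 * |x - y|)) := by
  refine (norm_stConv_kerS_K₀_le k x y ht).trans ?_
  have q : 0 < t ^ (1 / 4 : ℝ) := Real.rpow_pos_of_pos ht _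
  have hC := C₀_pos
  have e1 : Real.exp (kap k * t) ≤ Real.exp |kap k| := by
    rw [Real.exp_le_exp]
    calc kap k * t ≤ |kap k| * t := by gcongr; exact le_abs_self _
      _ ≤ _ := mul_le_of_le_one_right (abs_nonneg _) ht1
  have e2 : Real.exp (-(rate t * |x - y|)) ≤ Real.exp (-(1 * |x - y|)) := by
    rw [Real.exp_le_exp, neg_le_neg_iff]
    gcongr
    exact one_le_rate ht
  gcongr

/-- The free part moves a test function by O(t), the perturbation by O(t^{1/4}). Together with the
uniform norm bound this gives strong continuity by density. -/
theorem norm_semigroup_test_sub_le (k : ℝ) {φ : ℝ → ℂ} (h : IsTest φ) : ∃ C : ℝ, 0 ≤ C ∧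
    ∀ t : ℝ, 0 < t → t ≤ 1 → ‖semigroup k t h.memLp.toLp - h.memLp.toLp‖ ≤ C * t ^ (1 / 4 : ℝ) := by
  obtain ⟨C, hC, hφ⟩ := h.exists_bound
  obtain ⟨C', hC', hsub⟩ := norm_freeEvol_sub_le k h
  have hC0 := C₀_pos
  set B := 24 * C₀ ^ 2 * Real.exp |kap k| with hB
  have hB0 : 0 ≤ B := by positivity
  refine ⟨(C' + 4 * B * C) / √(1 / 2), by positivity, fun t ht ht1 => ?_⟩
  have q : 0 < t ^ (1 / 4 : ℝ) := Real.rpow_pos_of_pos ht _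
  have hφi : Integrable φ := h.integrable
  rw [div_mul_eq_mul_div]
  refine norm_le_of_ae_bound (by positivity) (by norm_num) ?_
  filter_upwards [Lp.coeFn_sub (semigroup k t h.memLp.toLp) h.memLp.toLp,
    semigroup_ae k ht h.memLp.toLp, h.memLp.coeFn_toLp] with x h1 h2 h3
  have e1 : ∫ y, kerK k x y t * h.memLp.toLp φ y = ∫ y, kerK k x y t * φ y := by
    refine integral_congr_ae ?_
    filter_upwards [h.memLp.coeFn_toLp] with y hy
    rw [hy]
  have i1 : Integrable fun y => K₀ k (x - y) t * φ y := by
    refine hφi.bdd_mul (c := C₀ * Real.exp (|Λ₀ - 3 / 4 * k ^ 4| * (t + 1)) *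
      t ^ (-(1 / 4) : ℝ)) ?_ (Eventually.of_forall fun y =>
        bound_of_isFreeKer (isFreeKer_K₀ k) _ _ ht (lt_add_one t))
    exact ((continuousOn_K₀ k).comp_continuous (f := fun y : ℝ => (x - y, t)) (by fun_prop)
      fun _ => ht).aestronglyMeasurable
  have i0 : Integrable fun y => kerK k x y t * φ y := by
    refine ((isExpKer_kerK k ht).integrable h.memLp.toLp x).congr ?_
    filter_upwards [h.memLp.coeFn_toLp] with y hy
    rw [hy]
  have i2 : Integrable fun y => stConv (kerS k x) (K₀ k) y t * φ y := by
    refine (i0.sub i1).congr (Eventually.of_forall fun y => ?_)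
    simp only [Pi.sub_apply, kerK]
    ring
  have e2 : ∫ y, kerK k x y t * φ y =
      freeEvol k φ t x + ∫ y, stConv (kerS k x) (K₀ k) y t * φ y := by
    rw [freeEvol, ← integral_add i1 i2]
    congr 1; ext y
    rw [kerK]; ring
  rw [h1, Pi.sub_apply, h2, h3, e1, e2, add_sub_right_comm]
  have b1 : ‖∫ y, stConv (kerS k x) (K₀ k) y t * φ y‖ ≤
      4 * B * C * t ^ (1 / 4 : ℝ) * Real.exp (-(1 / 2 * |x|)) := by
    refine (norm_integral_le_of_norm_le (((integrable_exp_neg_mul_abs_sub (c := 1 / 2)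
      (by norm_num) x)).const_mul (B * C * t ^ (1 / 4 : ℝ) * Real.exp (-(1 / 2 * |x|))))
      (Eventually.of_forall fun y => ?_)).trans (le_of_eq ?_)
    · have := exp_mul_exp_le x y 0
      rw [sub_zero, sub_zero] at this
      rw [norm_mul]
      calc _ ≤ (B * t ^ (1 / 4 : ℝ) * Real.exp (-(1 * |x - y|))) * (C * Real.exp (-|y|)) :=
            mul_le_mul (norm_stConv_kerS_K₀_le_of_le_one k x y ht ht1) (hφ y) (norm_nonneg _)
              (by positivity)
        _ = B * C * t ^ (1 / 4 : ℝ) * (Real.exp (-(1 * |x - y|)) * Real.exp (-(1 * |y|))) := by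
            rw [one_mul |y|]; ring
        _ ≤ B * C * t ^ (1 / 4 : ℝ) * (Real.exp (-(1 / 2 * |x - y|)) *
            Real.exp (-(1 / 2 * |x|))) := mul_le_mul_of_nonneg_left this (by positivity)
        _ = _ := by ring
    · rw [integral_const_mul, integral_exp_neg_mul_abs_sub (by norm_num)]
      ring
  have b2 : ‖freeEvol k φ t x - φ x‖ ≤ C' * t ^ (1 / 4 : ℝ) * Real.exp (-(1 / 2 * |x|)) := by
    refine (hsub t x ht ht1).trans ?_
    have e3 : t ≤ t ^ (1 / 4 : ℝ) := by
      simpa using Real.rpow_le_rpow_of_exponent_ge ht ht1 (by norm_num : (1 / 4 : ℝ) ≤ 1)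
    have e4 : Real.exp (-|x|) ≤ Real.exp (-(1 / 2 * |x|)) := by
      rw [Real.exp_le_exp]
      have := abs_nonneg x
      linarith
    gcongr
  refine (norm_add_le _ _).trans ((add_le_add b2 b1).trans (le_of_eq (by ring)))

theorem tendsto_rpow_quarter : Tendsto (fun t : ℝ => t ^ (1 / 4 : ℝ)) (𝓝[>] 0) (𝓝 0) := by
  have : ContinuousAt (fun t : ℝ => t ^ (1 / 4 : ℝ)) 0 :=
    Real.continuousAt_rpow_const _ _ (Or.inr (by norm_num))
  have h := this.tendsto
  rw [Real.zero_rpow (by norm_num)] at h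
  exact h.mono_left nhdsWithin_le_nhds

theorem eventually_pos_le_one : ∀ᶠ t : ℝ in 𝓝[>] 0, 0 < t ∧ t ≤ 1 := by
  filter_upwards [Ioc_mem_nhdsGT (zero_lt_one (α := ℝ))] with t ht
  exact ht

theorem tendsto_semigroup_test (k : ℝ) {φ : ℝ → ℂ} (h : IsTest φ) :
    Tendsto (fun t => semigroup k t h.memLp.toLp) (𝓝[>] 0) (𝓝 h.memLp.toLp) := by
  obtain ⟨C, hC, hb⟩ := norm_semigroup_test_sub_le k h
  rw [tendsto_iff_norm_sub_tendsto_zero]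
  have h1 := tendsto_rpow_quarter.const_mul C
  rw [mul_zero] at h1
  refine squeeze_zero' (Eventually.of_forall fun t => norm_nonneg _) ?_ h1
  filter_upwards [eventually_pos_le_one] with t ht
  exact hb t ht.1 ht.2

theorem tendsto_semigroup (k : ℝ) (u : L2) :
    Tendsto (fun t => semigroup k t u) (𝓝[>] 0) (𝓝 u) := by
  have hC := C₁_pos
  set M := 2 * C₁ * Real.exp |kap k + 1| with hM
  have hM0 : 0 < M := by positivity
  rw [Metric.tendsto_nhds]
  intro ε hε
  have hd := Lp.dense_hasCompactSupport_contDiff (E := ℝ) (F := ℂ) (μ := volume) (p := 2) (by simp)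
  obtain ⟨v, ⟨φ, hφv, hφs, hφc⟩, hv⟩ := hd.exists_dist_lt u (ε := ε / (2 * (M + 1)))
    (by positivity)
  have hφ : IsTest φ := ⟨hφc, hφs⟩
  have hv' : v = hφ.memLp.toLp := by
    refine Lp.ext (hφv.trans hφ.memLp.coeFn_toLp.symm)
  filter_upwards [(Metric.tendsto_nhds.1 (tendsto_semigroup_test k hφ)) (ε / 2) (half_pos hε),
    eventually_pos_le_one] with t h1 ht
  rw [← hv'] at h1
  rw [dist_eq_norm] at *
  have e : semigroup k t u - u = semigroup k t (u - v) + (semigroup k t v - v) - (u - v) := by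
    rw [map_sub]; abel
  have h2 : ‖semigroup k t (u - v)‖ ≤ M * ‖u - v‖ :=
    ContinuousLinearMap.le_of_opNorm_le _ (norm_semigroup_le_of_le_one k ht.1 ht.2) _
  rw [e]
  have h3 : (M + 1) * ‖u - v‖ < ε / 2 := by
    rw [lt_div_iff₀ (by positivity)] at hv
    linarith
  have h4 := norm_sub_le (semigroup k t (u - v) + (semigroup k t v - v)) (u - v)
  have h5 := norm_add_le (semigroup k t (u - v)) (semigroup k t v - v)
  linarith


/-! ### Short-time expansion and inclusion of the generator in -D H. -/

theorem exp_neg_abs_le (x : ℝ) : Real.exp (-|x|) ≤ Real.exp (-(1 / 2 * |x|)) := by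
  rw [Real.exp_le_exp]
  have := abs_nonneg x
  linarith

/-- A variant of `norm_stInt_le` for rows of test functions: decay is measured from the origin at
the fixed rate 1/2, and the surplus rate of the free kernel carries it from z to y. Times are at
most 1, so growth factors become constants. -/
theorem norm_stInt_le_of_decay {F P : ℝ → ℝ → ℂ} {θ N b M y t : ℝ} (hP : IsFreeKer P θ N b)
    (ht1 : t ≤ 1) (hM : 0 ≤ M) (hF : ∀ z s : ℝ, 0 < s → s < t → ‖F z s‖ ≤
      M * s ^ (-(3 / 4) : ℝ) * Real.exp (-(1 / 2 * |z|))) {p : ℝ × ℝ} (hp : p ∈ slab t) :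
    ‖stInt F P y t p‖ ≤ (3 / 2 * M * N * Real.exp |θ| * Real.exp (-(1 / 2 * |y|))) *
      (((t - p.1) ^ (-(3 / 4) : ℝ) * p.1 ^ (-b) * Real.exp (-(0 * p.1))) *
        Real.exp (-(rate p.1 * |p.2 - y|))) := by
  obtain ⟨s, z⟩ := p
  obtain ⟨hs, hst⟩ : 0 < s ∧ s < t := hp.1
  have h1 : 0 < t - s := sub_pos.2 hst
  have hN := hP.nonneg
  have q1 : 0 < s ^ (-b) := Real.rpow_pos_of_pos hs _
  have q2 : 0 < (t - s) ^ (-(3 / 4) : ℝ) := Real.rpow_pos_of_pos h1 _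
  have e1 : Real.exp (-(1 / 2 * |z|)) * Real.exp (-(2 * rate s * |z - y|)) ≤
      Real.exp (-(1 / 2 * |y|)) * Real.exp (-(rate s * |z - y|)) := by
    rw [← Real.exp_add, ← Real.exp_add, Real.exp_le_exp]
    have a1 : |y| ≤ |z| + |z - y| := by
      have := abs_sub_le y z 0
      rw [sub_zero, sub_zero, abs_sub_comm y z] at this
      linarith
    have a2 := mul_le_mul_of_nonneg_right (one_le_rate hs) (abs_nonneg (z - y))
    have a3 := abs_nonneg (z - y)
    linarith
  have e2 : Real.exp (θ * s) ≤ Real.exp |θ| := by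
    rw [Real.exp_le_exp]
    calc θ * s ≤ |θ| * s := by gcongr; exact le_abs_self θ
      _ ≤ _ := mul_le_of_le_one_right (abs_nonneg _) (by linarith)
  dsimp only [stInt]
  rw [norm_mul, norm_mul]
  calc _ ≤ (M * (t - s) ^ (-(3 / 4) : ℝ) * Real.exp (-(1 / 2 * |z|))) * (3 / 2) *
        (N * Real.exp |θ| * s ^ (-b) * Real.exp (-(2 * rate s * |z - y|))) := by
        have c1 := hF z _ h1 (by linarith)
        have c3 : ‖P (z - y) s‖ ≤ N * Real.exp |θ| * s ^ (-b) *
            Real.exp (-(2 * rate s * |z - y|)) := (hP.bound (z - y) s hs).trans (by gcongr)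
        exact mul_le_mul (mul_le_mul c1 (norm_V_le z) (norm_nonneg _) (by positivity)) c3
          (norm_nonneg _) (by positivity)
    _ = (3 / 2 * M * N * Real.exp |θ| * ((t - s) ^ (-(3 / 4) : ℝ) * s ^ (-b))) *
        (Real.exp (-(1 / 2 * |z|)) * Real.exp (-(2 * rate s * |z - y|))) := by ring
    _ ≤ (3 / 2 * M * N * Real.exp |θ| * ((t - s) ^ (-(3 / 4) : ℝ) * s ^ (-b))) *
        (Real.exp (-(1 / 2 * |y|)) * Real.exp (-(rate s * |z - y|))) := by gcongr
    _ = _ := by rw [zero_mul, neg_zero, Real.exp_zero]; ring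

theorem norm_stConv_le_of_decay {F P : ℝ → ℝ → ℂ} {θ N b M y t : ℝ} (hP : IsFreeKer P θ N b)
    (hb : 0 ≤ b) (hb1 : b < 1) (ht1 : t ≤ 1) (hM : 0 ≤ M)
    (hF : ∀ z s : ℝ, 0 < s → s < t → ‖F z s‖ ≤
      M * s ^ (-(3 / 4) : ℝ) * Real.exp (-(1 / 2 * |z|))) :
    ‖stConv F P y t‖ ≤ (3 * M * N * Real.exp |θ| * Real.exp (-(1 / 2 * |y|))) *
      ∫ s in Set.Ioo 0 t, (t - s) ^ (-(3 / 4) : ℝ) * s ^ (-b) * s ^ (1 / 4 : ℝ) := by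
  obtain ⟨h1, h2⟩ := stInt_majorant (t := t) hb hb1 le_rfl y
  have hN := hP.nonneg
  refine (norm_integral_le_of_norm_le (h1.const_mul
    (3 / 2 * M * N * Real.exp |θ| * Real.exp (-(1 / 2 * |y|)))) ?_).trans ?_
  · filter_upwards [ae_restrict_mem (measurableSet_slab t)] with p hp
    exact norm_stInt_le_of_decay hP ht1 hM hF hp
  · rw [integral_const_mul]
    simp only [zero_mul, neg_zero, Real.exp_zero, mul_one] at h2 ⊢
    refine (mul_le_mul_of_nonneg_left h2 (by positivity)).trans (le_of_eq (by ring))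

theorem integral_rpow_neg_le {t : ℝ} (ht : 0 < t) :
    ∫ s in Set.Ioo 0 t, (t - s) ^ (-(3 / 4) : ℝ) * s ^ (-(1 / 2) : ℝ) ≤ 36 * t ^ (-(1 / 4) : ℝ) := by
  have h := integral_rpow_exp_le (inv_pos.2 ht) ht
  have hi := integrableOn_rpow_mul_rpow (a := 3 / 4) (b := 1 / 2) (by norm_num) (by norm_num)
    (by norm_num) (by norm_num) t
  have e1 : (t⁻¹) ^ (-(1 / 2) : ℝ) * t ^ (-(3 / 4) : ℝ) = t ^ (-(1 / 4) : ℝ) := by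
    rw [Real.inv_rpow ht.le, ← Real.rpow_neg ht.le, ← Real.rpow_add ht]; norm_num
  have he : Real.exp 1 ≤ 3 := by have := Real.exp_one_lt_d9; linarith
  have hexp : ∀ s ∈ Set.Ioo 0 t, 1 ≤ Real.exp 1 * Real.exp (-(t⁻¹ * s)) := by
    intro s hs
    rw [← Real.exp_add, Real.one_le_exp_iff]
    have : t⁻¹ * s ≤ 1 := by
      rw [inv_mul_le_iff₀ ht, mul_one]; exact hs.2.le
    linarith
  have q : 0 < t ^ (-(1 / 4) : ℝ) := Real.rpow_pos_of_pos ht _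
  calc _ ≤ ∫ s in Set.Ioo 0 t, Real.exp 1 * ((t - s) ^ (-(3 / 4) : ℝ) * s ^ (-(1 / 2) : ℝ) *
          Real.exp (-(t⁻¹ * s))) := by
        refine setIntegral_mono_on hi ?_ measurableSet_Ioo fun s hs => ?_
        · refine (hi.mul_bdd (c := 1) (Continuous.aestronglyMeasurable (by fun_prop)) ?_).const_mul _
          filter_upwards [ae_restrict_mem measurableSet_Ioo] with s hs
          rw [Real.norm_of_nonneg (Real.exp_pos _).le, Real.exp_le_one_iff]
          have := mul_pos (inv_pos.2 ht) hs.1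
          linarith
        · have h1 := Real.rpow_pos_of_pos (sub_pos.2 hs.2) (-(3 / 4))
          have h2 := Real.rpow_pos_of_pos hs.1 (-(1 / 2))
          have := mul_le_mul_of_nonneg_left (hexp s hs) (mul_pos h1 h2).le
          linarith
    _ ≤ 3 * (12 * (t⁻¹) ^ (-(1 / 2) : ℝ) * t ^ (-(3 / 4) : ℝ)) := by
        rw [integral_const_mul]
        exact mul_le_mul he h (setIntegral_nonneg measurableSet_Ioo fun s hs => by
          have h1 := Real.rpow_pos_of_pos (sub_pos.2 hs.2) (-(3 / 4))
          have h2 := Real.rpow_pos_of_pos hs.1 (-(1 / 2))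
          positivity) (by norm_num)
    _ = _ := by linear_combination 36 * e1

theorem norm_stConv_S₀_le_of_decay {F : ℝ → ℝ → ℂ} {k M y t : ℝ} (ht : 0 < t) (ht1 : t ≤ 1)
    (hM : 0 ≤ M) (hF : ∀ z s : ℝ, 0 < s → s < t → ‖F z s‖ ≤
      M * s ^ (-(3 / 4) : ℝ) * Real.exp (-(1 / 2 * |z|))) :
    ‖stConv F (S₀ k) y t‖ ≤ 108 * M * C₀ * Real.exp |Λ₀ - 3 / 4 * k ^ 4| *
      t ^ (-(1 / 4) : ℝ) * Real.exp (-(1 / 2 * |y|)) := by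
  refine (norm_stConv_le_of_decay (isFreeKer_S₀ k) (by norm_num) (by norm_num) ht1 hM hF).trans ?_
  have h1 : ∫ s in Set.Ioo 0 t, (t - s) ^ (-(3 / 4) : ℝ) * s ^ (-(3 / 4) : ℝ) * s ^ (1 / 4 : ℝ) =
      ∫ s in Set.Ioo 0 t, (t - s) ^ (-(3 / 4) : ℝ) * s ^ (-(1 / 2) : ℝ) := by
    refine setIntegral_congr_fun measurableSet_Ioo fun s hs => ?_
    have : s ^ (-(1 / 2) : ℝ) = s ^ (-(3 / 4) : ℝ) * s ^ (1 / 4 : ℝ) := by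
      rw [← Real.rpow_add hs.1]; norm_num
    rw [this]; ring
  rw [h1]
  have hC := C₀_pos
  exact (mul_le_mul_of_nonneg_left (integral_rpow_neg_le ht) (by positivity)).trans
    (le_of_eq (by ring))

theorem norm_stConv_K₀_le_of_decay {F : ℝ → ℝ → ℂ} {k M y t : ℝ} (ht : 0 < t) (ht1 : t ≤ 1)
    (hM : 0 ≤ M) (hF : ∀ z s : ℝ, 0 < s → s < t → ‖F z s‖ ≤
      M * s ^ (-(3 / 4) : ℝ) * Real.exp (-(1 / 2 * |z|))) :
    ‖stConv F (K₀ k) y t‖ ≤ 12 * M * C₀ * Real.exp |Λ₀ - 3 / 4 * k ^ 4| *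
      t ^ (1 / 4 : ℝ) * Real.exp (-(1 / 2 * |y|)) := by
  refine (norm_stConv_le_of_decay (isFreeKer_K₀ k) (by norm_num) (by norm_num) ht1 hM hF).trans ?_
  have h1 : ∫ s in Set.Ioo 0 t, (t - s) ^ (-(3 / 4) : ℝ) * s ^ (-(1 / 4) : ℝ) * s ^ (1 / 4 : ℝ) =
      ∫ s in Set.Ioo 0 t, (t - s) ^ (-(3 / 4) : ℝ) := by
    refine setIntegral_congr_fun measurableSet_Ioo fun s hs => ?_
    have : s ^ (-(1 / 4) : ℝ) * s ^ (1 / 4 : ℝ) = 1 := by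
      rw [← Real.rpow_add hs.1]; norm_num
    rw [mul_assoc, this, mul_one]
  rw [h1, integral_rpow_sub_Ioo (by norm_num) ht]
  refine le_of_eq ?_
  rw [show (1 - 3 / 4 : ℝ) = 1 / 4 by norm_num]
  ring

theorem rpow_neg_quarter_eq {s : ℝ} (hs : 0 < s) :
    s ^ (-(1 / 4) : ℝ) = s ^ (1 / 2 : ℝ) * s ^ (-(3 / 4) : ℝ) := by
  rw [← Real.rpow_add hs]; norm_num

/-- Average of the free evolution over a short time. -/
theorem integral_freeEvol (k : ℝ) {φ : ℝ → ℂ} (h : IsTest φ) : ∃ C : ℝ, 0 ≤ C ∧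
    ∀ y t : ℝ, 0 < t → t ≤ 1 → ‖(∫ s in Set.Ioo 0 t, freeEvol k φ s y) - t * φ y‖ ≤
      C * t ^ 2 * Real.exp (-|y|) := by
  obtain ⟨C, hC, hb⟩ := norm_freeEvol_sub_le k h
  refine ⟨C, hC, fun y t ht ht1 => ?_⟩
  have hm : AEStronglyMeasurable (fun s => freeEvol k φ s y) (volume.restrict (Set.Ioo 0 t)) := by
    have h1 : ContinuousOn (fun p : ℝ × ℝ => K₀ k (y - p.2) p.1 * φ p.2) (slab t) :=
      ((continuousOn_K₀ k).comp (f := fun p : ℝ × ℝ => (y - p.2, p.1)) (by fun_prop)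
        fun p hp => hp.1.1).mul (h.smooth.continuous.comp continuous_snd).continuousOn
    have h2 := h1.aestronglyMeasurable (μ := volume) (measurableSet_slab t)
    rw [volume_restrict_slab] at h2
    exact h2.integral_prod_right'
  have hle : ∀ s ∈ Set.Ioo 0 t, ‖freeEvol k φ s y - φ y‖ ≤ C * t * Real.exp (-|y|) := by
    intro s hs
    refine (hb s y hs.1 (hs.2.le.trans ht1)).trans ?_
    have := hs.2
    gcongr
  have hi : IntegrableOn (fun s => freeEvol k φ s y - φ y) (Set.Ioo 0 t) := by
    refine (integrable_const (C * t * Real.exp (-|y|))).mono'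
      (hm.sub aestronglyMeasurable_const) ?_
    filter_upwards [ae_restrict_mem measurableSet_Ioo] with s hs
    exact hle s hs
  have hc : IntegrableOn (fun _ : ℝ => φ y) (Set.Ioo 0 t) := integrable_const _
  have e : (∫ s in Set.Ioo 0 t, freeEvol k φ s y) - t * φ y =
      ∫ s in Set.Ioo 0 t, (freeEvol k φ s y - φ y) := by
    have h1 := integral_add hi hc
    simp only [sub_add_cancel] at h1
    rw [h1, setIntegral_const]
    simp [Measure.real, ht.le]
  rw [e]
  have h1 := norm_setIntegral_le_of_norm_le_const (μ := volume) (s := Set.Ioo 0 t) (by simp) hle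
  simp only [Measure.real, Real.volume_Ioo, sub_zero, ENNReal.toReal_ofReal ht.le] at h1
  exact h1.trans (le_of_eq (by ring))

theorem integral_mul_K₀_sub (k : ℝ) (φ : ℝ → ℂ) (y t : ℝ) :
    ∫ z, φ z * K₀ k (z - y) t = freeEvol k φ t y := by
  rw [freeEvol]
  congr 1; ext z
  rw [← K₀_neg, neg_sub, mul_comm]

theorem integral_mul_S₀_sub (k : ℝ) {φ : ℝ → ℂ} (h : IsTest φ) (y : ℝ) {t : ℝ} (ht : 0 < t) :
    ∫ z, φ z * S₀ k (z - y) t = -freeEvol k (D k φ) t y := by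
  rw [← integral_S₀_mul k h ht]
  congr 1; ext z
  rw [← S₀_neg, neg_sub, mul_comm]

/-- Formally ∫ φ(z) S(z,y,t) dz tends to (∂² - k²)φ. Each passage through the Volterra equation
improves the bound on the convolution term by t^{1/2}: the crude t^{-3/4} becomes t^{-1/4}, and a
second passage gives t^{1/4}, which is then an error term next to the O(t) of the free part. -/
theorem norm_rowS_add_D_le (k : ℝ) {φ : ℝ → ℂ} (h : IsTest φ) : ∃ C : ℝ, 0 ≤ C ∧
    ∀ y t : ℝ, 0 < t → t ≤ 1 → ‖rowS k φ y t + D k φ y‖ ≤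
      C * t ^ (1 / 4 : ℝ) * Real.exp (-(1 / 2 * |y|)) := by
  obtain ⟨A, hA, hφ⟩ := h.exists_bound
  obtain ⟨B, hB, hDφ⟩ := (h.D k).exists_bound
  obtain ⟨E, hE, hsub⟩ := norm_freeEvol_sub_le k (h.D k)
  have hC := C₀_pos
  set X := 108 * C₀ * Real.exp |Λ₀ - 3 / 4 * k ^ 4| with hX
  have hX0 : 0 ≤ X := by positivity
  set M₁ := 8 * A * C₀ * Real.exp |kap k| with hM₁
  have hM₁0 : 0 ≤ M₁ := by positivity
  have heq : ∀ y t : ℝ, 0 < t → rowS k φ y t =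
      -freeEvol k (D k φ) t y + stConv (rowS k φ) (S₀ k) y t := fun y t ht => by
    rw [← integral_mul_S₀_sub k h y ht]
    exact rowS_eq k h.smooth.continuous (IsTest.bound' hφ) y ht
  have hfree : ∀ y t : ℝ, 0 < t → t ≤ 1 → ‖freeEvol k (D k φ) t y‖ ≤
      (E + B) * Real.exp (-(1 / 2 * |y|)) := by
    intro y t ht ht1
    have h1 := hsub t y ht ht1
    have h2 := hDφ y
    have h3 : E * t * Real.exp (-|y|) ≤ E * 1 * Real.exp (-|y|) := by gcongr
    have h4 := norm_add_le (freeEvol k (D k φ) t y - D k φ y) (D k φ y)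
    rw [sub_add_cancel] at h4
    calc _ ≤ (E + B) * Real.exp (-|y|) := by linarith
      _ ≤ _ := by gcongr ?_ * ?_; exact exp_neg_abs_le y
  have h1 : ∀ y t : ℝ, 0 < t → t ≤ 1 → ‖rowS k φ y t‖ ≤
      M₁ * t ^ (-(3 / 4) : ℝ) * Real.exp (-(1 / 2 * |y|)) := by
    intro y t ht ht1
    have q : 0 < t ^ (-(3 / 4) : ℝ) := Real.rpow_pos_of_pos ht _
    have h2 := norm_rowS_le k (IsTest.bound' hφ) y ht
    rw [zero_sub, abs_neg] at h2
    refine h2.trans ?_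
    have e1 : Real.exp (kap k * t) ≤ Real.exp |kap k| := by
      rw [Real.exp_le_exp]
      calc kap k * t ≤ |kap k| * t := by gcongr; exact le_abs_self _
        _ ≤ _ := mul_le_of_le_one_right (abs_nonneg _) ht1
    have e2 : 8 * A * C₀ * Real.exp (kap k * t) ≤ M₁ := by rw [hM₁]; gcongr
    gcongr
  have h2 : ∀ y t : ℝ, 0 < t → t ≤ 1 → ‖rowS k φ y t‖ ≤
      (E + B + X * M₁) * t ^ (-(1 / 4) : ℝ) * Real.exp (-(1 / 2 * |y|)) := by
    intro y t ht ht1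
    have q : 1 ≤ t ^ (-(1 / 4) : ℝ) := Real.one_le_rpow_of_pos_of_le_one_of_nonpos ht ht1
      (by norm_num)
    have h3 := norm_stConv_S₀_le_of_decay (k := k) (y := y) ht ht1 hM₁0
      (fun z s hs hst => h1 z s hs (hst.le.trans ht1))
    have h4 := hfree y t ht ht1
    have h5 : (E + B) * Real.exp (-(1 / 2 * |y|)) ≤
        (E + B) * t ^ (-(1 / 4) : ℝ) * Real.exp (-(1 / 2 * |y|)) := by
      gcongr
      exact le_mul_of_one_le_right (by positivity) q
    rw [heq y t ht]
    refine (norm_add_le _ _).trans ?_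
    rw [norm_neg]
    refine (add_le_add (h4.trans h5) h3).trans (le_of_eq ?_)
    rw [hX]; ring
  refine ⟨E + X * (E + B + X * M₁), by positivity, fun y t ht ht1 => ?_⟩
  have q1 : 0 < t ^ (-(1 / 4) : ℝ) := Real.rpow_pos_of_pos ht _
  have q2 : 0 < t ^ (1 / 4 : ℝ) := Real.rpow_pos_of_pos ht _
  have q3 : 0 < t ^ (1 / 2 : ℝ) := Real.rpow_pos_of_pos ht _
  have h3 := norm_stConv_S₀_le_of_decay (k := k) (y := y) (F := rowS k φ)
    (M := (E + B + X * M₁) * t ^ (1 / 2 : ℝ)) ht ht1 (by positivity)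
    (fun z s hs hst => by
      refine (h2 z s hs (hst.le.trans ht1)).trans ?_
      have q4 : 0 < s ^ (-(3 / 4) : ℝ) := Real.rpow_pos_of_pos hs _
      have q5 : s ^ (1 / 2 : ℝ) ≤ t ^ (1 / 2 : ℝ) := by gcongr
      rw [rpow_neg_quarter_eq hs, ← mul_assoc]
      gcongr)
  have e1 : t ^ (1 / 2 : ℝ) * t ^ (-(1 / 4) : ℝ) = t ^ (1 / 4 : ℝ) := by
    rw [← Real.rpow_add ht]; norm_num
  have e2 : rowS k φ y t + D k φ y =
      -(freeEvol k (D k φ) t y - D k φ y) + stConv (rowS k φ) (S₀ k) y t := by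
    rw [heq y t ht]; ring
  have e3 : t ≤ t ^ (1 / 4 : ℝ) := by
    simpa using Real.rpow_le_rpow_of_exponent_ge ht ht1 (by norm_num : (1 / 4 : ℝ) ≤ 1)
  have h4 : ‖freeEvol k (D k φ) t y - D k φ y‖ ≤
      E * t ^ (1 / 4 : ℝ) * Real.exp (-(1 / 2 * |y|)) := by
    refine (hsub t y ht ht1).trans ?_
    have := exp_neg_abs_le y
    gcongr
  rw [e2]
  refine (norm_add_le _ _).trans ?_
  rw [norm_neg]
  refine (add_le_add h4 h3).trans (le_of_eq ?_)
  rw [hX, ← e1]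
  ring

theorem integrableOn_stInt_const (k : ℝ) {g : ℝ → ℂ} (h : IsTest g) (y : ℝ) {t : ℝ}
    (ht1 : t ≤ 1) : IntegrableOn (stInt (fun z _ => g z) (K₀ k) y t) (slab t) := by
  obtain ⟨A, hA, hg⟩ := h.exists_bound
  refine ((stInt_majorant (b := 1 / 4) (t := t) (by norm_num) (by norm_num) le_rfl y).1.const_mul
    (3 / 2 * A * C₀ * Real.exp |Λ₀ - 3 / 4 * k ^ 4| * Real.exp (-(1 / 2 * |y|)))).mono' ?_ ?_
  · have hg := h.smooth.continuous
    exact (continuousOn_stInt y t (by fun_prop)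
      (continuousOn_K₀ k)).aestronglyMeasurable (measurableSet_slab t)
  · filter_upwards [ae_restrict_mem (measurableSet_slab t)] with p hp
    refine norm_stInt_le_of_decay (isFreeKer_K₀ k) ht1 hA (fun z s hs hst => ?_) hp
    have q : 1 ≤ s ^ (-(3 / 4) : ℝ) := Real.one_le_rpow_of_pos_of_le_one_of_nonpos hs
      (hst.le.trans ht1) (by norm_num)
    refine (hg z).trans ?_
    have := exp_neg_abs_le z
    have := le_mul_of_one_le_right hA q
    gcongr

theorem stConv_const_eq (k : ℝ) {g : ℝ → ℂ} (h : IsTest g) (y : ℝ) {t : ℝ}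
    (ht1 : t ≤ 1) : stConv (fun z _ => g z) (K₀ k) y t =
      ∫ s in Set.Ioo 0 t, freeEvol k (fun z => (V z : ℂ) * g z) s y := by
  have hi := integrableOn_stInt_const k h y ht1
  rw [IntegrableOn, volume_restrict_slab] at hi
  rw [stConv, volume_restrict_slab, integral_prod _ hi]
  congr 1; ext s
  rw [← integral_mul_K₀_sub]
  congr 1; ext z
  simp only [stInt]
  ring

/-- Short time expansion of the dual evolution of a test function. -/
theorem norm_rowK_sub_le (k : ℝ) {φ : ℝ → ℂ} (h : IsTest φ) : ∃ C : ℝ, 0 ≤ C ∧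
    ∀ y t : ℝ, 0 < t → t ≤ 1 → ‖rowK k φ y t - φ y + t * H k (D k φ) y‖ ≤
      C * (t * t ^ (1 / 4 : ℝ)) * Real.exp (-(1 / 2 * |y|)) := by
  obtain ⟨A, hA, hφ⟩ := h.exists_bound
  obtain ⟨C1, hC1, hb1⟩ := integral_freeEvol k (h.freeGen k)
  obtain ⟨C2, hC2, hb2⟩ := integral_freeEvol k ((h.D k).neg.smooth_mul contDiff_V)
  obtain ⟨C3, hC3, hb3⟩ := norm_rowS_add_D_le k h
  have hC := C₀_pos
  set X := 12 * C₀ * Real.exp |Λ₀ - 3 / 4 * k ^ 4| with hX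
  refine ⟨C1 + C2 + X * C3, by positivity, fun y t ht ht1 => ?_⟩
  have q2 : 0 < t ^ (1 / 4 : ℝ) := Real.rpow_pos_of_pos ht _
  have q3 : 0 < t ^ (3 / 4 : ℝ) := Real.rpow_pos_of_pos ht _
  have e1 : freeEvol k φ t y - φ y = ∫ s in Set.Ioo 0 t, freeEvol k (freeGen k φ) s y := by
    rw [freeEvol_sub_eq k h ht, intervalIntegral.integral_of_le ht.le,
      integral_Ioc_eq_integral_Ioo]
  have i1 := integrableOn_stInt_rowS (isFreeKer_K₀ k) (by norm_num) (by norm_num)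
    h.smooth.continuous (IsTest.bound' hφ) y t
  have i2 := integrableOn_stInt_const k (h.D k).neg y ht1
  -- The row of S is replaced by its limit -Dφ. The replacement contributes t V(-Dφ) to first order,
  -- and the O(s^{1/4}) discrepancy will contribute O(t^{5/4}).
  have e2 : stConv (rowS k φ) (K₀ k) y t =
      stConv (fun z s => rowS k φ z s - -D k φ z) (K₀ k) y t +
      ∫ s in Set.Ioo 0 t, freeEvol k (fun z => (V z : ℂ) * -D k φ z) s y := by
    rw [stConv_sub i1 i2, stConv_const_eq k (h.D k).neg y ht1, sub_add_cancel]
  have e3 := rowK_eq k h.smooth.continuous (IsTest.bound' hφ) y ht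
  rw [integral_mul_K₀_sub] at e3
  -- The error s^{1/4} has to be written with s^{-3/4} to fit this lemma, hence the insertion of
  -- t^{3/4} s^{-3/4} ≥ 1 for s < t.
  have b3 := norm_stConv_K₀_le_of_decay (k := k) (y := y)
    (F := fun z s => rowS k φ z s - -D k φ z) (M := C3 * (t ^ (1 / 4 : ℝ) * t ^ (3 / 4 : ℝ)))
    ht ht1 (by positivity) (fun z s hs hst => by
      rw [sub_neg_eq_add]
      refine (hb3 z s hs (hst.le.trans ht1)).trans ?_
      have q5 : s ^ (1 / 4 : ℝ) ≤ t ^ (1 / 4 : ℝ) := by gcongr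
      have q6 : 1 ≤ t ^ (3 / 4 : ℝ) * s ^ (-(3 / 4) : ℝ) := by
        rw [Real.rpow_neg hs.le, ← div_eq_mul_inv, one_le_div (Real.rpow_pos_of_pos hs _)]
        gcongr
      have q7 : s ^ (1 / 4 : ℝ) ≤ t ^ (1 / 4 : ℝ) * (t ^ (3 / 4 : ℝ) * s ^ (-(3 / 4) : ℝ)) :=
        q5.trans (le_mul_of_one_le_right q2.le q6)
      calc _ ≤ C3 * (t ^ (1 / 4 : ℝ) * (t ^ (3 / 4 : ℝ) * s ^ (-(3 / 4) : ℝ))) *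
            Real.exp (-(1 / 2 * |z|)) := by gcongr
        _ = _ := by ring)
  have e4 : t ^ (1 / 4 : ℝ) * t ^ (3 / 4 : ℝ) = t := by
    rw [← Real.rpow_add ht]; norm_num
  rw [e4] at b3
  have e5 : t ^ 2 ≤ t * t ^ (1 / 4 : ℝ) := by
    rw [sq]
    gcongr
    simpa using Real.rpow_le_rpow_of_exponent_ge ht ht1 (by norm_num : (1 / 4 : ℝ) ≤ 1)
  have b1 : ∀ c, 0 ≤ c → c * t ^ 2 * Real.exp (-|y|) ≤
      c * (t * t ^ (1 / 4 : ℝ)) * Real.exp (-(1 / 2 * |y|)) := by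
    intro c hc
    have := exp_neg_abs_le y
    gcongr
  have e6 : rowK k φ y t - φ y + t * H k (D k φ) y =
      ((∫ s in Set.Ioo 0 t, freeEvol k (freeGen k φ) s y) - t * freeGen k φ y) +
      ((∫ s in Set.Ioo 0 t, freeEvol k (fun z => (V z : ℂ) * -D k φ z) s y) -
        t * ((V y : ℂ) * -D k φ y)) +
      stConv (fun z s => rowS k φ z s - -D k φ z) (K₀ k) y t := by
    rw [e3, e2, ← e1, freeGen, H]
    ring
  rw [e6]
  refine (norm_add₃_le).trans ?_
  refine (add_le_add_three ((hb1 y t ht ht1).trans (b1 _ hC1)) ((hb2 y t ht ht1).trans (b1 _ hC2))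
    b3).trans (le_of_eq ?_)
  rw [hX]; ring

theorem integral_mul_toLp (f : L2) {φ : ℝ → ℂ} (h : IsTest φ) :
    ∫ x, f x * φ x = inner ℂ (IsTest.memLp (φ := fun x => star (φ x))
      ⟨Complex.conjCLE.contDiff.comp h.smooth, h.supp.comp_left (g := star) (star_zero _)⟩).toLp f := by
  rw [MeasureTheory.L2.inner_def]
  refine integral_congr_ae ?_
  filter_upwards [(IsTest.memLp (φ := fun x => star (φ x))
      ⟨Complex.conjCLE.contDiff.comp h.smooth, h.supp.comp_left (g := star)
        (star_zero _)⟩).coeFn_toLp] with x hx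
  rw [hx]
  simp [mul_comm]

theorem tendsto_integral_mul {ι : Type*} {l : Filter ι} {f : ι → L2} {g : L2}
    (hf : Tendsto f l (𝓝 g)) {φ : ℝ → ℂ} (h : IsTest φ) :
    Tendsto (fun i => ∫ x, f i x * φ x) l (𝓝 (∫ x, g x * φ x)) := by
  simp_rw [integral_mul_toLp _ h]
  exact tendsto_const_nhds.inner hf

/-- The generator of the semigroup is contained in `-D_k H_k`. -/
theorem isNegDH_of_tendsto (k : ℝ) {u w : L2}
    (h : Tendsto (fun t : ℝ => ((t : ℂ)⁻¹) • (semigroup k t u - u)) (𝓝[>] 0) (𝓝 w)) :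
    IsNegDH k u w := by
  intro φ hφ hs
  have hT : IsTest φ := ⟨hφ, hs⟩
  obtain ⟨A, hA, hb⟩ := hT.exists_bound
  obtain ⟨C, hC, hK⟩ := norm_rowK_sub_le k hT
  have h1 := tendsto_integral_mul h hT
  have hHD : IsTest (H k (D k φ)) :=
    (((hT.D k).D k).add (hT.D k)).add ((hT.D k).smooth_mul contDiff_V)
  have hexp : MemLp (fun y => (Real.exp (-(1 / 2 * |y|)) : ℂ)) 2 :=
    memLp_two_of_bound (A := 1) (c := 1 / 2) (x₀ := 0) (by norm_num)
      (Continuous.aestronglyMeasurable (by fun_prop)) fun z => by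
        rw [one_mul, Complex.norm_real, Real.norm_of_nonneg (Real.exp_pos _).le, zero_sub, abs_neg]
  have hi0 : Integrable fun y => Real.exp (-(1 / 2 * |y|)) * ‖u y‖ := by
    refine (integrable_mul_L2 hexp u).norm.congr (Eventually.of_forall fun y => ?_)
    simp only [norm_mul]
    rw [Complex.norm_real, Real.norm_of_nonneg (Real.exp_pos _).le]
  set I := ∫ y, Real.exp (-(1 / 2 * |y|)) * ‖u y‖ with hI
  -- The semigroup is transposed onto φ, where the expansion φ - t H D φ + O(t^{5/4}) holds with
  -- exponential decay; the remainder can therefore be paired with any u in L².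
  have key : ∀ t : ℝ, 0 < t → t ≤ 1 →
      ‖(∫ x, (((t : ℂ)⁻¹) • (semigroup k t u - u) : L2) x * φ x) +
        ∫ x, u x * H k (D k φ) x‖ ≤ C * I * t ^ (1 / 4 : ℝ) := by
    intro t ht ht1
    have htc : (t : ℂ) ≠ 0 := Complex.ofReal_ne_zero.2 ht.ne'
    have ha := isExpKer_kerK k ht
    have p1 : ∫ x, semigroup k t u x * φ x = ∫ y, rowK k φ y t * u y := by
      have := ha.pairing u one_pos hφ.continuous.measurable (IsTest.bound' hb)
      simp only [rowK]
      rw [← this]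
      refine integral_congr_ae ?_
      filter_upwards [semigroup_ae k ht u] with x hx
      rw [hx, mul_comm]
    have i1 : Integrable fun x => semigroup k t u x * φ x :=
      (Lp.memLp _).integrable_mul hT.memLp
    have i2 : Integrable fun x => u x * φ x := (Lp.memLp _).integrable_mul hT.memLp
    have i3 : Integrable fun x => u x * H k (D k φ) x := (Lp.memLp _).integrable_mul hHD.memLp
    have i4 : Integrable fun y => rowK k φ y t * u y := by
      have := (ha.integrable_pairing u one_pos hφ.continuous.measurable
        (IsTest.bound' hb)).integral_prod_right
      refine this.congr (Eventually.of_forall fun y => ?_)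
      simp only [Function.uncurry_apply_pair, rowK]
      rw [← integral_mul_const]
      congr 1; ext x
      ring
    have p2 : ∫ x, (((t : ℂ)⁻¹) • (semigroup k t u - u) : L2) x * φ x =
        (t : ℂ)⁻¹ * ((∫ y, rowK k φ y t * u y) - ∫ x, u x * φ x) := by
      rw [← p1, ← integral_sub i1 i2, ← integral_const_mul]
      refine integral_congr_ae ?_
      filter_upwards [Lp.coeFn_smul ((t : ℂ)⁻¹) (semigroup k t u - u),
        Lp.coeFn_sub (semigroup k t u) u] with x h1 h2
      rw [h1, Pi.smul_apply, h2, Pi.sub_apply, smul_eq_mul]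
      ring
    have p3 : (∫ x, (((t : ℂ)⁻¹) • (semigroup k t u - u) : L2) x * φ x) +
        ∫ x, u x * H k (D k φ) x =
        (t : ℂ)⁻¹ * ∫ y, (rowK k φ y t - φ y + t * H k (D k φ) y) * u y := by
      have e : ∫ y, (rowK k φ y t - φ y + t * H k (D k φ) y) * u y =
          (∫ y, rowK k φ y t * u y) - (∫ x, u x * φ x) + t * ∫ x, u x * H k (D k φ) x := by
        have i5 : Integrable fun y => rowK k φ y t * u y - u y * φ y := i4.sub i2
        rw [← integral_sub i4 i2, ← integral_const_mul, ← integral_add i5 (i3.const_mul _)]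
        congr 1; ext y
        ring
      rw [e, p2]
      field_simp
    rw [p3, norm_mul, norm_inv, Complex.norm_real, Real.norm_of_nonneg ht.le,
      inv_mul_le_iff₀ ht]
    refine (norm_integral_le_of_norm_le (hi0.const_mul (C * (t * t ^ (1 / 4 : ℝ))))
      (Eventually.of_forall fun y => ?_)).trans (le_of_eq ?_)
    · rw [norm_mul, ← mul_assoc]
      gcongr
      exact hK y t ht ht1
    · rw [integral_const_mul]
      ring
  have h2 : Tendsto (fun t : ℝ => (∫ x, (((t : ℂ)⁻¹) • (semigroup k t u - u) : L2) x * φ x) +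
      ∫ x, u x * H k (D k φ) x) (𝓝[>] 0) (𝓝 0) := by
    rw [tendsto_zero_iff_norm_tendsto_zero]
    have h3 := tendsto_rpow_quarter.const_mul (C * I)
    rw [mul_zero] at h3
    refine squeeze_zero' (Eventually.of_forall fun t => norm_nonneg _) ?_ h3
    filter_upwards [eventually_pos_le_one] with t ht
    exact key t ht.1 ht.2
  have h3 := tendsto_nhds_unique h2 (h1.add_const _)
  exact eq_neg_of_add_eq_zero_right h3.symm


/-! ### Abstract theory of strongly continuous semigroups. -/

/-- Strongly continuous semigroups on `L²(ℝ)`. -/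
structure IsC0Semigroup (T : ℝ → L2 →L[ℂ] L2) : Prop where
  map_zero : T 0 = ContinuousLinearMap.id ℂ L2
  map_add : ∀ s t : ℝ, 0 ≤ s → 0 ≤ t → T (s + t) = (T s).comp (T t)
  tendsto_zero : ∀ u : L2, Tendsto (fun t : ℝ => T t u) (𝓝[>] 0) (𝓝 u)

/-- `w` is the value at `u` of the infinitesimal generator of `T`. -/
def Generates (T : ℝ → L2 →L[ℂ] L2) (u w : L2) : Prop :=
  Tendsto (fun t : ℝ => ((t : ℂ)⁻¹) • (T t u - u)) (𝓝[>] 0) (𝓝 w)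

theorem ofReal_inv_smul (a : ℝ) (v : L2) : (a : ℂ)⁻¹ • v = a⁻¹ • v := by
  rw [← Complex.ofReal_inv]
  exact Complex.coe_smul _ _

namespace IsC0Semigroup

variable {T T' : ℝ → L2 →L[ℂ] L2}

theorem tendsto_zero' (h : IsC0Semigroup T) (u : L2) :
    Tendsto (fun t : ℝ => T t u) (𝓝[≥] 0) (𝓝 u) := by
  rw [← Set.Ioi_insert, nhdsWithin_insert, tendsto_sup]
  refine ⟨?_, h.tendsto_zero u⟩
  rw [tendsto_pure_left]
  intro s hs
  rw [h.map_zero]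
  exact mem_of_mem_nhds hs

/-- If the norms were unbounded near 0, Banach–Steinhaus along a sequence t_n → 0 with ‖T(t_n)‖ > n
+ 1 would contradict strong continuity. -/
theorem exists_bound_near_zero (h : IsC0Semigroup T) :
    ∃ δ > 0, ∃ M : ℝ, 1 ≤ M ∧ ∀ t, 0 ≤ t → t ≤ δ → ‖T t‖ ≤ M := by
  by_contra! hc
  have h1 : ∀ n : ℕ, ∃ t : ℝ, 0 ≤ t ∧ t ≤ 1 / ((n : ℝ) + 1) ∧ (n : ℝ) + 1 < ‖T t‖ := fun n =>
    hc _ (by positivity) _ (by have := Nat.cast_nonneg (α := ℝ) n; linarith)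
  choose t ht0 ht1 htn using h1
  have htl : Tendsto t atTop (𝓝[≥] 0) := by
    refine tendsto_nhdsWithin_iff.2 ⟨?_, Eventually.of_forall ht0⟩
    exact squeeze_zero ht0 ht1 tendsto_one_div_add_atTop_nhds_zero_nat
  obtain ⟨C, hC⟩ := banach_steinhaus (g := fun n => T (t n)) fun u => by
    have := ((h.tendsto_zero' u).comp htl).norm
    obtain ⟨C, hC⟩ := this.bddAbove_range
    exact ⟨C, fun n => hC ⟨n, rfl⟩⟩
  obtain ⟨n, hn⟩ := exists_nat_gt C
  have := hC n
  have := htn n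
  linarith

theorem exists_bound (h : IsC0Semigroup T) (R : ℝ) :
    ∃ M : ℝ, 1 ≤ M ∧ ∀ t, 0 ≤ t → t ≤ R → ‖T t‖ ≤ M := by
  obtain ⟨δ, hδ, M, hM, hb⟩ := h.exists_bound_near_zero
  have h1 : ∀ n : ℕ, ∀ t, 0 ≤ t → t ≤ n * δ → ‖T t‖ ≤ M ^ n := by
    intro n
    induction n with
    | zero =>
      intro t h0 h1
      have : t = 0 := le_antisymm (by simpa using h1) h0
      rw [this, h.map_zero, pow_zero]
      exact ContinuousLinearMap.norm_id_le
    | succ n ih =>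
      intro t h0 h1
      push_cast at h1
      rcases le_total t δ with h2 | h2
      · exact (hb t h0 h2).trans (le_self_pow₀ hM n.succ_ne_zero)
      · have h3 : 0 ≤ t - δ := sub_nonneg.2 h2
        have e := h.map_add (t - δ) δ h3 hδ.le
        rw [sub_add_cancel] at e
        rw [e, pow_succ]
        refine (ContinuousLinearMap.opNorm_comp_le _ _).trans ?_
        exact mul_le_mul (ih _ h3 (by linarith)) (hb δ hδ.le le_rfl) (norm_nonneg _) (by positivity)
  obtain ⟨n, hn⟩ := exists_nat_gt (R / δ)
  rw [div_lt_iff₀ hδ] at hn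
  exact ⟨M ^ n, one_le_pow₀ hM, fun t h0 h2 => h1 n t h0 (h2.trans hn.le)⟩

theorem norm_sub_le (h : IsC0Semigroup T) {R M : ℝ} (hM : ∀ t, 0 ≤ t → t ≤ R → ‖T t‖ ≤ M)
    (u : L2) {s t : ℝ} (hs : 0 ≤ s) (hsR : s ≤ R) (ht : 0 ≤ t) (htR : t ≤ R) :
    ‖T t u - T s u‖ ≤ M * ‖T |t - s| u - u‖ := by
  wlog hst : s ≤ t generalizing s t
  · rw [norm_sub_rev, abs_sub_comm]
    exact this ht htR hs hsR (le_of_not_ge hst)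
  have h1 : 0 ≤ t - s := sub_nonneg.2 hst
  have e := h.map_add s (t - s) hs h1
  rw [add_sub_cancel] at e
  rw [e, ContinuousLinearMap.comp_apply, ← map_sub, abs_of_nonneg h1]
  exact ContinuousLinearMap.le_of_opNorm_le _ (hM s hs hsR) _

theorem continuous_apply (h : IsC0Semigroup T) (u : L2) : Continuous fun t : ℝ => T |t| u := by
  rw [continuous_iff_continuousAt]
  intro t
  obtain ⟨M, hM1, hM⟩ := h.exists_bound (|t| + 1)
  rw [ContinuousAt, tendsto_iff_norm_sub_tendsto_zero]
  have h1 : Tendsto (fun s : ℝ => M * ‖T |(|s| - |t|)| u - u‖) (𝓝 t) (𝓝 0) := by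
    have h2 : Tendsto (fun s : ℝ => |(|s| - |t|)|) (𝓝 t) (𝓝[≥] 0) := by
      refine tendsto_nhdsWithin_iff.2 ⟨?_, Eventually.of_forall fun s => abs_nonneg (|s| - |t|)⟩
      have : ContinuousAt (fun s : ℝ => |(|s| - |t|)|) t := by fun_prop
      simpa [ContinuousAt] using this
    have h3 := tendsto_iff_norm_sub_tendsto_zero.1 ((h.tendsto_zero' u).comp h2)
    simpa using h3.const_mul M
  refine squeeze_zero' (Eventually.of_forall fun s => norm_nonneg _) ?_ h1
  have h4 : ∀ᶠ s : ℝ in 𝓝 t, |s| < |t| + 1 :=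
    (continuous_abs.tendsto t).eventually_lt_const (lt_add_one _)
  filter_upwards [h4] with s hs
  exact h.norm_sub_le hM u (abs_nonneg t) (by linarith) (abs_nonneg s) hs.le

theorem generates_apply (h : IsC0Semigroup T) {u w : L2} (hu : Generates T u w) {s : ℝ}
    (hs : 0 ≤ s) : Generates T (T s u) (T s w) := by
  have h1 := ((T s).continuous.tendsto w).comp hu
  refine h1.congr' ?_
  filter_upwards [self_mem_nhdsWithin] with t ht
  have e : T t (T s u) = T s (T t u) := by
    rw [← ContinuousLinearMap.comp_apply, ← ContinuousLinearMap.comp_apply,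
      ← h.map_add t s (le_of_lt ht) hs, ← h.map_add s t hs (le_of_lt ht), add_comm]
  simp only [Function.comp_apply, map_smul, map_sub, e]

/-- The integrals `∫₀ᵃ e^{-λt} T(t) f dt` lie in the domain of the generator. -/
theorem generates_integral (h : IsC0Semigroup T) (l : ℝ) {a : ℝ} (ha : 0 ≤ a) (f : L2) :
    Generates T (∫ t in (0 : ℝ)..a, Real.exp (-(l * t)) • T |t| f)
      (l • (∫ t in (0 : ℝ)..a, Real.exp (-(l * t)) • T |t| f) -
        (f - Real.exp (-(l * a)) • T a f)) := by
  set F : ℝ → L2 := fun t => Real.exp (-(l * t)) • T |t| f with hF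
  have hFc : Continuous F := (by fun_prop : Continuous fun t : ℝ => Real.exp (-(l * t))).smul
    (h.continuous_apply f)
  set v := ∫ t in (0 : ℝ)..a, F t with hv
  -- For x > 0 this is T(x)v, by the semigroup law and a shift of the integration variable. The
  -- formula makes sense on both sides of 0 and is differentiable there, and the value of the
  -- generator is its derivative.
  set Ψ : ℝ → L2 := fun x => Real.exp (l * x) • ((∫ t in (0 : ℝ)..(a + x), F t) -
    ∫ t in (0 : ℝ)..x, F t) with hΨ
  have hFx : ∀ x, HasDerivAt (fun x => ∫ t in (0 : ℝ)..x, F t) (F x) x := fun x =>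
    intervalIntegral.integral_hasDerivAt_right (hFc.intervalIntegrable _ _)
      (hFc.stronglyMeasurableAtFilter _ _) hFc.continuousAt
  have h1 : HasDerivAt (fun x => ∫ t in (0 : ℝ)..(a + x), F t) (F a) 0 := by
    have h2 := hFx (a + 0)
    have h3 := h2.scomp (0 : ℝ) ((hasDerivAt_id (0 : ℝ)).const_add a)
    simpa using! h3
  have h4 : HasDerivAt (fun x : ℝ => Real.exp (l * x)) l 0 := by
    have := ((hasDerivAt_id (0 : ℝ)).const_mul l).exp
    simpa using! this
  have hd : HasDerivAt Ψ (F a - F 0 + l • v) 0 := by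
    have := h4.smul (h1.sub (hFx 0))
    simpa using! this
  have e0 : Ψ 0 = v := by simp [hΨ, hv]
  have e1 : F a - F 0 + l • v = l • v - (f - Real.exp (-(l * a)) • T a f) := by
    have : F 0 = f := by simp [hF, h.map_zero]
    have h5 : F a = Real.exp (-(l * a)) • T a f := by simp [hF, abs_of_nonneg ha]
    rw [this, h5]; abel
  have e2 : ∀ t : ℝ, 0 < t → T t v = Ψ t := by
    intro t ht
    have h5 : ∫ s in (0 : ℝ)..a, T t (F s) = T t v :=
      (T t).intervalIntegral_comp_comm (hFc.intervalIntegrable _ _)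
    have h6 : ∀ s ∈ Set.uIcc (0 : ℝ) a, T t (F s) = Real.exp (l * t) • F (s + t) := by
      intro s hs
      rw [Set.uIcc_of_le ha] at hs
      have h7 : |s + t| = t + |s| := by
        rw [abs_of_nonneg (add_nonneg hs.1 ht.le), abs_of_nonneg hs.1, add_comm]
      simp only [hF]
      rw [h7, h.map_add t |s| ht.le (abs_nonneg s), ContinuousLinearMap.comp_apply, smul_smul,
        ← Real.exp_add, ContinuousLinearMap.map_smul_of_tower]
      congr 2
      ring
    rw [← h5, intervalIntegral.integral_congr h6, intervalIntegral.integral_smul,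
      intervalIntegral.integral_comp_add_right, zero_add]
    simp only [hΨ]
    rw [← intervalIntegral.integral_interval_sub_left (hFc.intervalIntegrable _ _)
      (hFc.intervalIntegrable _ _)]
  rw [e1] at hd
  have h7 := hd.hasDerivWithinAt (s := Set.Ioi 0)
  rw [hasDerivWithinAt_iff_tendsto_slope' (by simp)] at h7
  refine h7.congr' ?_
  filter_upwards [self_mem_nhdsWithin] with t ht
  rw [slope_def_module, e0, sub_zero, ← e2 t ht, ofReal_inv_smul]

/-- The resolvent equation is solvable. -/
theorem exists_resolvent (h : IsC0Semigroup T) : ∃ l₁ : ℝ, ∀ l : ℝ, l₁ ≤ l → ∀ g : L2,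
    ∃ v w : L2, Generates T v w ∧ l • v - w = g := by
  have hM : 0 < ‖T 1‖ + 1 := by positivity
  refine ⟨Real.log (2 * (‖T 1‖ + 1)), fun l hl g => ?_⟩
  have h1 : Real.exp (-l) * ‖T 1‖ < 1 := by
    have h2 : Real.exp (-l) ≤ (2 * (‖T 1‖ + 1))⁻¹ := by
      rw [Real.exp_neg]
      gcongr
      rw [← Real.exp_log (x := 2 * (‖T 1‖ + 1)) (by positivity)]
      gcongr
    calc _ ≤ (2 * (‖T 1‖ + 1))⁻¹ * ‖T 1‖ := by gcongr
      _ < 1 := by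
        rw [inv_mul_lt_iff₀ (by positivity)]
        linarith [norm_nonneg (T 1)]
  -- For large l the operator exp(-l)T(1) has norm below 1. With f = (1 - exp(-l)T(1))⁻¹ g, the
  -- integral of exp(-lt)T(t)f over [0, 1] already solves the resolvent equation, so no integral
  -- over the half line is needed.
  set B : L2 →L[ℂ] L2 := Real.exp (-l) • T 1 with hB
  have hBn : ‖B‖ < 1 := by
    rw [hB, norm_smul, Real.norm_of_nonneg (Real.exp_pos _).le]
    exact h1
  obtain ⟨f, hf⟩ : ∃ f : L2, f - B f = g := by
    refine ⟨(Units.oneSub B hBn).inv g, ?_⟩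
    have := congrArg (fun X : L2 →L[ℂ] L2 => X g) (Units.oneSub B hBn).val_inv
    simpa [Units.val_oneSub] using! this
  refine ⟨_, _, h.generates_integral l zero_le_one f, ?_⟩
  rw [sub_sub_cancel, ← hf, hB, mul_one]
  rfl

/-- The averages a⁻¹ ∫₀ᵃ T(t)f dt lie in the domain and tend to f. -/
theorem dense_domain (h : IsC0Semigroup T) : Dense {u : L2 | ∃ w, Generates T u w} := by
  intro f
  have hFc := h.continuous_apply f
  have h1 : HasDerivAt (fun x => ∫ t in (0 : ℝ)..x, T |t| f) f 0 := by
    have := intervalIntegral.integral_hasDerivAt_right (hFc.intervalIntegrable 0 0)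
      (hFc.stronglyMeasurableAtFilter _ _) hFc.continuousAt
    simpa [h.map_zero] using this
  have h2 := h1.hasDerivWithinAt (s := Set.Ioi 0)
  rw [hasDerivWithinAt_iff_tendsto_slope' (by simp)] at h2
  refine mem_closure_of_tendsto h2 ?_
  filter_upwards [self_mem_nhdsWithin] with a ha
  have h3 := h.generates_integral 0 (le_of_lt ha) f
  simp only [zero_mul, neg_zero, Real.exp_zero, one_smul] at h3
  refine ⟨_, (Tendsto.const_smul h3 ((a : ℂ)⁻¹)).congr fun t => ?_⟩
  rw [slope_def_module, sub_zero, intervalIntegral.integral_same, sub_zero]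
  rw [← ofReal_inv_smul a, map_smul, ← smul_sub, smul_comm]

/-- Strongly continuous semigroups with the same generator agree. -/
theorem eq_of_generates (h : IsC0Semigroup T) (h' : IsC0Semigroup T')
    (hg : ∀ u w, Generates T u w ↔ Generates T' u w) {t : ℝ} (ht : 0 ≤ t) : T' t = T t := by
  have key : ∀ u w : L2, Generates T' u w → T' t u = T t u := by
    intro u w hu
    obtain ⟨M, hM1, hM⟩ := h.exists_bound t
    -- The standard interpolation between T(t)u at s = 0 and T'(t)u at s = t; it is constant because
    -- its right derivative vanishes.
    set g : ℝ → L2 := fun s => T (t - s) (T' s u) with hg'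
    have hcont : ContinuousOn g (Set.Icc 0 t) := by
      intro s hs
      have c1 : Tendsto (fun r => T' r u) (𝓝[Set.Icc 0 t] s) (𝓝 (T' s u)) := by
        have := ((h'.continuous_apply u).tendsto s).mono_left
          (nhdsWithin_le_nhds (s := Set.Icc 0 t))
        rw [abs_of_nonneg hs.1] at this
        refine this.congr' ?_
        filter_upwards [self_mem_nhdsWithin] with r hr
        rw [abs_of_nonneg hr.1]
      have c2 : Tendsto (fun r => T (t - r) (T' s u)) (𝓝[Set.Icc 0 t] s) (𝓝 (g s)) := by
        have c3 : Continuous fun r : ℝ => T |t - r| (T' s u) :=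
          (h.continuous_apply (T' s u)).comp (f := fun r : ℝ => t - r) (by fun_prop)
        have := (c3.tendsto s).mono_left (nhdsWithin_le_nhds (s := Set.Icc 0 t))
        rw [abs_of_nonneg (sub_nonneg.2 hs.2)] at this
        refine this.congr' ?_
        filter_upwards [self_mem_nhdsWithin] with r hr
        rw [abs_of_nonneg (sub_nonneg.2 hr.2)]
      have c4 : Tendsto (fun r => T (t - r) (T' r u - T' s u)) (𝓝[Set.Icc 0 t] s) (𝓝 0) := by
        rw [tendsto_zero_iff_norm_tendsto_zero]
        have c5 := (tendsto_iff_norm_sub_tendsto_zero.1 c1).const_mul M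
        rw [mul_zero] at c5
        refine squeeze_zero' (Eventually.of_forall fun r => norm_nonneg _) ?_ c5
        filter_upwards [self_mem_nhdsWithin] with r hr
        exact ContinuousLinearMap.le_of_opNorm_le _
          (hM (t - r) (sub_nonneg.2 hr.2) (by linarith [hr.1])) _
      have c6 := c4.add c2
      rw [zero_add] at c6
      refine c6.congr fun r => ?_
      simp only [hg', map_sub, sub_add_cancel]
    have hder : ∀ s ∈ Set.Ico 0 t, HasDerivWithinAt g 0 (Set.Ici s) s := by
      intro s hs
      rw [← hasDerivWithinAt_Ioi_iff_Ici, hasDerivWithinAt_iff_tendsto_slope' (by simp)]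
      have hv := h'.generates_apply hu hs.1
      have hv' := (hg _ _).2 hv
      have d1 := hv.sub hv'
      rw [sub_self] at d1
      have d2 : Tendsto (fun r : ℝ => r - s) (𝓝[>] s) (𝓝[>] 0) := by
        refine tendsto_nhdsWithin_iff.2 ⟨?_, ?_⟩
        · have : ContinuousAt (fun r : ℝ => r - s) s := by fun_prop
          have h2 := this.tendsto
          rw [sub_self] at h2
          exact h2.mono_left nhdsWithin_le_nhds
        · filter_upwards [self_mem_nhdsWithin] with r hr
          exact sub_pos.2 (Set.mem_Ioi.1 hr)
      have d3 := (tendsto_zero_iff_norm_tendsto_zero.1 (d1.comp d2)).const_mul M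
      rw [mul_zero] at d3
      rw [tendsto_zero_iff_norm_tendsto_zero]
      refine squeeze_zero' (Eventually.of_forall fun r => norm_nonneg _) ?_ d3
      filter_upwards [Ioc_mem_nhdsGT hs.2] with r hr
      have hrs : 0 < r - s := sub_pos.2 hr.1
      have htr : 0 ≤ t - r := sub_nonneg.2 hr.2
      have a1 : T' r u = T' (r - s) (T' s u) := by
        rw [← ContinuousLinearMap.comp_apply, ← h'.map_add _ _ hrs.le hs.1, sub_add_cancel]
      have a2 : T (t - s) (T' s u) = T (t - r) (T (r - s) (T' s u)) := by
        rw [← ContinuousLinearMap.comp_apply (T (t - r)), ← h.map_add _ _ htr hrs.le,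
            sub_add_sub_cancel]
      -- The slope is a bounded operator applied to the difference of two difference quotients. Both
      -- converge to T'(s)w, since the generators agree on T'(s)u.
      have a3 : slope g s r = T (t - r) ((((r - s : ℝ) : ℂ)⁻¹) • (T' (r - s) (T' s u) - T' s u) -
          (((r - s : ℝ) : ℂ)⁻¹) • (T (r - s) (T' s u) - T' s u)) := by
        rw [slope_def_module, ← ofReal_inv_smul, ← smul_sub, map_smul]
        simp only [hg', a1, a2, ← map_sub]
        congr 2
        abel
      rw [a3]
      exact ContinuousLinearMap.le_of_opNorm_le _ (hM (t - r) htr (by linarith [hs.1, hr.1])) _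
    have := constant_of_has_deriv_right_zero hcont hder t ⟨ht, le_rfl⟩
    simpa [hg', h.map_zero, h'.map_zero] using this
  have hdense := h'.dense_domain
  have := Continuous.ext_on hdense (T' t).continuous (T t).continuous fun u ⟨w, hu⟩ => key u w hu
  exact ContinuousLinearMap.ext fun u => congrFun this u

end IsC0Semigroup


/-! ### Mollification on L². -/

theorem IsTest.exists_isExpKer {ρ : ℝ → ℂ} (h : IsTest ρ) :
    ∃ C, IsExpKer (fun x y => ρ (x - y)) C 1 := by
  obtain ⟨C, -, hb⟩ := h.exists_bound
  have hc := h.smooth.continuous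
  exact ⟨C, (by fun_prop : Continuous fun p : ℝ × ℝ => ρ (p.1 - p.2)).measurable, one_pos,
    fun x y => by rw [one_mul]; exact hb _⟩

open Classical in
/-- Convolution with a test function, as an operator on `L²(ℝ)`. -/
def molL (ρ : ℝ → ℂ) : L2 →L[ℂ] L2 :=
  if h : IsTest ρ then h.exists_isExpKer.choose_spec.op else 0

/-- Convolution with a test function. -/
def mol (ρ f : ℝ → ℂ) (x : ℝ) : ℂ := ∫ y, ρ (x - y) * f y

theorem molL_eq {ρ : ℝ → ℂ} (h : IsTest ρ) {C a : ℝ}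
    (hP : IsExpKer (fun x y => ρ (x - y)) C a) : molL ρ = hP.op := by
  rw [molL, dif_pos h]
  exact IsExpKer.op_eq_op _ _

theorem molL_ae {ρ : ℝ → ℂ} (h : IsTest ρ) (f : L2) : molL ρ f =ᵐ[volume] mol ρ f := by
  rw [molL, dif_pos h]
  exact IsExpKer.op_ae _ f

theorem integrable_mol {ρ : ℝ → ℂ} (h : IsTest ρ) (f : L2) (x : ℝ) :
    Integrable fun y => ρ (x - y) * f y :=
  h.exists_isExpKer.choose_spec.integrable f x

theorem memLp_mol {ρ : ℝ → ℂ} (h : IsTest ρ) (f : L2) : MemLp (mol ρ f) 2 :=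
  h.exists_isExpKer.choose_spec.memLp_apply f

theorem hasDerivAt_mol {ρ : ℝ → ℂ} (h : IsTest ρ) (f : L2) (x : ℝ) :
    HasDerivAt (mol ρ f) (mol (deriv ρ) f x) x := by
  have hf : LocallyIntegrable f volume := (Lp.memLp f).locallyIntegrable (by norm_num)
  have h1 := h.supp.hasDerivAt_convolution_right (ContinuousLinearMap.mul ℝ ℂ) hf
    (h.smooth.of_le (by norm_num)) x
  have e : ∀ σ : ℝ → ℂ, (convolution f σ (ContinuousLinearMap.mul ℝ ℂ) volume) = mol σ f := by
    intro σ
    ext x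
    simp only [convolution_def, mol, ContinuousLinearMap.mul_apply']
    congr 1; ext y
    ring
  rw [e, e] at h1
  exact h1

theorem molL_add {ρ σ : ℝ → ℂ} (hρ : IsTest ρ) (hσ : IsTest σ) (f : L2) :
    molL (fun x => ρ x + σ x) f = molL ρ f + molL σ f := by
  refine Lp.ext ?_
  filter_upwards [molL_ae (hρ.add hσ) f, molL_ae hρ f, molL_ae hσ f,
    Lp.coeFn_add (molL ρ f) (molL σ f)] with x h1 h2 h3 h4
  rw [h1, h4, Pi.add_apply, h2, h3, mol, mol, mol,
    ← integral_add (integrable_mol hρ f x) (integrable_mol hσ f x)]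
  congr 1; ext y
  ring

theorem molL_const_mul {ρ : ℝ → ℂ} (hρ : IsTest ρ) (c : ℂ) (f : L2) :
    molL (fun x => c * ρ x) f = c • molL ρ f := by
  refine Lp.ext ?_
  filter_upwards [molL_ae (hρ.const_mul c) f, molL_ae hρ f,
    Lp.coeFn_smul c (molL ρ f)] with x h1 h2 h3
  rw [h1, h3, Pi.smul_apply, h2, mol, mol, smul_eq_mul, ← integral_const_mul]
  congr 1; ext y
  ring

theorem molL_neg {ρ : ℝ → ℂ} (hρ : IsTest ρ) (f : L2) :
    molL (fun x => -ρ x) f = -molL ρ f := by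
  have := molL_const_mul hρ (-1) f
  simpa using this

theorem inner_toLp {a b : L2} {a' b' : ℝ → ℂ} (ha : a =ᵐ[volume] a') (hb : b =ᵐ[volume] b') :
    inner ℂ a b = ∫ x, star (a' x) * b' x := by
  rw [MeasureTheory.L2.inner_def]
  refine integral_congr_ae ?_
  filter_upwards [ha, hb] with x h1 h2
  rw [h1, h2, RCLike.inner_apply, mul_comm]
  rfl

/-- Mollified functions are differentiable with derivatives in L², so integration by parts is
elementary. Quadratic forms on the maximal domain are computed after mollification and then passed
to the limit, without any regularity theory. -/
theorem inner_molL_deriv {ρ σ : ℝ → ℂ} (hρ : IsTest ρ) (hσ : IsTest σ) (f g : L2) :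
    inner ℂ (molL (deriv ρ) f) (molL σ g) = -inner ℂ (molL ρ f) (molL (deriv σ) g) := by
  rw [inner_toLp (molL_ae hρ.deriv f) (molL_ae hσ g),
    inner_toLp (molL_ae hρ f) (molL_ae hσ.deriv g)]
  have h1 := integral_mul_deriv_eq_deriv_mul_of_integrable (u := fun x => star (mol ρ f x))
    (u' := fun x => star (mol (deriv ρ) f x)) (v := mol σ g) (v' := mol (deriv σ) g)
    (fun x _ => (hasDerivAt_mol hρ f x).star) (fun x _ => hasDerivAt_mol hσ g x)
    ((memLp_mol hρ f).star.integrable_mul (memLp_mol hσ.deriv g))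
    ((memLp_mol hρ.deriv f).star.integrable_mul (memLp_mol hσ g))
    ((memLp_mol hρ f).star.integrable_mul (memLp_mol hσ g))
  rw [h1, neg_neg]

theorem D_eq (k : ℝ) (ρ : ℝ → ℂ) : D k ρ = fun x => -deriv (deriv ρ) x + (k : ℂ) ^ 2 * ρ x := by
  ext x
  rw [D, iteratedDeriv_succ, iteratedDeriv_one]

theorem molL_D (k : ℝ) {ρ : ℝ → ℂ} (h : IsTest ρ) (f : L2) :
    molL (D k ρ) f = -molL (deriv (deriv ρ)) f + ((k : ℂ) ^ 2) • molL ρ f := by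
  rw [D_eq, molL_add h.deriv.deriv.neg (h.const_mul _), molL_neg h.deriv.deriv, molL_const_mul h]

theorem inner_molL_D (k : ℝ) {ρ σ : ℝ → ℂ} (hρ : IsTest ρ) (hσ : IsTest σ) (f g : L2) :
    inner ℂ (molL (D k ρ) f) (molL σ g) = inner ℂ (molL ρ f) (molL (D k σ) g) := by
  rw [molL_D k hρ, molL_D k hσ, inner_add_left, inner_add_right, inner_neg_left, inner_neg_right,
    inner_molL_deriv hρ.deriv hσ, inner_molL_deriv hρ hσ.deriv, inner_smul_left, inner_smul_right]
  simp

theorem inner_molL_D_self (k : ℝ) {ρ : ℝ → ℂ} (h : IsTest ρ) (f : L2) :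
    inner ℂ (molL (D k ρ) f) (molL ρ f) =
      ((‖molL (deriv ρ) f‖ ^ 2 + k ^ 2 * ‖molL ρ f‖ ^ 2 : ℝ) : ℂ) := by
  rw [molL_D k h, inner_add_left, inner_neg_left, inner_molL_deriv h.deriv h, inner_smul_left,
    inner_self_eq_norm_sq_to_K, inner_self_eq_norm_sq_to_K]
  simp

theorem memLp_V_mul (f : L2) : MemLp (fun x => (V x : ℂ) * f x) 2 := by
  refine (Lp.memLp f).of_le_mul (c := 3 / 2)
    (continuous_V.aestronglyMeasurable.mul (Lp.aestronglyMeasurable f))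
    (Eventually.of_forall fun x => ?_)
  rw [norm_mul]
  gcongr
  exact norm_V_le x

/-- Multiplication by the potential. -/
def mulV : L2 →L[ℂ] L2 :=
  LinearMap.mkContinuous
    { toFun := fun f => (memLp_V_mul f).toLp
      map_add' := fun f g => by
        rw [← MemLp.toLp_add]
        refine (MemLp.toLp_eq_toLp_iff _ _).2 ?_
        filter_upwards [Lp.coeFn_add f g] with y hy
        simp only [Pi.add_apply, hy]
        ring
      map_smul' := fun c f => by
        rw [RingHom.id_apply, ← MemLp.toLp_const_smul]
        refine (MemLp.toLp_eq_toLp_iff _ _).2 ?_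
        filter_upwards [Lp.coeFn_smul c f] with y hy
        simp only [Pi.smul_apply, hy, smul_eq_mul]
        ring }
    (3 / 2) fun f => by
      refine Lp.norm_le_mul_norm_of_ae_le_mul ?_
      filter_upwards [(memLp_V_mul f).coeFn_toLp] with x hx
      simp only [LinearMap.coe_mk, AddHom.coe_mk]
      rw [hx, norm_mul]
      gcongr
      exact norm_V_le x

theorem mulV_ae (f : L2) : mulV f =ᵐ[volume] fun x => (V x : ℂ) * f x :=
  (memLp_V_mul f).coeFn_toLp

theorem norm_mulV_le (f : L2) : ‖mulV f‖ ≤ 3 / 2 * ‖f‖ :=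
  ContinuousLinearMap.le_of_opNorm_le _ (LinearMap.mkContinuous_norm_le _ (by norm_num) _) f

theorem iteratedDeriv_two_comp_sub (ρ : ℝ → ℂ) (x y : ℝ) :
    iteratedDeriv 2 (fun y => ρ (x - y)) y = iteratedDeriv 2 ρ (x - y) := by
  rw [iteratedDeriv_comp_const_sub]
  simp

theorem D_comp_sub (k : ℝ) (ρ : ℝ → ℂ) (x : ℝ) :
    D k (fun y => ρ (x - y)) = fun y => D k ρ (x - y) := by
  ext y
  rw [D, D, iteratedDeriv_two_comp_sub]

/-- The mollified equation. -/
theorem molL_of_isNegDH {k : ℝ} {u w : L2} (h : IsNegDH k u w) {ρ : ℝ → ℂ} (hρ : IsTest ρ) :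
    molL (D k (D k ρ)) u + molL (D k ρ) u + molL (D k ρ) (mulV u) = -molL ρ w := by
  refine Lp.ext ?_
  filter_upwards [molL_ae ((hρ.D k).D k) u, molL_ae (hρ.D k) u, molL_ae (hρ.D k) (mulV u),
    molL_ae hρ w, Lp.coeFn_add (molL (D k (D k ρ)) u + molL (D k ρ) u) (molL (D k ρ) (mulV u)),
    Lp.coeFn_add (molL (D k (D k ρ)) u) (molL (D k ρ) u), Lp.coeFn_neg (molL ρ w)]
    with x h1 h2 h3 h4 h5 h6 h7
  rw [h5, Pi.add_apply, h6, Pi.add_apply, h7, Pi.neg_apply, h1, h2, h3, h4]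
  have hsm : ContDiff ℝ ∞ fun y => ρ (x - y) := hρ.smooth.comp (contDiff_const.sub contDiff_id)
  have hsu : HasCompactSupport fun y => ρ (x - y) :=
    hρ.supp.comp_homeomorph (Homeomorph.subLeft x)
  -- The weak equation is tested with y ↦ ρ(x-y); D has even order, so it commutes with this
  -- reflection.
  have h8 := h _ hsm hsu
  rw [D_comp_sub] at h8
  have e : ∀ y, u y * H k (fun y => D k ρ (x - y)) y = D k (D k ρ) (x - y) * u y +
      D k ρ (x - y) * u y + D k ρ (x - y) * ((V y : ℂ) * u y) := by
    intro y
    rw [H, D_comp_sub]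
    ring
  simp_rw [e] at h8
  have e2 : ∫ y, D k ρ (x - y) * mulV u y = ∫ y, D k ρ (x - y) * ((V y : ℂ) * u y) := by
    refine integral_congr_ae ?_
    filter_upwards [mulV_ae u] with y hy
    rw [hy]
  have i3 : Integrable fun y => D k ρ (x - y) * ((V y : ℂ) * u y) := by
    refine (integrable_mol (hρ.D k) (mulV u) x).congr ?_
    filter_upwards [mulV_ae u] with y hy
    rw [hy]
  have i1 := integrable_mol ((hρ.D k).D k) u x
  have i2 := integrable_mol (hρ.D k) u x
  have i12 : Integrable fun y => D k (D k ρ) (x - y) * u y + D k ρ (x - y) * u y := i1.add i2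
  rw [integral_add i12 i3, integral_add i1 i2] at h8
  simp only [mol]
  rw [e2, h8]
  congr 2; ext y
  ring

/-- There is a sequence of mollifiers. -/
theorem exists_mollifier : ∃ ρ : ℕ → ℝ → ℂ, (∀ n, IsTest (ρ n)) ∧
    ∀ f : L2, Tendsto (fun n => molL (ρ n) f) atTop (𝓝 f) := by
  let b : ContDiffBump (0 : ℝ) := ⟨1, 2, one_pos, one_lt_two⟩
  set φ₀ : ℝ → ℂ := fun x => (b.normed volume x : ℂ) with hφ₀
  have ht0 : IsTest φ₀ := ⟨Complex.ofRealCLM.contDiff.comp b.contDiff_normed,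
    b.hasCompactSupport_normed.comp_left (g := fun x : ℝ => (x : ℂ)) Complex.ofReal_zero⟩
  have hint0 : ∫ x, φ₀ x = 1 := by
    rw [hφ₀, integral_complex_ofReal, b.integral_normed]; rfl
  have hsupp0 : ∀ x, 2 ≤ |x| → φ₀ x = 0 := by
    intro x hx
    have : x ∉ Function.support (b.normed volume) := by
      rw [b.support_normed_eq, Metric.mem_ball, dist_zero_right, Real.norm_eq_abs, not_lt]
      exact hx
    simp only [hφ₀, Function.notMem_support.1 this, Complex.ofReal_zero]
  obtain ⟨C, hC, hb⟩ := ht0.exists_bound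
  set ρ : ℕ → ℝ → ℂ := fun n x => (((n : ℝ) + 1 : ℝ) : ℂ) * φ₀ (((n : ℝ) + 1) * x) with hρ
  have hm : ∀ n : ℕ, (0 : ℝ) < (n : ℝ) + 1 := fun n => by positivity
  have ht : ∀ n, IsTest (ρ n) := fun n => by
    have : IsTest fun x => φ₀ (((n : ℝ) + 1) * x) :=
      ⟨ht0.smooth.comp (contDiff_const.mul contDiff_id),
        ht0.supp.comp_homeomorph (Homeomorph.mulLeft₀ ((n : ℝ) + 1) (hm n).ne')⟩
    exact this.const_mul _
  have hker : ∀ n, IsExpKer (fun x y => ρ n (x - y)) (C * ((n : ℝ) + 1)) ((n : ℝ) + 1) := fun n => by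
    have hc := (ht n).smooth.continuous
    refine ⟨(by fun_prop : Continuous fun p : ℝ × ℝ => ρ n (p.1 - p.2)).measurable, hm n,
      fun x y => ?_⟩
    simp only [hρ]
    rw [norm_mul, Complex.norm_real, Real.norm_of_nonneg (hm n).le, mul_comm C, mul_assoc]
    have := hb (((n : ℝ) + 1) * (x - y))
    rw [abs_mul, abs_of_pos (hm n)] at this
    exact mul_le_mul_of_nonneg_left this (hm n).le
  -- Scaling multiplies both the height and the decay rate of the kernel by n + 1, so Schur's bound
  -- does not depend on n.
  have hnorm : ∀ n, ‖molL (ρ n)‖ ≤ 2 * C := fun n => by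
    rw [molL_eq (ht n) (hker n)]
    refine (hker n).norm_op_le.trans (le_of_eq ?_)
    have := (hm n).ne'
    field_simp
  have hint : ∀ n, ∫ x, ρ n x = 1 := fun n => by
    simp only [hρ]
    rw [integral_const_mul, Measure.integral_comp_mul_left φ₀, hint0, abs_inv, abs_of_pos (hm n)]
    have : (((n : ℝ) + 1 : ℝ) : ℂ) ≠ 0 := Complex.ofReal_ne_zero.2 (hm n).ne'
    rw [Complex.real_smul, mul_one, Complex.ofReal_inv, mul_inv_cancel₀ this]
  have hint' : ∀ n, ∫ x, ‖ρ n x‖ = ∫ x, ‖φ₀ x‖ := fun n => by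
    simp only [hρ, norm_mul]
    rw [integral_const_mul, Measure.integral_comp_mul_left (fun x => ‖φ₀ x‖), abs_inv,
      abs_of_pos (hm n), Complex.norm_real, Real.norm_of_nonneg (hm n).le, smul_eq_mul,
      ← mul_assoc, mul_inv_cancel₀ (hm n).ne', one_mul]
  refine ⟨ρ, ht, fun f => ?_⟩
  have htest : ∀ φ : ℝ → ℂ, ∀ h : IsTest φ,
      Tendsto (fun n => molL (ρ n) h.memLp.toLp) atTop (𝓝 h.memLp.toLp) := by
    intro φ h
    obtain ⟨B, hB, hφ'⟩ := h.deriv.exists_bound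
    set I := ∫ x, ‖φ₀ x‖ with hI
    have hI0 : 0 ≤ I := integral_nonneg fun x => norm_nonneg _
    have key : ∀ n : ℕ, ‖molL (ρ n) h.memLp.toLp - h.memLp.toLp‖ ≤
        (2 * B * Real.exp 2 * I) * (1 / ((n : ℝ) + 1)) := by
      intro n
      have h1 : (2 * B * Real.exp 2 * I) * (1 / ((n : ℝ) + 1)) =
          ((2 * B * Real.exp 2 * I) * (1 / ((n : ℝ) + 1))) / √1 := by simp
      rw [h1]
      have := hm n
      refine norm_le_of_ae_bound (by positivity) one_pos ?_
      filter_upwards [Lp.coeFn_sub (molL (ρ n) h.memLp.toLp) h.memLp.toLp,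
        molL_ae (ht n) h.memLp.toLp, h.memLp.coeFn_toLp] with x h2 h3 h4
      rw [h2, Pi.sub_apply, h3, h4]
      have e1 : mol (ρ n) (h.memLp.toLp φ) x = ∫ y, ρ n (x - y) * φ y := by
        refine integral_congr_ae ?_
        filter_upwards [h.memLp.coeFn_toLp] with y hy
        rw [hy]
      have i1 : Integrable fun y => ρ n (x - y) * φ y := by
        refine (integrable_mol (ht n) h.memLp.toLp x).congr ?_
        filter_upwards [h.memLp.coeFn_toLp] with y hy
        rw [hy]
      have i2 : Integrable fun y => ρ n (x - y) := (ht n).integrable.comp_sub_left x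
      have e2 : ∫ y, ρ n (x - y) = 1 := by
        rw [integral_sub_left_eq_self (ρ n) volume x, hint]
      have e3 : mol (ρ n) (h.memLp.toLp φ) x - φ x = ∫ y, ρ n (x - y) * (φ y - φ x) := by
        rw [e1]
        conv_lhs => rw [← one_mul (φ x), ← e2, ← integral_mul_const]
        rw [← integral_sub i1 (i2.mul_const _)]
        congr 1; ext y
        ring
      rw [e3]
      refine (norm_integral_le_of_norm_le (i2.norm.mul_const
        (2 * (1 / ((n : ℝ) + 1)) * (B * Real.exp 2 * Real.exp (-|x|))))
        (Eventually.of_forall fun y => ?_)).trans (le_of_eq ?_)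
      · rw [norm_mul]
        rcases le_or_gt 2 |((n : ℝ) + 1) * (x - y)| with h5 | h5
        · have : ρ n (x - y) = 0 := by simp only [hρ, hsupp0 _ h5, mul_zero]
          simp [this]
        · refine mul_le_mul_of_nonneg_left ?_ (norm_nonneg _)
          rw [abs_mul, abs_of_pos (hm n)] at h5
          have h6 : |x - y| ≤ 2 * (1 / ((n : ℝ) + 1)) := by
            rw [mul_one_div, le_div_iff₀ (hm n)]
            linarith
          have h7 : |x - y| ≤ 2 := by
            refine h6.trans ?_
            have : 1 / ((n : ℝ) + 1) ≤ 1 := by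
              rw [div_le_one (hm n)]
              have := Nat.cast_nonneg (α := ℝ) n
              linarith
            linarith
          have h8 := Convex.norm_image_sub_le_of_norm_deriv_le (𝕜 := ℝ) (f := φ)
            (C := B * Real.exp 2 * Real.exp (-|x|)) (s := Metric.closedBall x 2) (x := x) (y := y)
            (fun z _ => (h.smooth.differentiable (by norm_num)).differentiableAt)
            (fun z hz => by
              refine (hφ' z).trans ?_
              rw [mul_assoc, ← Real.exp_add]
              gcongr
              rw [Metric.mem_closedBall, Real.dist_eq] at hz
              have := abs_sub_abs_le_abs_sub x z
              rw [abs_sub_comm] at this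
              linarith) (convex_closedBall x 2) (Metric.mem_closedBall_self (by norm_num))
            (by rw [Metric.mem_closedBall, Real.dist_eq, abs_sub_comm]; exact h7)
          rw [Real.norm_eq_abs, abs_sub_comm] at h8
          refine h8.trans ?_
          rw [mul_comm]
          gcongr
      · rw [integral_mul_const, integral_sub_left_eq_self (fun z => ‖ρ n z‖) volume x, hint', one_mul]
        ring
    rw [tendsto_iff_norm_sub_tendsto_zero]
    refine squeeze_zero (fun n => norm_nonneg _) key ?_
    simpa using (tendsto_one_div_add_atTop_nhds_zero_nat (𝕜 := ℝ)).const_mul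
      (2 * B * Real.exp 2 * I)
  rw [Metric.tendsto_atTop]
  intro ε hε
  have hd := Lp.dense_hasCompactSupport_contDiff (E := ℝ) (F := ℂ) (μ := volume) (p := 2) (by simp)
  obtain ⟨v, ⟨φ, hφv, hφs, hφc⟩, hv⟩ := hd.exists_dist_lt f (ε := ε / (2 * (2 * C + 1)))
    (by positivity)
  have hφ : IsTest φ := ⟨hφc, hφs⟩
  have hv' : v = hφ.memLp.toLp := Lp.ext (hφv.trans hφ.memLp.coeFn_toLp.symm)
  obtain ⟨N, hN⟩ := (Metric.tendsto_atTop.1 (htest φ hφ)) (ε / 2) (half_pos hε)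
  refine ⟨N, fun n hn => ?_⟩
  have h1 := hN n hn
  rw [← hv'] at h1
  rw [dist_eq_norm] at *
  have e : molL (ρ n) f - f = molL (ρ n) (f - v) + (molL (ρ n) v - v) - (f - v) := by
    rw [map_sub]; abel
  have h2 : ‖molL (ρ n) (f - v)‖ ≤ 2 * C * ‖f - v‖ :=
    ContinuousLinearMap.le_of_opNorm_le _ (hnorm n) _
  rw [e]
  have h3 : (2 * C + 1) * ‖f - v‖ < ε / 2 := by
    rw [lt_div_iff₀ (by positivity)] at hv
    linarith
  have h4 := norm_sub_le (molL (ρ n) (f - v) + (molL (ρ n) v - v)) (f - v)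
  have h5 := norm_add_le (molL (ρ n) (f - v)) (molL (ρ n) v - v)
  linarith

/-! ### Identification of the generator. -/

/-- Pairing the mollified equation with the mollified u gives l‖u‖² + ‖Du‖² ≤ ‖Du‖‖Vu‖, hence l‖u‖²
≤ ‖Vu‖²/4 ≤ (9/16)‖u‖² in the limit, because |V| ≤ 3/2. This forces u = 0 as soon as l ≥ 1. -/
theorem eq_zero_of_isNegDH {k l : ℝ} (hl : 1 ≤ l) {u : L2} (h : IsNegDH k u ((l : ℂ) • u)) :
    u = 0 := by
  have key : ∀ ρ : ℝ → ℂ, IsTest ρ → l * ‖molL ρ u‖ ^ 2 ≤ 1 / 4 * ‖molL ρ (mulV u)‖ ^ 2 := by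
    intro ρ hρ
    have h1 := congrArg (fun X => (inner ℂ (molL ρ u) X : ℂ)) (molL_of_isNegDH h hρ)
    simp only [inner_add_right, inner_neg_right, map_smul, inner_smul_right] at h1
    rw [← inner_molL_D k hρ (hρ.D k), ← inner_molL_D k hρ hρ, ← inner_molL_D k hρ hρ,
      inner_molL_D_self k hρ, inner_self_eq_norm_sq_to_K, inner_self_eq_norm_sq_to_K] at h1
    set E := molL (D k ρ) u
    set F := molL ρ (mulV u)
    have h2 := congrArg Complex.re h1
    have h3 : |(inner ℂ E F : ℂ).re| ≤ ‖E‖ * ‖F‖ :=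
      (Complex.abs_re_le_norm _).trans (norm_inner_le_norm E F)
    have h4 := (abs_le.1 h3).1
    simp only [Complex.add_re, Complex.neg_re, Complex.coe_algebraMap, Complex.ofReal_re,
      ← Complex.ofReal_pow, Complex.re_ofReal_mul] at h2
    have h5 : 0 ≤ k ^ 2 * ‖molL ρ u‖ ^ 2 := by positivity
    nlinarith [sq_nonneg (‖E‖ - ‖F‖ / 2), sq_nonneg ‖molL (deriv ρ) u‖]
  obtain ⟨ρ, ht, hlim⟩ := exists_mollifier
  have h1 : l * ‖u‖ ^ 2 ≤ 1 / 4 * ‖mulV u‖ ^ 2 :=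
    le_of_tendsto_of_tendsto' (((hlim u).norm.pow 2).const_mul l)
      (((hlim (mulV u)).norm.pow 2).const_mul (1 / 4)) fun n => key _ (ht n)
  have h2 := norm_mulV_le u
  have h3 : ‖mulV u‖ ^ 2 ≤ 9 / 4 * ‖u‖ ^ 2 := by
    calc _ ≤ (3 / 2 * ‖u‖) ^ 2 := by gcongr
      _ = _ := by ring
  have h4 : ‖u‖ ^ 2 ≤ l * ‖u‖ ^ 2 := le_mul_of_one_le_left (by positivity) hl
  have h5 : ‖u‖ ^ 2 ≤ 0 := by nlinarith [sq_nonneg ‖u‖]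
  exact norm_eq_zero.1 (pow_eq_zero_iff two_ne_zero |>.1 (le_antisymm h5 (sq_nonneg _)))

theorem IsNegDH.sub {k : ℝ} {u w u' w' : L2} (h : IsNegDH k u w) (h' : IsNegDH k u' w') :
    IsNegDH k (u - u') (w - w') := by
  intro φ hφ hs
  have hT : IsTest φ := ⟨hφ, hs⟩
  have hHD : IsTest (H k (D k φ)) :=
    (((hT.D k).D k).add (hT.D k)).add ((hT.D k).smooth_mul contDiff_V)
  have e : ∀ (a b : L2) (ψ : ℝ → ℂ), IsTest ψ → ∫ x, (a - b : L2) x * ψ x =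
      (∫ x, a x * ψ x) - ∫ x, b x * ψ x := by
    intro a b ψ hψ
    rw [integral_mul_toLp _ hψ, integral_mul_toLp _ hψ, integral_mul_toLp _ hψ, inner_sub_right]
  rw [e _ _ _ hHD, e _ _ _ hT, h φ hφ hs, h' φ hφ hs]
  ring

theorem isC0Semigroup_semigroup (k : ℝ) : IsC0Semigroup (semigroup k) :=
  ⟨semigroup_zero k, fun _ _ => semigroup_add k, tendsto_semigroup k⟩

/-- The generator of the semigroup is `-D_k H_k`. -/
theorem generates_semigroup_iff (k : ℝ) (u w : L2) :
    Generates (semigroup k) u w ↔ IsNegDH k u w := by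
  refine ⟨isNegDH_of_tendsto k, fun h => ?_⟩
  -- With l = max l₁ 1 the resolvent equation lv - z = lu - w has a solution v in the domain of the
  -- generator. Then u - v is an eigenvector of -D H for the eigenvalue l, so u = v and w = z.
  obtain ⟨l₁, hl₁⟩ := (isC0Semigroup_semigroup k).exists_resolvent
  obtain ⟨v, z, hv, he⟩ := hl₁ (max l₁ 1) (le_max_left _ _) (max l₁ 1 • u - w)
  have h1 := h.sub (isNegDH_of_tendsto k hv)
  have e : w - z = ((max l₁ 1 : ℝ) : ℂ) • (u - v) := by
    have e1 : ((max l₁ 1 : ℝ) : ℂ) • (u - v) = max l₁ 1 • (u - v) := Complex.coe_smul _ _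
    rw [e1, smul_sub]
    have : z = max l₁ 1 • v - (max l₁ 1 • u - w) := by rw [← he]; abel
    rw [this]; abel
  rw [e] at h1
  have h2 := sub_eq_zero.1 (eq_zero_of_isNegDH (le_max_right _ _) h1)
  rw [h2, sub_self, smul_zero, sub_eq_zero] at e
  rw [h2, e]
  exact hv

theorem isC0SemigroupWithGenerator_semigroup (k : ℝ) :
    IsC0SemigroupWithGenerator (semigroup k) (IsNegDH k) :=
  ⟨semigroup_zero k, fun _ _ => semigroup_add k, tendsto_semigroup k, generates_semigroup_iff k⟩

theorem isSemigroupKernel_kerK (k : ℝ) : IsSemigroupKernel k fun x y t => kerK k x y t :=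
  ⟨semigroup k, isC0SemigroupWithGenerator_semigroup k, fun t ht => ⟨continuous_kerK k ht, fun f => by
    filter_upwards [semigroup_ae k ht f] with x hx
    exact ⟨(isExpKer_kerK k ht).integrable f x, hx⟩⟩⟩

/-- The semigroup generated by `-D_k H_k` is unique. -/
theorem eq_semigroup {k : ℝ} {T : ℝ → L2 →L[ℂ] L2}
    (h : IsC0SemigroupWithGenerator T (IsNegDH k)) {t : ℝ} (ht : 0 ≤ t) : T t = semigroup k t :=
  (isC0Semigroup_semigroup k).eq_of_generates ⟨h.map_zero, h.map_add, h.tendsto_zero⟩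
    (fun u w => (generates_semigroup_iff k u w).trans (h.generator u w).symm) ht


/-! ### Uniqueness of the integral kernel. -/

theorem eq_zero_of_integral_eq_zero {d : ℝ → ℂ} (hd : Continuous d)
    (h : ∀ a b : ℝ, a ≤ b → ∫ y in a..b, d y = 0) (y : ℝ) : d y = 0 := by
  have h1 : HasDerivAt (fun b => ∫ z in (y - 1)..b, d z) (d y) y :=
    intervalIntegral.integral_hasDerivAt_right (hd.intervalIntegrable _ _)
      (hd.stronglyMeasurableAtFilter _ _) hd.continuousAt
  have h2 : (fun b => ∫ z in (y - 1)..b, d z) =ᶠ[𝓝 y] fun _ => 0 := by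
    filter_upwards [eventually_gt_nhds (sub_one_lt y)] with b hb
    exact h _ _ hb.le
  have h3 := h1.congr_of_eventuallyEq h2.symm
  exact h3.unique (hasDerivAt_const y 0)

/-- The integral kernel of the semigroup is unique. -/
theorem IsSemigroupKernel.eq_kerK {k : ℝ} {K : ℝ → ℝ → ℝ → ℂ} (h : IsSemigroupKernel k K)
    (x y : ℝ) {t : ℝ} (ht : 0 < t) : K x y t = kerK k x y t := by
  obtain ⟨T, hT, hK⟩ := h
  obtain ⟨hc, hf⟩ := hK t ht
  have hc' := continuous_kerK k ht
  have hcd : Continuous fun p : ℝ × ℝ => K p.1 p.2 t - kerK k p.1 p.2 t := hc.sub hc'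
  have key : ∀ a b : ℝ, a ≤ b → ∀ x, ∫ y in a..b, (K x y t - kerK k x y t) = 0 := by
    intro a b hab
    -- Indicators of intervals as inputs compare the integrals of the two kernels over [a, b] for
    -- almost every x. These integrals are continuous in x, so they agree for every x.
    set f : L2 := indicatorConstLp 2 (measurableSet_Ioc (a := a) (b := b)) (by simp) (1 : ℂ)
      with hfd
    have hcx : Continuous fun x => ∫ y in a..b, (K x y t - kerK k x y t) :=
      intervalIntegral.continuous_parametric_intervalIntegral_of_continuous' hcd a b
    have hae : (fun x => ∫ y in a..b, (K x y t - kerK k x y t)) =ᵐ[volume] fun _ => (0 : ℂ) := by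
      filter_upwards [hf f, semigroup_ae k ht f] with x hx hx'
      rw [eq_semigroup hT ht.le, hx'] at hx
      have e : ∀ P : ℝ → ℂ, ∫ y, P y * f y = ∫ y in a..b, P y := by
        intro P
        rw [intervalIntegral.integral_of_le hab, ← integral_indicator measurableSet_Ioc]
        refine integral_congr_ae ?_
        filter_upwards [indicatorConstLp_coeFn (p := 2) (hs := measurableSet_Ioc (a := a) (b := b))
          (hμs := by simp) (c := (1 : ℂ))] with y hy
        rw [hfd, hy]
        by_cases hm : y ∈ Set.Ioc a b <;> simp [hm]
      rw [e, e] at hx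
      have c1 : Continuous fun y => K x y t := hc.comp (f := fun y : ℝ => (x, y)) (by fun_prop)
      rw [intervalIntegral.integral_sub (c1.intervalIntegrable _ _)
        ((continuous_kerK_right k x ht).intervalIntegrable _ _), ← hx.2, sub_self]
    exact fun x => congrFun ((hcx.ae_eq_iff_eq volume continuous_const).1 hae) x
  have c2 : Continuous fun y => K x y t - kerK k x y t :=
    hcd.comp (f := fun y : ℝ => (x, y)) (by fun_prop)
  exact sub_eq_zero.1 (eq_zero_of_integral_eq_zero c2 (fun a b hab => key a b hab x) y)

theorem S_eq_kerS {K : ℝ → ℝ → ℝ → ℝ → ℂ} {k : ℝ}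
    (h : IsSemigroupKernel k fun x y t => K x y k t) (x y : ℝ) {t : ℝ} (ht : 0 < t) :
    S K x y k t = kerS k x y t := by
  rw [← S_kerK k x y ht, S, S]
  have e : (fun y' => K x y' k t) = fun y' => kerK k x y' t :=
    funext fun y' => IsSemigroupKernel.eq_kerK h x y' ht
  rw [e, IsSemigroupKernel.eq_kerK h x y ht]

/-! ### Estimates for short times and for large k. -/

/-- The estimates for short times. -/
theorem short_time_bounds : ∃ C : ℝ, 0 < C ∧ ∀ k t x y : ℝ, 0 < t → t < 1 →
    ‖kerK k x y t‖ ≤ C * Real.exp (-(1 / 2) * k ^ 4 * t) * t ^ (-(1 / 4) : ℝ) *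
      Real.exp (-(t ^ (-(1 / 4) : ℝ) * |x - y|)) ∧
    ‖kerS k x y t‖ ≤ C * Real.exp (-(1 / 2) * k ^ 4 * t) * t ^ (-(3 / 4) : ℝ) *
      Real.exp (-(t ^ (-(1 / 4) : ℝ) * |x - y|)) := by
  have hC := C₀_pos
  have hC1 := C₁_pos
  set L := Real.exp |Λ₀ + l₀ + 1| with hL
  refine ⟨(C₁ + 2 * C₀) * L, by positivity, fun k t x y ht ht1 => ?_⟩
  have q1 : 0 < t ^ (-(1 / 4) : ℝ) := Real.rpow_pos_of_pos ht _
  have q3 : 0 < t ^ (-(3 / 4) : ℝ) := Real.rpow_pos_of_pos ht _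
  have hk : 0 ≤ k ^ 4 := by positivity
  have e1 : Real.exp ((kap k + 1) * t) ≤ L * Real.exp (-(1 / 2) * k ^ 4 * t) := by
    rw [hL, ← Real.exp_add, Real.exp_le_exp]
    have h1 : (Λ₀ + l₀ + 1) * t ≤ |Λ₀ + l₀ + 1| := by
      calc (Λ₀ + l₀ + 1) * t ≤ |Λ₀ + l₀ + 1| * t := by gcongr; exact le_abs_self _
        _ ≤ _ := mul_le_of_le_one_right (abs_nonneg _) ht1.le
    have h2 := mul_nonneg hk ht.le
    unfold kap
    nlinarith
  have e2 : Real.exp (-(rate t * |x - y|)) ≤ Real.exp (-(t ^ (-(1 / 4) : ℝ) * |x - y|)) := by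
    rw [Real.exp_le_exp, neg_le_neg_iff]
    gcongr
    exact rpow_neg_quarter_le_rate t
  have e3 : Real.exp (kap k * t) ≤ L * Real.exp (-(1 / 2) * k ^ 4 * t) := by
    refine le_trans ?_ e1
    rw [Real.exp_le_exp]
    linarith
  constructor
  · refine (norm_kerK_le k x y ht).trans ?_
    calc _ ≤ C₁ * (L * Real.exp (-(1 / 2) * k ^ 4 * t)) * t ^ (-(1 / 4) : ℝ) *
          Real.exp (-(t ^ (-(1 / 4) : ℝ) * |x - y|)) := by gcongr
      _ = C₁ * L * (Real.exp (-(1 / 2) * k ^ 4 * t) * t ^ (-(1 / 4) : ℝ) *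
          Real.exp (-(t ^ (-(1 / 4) : ℝ) * |x - y|))) := by ring
      _ ≤ (C₁ + 2 * C₀) * L * (Real.exp (-(1 / 2) * k ^ 4 * t) * t ^ (-(1 / 4) : ℝ) *
          Real.exp (-(t ^ (-(1 / 4) : ℝ) * |x - y|))) := by gcongr; linarith
      _ = _ := by ring
  · refine (norm_kerS_le k x y t ht).trans ?_
    calc _ ≤ 2 * C₀ * (L * Real.exp (-(1 / 2) * k ^ 4 * t)) * t ^ (-(3 / 4) : ℝ) *
          Real.exp (-(t ^ (-(1 / 4) : ℝ) * |x - y|)) := by gcongr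
      _ = 2 * C₀ * L * (Real.exp (-(1 / 2) * k ^ 4 * t) * t ^ (-(3 / 4) : ℝ) *
          Real.exp (-(t ^ (-(1 / 4) : ℝ) * |x - y|))) := by ring
      _ ≤ (C₁ + 2 * C₀) * L * (Real.exp (-(1 / 2) * k ^ 4 * t) * t ^ (-(3 / 4) : ℝ) *
          Real.exp (-(t ^ (-(1 / 4) : ℝ) * |x - y|))) := by gcongr; linarith
      _ = _ := by ring

/-- The estimates for large times and large `k`. -/
theorem large_k_bounds {k t : ℝ} (x y : ℝ) (hk : 4 * (Λ₀ + l₀ + 1) ≤ k ^ 4) (ht : 1 < t) :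
    ‖kerK k x y t‖ ≤ (C₁ + 2 * C₀) * Real.exp (-(1 / 2) * k ^ 4 * t) * Real.exp (-|x - y|) ∧
    ‖kerS k x y t‖ ≤ (C₁ + 2 * C₀) * Real.exp (-(1 / 2) * k ^ 4 * t) * Real.exp (-|x - y|) := by
  have hC := C₀_pos
  have hC1 := C₁_pos
  have ht0 : 0 < t := by linarith
  -- The margin k⁴/4 between the rates 3/4 and 1/2 covers the whole growth constant.
  have e0 : kap k + 1 ≤ -(1 / 2) * k ^ 4 := by unfold kap; linarith
  have e1 : Real.exp ((kap k + 1) * t) ≤ Real.exp (-(1 / 2) * k ^ 4 * t) := by gcongr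
  have e3 : Real.exp (kap k * t) ≤ Real.exp (-(1 / 2) * k ^ 4 * t) := by
    gcongr
    linarith
  have e2 : Real.exp (-(rate t * |x - y|)) ≤ Real.exp (-|x - y|) := by
    rw [Real.exp_le_exp, neg_le_neg_iff]
    exact le_mul_of_one_le_left (abs_nonneg _) (one_le_rate ht0)
  have q1 : t ^ (-(1 / 4) : ℝ) ≤ 1 := Real.rpow_le_one_of_one_le_of_nonpos ht.le (by norm_num)
  have q3 : t ^ (-(3 / 4) : ℝ) ≤ 1 := Real.rpow_le_one_of_one_le_of_nonpos ht.le (by norm_num)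
  have q1' : 0 < t ^ (-(1 / 4) : ℝ) := Real.rpow_pos_of_pos ht0 _
  have q3' : 0 < t ^ (-(3 / 4) : ℝ) := Real.rpow_pos_of_pos ht0 _
  constructor
  · refine (norm_kerK_le k x y ht0).trans ?_
    calc _ ≤ C₁ * Real.exp (-(1 / 2) * k ^ 4 * t) * 1 * Real.exp (-|x - y|) := by gcongr
      _ ≤ _ := by rw [mul_one]; gcongr; linarith
  · refine (norm_kerS_le k x y t ht0).trans ?_
    calc _ ≤ 2 * C₀ * Real.exp (-(1 / 2) * k ^ 4 * t) * 1 * Real.exp (-|x - y|) := by gcongr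
      _ ≤ _ := by rw [mul_one]; gcongr; linarith


/-! ### The weak norm ‖(∂+k)⁻¹u‖ and dissipativity. -/

/-- The kernel of `(∂ + k)⁻¹`. -/
def lker (k x y : ℝ) : ℂ := if y < x then (Real.exp (-(k * (x - y))) : ℂ) else 0

theorem isExpKer_lker {k : ℝ} (hk : 0 < k) : IsExpKer (lker k) 1 k := by
  refine ⟨?_, hk, fun x y => ?_⟩
  · refine Measurable.ite (measurableSet_lt measurable_snd measurable_fst) ?_ measurable_const
    exact (by fun_prop : Continuous fun p : ℝ × ℝ =>
      (Real.exp (-(k * (p.1 - p.2))) : ℂ)).measurable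
  · rw [lker, one_mul]
    split_ifs with h
    · rw [Complex.norm_real, Real.norm_of_nonneg (Real.exp_pos _).le, abs_of_pos (sub_pos.2 h)]
    · rw [norm_zero]; positivity

open Classical in
/-- The operator `(∂ + k)⁻¹` on `L²(ℝ)`. -/
def opL (k : ℝ) : L2 →L[ℂ] L2 := if hk : 0 < k then (isExpKer_lker hk).op else 0

theorem opL_eq {k : ℝ} (hk : 0 < k) : opL k = (isExpKer_lker hk).op := dif_pos hk

theorem IsTest.comp_sub {ρ : ℝ → ℂ} (h : IsTest ρ) (y : ℝ) : IsTest fun z => ρ (z - y) :=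
  ⟨h.smooth.comp (contDiff_id.sub contDiff_const), h.supp.comp_homeomorph (Homeomorph.subRight y)⟩

/-- The function `ρ' + k ρ`. -/
def shiftD (k : ℝ) (ρ : ℝ → ℂ) : ℝ → ℂ := fun x => deriv ρ x + (k : ℂ) * ρ x

theorem IsTest.shiftD {ρ : ℝ → ℂ} (h : IsTest ρ) (k : ℝ) : IsTest (shiftD k ρ) :=
  h.deriv.add (h.const_mul _)

/-- e^{kz}(ρ' + kρ) is the derivative of e^{kz}ρ, which vanishes at -∞. -/
theorem integral_lker_mul (k : ℝ) {ρ : ℝ → ℂ} (h : IsTest ρ) (x y : ℝ) :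
    ∫ z, lker k x z * shiftD k ρ (z - y) = ρ (x - y) := by
  set f : ℝ → ℂ := fun z => (Real.exp (-(k * (x - z))) : ℂ) * ρ (z - y) with hf
  have hexp : ContDiff ℝ ∞ fun z : ℝ => (Real.exp (-(k * (x - z))) : ℂ) :=
    Complex.ofRealCLM.contDiff.comp (f := fun z : ℝ => Real.exp (-(k * (x - z)))) (by fun_prop)
  have hft : IsTest f := (h.comp_sub y).smooth_mul hexp
  have h1 := HasCompactSupport.integral_Iic_deriv_eq (hft.smooth.of_le (by norm_num)) hft.supp x
  have hfx : f x = ρ (x - y) := by simp [hf]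
  rw [hfx] at h1
  rw [← h1, integral_Iic_eq_integral_Iio, ← integral_indicator measurableSet_Iio]
  congr 1; ext z
  have hd : HasDerivAt f ((Real.exp (-(k * (x - z))) : ℂ) * shiftD k ρ (z - y)) z := by
    have d1 : HasDerivAt (fun z : ℝ => Real.exp (-(k * (x - z))))
        (Real.exp (-(k * (x - z))) * k) z := by
      have := (((hasDerivAt_id z).const_sub x).const_mul k).neg.exp
      simpa using! this
    have d2 : HasDerivAt (fun z => ρ (z - y)) (deriv ρ (z - y)) z := by
      have d3 := (h.smooth.differentiable (by norm_num) (z - y)).hasDerivAt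
      have := d3.scomp z ((hasDerivAt_id z).sub_const y)
      simpa using! this
    refine (d1.ofReal_comp.mul d2).congr_deriv ?_
    rw [shiftD]
    push_cast
    ring
  rw [lker, Set.indicator_apply]
  simp only [Set.mem_Iio]
  by_cases hz : z < x
  · rw [if_pos hz, if_pos hz, hd.deriv]
  · rw [if_neg hz, if_neg hz, zero_mul]

theorem integral_mul_lker (k : ℝ) (ρ : ℝ → ℂ) (x y : ℝ) :
    ∫ z, ρ (x - z) * lker k z y = ∫ z, lker k x z * ρ (z - y) := by
  rw [← integral_sub_left_eq_self _ volume (x + y)]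
  congr 1; ext z
  have e : lker k (x + y - z) y = lker k x z := by
    unfold lker
    have e1 : y < x + y - z ↔ z < x := by constructor <;> intro h <;> linarith
    simp only [e1, show x + y - z - y = x - z by ring]
  rw [e, show x - (x + y - z) = z - y by ring, mul_comm]

theorem opL_molL_shiftD {k : ℝ} (hk : 0 < k) {ρ : ℝ → ℂ} (h : IsTest ρ) (f : L2) :
    opL k (molL (shiftD k ρ) f) = molL ρ f := by
  obtain ⟨C, hC⟩ := h.exists_isExpKer
  obtain ⟨C', hC'⟩ := (h.shiftD k).exists_isExpKer
  rw [opL_eq hk, molL_eq h hC, molL_eq (h.shiftD k) hC', ← ContinuousLinearMap.comp_apply,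
    IsExpKer.op_comp_op _ _ hC fun x y => integral_lker_mul k h x y]

theorem molL_opL {k : ℝ} (hk : 0 < k) {ρ : ℝ → ℂ} (h : IsTest ρ) (f : L2) :
    molL ρ (opL k f) = opL k (molL ρ f) := by
  obtain ⟨C, hC⟩ := h.exists_isExpKer
  rw [opL_eq hk, molL_eq h hC]
  refine Lp.ext ?_
  filter_upwards [hC.op_op_ae (isExpKer_lker hk) f, (isExpKer_lker hk).op_op_ae hC f]
    with x h1 h2
  rw [h1, h2]
  simp_rw [integral_mul_lker]

theorem molL_shiftD (k : ℝ) {ρ : ℝ → ℂ} (h : IsTest ρ) (f : L2) :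
    molL (shiftD k ρ) f = molL (deriv ρ) f + (k : ℂ) • molL ρ f := by
  rw [← molL_const_mul h, ← molL_add h.deriv (h.const_mul _)]
  rfl

/-- The operator norm of `(∂ + k)⁻¹` is at most `1 / k`. -/
theorem norm_opL_le {k : ℝ} (hk : 0 < k) (f : L2) : k ^ 2 * ‖opL k f‖ ^ 2 ≤ ‖f‖ ^ 2 := by
  have key : ∀ ρ : ℝ → ℂ, IsTest ρ → k ^ 2 * ‖molL ρ (opL k f)‖ ^ 2 ≤ ‖molL ρ f‖ ^ 2 := by
    intro ρ h
    have e : molL ρ f = molL (deriv ρ) (opL k f) + (k : ℂ) • molL ρ (opL k f) := by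
      rw [← molL_shiftD k h, molL_opL hk (h.shiftD k), opL_molL_shiftD hk h]
    have h1 := inner_molL_deriv h h (opL k f) (opL k f)
    -- ⟨v', v⟩ is purely imaginary, so ‖v' + kv‖² = ‖v'‖² + k²‖v‖².
    have h2 : (inner ℂ (molL (deriv ρ) (opL k f)) (molL ρ (opL k f)) : ℂ).re = 0 := by
      have h3 := congrArg Complex.re h1
      rw [Complex.neg_re] at h3
      have h4 : (inner ℂ (molL ρ (opL k f)) (molL (deriv ρ) (opL k f)) : ℂ).re =
          (inner ℂ (molL (deriv ρ) (opL k f)) (molL ρ (opL k f)) : ℂ).re :=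
        inner_re_symm (𝕜 := ℂ) _ _
      linarith
    rw [e]
    have h5 := norm_add_sq (𝕜 := ℂ) (molL (deriv ρ) (opL k f)) ((k : ℂ) • molL ρ (opL k f))
    rw [inner_smul_right, norm_smul, Complex.norm_real, Real.norm_of_nonneg hk.le] at h5
    simp only [RCLike.re_to_complex, Complex.re_ofReal_mul, h2] at h5
    rw [h5]
    nlinarith [sq_nonneg ‖molL (deriv ρ) (opL k f)‖]
  obtain ⟨ρ, ht, hlim⟩ := exists_mollifier
  exact le_of_tendsto_of_tendsto' (((hlim (opL k f)).norm.pow 2).const_mul (k ^ 2))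
    ((hlim f).norm.pow 2) fun n => key _ (ht n)

theorem D_eq_shiftD (k : ℝ) {σ : ℝ → ℂ} (h : IsTest σ) :
    D k σ = shiftD k (fun x => -deriv σ x + (k : ℂ) * σ x) := by
  ext x
  have h1 := (h.deriv.smooth.differentiable (by norm_num) x).hasDerivAt
  have h2 := (h.smooth.differentiable (by norm_num) x).hasDerivAt
  have h3 : deriv (fun x => -deriv σ x + (k : ℂ) * σ x) x =
      -deriv (deriv σ) x + (k : ℂ) * deriv σ x := (h1.neg.add (h2.const_mul (k : ℂ))).deriv
  rw [D_eq, shiftD, h3]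
  ring

/-- D = (∂+k)(-∂+k), and -∂+k is the adjoint of ∂+k. Thus ⟨(∂+k)⁻¹·, (∂+k)⁻¹·⟩ is the form of D⁻¹,
and it cancels the outer factor D of D H. -/
theorem inner_opL_molL_D {k : ℝ} (hk : 0 < k) {ρ σ : ℝ → ℂ} (hρ : IsTest ρ) (hσ : IsTest σ)
    (f u : L2) : inner ℂ (opL k (molL (D k σ) f)) (opL k (molL ρ u)) =
      inner ℂ (molL σ f) (molL ρ u) := by
  have ht : IsTest fun x => -deriv σ x + (k : ℂ) * σ x := hσ.deriv.neg.add (hσ.const_mul _)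
  have e : molL ρ u = molL (shiftD k ρ) (opL k u) := by
    rw [molL_opL hk (hρ.shiftD k), opL_molL_shiftD hk hρ]
  rw [D_eq_shiftD k hσ, opL_molL_shiftD hk ht, molL_add hσ.deriv.neg (hσ.const_mul _),
    molL_neg hσ.deriv, molL_const_mul hσ, ← molL_opL hk hρ]
  conv_rhs => rw [e, molL_shiftD k hρ, inner_add_right, inner_smul_right]
  rw [inner_add_left, inner_neg_left, inner_molL_deriv hσ hρ, inner_smul_left]
  simp

/-- With τ = tanh(x/2) this is 1 + V = τ² - τ', the identity behind the factorization (-∂ + τ)(∂ +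
τ). -/
theorem one_add_V_sub (x : ℝ) :
    1 + V x - Real.tanh (x / 2) ^ 2 = -(1 / 2 * (Real.cosh (x / 2) ^ 2)⁻¹) := by
  have h := Real.cosh_sq (x / 2)
  have hc := (Real.cosh_pos (x / 2)).ne'
  rw [V, Real.tanh_eq_sinh_div_cosh]
  field_simp
  linarith

theorem hasDerivAt_tanh_half (x : ℝ) :
    HasDerivAt (fun x : ℝ => Real.tanh (x / 2)) (1 / 2 * (Real.cosh (x / 2) ^ 2)⁻¹) x := by
  have h1 : HasDerivAt (fun x : ℝ => x / 2) (1 / 2) x := (hasDerivAt_id x).div_const 2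
  have hc := (Real.cosh_pos (x / 2)).ne'
  have h2 : HasDerivAt (fun x : ℝ => Real.sinh (x / 2) / Real.cosh (x / 2)) _ x :=
    h1.sinh.div h1.cosh hc
  simp_rw [Real.tanh_eq_sinh_div_cosh]
  refine h2.congr_deriv ?_
  have h := Real.cosh_sq (x / 2)
  field_simp
  linarith

theorem abs_tanh_le (x : ℝ) : |Real.tanh x| ≤ 1 := (Real.abs_tanh_lt_one x).le

/-- Nonnegativity of the operator `-∂² + 1 + V`. -/
theorem energy_nonneg {ρ : ℝ → ℂ} (h : IsTest ρ) (u : L2) :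
    0 ≤ ‖molL (deriv ρ) u‖ ^ 2 + ‖molL ρ u‖ ^ 2 + (inner ℂ (mulV (molL ρ u)) (molL ρ u) : ℂ).re := by
  set U := mol ρ u with hU
  set U' := mol (deriv ρ) u with hU'
  have m0 : MemLp U 2 := memLp_mol h u
  have m1 : MemLp U' 2 := memLp_mol h.deriv u
  have i0 : Integrable fun x => ‖U x‖ ^ 2 := (memLp_two_iff_integrable_sq_norm m0.1).1 m0
  have i1 : Integrable fun x => ‖U' x‖ ^ 2 := (memLp_two_iff_integrable_sq_norm m1.1).1 m1
  have n0 : ‖molL ρ u‖ ^ 2 = ∫ x, ‖U x‖ ^ 2 := by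
    rw [norm_sq_L2]
    refine integral_congr_ae ?_
    filter_upwards [molL_ae h u] with x hx
    rw [hx]
  have n1 : ‖molL (deriv ρ) u‖ ^ 2 = ∫ x, ‖U' x‖ ^ 2 := by
    rw [norm_sq_L2]
    refine integral_congr_ae ?_
    filter_upwards [molL_ae h.deriv u] with x hx
    rw [hx]
  have iV : Integrable fun x => V x * ‖U x‖ ^ 2 := by
    refine i0.bdd_mul (c := 3 / 2) ?_ (Eventually.of_forall fun x => ?_)
    · exact (Complex.continuous_re.comp continuous_V).aestronglyMeasurable
    · have := norm_V_le x
      rwa [Complex.norm_real] at this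
  have n2 : (inner ℂ (mulV (molL ρ u)) (molL ρ u) : ℂ).re = ∫ x, V x * ‖U x‖ ^ 2 := by
    have a1 : mulV (molL ρ u) =ᵐ[volume] fun x => (V x : ℂ) * U x := by
      filter_upwards [mulV_ae (molL ρ u), molL_ae h u] with x h1 h2
      rw [h1, h2]
    have a2 : inner ℂ (mulV (molL ρ u)) (molL ρ u) = ((∫ x, V x * ‖U x‖ ^ 2 : ℝ) : ℂ) := by
      rw [inner_toLp a1 (molL_ae h u), ← integral_complex_ofReal]
      congr 1; ext x
      rw [star_mul', mul_assoc]
      have : star (U x) * U x = ((‖U x‖ ^ 2 : ℝ) : ℂ) := by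
        have := Complex.conj_mul' (U x)
        push_cast
        exact this
      rw [← hU, this]
      simp
    rw [a2, Complex.ofReal_re]
  have itau : Integrable fun x => Real.tanh (x / 2) * ‖U x‖ ^ 2 := by
    refine i0.bdd_mul (c := 1) ?_ (Eventually.of_forall fun x => abs_tanh_le _)
    exact (continuous_iff_continuousAt.2 fun x =>
      (hasDerivAt_tanh_half x).continuousAt).aestronglyMeasurable
  -- The energy density differs from the square |U' + τU|² by the exact derivative of τ|U|², which
  -- integrates to zero.
  have hd : ∀ x, HasDerivAt (fun x => Real.tanh (x / 2) * ‖U x‖ ^ 2)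
      (‖U' x + (Real.tanh (x / 2) : ℂ) * U x‖ ^ 2 -
        (‖U' x‖ ^ 2 + ‖U x‖ ^ 2 + V x * ‖U x‖ ^ 2)) x := by
    intro x
    refine ((hasDerivAt_tanh_half x).mul (hasDerivAt_mol h u x).norm_sq).congr_deriv ?_
    have e1 : ‖U' x + (Real.tanh (x / 2) : ℂ) * U x‖ ^ 2 = ‖U' x‖ ^ 2 +
        2 * (Real.tanh (x / 2) * inner ℝ (U x) (U' x)) + Real.tanh (x / 2) ^ 2 * ‖U x‖ ^ 2 := by
      rw [← Complex.real_smul, norm_add_sq_real, inner_smul_right, real_inner_comm, norm_smul,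
        mul_pow, Real.norm_eq_abs, sq_abs]
    rw [e1]
    have e2 := one_add_V_sub x
    have e3 : 1 / 2 * (Real.cosh (x / 2) ^ 2)⁻¹ = Real.tanh (x / 2) ^ 2 - 1 - V x := by linarith
    rw [e3]
    ring
  have mt : MemLp (fun x => (Real.tanh (x / 2) : ℂ) * U x) 2 := by
    refine m0.of_le_mul (c := 1) ?_ (Eventually.of_forall fun x => ?_)
    · exact ((Complex.continuous_ofReal.comp (continuous_iff_continuousAt.2 fun x =>
        (hasDerivAt_tanh_half x).continuousAt)).aestronglyMeasurable).mul m0.1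
    · rw [norm_mul, Complex.norm_real]
      gcongr
      exact abs_tanh_le _
  have i2 : Integrable fun x => ‖U' x + (Real.tanh (x / 2) : ℂ) * U x‖ ^ 2 :=
    (memLp_two_iff_integrable_sq_norm (m1.add mt).1).1 (m1.add mt)
  have i3 : Integrable fun x => ‖U' x‖ ^ 2 + ‖U x‖ ^ 2 := i1.add i0
  have i4 : Integrable fun x => ‖U' x‖ ^ 2 + ‖U x‖ ^ 2 + V x * ‖U x‖ ^ 2 := i3.add iV
  have h0 := integral_eq_zero_of_hasDerivAt_of_integrable hd (i2.sub i4) itau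
  rw [integral_sub i2 i4, integral_add i3 iV, integral_add i1 i0] at h0
  have h1 : 0 ≤ ∫ x, ‖U' x + (Real.tanh (x / 2) : ℂ) * U x‖ ^ 2 :=
    integral_nonneg fun x => by positivity
  rw [n0, n1, n2]
  linarith

/-- The operator `-D_k H_k` is strictly dissipative in the norm `‖(∂ + k)⁻¹ u‖`. -/
theorem re_inner_opL_le {k : ℝ} (hk : 0 < k) {u w : L2} (h : IsNegDH k u w) :
    (inner ℂ (opL k w) (opL k u) : ℂ).re ≤ -(k ^ 2 * ‖u‖ ^ 2) := by
  -- The last term is the commutator of mollification with V; it disappears as the mollifier is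
  -- removed.
  have key : ∀ ρ : ℝ → ℂ, IsTest ρ → (inner ℂ (opL k (molL ρ w)) (opL k (molL ρ u)) : ℂ).re ≤
      -(k ^ 2 * ‖molL ρ u‖ ^ 2) -
      (inner ℂ (molL ρ (mulV u) - mulV (molL ρ u)) (molL ρ u) : ℂ).re := by
    intro ρ hρ
    have h1 := molL_of_isNegDH h hρ
    have h2 : opL k (molL ρ w) = -(opL k (molL (D k (D k ρ)) u) + opL k (molL (D k ρ) u) +
        opL k (molL (D k ρ) (mulV u))) := by
      rw [← map_add, ← map_add, h1, map_neg, neg_neg]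
    rw [h2, inner_neg_left, inner_add_left, inner_add_left, inner_opL_molL_D hk hρ (hρ.D k),
      inner_opL_molL_D hk hρ hρ, inner_opL_molL_D hk hρ hρ, inner_molL_D_self k hρ,
      inner_self_eq_norm_sq_to_K, inner_sub_left]
    have h3 := energy_nonneg hρ u
    simp only [Complex.neg_re, Complex.add_re, Complex.ofReal_re, Complex.coe_algebraMap,
      ← Complex.ofReal_pow, Complex.sub_re]
    linarith
  obtain ⟨ρ, ht, hlim⟩ := exists_mollifier
  have c1 : Tendsto (fun n => (inner ℂ (opL k (molL (ρ n) w)) (opL k (molL (ρ n) u)) : ℂ).re) atTop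
      (𝓝 (inner ℂ (opL k w) (opL k u) : ℂ).re) :=
    (Complex.continuous_re.tendsto _).comp ((((opL k).continuous.tendsto _).comp (hlim w)).inner
      (((opL k).continuous.tendsto _).comp (hlim u)))
  have c2 : Tendsto (fun n => -(k ^ 2 * ‖molL (ρ n) u‖ ^ 2) -
      (inner ℂ (molL (ρ n) (mulV u) - mulV (molL (ρ n) u)) (molL (ρ n) u) : ℂ).re) atTop
      (𝓝 (-(k ^ 2 * ‖u‖ ^ 2) - (inner ℂ (mulV u - mulV u) u : ℂ).re)) := by
    refine ((((hlim u).norm.pow 2).const_mul (k ^ 2)).neg).sub ?_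
    exact (Complex.continuous_re.tendsto _).comp
      (((hlim (mulV u)).sub ((mulV.continuous.tendsto _).comp (hlim u))).inner (hlim u))
  have := le_of_tendsto_of_tendsto' c1 c2 fun n => key _ (ht n)
  simpa using this


/-! ### Exponential decay of the semigroup for bounded k. -/

theorem hasDerivWithinAt_semigroup {k : ℝ} {u w : L2} (h : IsNegDH k u w) {s : ℝ} (hs : 0 ≤ s) :
    HasDerivWithinAt (fun r => semigroup k |r| u) (semigroup k s w) (Set.Ici s) s := by
  have hC := isC0Semigroup_semigroup k
  rw [← hasDerivWithinAt_Ioi_iff_Ici, hasDerivWithinAt_iff_tendsto_slope' (by simp)]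
  have hv := hC.generates_apply ((generates_semigroup_iff k u w).2 h) hs
  have d2 : Tendsto (fun r : ℝ => r - s) (𝓝[>] s) (𝓝[>] 0) := by
    refine tendsto_nhdsWithin_iff.2 ⟨?_, ?_⟩
    · have : ContinuousAt (fun r : ℝ => r - s) s := by fun_prop
      have h2 := this.tendsto
      rw [sub_self] at h2
      exact h2.mono_left nhdsWithin_le_nhds
    · filter_upwards [self_mem_nhdsWithin] with r hr
      exact sub_pos.2 (Set.mem_Ioi.1 hr)
  refine (hv.comp d2).congr' ?_
  filter_upwards [self_mem_nhdsWithin] with r hr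
  have hr' : s < r := hr
  have hrs : 0 ≤ r - s := sub_nonneg.2 hr'.le
  rw [Function.comp_apply, slope_def_module, ofReal_inv_smul, abs_of_nonneg hs,
    abs_of_nonneg (hs.trans hr'.le), ← ContinuousLinearMap.comp_apply (semigroup k (r - s)),
    ← semigroup_add k hrs hs, sub_add_cancel]

/-- Along an orbit in the domain the squared weak norm has right derivative at most -2k²‖T(s)u‖²,
and this is at most -2k⁴ times the squared weak norm by `norm_opL_le`. Grönwall's argument gives the
decay there, and density extends it to L². -/
theorem norm_opL_semigroup_le {k : ℝ} (hk : 0 < k) (u : L2) {t : ℝ} (ht : 0 ≤ t) :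
    ‖opL k (semigroup k t u)‖ ≤ Real.exp (-(k ^ 4 * t)) * ‖opL k u‖ := by
  have hC := isC0Semigroup_semigroup k
  have key : ∀ u w : L2, IsNegDH k u w →
      ‖opL k (semigroup k t u)‖ ≤ Real.exp (-(k ^ 4 * t)) * ‖opL k u‖ := by
    intro u w h
    -- The absolute value makes the orbit continuous on all of ℝ; only s ≥ 0 matters.
    set f : ℝ → L2 := fun s => opL k (semigroup k |s| u) with hf
    have hfc : Continuous f := (opL k).continuous.comp (hC.continuous_apply u)
    have hfd : ∀ s, 0 ≤ s → HasDerivWithinAt f (opL k (semigroup k s w)) (Set.Ici s) s :=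
      fun s hs => ((opL k).restrictScalars ℝ).hasFDerivAt.comp_hasDerivWithinAt s
        (hasDerivWithinAt_semigroup h hs)
    have hgd : ∀ s, 0 ≤ s → HasDerivWithinAt (fun s => ‖f s‖ ^ 2)
        (2 * (inner ℂ (opL k (semigroup k s w)) (f s) : ℂ).re) (Set.Ici s) s := by
      intro s hs
      have h1 := Complex.reCLM.hasFDerivAt.comp_hasDerivWithinAt s
        ((hfd s hs).inner ℂ (hfd s hs))
      have e : (fun s => ‖f s‖ ^ 2) = Complex.reCLM ∘ fun s => inner ℂ (f s) (f s) := by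
        ext r
        rw [Function.comp_apply, inner_self_eq_norm_sq_to_K]
        simp [← Complex.ofReal_pow]
      rw [e]
      refine h1.congr_deriv ?_
      have h4 : (inner ℂ (f s) (opL k (semigroup k s w)) : ℂ).re =
          (inner ℂ (opL k (semigroup k s w)) (f s) : ℂ).re := inner_re_symm (𝕜 := ℂ) _ _
      simp only [map_add, Complex.reCLM_apply, h4]
      ring
    have hle : ∀ s, 0 ≤ s → 2 * (inner ℂ (opL k (semigroup k s w)) (f s) : ℂ).re ≤
        -(2 * k ^ 4 * ‖f s‖ ^ 2) := by
      intro s hs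
      have h1 : IsNegDH k (semigroup k s u) (semigroup k s w) :=
        (generates_semigroup_iff k _ _).1
          (hC.generates_apply ((generates_semigroup_iff k u w).2 h) hs)
      have h2 := re_inner_opL_le hk h1
      have h3 := norm_opL_le hk (semigroup k s u)
      simp only [hf, abs_of_nonneg hs]
      nlinarith [sq_nonneg k]
    have hE : ∀ s : ℝ, HasDerivAt (fun s => Real.exp (2 * k ^ 4 * s))
        (Real.exp (2 * k ^ 4 * s) * (2 * k ^ 4)) s := by
      intro s
      have := ((hasDerivAt_id s).const_mul (2 * k ^ 4)).exp
      simpa using! this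
    have h5 := image_le_of_deriv_right_le_deriv_boundary (a := 0) (b := t)
      (f := fun s => Real.exp (2 * k ^ 4 * s) * ‖f s‖ ^ 2) (B := fun _ => ‖f 0‖ ^ 2)
      (f' := fun s => Real.exp (2 * k ^ 4 * s) * (2 * k ^ 4) * ‖f s‖ ^ 2 +
        Real.exp (2 * k ^ 4 * s) * (2 * (inner ℂ (opL k (semigroup k s w)) (f s) : ℂ).re))
      (B' := fun _ => 0) (by fun_prop)
      (fun s hs => (hE s).hasDerivWithinAt.mul (hgd s hs.1)) (by simp) (by fun_prop)
      (fun s _ => hasDerivWithinAt_const _ _ _)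
      (fun s hs => by
        have := mul_le_mul_of_nonneg_left (hle s hs.1) (Real.exp_pos (2 * k ^ 4 * s)).le
        linarith) ⟨ht, le_rfl⟩
    have h6 : ‖f t‖ ^ 2 ≤ (Real.exp (-(k ^ 4 * t)) * ‖f 0‖) ^ 2 := by
      rw [mul_pow, ← Real.exp_nat_mul, show ((2 : ℕ) : ℝ) * -(k ^ 4 * t) = -(2 * k ^ 4 * t) by
        push_cast; ring, Real.exp_neg, ← div_eq_inv_mul, le_div_iff₀ (Real.exp_pos _), mul_comm]
      exact h5
    have h7 := le_of_sq_le_sq h6 (by positivity)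
    simpa [hf, abs_of_nonneg ht, semigroup_zero] using h7
  have hd := hC.dense_domain
  have hcl : IsClosed {u : L2 | ‖opL k (semigroup k t u)‖ ≤
      Real.exp (-(k ^ 4 * t)) * ‖opL k u‖} :=
    isClosed_le (by fun_prop) (by fun_prop)
  have hsub : {u : L2 | ∃ w, Generates (semigroup k) u w} ⊆ {u : L2 |
      ‖opL k (semigroup k t u)‖ ≤ Real.exp (-(k ^ 4 * t)) * ‖opL k u‖} :=
    fun u ⟨w, hw⟩ => key u w ((generates_semigroup_iff k u w).1 hw)
  exact hcl.closure_subset_iff.2 hsub (hd u)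

theorem kap_le (k : ℝ) : kap k ≤ Λ₀ + l₀ := by
  unfold kap
  have : 0 ≤ k ^ 4 := by positivity
  linarith

theorem continuousOn_kerK' (k : ℝ) :
    ContinuousOn (fun p : ℝ × ℝ × ℝ => kerK' k p.1 p.2.1 p.2.2) {p | 0 < p.2.2} := by
  have h1 := continuousOn_stConv (F := kerS k) (isFreeKer_K₀' k) (by norm_num) (by norm_num)
    l₀_pos.le (M := 2 * C₀) (by have := C₀_pos; positivity) (continuousOn_kerS k) (norm_kerS_le k)
  have h2 : ContinuousOn (fun p : ℝ × ℝ × ℝ => K₀' k (p.1 - p.2.1) p.2.2) {p | 0 < p.2.2} :=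
    (continuousOn_K₀' k).comp (f := fun p : ℝ × ℝ × ℝ => (p.1 - p.2.1, p.2.2)) (by fun_prop)
      fun p hp => hp
  exact (h2.add h1).neg

theorem continuous_kerK' (k : ℝ) {t : ℝ} (ht : 0 < t) :
    Continuous fun p : ℝ × ℝ => kerK' k p.1 p.2 t :=
  (continuousOn_kerK' k).comp_continuous (f := fun p : ℝ × ℝ => (p.1, p.2, t)) (by fun_prop)
    fun _ => ht

theorem norm_kerK'_one_le : ∃ C : ℝ, 0 ≤ C ∧ ∀ k x y : ℝ,
    ‖kerK' k x y 1‖ ≤ C * Real.exp (-(1 * |x - y|)) := by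
  have hC := C₀_pos
  have hl := l₀_pos
  set J := ∫ s in Set.Ioo (0 : ℝ) 1, (1 - s) ^ (-(3 / 4) : ℝ) * s ^ (-(1 / 2) : ℝ) *
    Real.exp (-(l₀ * s)) * s ^ (1 / 4 : ℝ) with hJ
  have hJ0 : 0 ≤ J := setIntegral_nonneg measurableSet_Ioo fun s hs => by
    have h1 := Real.rpow_pos_of_pos (sub_pos.2 hs.2) (-(3 / 4))
    have h2 := Real.rpow_pos_of_pos hs.1 (-(1 / 2))
    have h3 := Real.rpow_pos_of_pos hs.1 (1 / 4)
    positivity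
  refine ⟨C₀ * Real.exp (Λ₀ + l₀) + 3 * (2 * C₀) * C₀ * Real.exp (Λ₀ + l₀) * J, by positivity,
    fun k x y => ?_⟩
  have r1 : 1 ≤ rate 1 := one_le_rate one_pos
  have e0 : ∀ c, 1 ≤ c → Real.exp (-(c * |x - y|)) ≤ Real.exp (-(1 * |x - y|)) := by
    intro c hc
    rw [Real.exp_le_exp, neg_le_neg_iff]
    gcongr
  have h1 : ‖K₀' k (x - y) 1‖ ≤ C₀ * Real.exp (Λ₀ + l₀) * Real.exp (-(1 * |x - y|)) := by
    refine (norm_K₀'_le k (x - y) one_pos).trans ?_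
    rw [Real.one_rpow, mul_one, mul_one]
    have := kap_le k
    have e1 := e0 (2 * rate 1) (by linarith)
    gcongr
    unfold kap at this
    linarith
  have h2 := norm_stConv_le (F := kerS k x) (y := y) (t := 1) (isFreeKer_K₀' k) (by norm_num)
    (by norm_num) hl.le (M := 2 * C₀) (by positivity) zero_le_one le_rfl (norm_kerS_le_one k x)
  rw [← hJ, one_mul, mul_one] at h2
  have h3 : ‖stConv (kerS k x) (K₀' k) y 1‖ ≤
      3 * (2 * C₀) * C₀ * Real.exp (Λ₀ + l₀) * Real.exp (-(1 * |x - y|)) * J := by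
    refine h2.trans ?_
    have := kap_le k
    unfold kap at this
    have e1 := e0 (rate 1) r1
    gcongr
  rw [kerK', norm_neg]
  refine (norm_add_le _ _).trans ((add_le_add h1 h3).trans (le_of_eq (by ring)))

/-- A constant for bounds on bounded time intervals. -/
def Aconst (R : ℝ) : ℝ := 2 * (C₁ + 2 * C₀) * Real.exp ((Λ₀ + l₀ + 1) * R)

theorem Λ₀_add_pos : 0 < Λ₀ + l₀ + 1 := by
  have := l₀_pos
  have : (0 : ℝ) ≤ Λ₀ := by unfold Λ₀; norm_num
  linarith

theorem Aconst_pos (R : ℝ) : 0 < Aconst R := by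
  have := C₀_pos
  have := C₁_pos
  unfold Aconst
  positivity

theorem rpow_le_two {b r : ℝ} (hb : 0 ≤ b) (hb1 : b ≤ 1) (hr : 1 / 2 ≤ r) : r ^ (-b) ≤ 2 := by
  calc r ^ (-b) ≤ (1 / 2 : ℝ) ^ (-b) :=
        Real.rpow_le_rpow_of_nonpos (by norm_num) hr (by linarith)
    _ ≤ (1 / 2 : ℝ) ^ (-1 : ℝ) :=
        Real.rpow_le_rpow_of_exponent_ge (by norm_num) (by norm_num) (by linarith)
    _ = 2 := by rw [Real.rpow_neg_one]; norm_num

/-- Staying away from t = 0 removes the singularity, and since `kap k` is bounded above the constant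
does not depend on k. -/
theorem norm_kerK_le_Aconst (k x y : ℝ) {r R : ℝ} (hr : 1 / 2 ≤ r) (hR : r ≤ R) :
    ‖kerK k x y r‖ ≤ Aconst R * Real.exp (-(1 * |x - y|)) := by
  have hr0 : 0 < r := by linarith
  have hC := C₀_pos
  have hC1 := C₁_pos
  have hk := kap_le k
  have hL := Λ₀_add_pos
  refine (rowBound_kerK k x hr0 y).trans (mul_le_mul_of_nonneg_right ?_ (Real.exp_pos _).le)
  have e1 : (kap k + 1) * r ≤ (Λ₀ + l₀ + 1) * R := by
    calc _ ≤ (Λ₀ + l₀ + 1) * r := by gcongr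
      _ ≤ _ := by gcongr
  have e2 := rpow_le_two (b := 1 / 4) (by norm_num) (by norm_num) hr
  have q : 0 < r ^ (-(1 / 4) : ℝ) := Real.rpow_pos_of_pos hr0 _
  calc _ ≤ C₁ * Real.exp ((Λ₀ + l₀ + 1) * R) * 2 := by gcongr
    _ = 2 * C₁ * Real.exp ((Λ₀ + l₀ + 1) * R) := by ring
    _ ≤ _ := by unfold Aconst; gcongr; linarith

theorem norm_kerS_le_Aconst (k x y : ℝ) {r R : ℝ} (hr : 1 / 2 ≤ r) (hR : r ≤ R) :
    ‖kerS k x y r‖ ≤ Aconst R * Real.exp (-(1 * |x - y|)) := by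
  have hr0 : 0 < r := by linarith
  have hC := C₀_pos
  have hC1 := C₁_pos
  have hk := kap_le k
  have hL := Λ₀_add_pos
  have e1 : kap k * r ≤ (Λ₀ + l₀ + 1) * R := by
    calc _ ≤ (Λ₀ + l₀ + 1) * r := by gcongr; linarith
      _ ≤ _ := by gcongr
  have e2 := rpow_le_two (b := 3 / 4) (by norm_num) (by norm_num) hr
  have q : 0 < r ^ (-(3 / 4) : ℝ) := Real.rpow_pos_of_pos hr0 _
  have e3 : Real.exp (-(rate r * |x - y|)) ≤ Real.exp (-(1 * |x - y|)) := by
    rw [Real.exp_le_exp, neg_le_neg_iff]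
    gcongr
    exact one_le_rate hr0
  refine (norm_kerS_le k x y r hr0).trans ?_
  calc _ ≤ 2 * C₀ * Real.exp ((Λ₀ + l₀ + 1) * R) * 2 * Real.exp (-(1 * |x - y|)) := by gcongr
    _ = 2 * (2 * C₀) * Real.exp ((Λ₀ + l₀ + 1) * R) * Real.exp (-(1 * |x - y|)) := by ring
    _ ≤ _ := by unfold Aconst; gcongr; linarith

/-- Integration by parts in y factors T(1) as Q(∂+k)⁻¹, where Q has the kernel (k - ∂_y)K at time 1.
The semigroup therefore maps the weak norm into L² within one unit of time. -/
theorem integral_kernel_mul_lker {k : ℝ} (hk : 0 < k) {C : ℝ}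
    (hC : ∀ x y : ℝ, ‖(k : ℂ) * kerK k x y 1 - kerK' k x y 1‖ ≤ C * Real.exp (-(1 * |x - y|)))
    (x z : ℝ) :
    ∫ y, ((k : ℂ) * kerK k x y 1 - kerK' k x y 1) * lker k y z = kerK k x z 1 := by
  set f : ℝ → ℂ := fun y => -(kerK k x y 1 * (Real.exp (-(k * (y - z))) : ℂ)) with hf
  set f' : ℝ → ℂ := fun y => ((k : ℂ) * kerK k x y 1 - kerK' k x y 1) *
    (Real.exp (-(k * (y - z))) : ℂ) with hf'
  have hd : ∀ y, HasDerivAt f (f' y) y := by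
    intro y
    have d1 : HasDerivAt (fun y : ℝ => Real.exp (-(k * (y - z))))
        (Real.exp (-(k * (y - z))) * -k) y := by
      have := (((hasDerivAt_id y).sub_const z).const_mul k).neg.exp
      simpa using! this
    refine (((hasDerivAt_kerK k x y one_pos).mul d1.ofReal_comp).neg).congr_deriv ?_
    simp only [hf']
    push_cast
    ring
  have hexp : ∀ y ∈ Set.Ioi z, ‖(Real.exp (-(k * (y - z))) : ℂ)‖ ≤ 1 := by
    intro y hy
    rw [Complex.norm_real, Real.norm_of_nonneg (Real.exp_pos _).le, Real.exp_le_one_iff]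
    have := mul_pos hk (sub_pos.2 (Set.mem_Ioi.1 hy))
    linarith
  have hcQ : Continuous fun y => (k : ℂ) * kerK k x y 1 - kerK' k x y 1 := by
    have c1 := continuous_kerK_right k x one_pos
    have c2 : Continuous fun y => kerK' k x y 1 :=
      (continuous_kerK' k one_pos).comp (f := fun y : ℝ => (x, y)) (by fun_prop)
    fun_prop
  have hi : IntegrableOn f' (Set.Ioi z) := by
    have i1 : Integrable fun y => (k : ℂ) * kerK k x y 1 - kerK' k x y 1 :=
      ((integrable_exp_neg_mul_abs_sub one_pos x).const_mul C).mono' hcQ.aestronglyMeasurable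
        (Eventually.of_forall fun y => hC x y)
    refine (i1.integrableOn).mul_bdd (c := 1) (Continuous.aestronglyMeasurable (by fun_prop)) ?_
    filter_upwards [ae_restrict_mem measurableSet_Ioi] with y hy
    exact hexp y hy
  have hlim : Tendsto f atTop (𝓝 0) := by
    rw [tendsto_zero_iff_norm_tendsto_zero]
    have h1 : Tendsto (fun y : ℝ => Aconst 1 * Real.exp (-(k * (y - z)))) atTop (𝓝 0) := by
      rw [← mul_zero (Aconst 1)]
      refine Tendsto.const_mul _ (Real.tendsto_exp_neg_atTop_nhds_zero.comp ?_)
      exact (tendsto_atTop_add_const_right _ (-z) tendsto_id).const_mul_atTop hk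
    refine squeeze_zero (fun y => norm_nonneg _) (fun y => ?_) h1
    simp only [hf]
    rw [norm_neg, norm_mul, Complex.norm_real, Real.norm_of_nonneg (Real.exp_pos _).le]
    have h2 := norm_kerK_le_Aconst k x y (r := 1) (R := 1) (by norm_num) le_rfl
    have h3 : Real.exp (-(1 * |x - y|)) ≤ 1 := by
      rw [Real.exp_le_one_iff]
      have := abs_nonneg (x - y)
      linarith
    have h4 := Aconst_pos 1
    have h5 : ‖kerK k x y 1‖ ≤ Aconst 1 := h2.trans (mul_le_of_le_one_right h4.le h3)
    gcongr
  have h1 := integral_Ioi_of_hasDerivAt_of_tendsto' (a := z) (fun y _ => hd y) hi hlim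
  have hfz : f z = -kerK k x z 1 := by simp [hf]
  rw [hfz, zero_sub, neg_neg] at h1
  rw [← h1, ← integral_indicator measurableSet_Ioi]
  congr 1; ext y
  rw [lker, Set.indicator_apply]
  simp only [Set.mem_Ioi]
  by_cases hy : z < y
  · rw [if_pos hy, if_pos hy]
  · rw [if_neg hy, if_neg hy, mul_zero]

/-- Decay of the semigroup. -/
theorem norm_semigroup_decay {k₀ : ℝ} (hk₀ : 0 < k₀) (B : ℝ) : ∃ C : ℝ, 0 ≤ C ∧
    ∀ k t : ℝ, k₀ < k → k ^ 4 ≤ B → 1 ≤ t → ‖semigroup k t‖ ≤ C * Real.exp (-(k ^ 4 * t)) := by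
  obtain ⟨E, hE, hEb⟩ := norm_kerK'_one_le
  rcases lt_or_ge B 0 with hB | hB
  · exact ⟨0, le_rfl, fun k t _ hkB _ => absurd hkB (not_le.2 (hB.trans_le (by positivity)))⟩
  have hA := Aconst_pos 1
  set C := (B + 1) * Aconst 1 + E with hC
  refine ⟨2 * C * Real.exp B / k₀, by positivity, fun k t hk hkB ht => ?_⟩
  have hk0 : 0 < k := hk₀.trans hk
  have hkle : k ≤ B + 1 := by
    nlinarith [sq_nonneg (k ^ 2 - 1), sq_nonneg (k - 1)]
  have hb : ∀ x y : ℝ, ‖(k : ℂ) * kerK k x y 1 - kerK' k x y 1‖ ≤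
      C * Real.exp (-(1 * |x - y|)) := by
    intro x y
    refine (norm_sub_le _ _).trans ?_
    rw [norm_mul, Complex.norm_real, Real.norm_of_nonneg hk0.le]
    have h1 := norm_kerK_le_Aconst k x y (r := 1) (R := 1) (by norm_num) le_rfl
    have h2 := hEb k x y
    have h3 : k * ‖kerK k x y 1‖ ≤ (B + 1) * (Aconst 1 * Real.exp (-(1 * |x - y|))) := by gcongr
    rw [hC]
    linarith
  have hQ : IsExpKer (fun x y => (k : ℂ) * kerK k x y 1 - kerK' k x y 1) C 1 :=
    ⟨((continuous_const.mul (continuous_kerK k one_pos)).sub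
      (continuous_kerK' k one_pos)).measurable, one_pos, hb⟩
  -- The last unit of time recovers the L² norm by Q. The weak norm of the initial value is at most
  -- ‖v‖/k₀, which is where k must stay away from 0, and the lost factor exp(k⁴) is at most exp B.
  have hcomp : semigroup k 1 = hQ.op.comp (opL k) := by
    rw [semigroup_of_pos k one_pos, opL_eq hk0]
    exact (hQ.op_comp_op (isExpKer_lker hk0) (isExpKer_kerK k one_pos)
      fun x z => integral_kernel_mul_lker hk0 hb x z).symm
  refine ContinuousLinearMap.opNorm_le_bound _ (by positivity) fun v => ?_
  have ht1 : 0 ≤ t - 1 := sub_nonneg.2 ht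
  have e : semigroup k t v = hQ.op (opL k (semigroup k (t - 1) v)) := by
    have h1 := semigroup_add k zero_le_one ht1
    rw [add_sub_cancel] at h1
    rw [h1, hcomp]
    rfl
  have h2 : ‖opL k v‖ ≤ ‖v‖ / k₀ := by
    have h3 := norm_opL_le hk0 v
    have h4 : k * ‖opL k v‖ ≤ ‖v‖ := by
      refine le_of_sq_le_sq ?_ (norm_nonneg v)
      rw [mul_pow]; exact h3
    rw [le_div_iff₀ hk₀]
    nlinarith [norm_nonneg (opL k v)]
  have h5 : Real.exp (-(k ^ 4 * (t - 1))) ≤ Real.exp B * Real.exp (-(k ^ 4 * t)) := by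
    rw [← Real.exp_add, Real.exp_le_exp]
    linarith
  rw [e]
  calc _ ≤ (2 * C / 1) * ‖opL k (semigroup k (t - 1) v)‖ :=
        ContinuousLinearMap.le_of_opNorm_le _ hQ.norm_op_le _
    _ ≤ (2 * C / 1) * (Real.exp (-(k ^ 4 * (t - 1))) * ‖opL k v‖) := by
        gcongr
        exact norm_opL_semigroup_le hk0 v ht1
    _ ≤ (2 * C / 1) * (Real.exp B * Real.exp (-(k ^ 4 * t)) * (‖v‖ / k₀)) := by gcongr
    _ = _ := by ring


/-! ### Exponential conjugation and columns of the kernels. -/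

/-- The kernel conjugated by an exponential weight. -/
def wker (c : ℝ) (F : ℝ → ℝ → ℂ) (x y : ℝ) : ℂ := (Real.exp (c * (x - y)) : ℂ) * F x y

theorem exp_weight_le {c : ℝ} (hc : |c| ≤ 1 / 2) (u : ℝ) :
    Real.exp (c * u) * Real.exp (-(1 * |u|)) ≤ Real.exp (-(1 / 2 * |u|)) := by
  rw [← Real.exp_add, Real.exp_le_exp]
  have h1 : c * u ≤ |c| * |u| := by rw [← abs_mul]; exact le_abs_self _
  nlinarith [abs_nonneg u]

theorem abs_exp_sub_one_le (s : ℝ) : |Real.exp s - 1| ≤ |s| * Real.exp |s| := by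
  have h1 : 1 ≤ Real.exp |s| := Real.one_le_exp (abs_nonneg s)
  rcases le_total 0 s with hs | hs
  · rw [abs_of_nonneg (sub_nonneg.2 (Real.one_le_exp hs)), abs_of_nonneg hs]
    have h2 := Real.add_one_le_exp (-s)
    have h3 : Real.exp s * Real.exp (-s) = 1 := by rw [← Real.exp_add, add_neg_cancel, Real.exp_zero]
    nlinarith [Real.exp_pos s]
  · rw [abs_of_nonpos (sub_nonpos.2 (Real.exp_le_one_iff.2 hs))]
    have h2 := Real.add_one_le_exp s
    rw [abs_of_nonpos hs] at h1 ⊢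
    nlinarith

/-- The factor |u| coming from |exp(cu) - 1| is absorbed by 4exp(|u|/4), which leaves decay at rate
1 - 1/2 - 1/4. -/
theorem exp_weight_sub_one_le {c : ℝ} (hc : |c| ≤ 1 / 2) (u : ℝ) :
    |Real.exp (c * u) - 1| * Real.exp (-(1 * |u|)) ≤ 4 * |c| * Real.exp (-(1 / 4 * |u|)) := by
  have h0 := abs_nonneg u
  have h1 : |c * u| ≤ 1 / 2 * |u| := by rw [abs_mul]; gcongr
  have h2 : |u| ≤ 4 * Real.exp (1 / 4 * |u|) := by
    have := Real.add_one_le_exp (1 / 4 * |u|)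
    linarith
  calc _ ≤ (|c * u| * Real.exp |c * u|) * Real.exp (-(1 * |u|)) := by
        gcongr; exact abs_exp_sub_one_le _
    _ ≤ (|c| * (4 * Real.exp (1 / 4 * |u|)) * Real.exp (1 / 2 * |u|)) * Real.exp (-(1 * |u|)) := by
        rw [abs_mul c u]
        rw [abs_mul c u] at h1
        gcongr
    _ = 4 * |c| * (Real.exp (1 / 4 * |u|) * Real.exp (1 / 2 * |u|) * Real.exp (-(1 * |u|))) := by
        ring
    _ = _ := by rw [← Real.exp_add, ← Real.exp_add]; congr 2; ring

theorem norm_wker (c : ℝ) (F : ℝ → ℝ → ℂ) (x y : ℝ) :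
    ‖wker c F x y‖ = Real.exp (c * (x - y)) * ‖F x y‖ := by
  rw [wker, norm_mul, Complex.norm_real, Real.norm_of_nonneg (Real.exp_pos _).le]

theorem measurable_wker (c : ℝ) {F : ℝ → ℝ → ℂ} (hF : Measurable (Function.uncurry F)) :
    Measurable (Function.uncurry (wker c F)) := by
  have h : Continuous fun p : ℝ × ℝ => (Real.exp (c * (p.1 - p.2)) : ℂ) := by fun_prop
  exact h.measurable.mul hF

namespace IsExpKer

variable {F : ℝ → ℝ → ℂ} {A c : ℝ}

theorem wker (h : IsExpKer F A 1) (hc : |c| ≤ 1 / 2) : IsExpKer (wker c F) A (1 / 2) := by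
  refine ⟨measurable_wker c h.meas, by norm_num, fun x y => ?_⟩
  have hA := h.nonneg
  rw [norm_wker]
  calc _ ≤ Real.exp (c * (x - y)) * (A * Real.exp (-(1 * |x - y|))) := by
        gcongr; exact h.bound x y
    _ = A * (Real.exp (c * (x - y)) * Real.exp (-(1 * |x - y|))) := by ring
    _ ≤ _ := by gcongr; exact exp_weight_le hc _

theorem wker_sub (h : IsExpKer F A 1) (hc : |c| ≤ 1 / 2) :
    IsExpKer (fun x y => CahnHilliard.wker c F x y - F x y) (4 * A * |c|) (1 / 4) := by
  refine ⟨(measurable_wker c h.meas).sub h.meas, by norm_num, fun x y => ?_⟩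
  have hA := h.nonneg
  have e : CahnHilliard.wker c F x y - F x y = ((Real.exp (c * (x - y)) - 1 : ℝ) : ℂ) * F x y := by
    rw [CahnHilliard.wker]; push_cast; ring
  rw [e, norm_mul, Complex.norm_real, Real.norm_eq_abs]
  calc _ ≤ |Real.exp (c * (x - y)) - 1| * (A * Real.exp (-(1 * |x - y|))) := by
        gcongr; exact h.bound x y
    _ = A * (|Real.exp (c * (x - y)) - 1| * Real.exp (-(1 * |x - y|))) := by ring
    _ ≤ A * (4 * |c| * Real.exp (-(1 / 4 * |x - y|))) := by
        exact mul_le_mul_of_nonneg_left (exp_weight_sub_one_le hc _) hA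
    _ = _ := by ring

/-- Conjugation perturbs the operator by a kernel of size O(|c|) with decay rate 1/4, and Schur's
bound for it is 2·4A|c|/(1/4). Norm decay thus survives conjugation with a small weight. -/
theorem norm_op_wker_le (h : IsExpKer F A 1) (hc : |c| ≤ 1 / 2) :
    ‖(h.wker hc).op‖ ≤ ‖h.op‖ + 32 * A * |c| := by
  have e : (h.wker hc).op = h.op + (h.wker_sub hc).op := by
    ext1 f
    refine Lp.ext ?_
    filter_upwards [(h.wker hc).op_ae f, h.op_ae f, (h.wker_sub hc).op_ae f,
      Lp.coeFn_add (h.op f) ((h.wker_sub hc).op f)] with x h1 h2 h3 h4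
    rw [_root_.add_apply, h4, Pi.add_apply, h1, h2, h3,
      ← integral_add (h.integrable f x) ((h.wker_sub hc).integrable f x)]
    congr 1; ext y
    ring
  rw [e]
  refine (norm_add_le _ _).trans ?_
  gcongr
  refine (h.wker_sub hc).norm_op_le.trans_eq ?_
  ring

/-- Pointwise bound of an integral operator. -/
theorem norm_integral_le (h : IsExpKer F A c) (f : L2) (x : ℝ) :
    ‖∫ y, F x y * f y‖ ≤ √(2 / c) * A * ‖f‖ := by
  have hc := h.pos
  have hA := h.nonneg
  refine le_of_sq_le_sq ((h.norm_sq_le f x).trans ?_) (by positivity)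
  rw [mul_pow, mul_pow, Real.sq_sqrt (by positivity), norm_sq_L2]
  have h1 : ∫ y, ‖f y‖ ^ 2 * Real.exp (-(c * |x - y|)) ≤ ∫ y, ‖f y‖ ^ 2 := by
    refine integral_mono_of_nonneg (Eventually.of_forall fun y => by positivity)
      (integrable_norm_sq f) (Eventually.of_forall fun y => ?_)
    refine mul_le_of_le_one_right (sq_nonneg _) (Real.exp_le_one_iff.2 ?_)
    have := mul_nonneg hc.le (abs_nonneg (x - y)); linarith
  calc _ ≤ 2 * A ^ 2 / c * ∫ y, ‖f y‖ ^ 2 := by gcongr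
    _ = _ := by ring

end IsExpKer

theorem isExpKer_kerK_one (k : ℝ) {t : ℝ} (ht : 1 / 2 ≤ t) :
    IsExpKer (fun x y => kerK k x y t) (Aconst t) 1 :=
  ⟨(continuous_kerK k (by linarith)).measurable, one_pos,
    fun x y => norm_kerK_le_Aconst k x y ht le_rfl⟩

/-- Functions transported by the semigroup kernel: the columns of `kerK` and `kerS`. -/
structure IsColumn (k y : ℝ) (F : ℝ → ℝ → ℂ) : Prop where
  cont : ∀ t : ℝ, 0 < t → Continuous fun x => F x t
  bound : ∀ x t R : ℝ, 1 / 2 ≤ t → t ≤ R → ‖F x t‖ ≤ Aconst R * Real.exp (-(1 * |x - y|))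
  law : ∀ x t r : ℝ, 0 < t → 0 < r → ∫ z, kerK k x z r * F z t = F x (r + t)

theorem isColumn_kerK (k y : ℝ) : IsColumn k y fun x t => kerK k x y t where
  cont t ht := Continuous.comp (g := fun p : ℝ × ℝ => kerK k p.1 p.2 t) (f := fun x : ℝ => (x, y))
    (continuous_kerK k ht) (by fun_prop)
  bound x t R ht hR := norm_kerK_le_Aconst k x y ht hR
  law x t r ht hr := integral_kerK_mul_kerK k x y ht hr

theorem isColumn_kerS (k y : ℝ) : IsColumn k y fun x t => kerS k x y t where
  cont t ht := Continuous.comp (g := fun p : ℝ × ℝ => kerS k p.1 p.2 t) (f := fun x : ℝ => (x, y))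
    (continuous_kerS k ht) (by fun_prop)
  bound x t R ht hR := norm_kerS_le_Aconst k x y ht hR
  law x t r ht hr := integral_kerK_mul_kerS k x y ht hr

namespace IsColumn

variable {k y c : ℝ} {F : ℝ → ℝ → ℂ}

theorem norm_weight_le (h : IsColumn k y F) (hc : |c| ≤ 1 / 2) {t R : ℝ} (ht : 1 / 2 ≤ t)
    (hR : t ≤ R) (x : ℝ) : ‖(Real.exp (c * (x - y)) : ℂ) * F x t‖ ≤
      Aconst R * Real.exp (-(1 / 2 * |y - x|)) := by
  have hA := Aconst_pos R
  rw [norm_mul, Complex.norm_real, Real.norm_of_nonneg (Real.exp_pos _).le, abs_sub_comm y x]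
  calc _ ≤ Real.exp (c * (x - y)) * (Aconst R * Real.exp (-(1 * |x - y|))) := by
        gcongr; exact h.bound x t R ht hR
    _ = Aconst R * (Real.exp (c * (x - y)) * Real.exp (-(1 * |x - y|))) := by ring
    _ ≤ _ := by gcongr; exact exp_weight_le hc _

theorem memLp (h : IsColumn k y F) (hc : |c| ≤ 1 / 2) {t : ℝ} (ht : 1 / 2 ≤ t) :
    MemLp (fun x => (Real.exp (c * (x - y)) : ℂ) * F x t) 2 :=
  memLp_two_of_bound (by norm_num)
    (((by fun_prop : Continuous fun x : ℝ => (Real.exp (c * (x - y)) : ℂ)).mul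
      (h.cont t (by linarith))).aestronglyMeasurable)
    (h.norm_weight_le hc ht le_rfl)

theorem norm_toLp_le (h : IsColumn k y F) (hc : |c| ≤ 1 / 2) {t R : ℝ} (ht : 1 / 2 ≤ t)
    (hR : t ≤ R) : ‖(h.memLp hc ht).toLp‖ ≤ 2 * Aconst R := by
  have hA := Aconst_pos R
  have h1 : ‖(h.memLp hc ht).toLp‖ ≤ Aconst R / √(1 / 2) := by
    refine norm_le_of_ae_bound_sub y hA.le (by norm_num) ?_
    filter_upwards [(h.memLp hc ht).coeFn_toLp] with x hx
    rw [hx]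
    exact h.norm_weight_le hc ht hR x
  refine h1.trans ?_
  have h2 : 1 / 2 ≤ √(1 / 2) := Real.le_sqrt_of_sq_le (by norm_num)
  rw [div_le_iff₀ (by positivity)]
  nlinarith

/-- The weight is multiplicative along x, z, y, so conjugated kernels compose like the original
ones. -/
theorem weight_law (h : IsColumn k y F) (hc : |c| ≤ 1 / 2) {t r : ℝ} (ht : 1 / 2 ≤ t)
    (hr : 1 / 2 ≤ r) (x : ℝ) :
    ∫ z, wker c (fun x y => kerK k x y r) x z * (h.memLp hc ht).toLp _ z =
      (Real.exp (c * (x - y)) : ℂ) * F x (r + t) := by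
  rw [← h.law x t r (by linarith) (by linarith), ← integral_const_mul]
  refine integral_congr_ae ?_
  filter_upwards [(h.memLp hc ht).coeFn_toLp] with z hz
  rw [hz, wker]
  have e : (Real.exp (c * (x - y)) : ℂ) = Real.exp (c * (x - z)) * Real.exp (c * (z - y)) := by
    rw [← Complex.ofReal_mul, ← Real.exp_add]; congr 2; ring
  rw [e]; ring

theorem op_toLp (h : IsColumn k y F) (hc : |c| ≤ 1 / 2) {t r : ℝ} (ht : 1 / 2 ≤ t)
    (hr : 1 / 2 ≤ r) (hrt : 1 / 2 ≤ r + t) :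
    ((isExpKer_kerK_one k hr).wker hc).op (h.memLp hc ht).toLp = (h.memLp hc hrt).toLp := by
  refine Lp.ext ?_
  filter_upwards [((isExpKer_kerK_one k hr).wker hc).op_ae (h.memLp hc ht).toLp,
    (h.memLp hc hrt).coeFn_toLp] with x h1 h2
  rw [h1, h2, h.weight_law hc ht hr]

/-- Each step of length N multiplies the weighted L² norm of the column by at most q. The time bound
is part of the conclusion because the L² element depends on it. -/
theorem norm_toLp_iterate_le (h : IsColumn k y F) (hc : |c| ≤ 1 / 2) {N q b : ℝ} (hN : 1 / 2 ≤ N)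
    (hq0 : 0 ≤ q) (hq : ‖((isExpKer_kerK_one k hN).wker hc).op‖ ≤ q) (hb : 1 / 2 ≤ b) (n : ℕ) :
    ∃ hn : 1 / 2 ≤ n * N + b, ‖(h.memLp hc hn).toLp‖ ≤ q ^ n * ‖(h.memLp hc hb).toLp‖ := by
  induction n with
  | zero =>
    have e : ((0 : ℕ) : ℝ) * N + b = b := by simp
    refine ⟨by rw [e]; exact hb, ?_⟩
    simp only [e, pow_zero, one_mul, le_refl]
  | succ n ih =>
    obtain ⟨hn, ih⟩ := ih
    have e : ((n + 1 : ℕ) : ℝ) * N + b = N + (n * N + b) := by push_cast; ring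
    have hn' : 1 / 2 ≤ N + (n * N + b) := by linarith
    refine ⟨by rw [e]; exact hn', ?_⟩
    simp only [e]
    rw [← h.op_toLp hc hn hN hn', pow_succ', mul_assoc]
    exact (ContinuousLinearMap.le_of_opNorm_le _ hq _).trans (by gcongr)

/-- A final half unit of time turns the weighted L² bound into a pointwise one. The constant is 2
from √(2/(1/2)) times 2 from the initial column. -/
theorem weighted_bound (h : IsColumn k y F) (hc : |c| ≤ 1 / 2) {N q b : ℝ} (hN : 1 / 2 ≤ N)
    (hq0 : 0 ≤ q) (hq : ‖((isExpKer_kerK_one k hN).wker hc).op‖ ≤ q) (hb : 1 / 2 ≤ b)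
    (hbN : b ≤ 1 / 2 + N) (n : ℕ) (x : ℝ) :
    Real.exp (c * (x - y)) * ‖F x (1 / 2 + (n * N + b))‖ ≤
      4 * Aconst (1 / 2) * Aconst (1 / 2 + N) * q ^ n := by
  obtain ⟨hn, h1⟩ := h.norm_toLp_iterate_le hc hN hq0 hq hb n
  have hA := Aconst_pos (1 / 2)
  have h2 := ((isExpKer_kerK_one k le_rfl).wker hc).norm_integral_le (h.memLp hc hn).toLp x
  rw [h.weight_law hc hn le_rfl, norm_mul, Complex.norm_real,
    Real.norm_of_nonneg (Real.exp_pos _).le] at h2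
  have e : √(2 / (1 / 2)) = 2 := by
    rw [show (2 / (1 / 2) : ℝ) = 2 ^ 2 by norm_num, Real.sqrt_sq (by norm_num)]
  rw [e] at h2
  refine h2.trans ?_
  calc _ ≤ 2 * Aconst (1 / 2) * (q ^ n * (2 * Aconst (1 / 2 + N))) := by
        gcongr
        exact h1.trans (by gcongr; exact h.norm_toLp_le hc hb hbN)
    _ = _ := by ring

end IsColumn


/-! ### Estimates for long times. -/

/-- Half of the decay rate pays for the constant C: k⁴N ≥ k₀⁴ + 8C makes exp(k⁴N/2) at least 2C. The
length N depends on k₀ and C only, so it is common to all k. -/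
theorem norm_op_kerK_le_half {k₀ C k N : ℝ} (hk₀ : 0 < k₀) (hC : 0 ≤ C) (hk : k₀ < k)
    (hN : N = 1 + 8 * C / k₀ ^ 4) (h : ‖semigroup k N‖ ≤ C * Real.exp (-(k ^ 4 * N))) :
    ‖semigroup k N‖ ≤ 1 / 2 * Real.exp (-(1 / 2 * k ^ 4 * N)) := by
  have h1 : C ≤ 1 / 2 * Real.exp (1 / 2 * k ^ 4 * N) := by
    have h2 := Real.add_one_le_exp (1 / 2 * k ^ 4 * N)
    have h3 : k₀ ^ 4 ≤ k ^ 4 := by gcongr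
    have h4 : k₀ ^ 4 * N = k₀ ^ 4 + 8 * C := by
      rw [hN, mul_add, mul_one, mul_div_cancel₀ _ (by positivity)]
    have h5 : k₀ ^ 4 * N ≤ k ^ 4 * N :=
      mul_le_mul_of_nonneg_right h3 (by rw [hN]; positivity)
    have h6 : 0 < k₀ ^ 4 := by positivity
    linarith
  calc _ ≤ C * Real.exp (-(k ^ 4 * N)) := h
    _ ≤ 1 / 2 * Real.exp (1 / 2 * k ^ 4 * N) * Real.exp (-(k ^ 4 * N)) := by gcongr
    _ = _ := by rw [mul_assoc, ← Real.exp_add]; congr 2; ring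

/-- The estimates for long times and bounded `k`. -/
theorem bounded_k_bound {k₀ : ℝ} (hk₀ : 0 < k₀) (B : ℝ) :
    ∃ C c : ℝ, 0 < C ∧ 0 < c ∧ c ≤ 1 / 2 ∧ ∀ (k t x y : ℝ) (F : ℝ → ℝ → ℂ), k₀ < k → k ^ 4 ≤ B →
      1 < t → IsColumn k y F →
      ‖F x t‖ ≤ C * Real.exp (-(1 / 2) * k ^ 4 * t) * Real.exp (-c * |x - y|) := by
  obtain ⟨C, hC, hdec⟩ := norm_semigroup_decay hk₀ B
  obtain ⟨N, hN⟩ : ∃ N, N = 1 + 8 * C / k₀ ^ 4 := ⟨_, rfl⟩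
  have hN1 : 1 ≤ N := by
    have : 0 ≤ 8 * C / k₀ ^ 4 := by positivity
    linarith
  have hN2 : 1 / 2 ≤ N := by linarith
  have hA := Aconst_pos N
  have hA1 := Aconst_pos (1 / 2)
  have hA2 := Aconst_pos (1 / 2 + N)
  -- Chosen so that the conjugation error 32 A c is at most half of exp(-BN/2) ≤ q. Added to the
  -- bound q/2 for the unconjugated operator it gives q, uniformly in the range of k.
  set c := min (1 / 2) (Real.exp (-(1 / 2 * B * N)) / (64 * Aconst N)) with hc
  have hc0 : 0 < c := lt_min (by norm_num) (by positivity)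
  have hc1 : c ≤ 1 / 2 := min_le_left _ _
  have hc2 : 32 * Aconst N * c ≤ 1 / 2 * Real.exp (-(1 / 2 * B * N)) := by
    have h1 : c ≤ Real.exp (-(1 / 2 * B * N)) / (64 * Aconst N) := min_le_right _ _
    rw [le_div_iff₀ (by positivity)] at h1
    linarith
  refine ⟨4 * Aconst (1 / 2) * Aconst (1 / 2 + N) * Real.exp (1 / 2 * B * (1 + N)), c,
    by positivity, hc0, hc1, fun k t x y F hk hkB ht hF => ?_⟩
  set q := Real.exp (-(1 / 2 * k ^ 4 * N)) with hq
  have hT : ‖(isExpKer_kerK_one k hN2).op‖ ≤ 1 / 2 * q := by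
    rw [(isExpKer_kerK_one k hN2).op_eq_op (isExpKer_kerK k (by linarith)),
      ← semigroup_of_pos k (by linarith)]
    exact norm_op_kerK_le_half hk₀ hC hk hN (hdec k N hk hkB hN1)
  have hBq : Real.exp (-(1 / 2 * B * N)) ≤ q := by
    rw [hq, Real.exp_le_exp]
    have := mul_le_mul_of_nonneg_right hkB (by linarith : 0 ≤ N)
    linarith
  have hop : ∀ d : ℝ, (hd : |d| = c) →
      ‖((isExpKer_kerK_one k hN2).wker (c := d) (hd.trans_le hc1)).op‖ ≤ q := by
    intro d hd
    have h1 := (isExpKer_kerK_one k hN2).norm_op_wker_le (c := d) (hd.trans_le hc1)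
    have h2 : 32 * Aconst N * |d| = 32 * Aconst N * c := by rw [hd]
    linarith
  -- The time is split as t = 1/2 + nN + b with 1/2 ≤ b ≤ 1/2 + N: a final half unit for the
  -- pointwise bound, n full steps, and an initial column away from time 0.
  set n := ⌊(t - 1) / N⌋₊ with hn
  have hn1 : n * N ≤ t - 1 := by
    rw [← le_div_iff₀ (by linarith)]
    exact Nat.floor_le (div_nonneg (by linarith) (by linarith))
  have hn2 : t - 1 ≤ n * N + N := by
    have h1 := (Nat.lt_floor_add_one ((t - 1) / N)).le
    rw [div_le_iff₀ (by linarith)] at h1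
    linarith
  -- The n steps cover t up to at most 1 + N, and decay over the missing stretch costs at most
  -- exp(B(1+N)/2).
  have hqn : q ^ n ≤ Real.exp (1 / 2 * B * (1 + N)) * Real.exp (-(1 / 2) * k ^ 4 * t) := by
    rw [hq, ← Real.exp_nat_mul, ← Real.exp_add, Real.exp_le_exp]
    have h1 := mul_le_mul_of_nonneg_left hn2 (by positivity : 0 ≤ k ^ 4)
    have h2 := mul_le_mul_of_nonneg_right hkB (by linarith : 0 ≤ 1 + N)
    linarith
  -- The sign of the weight follows the sign of x - y, so that exp(d(x-y)) = exp(c|x-y|).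
  obtain ⟨d, hd, hdx⟩ : ∃ d : ℝ, |d| = c ∧ d * (x - y) = c * |x - y| := by
    rcases le_total 0 (x - y) with h | h
    · exact ⟨c, abs_of_pos hc0, by rw [abs_of_nonneg h]⟩
    · exact ⟨-c, by rw [abs_neg, abs_of_pos hc0], by rw [abs_of_nonpos h]; ring⟩
  have key := hF.weighted_bound (hd.trans_le hc1) hN2 (Real.exp_pos _).le (hop d hd)
    (b := t - 1 / 2 - n * N) (by linarith) (by linarith) n x
  rw [hdx, show 1 / 2 + (n * N + (t - 1 / 2 - n * N)) = t by ring] at key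
  have e : Real.exp (c * |x - y|) * Real.exp (-c * |x - y|) = 1 := by
    rw [← Real.exp_add, neg_mul, add_neg_cancel, Real.exp_zero]
  calc ‖F x t‖ = Real.exp (c * |x - y|) * ‖F x t‖ * Real.exp (-c * |x - y|) := by
        rw [mul_right_comm, e, one_mul]
    _ ≤ 4 * Aconst (1 / 2) * Aconst (1 / 2 + N) * q ^ n * Real.exp (-c * |x - y|) := by gcongr
    _ ≤ 4 * Aconst (1 / 2) * Aconst (1 / 2 + N) *
        (Real.exp (1 / 2 * B * (1 + N)) * Real.exp (-(1 / 2) * k ^ 4 * t)) *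
          Real.exp (-c * |x - y|) := by gcongr
    _ = _ := by ring

/-- The estimates for long times. -/
theorem long_time_bounds {k₀ : ℝ} (hk₀ : 0 < k₀) : ∃ C c : ℝ, 0 < C ∧ 0 < c ∧
    ∀ k t x y : ℝ, k₀ < k → 1 < t →
      ‖kerK k x y t‖ ≤ C * Real.exp (-(1 / 2) * k ^ 4 * t) * Real.exp (-c * |x - y|) ∧
      ‖kerS k x y t‖ ≤ C * Real.exp (-(1 / 2) * k ^ 4 * t) * Real.exp (-c * |x - y|) := by
  obtain ⟨C, c, hC, hc, hc1, h⟩ := bounded_k_bound hk₀ (4 * (Λ₀ + l₀ + 1))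
  have hC0 := C₀_pos
  have hC1 := C₁_pos
  refine ⟨C + (C₁ + 2 * C₀), c, by positivity, hc, fun k t x y hk ht => ?_⟩
  rcases le_total (k ^ 4) (4 * (Λ₀ + l₀ + 1)) with hB | hB
  · have hle : C * Real.exp (-(1 / 2) * k ^ 4 * t) * Real.exp (-c * |x - y|) ≤
        (C + (C₁ + 2 * C₀)) * Real.exp (-(1 / 2) * k ^ 4 * t) * Real.exp (-c * |x - y|) := by
      gcongr
      exact le_add_of_nonneg_right (by positivity)
    exact ⟨(h k t x y _ hk hB ht (isColumn_kerK k y)).trans hle,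
      (h k t x y _ hk hB ht (isColumn_kerS k y)).trans hle⟩
  · have hle : (C₁ + 2 * C₀) * Real.exp (-(1 / 2) * k ^ 4 * t) * Real.exp (-|x - y|) ≤
        (C + (C₁ + 2 * C₀)) * Real.exp (-(1 / 2) * k ^ 4 * t) * Real.exp (-c * |x - y|) := by
      have h1 : C₁ + 2 * C₀ ≤ C + (C₁ + 2 * C₀) := le_add_of_nonneg_left hC.le
      have h2 : -|x - y| ≤ -c * |x - y| := by
        have := abs_nonneg (x - y)
        nlinarith
      exact mul_le_mul (mul_le_mul_of_nonneg_right h1 (Real.exp_pos _).le)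
        (Real.exp_le_exp.2 h2) (Real.exp_pos _).le (by positivity)
    obtain ⟨h1, h2⟩ := large_k_bounds x y hB ht
    exact ⟨h1.trans hle, h2.trans hle⟩

end CahnHilliard
end

theorem mainTheorem5 :
    (∃ K : ℝ → ℝ → ℝ → ℝ → ℂ, ∀ k : ℝ, 0 ≤ k →
      CahnHilliard.IsSemigroupKernel k (fun x y t => K x y k t)) ∧
    ∀ K : ℝ → ℝ → ℝ → ℝ → ℂ,
      (∀ k : ℝ, 0 ≤ k → CahnHilliard.IsSemigroupKernel k (fun x y t => K x y k t)) →
      (∀ k t x : ℝ, 0 ≤ k → 0 < t → ContDiff ℝ 2 (fun y : ℝ => K x y k t)) ∧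
      (∀ k₀ : ℝ, 0 < k₀ → ∃ C c : ℝ, 0 < C ∧ 0 < c ∧
        ∀ k t x y : ℝ, k₀ < k → 1 < t →
          ‖K x y k t‖ ≤ C * Real.exp (-(1 / 2) * k ^ 4 * t) * Real.exp (-c * |x - y|) ∧
          ‖CahnHilliard.S K x y k t‖ ≤
            C * Real.exp (-(1 / 2) * k ^ 4 * t) * Real.exp (-c * |x - y|)) ∧
      (∃ C : ℝ, 0 < C ∧
        ∀ k t x y : ℝ, 0 ≤ k → 0 < t → t < 1 →
          ‖K x y k t‖ ≤ C * Real.exp (-(1 / 2) * k ^ 4 * t) * t ^ (-(1 / 4) : ℝ) *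
            Real.exp (-(t ^ (-(1 / 4) : ℝ) * |x - y|)) ∧
          ‖CahnHilliard.S K x y k t‖ ≤
            C * Real.exp (-(1 / 2) * k ^ 4 * t) * t ^ (-(3 / 4) : ℝ) *
              Real.exp (-(t ^ (-(1 / 4) : ℝ) * |x - y|))) := by
  refine ⟨⟨fun x y k t => CahnHilliard.kerK k x y t,
    fun k _ => CahnHilliard.isSemigroupKernel_kerK k⟩, fun K hK => ?_⟩
  -- Uniqueness reduces every assertion about an arbitrary K to the constructed kernels.
  have hKk : ∀ k t x y : ℝ, 0 ≤ k → 0 < t → K x y k t = CahnHilliard.kerK k x y t :=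
    fun k t x y hk ht => (hK k hk).eq_kerK x y ht
  have hSk : ∀ k t x y : ℝ, 0 ≤ k → 0 < t → CahnHilliard.S K x y k t = CahnHilliard.kerS k x y t :=
    fun k t x y hk ht => CahnHilliard.S_eq_kerS (hK k hk) x y ht
  refine ⟨fun k t x hk ht => ?_, fun k₀ hk₀ => ?_, ?_⟩
  · simp_rw [fun y => hKk k t x y hk ht]
    exact CahnHilliard.contDiff_kerK k x ht
  · obtain ⟨C, c, hC, hc, h⟩ := CahnHilliard.long_time_bounds hk₀
    refine ⟨C, c, hC, hc, fun k t x y hk ht => ?_⟩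
    rw [hKk k t x y (hk₀.trans hk).le (by linarith), hSk k t x y (hk₀.trans hk).le (by linarith)]
    exact h k t x y hk ht
  · obtain ⟨C, hC, h⟩ := CahnHilliard.short_time_bounds
    refine ⟨C, hC, fun k t x y hk ht ht1 => ?_⟩
    rw [hKk k t x y hk ht, hSk k t x y hk ht]
    exact h k t x y ht ht1
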